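/- Let $\alpha\in(-1,1)$, let $\mathbf R_+^2=[0,\infty)^2$ be the closed quadrant, and let $w=(x_1,y_1)\in\partial\mathbf R_+^2$, i.e. $x_1,y_1\ge 0$ and $x_1y_1=0$. Then there exists a unique law (Borel probability measure on $C([0,1],\mathbf R^2)$ with the uniform topology) of a continuous process $Z=(X,Y)$ on $[0,1]$ with $Z_0=(0,0)$ and $Z_1=w$ almost surely such that the following two properties hold. (i) For each $t\in(0,1)$, $\mathbf P[X_t>0 \text{ and } Y_t>0]=1$. (ii) For each $0<s<t<1$, the conditional law of $Z|_{[s,t]}$ given $Z|_{[0,s]}$ and $Z|_{[t,1]}$ is almost surely that of a two-dimensional Brownian motion $(A,B)$ on $[s,t]$, whose increments satisfy $\operatorname{Var}(A_v-A_u)=\operatorname{Var}(B_v-B_u)=v-u$ and $\operatorname{Cov}(A_v-A_u,B_v-B_u)=\alpha(v-u)$ for $s\le u\le v\le t$, conditioned on $(A_s,B_s)=Z_s$, on $(A_t,B_t)=Z_t$, and on $A_u,B_u\ge 0$ for all $u\in[s,t]$. That is, it is the law of the corresponding Brownian bridge from $Z_s$ at time $s$ to $Z_t$ at time $t$, conditioned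 on the event, which almost surely has positive probability, that it stays in $\mathbf R_+^2$. -/

import Mathlib

open MeasureTheory ProbabilityTheory

namespace QuadrantExcursion

/-- The space of continuous planar paths on the time interval `[a, b]`, with the topology of
uniform convergence. -/
abbrev Path (a b : ℝ) : Type := C(Set.Icc a b, ℝ × ℝ)

/-- Path space carries the Borel σ-algebra of uniform convergence. -/
noncomputable instance instMeasurableSpacePath (a b : ℝ) : MeasurableSpace (Path a b) :=
  borel (Path a b)

instance instBorelSpacePath (a b : ℝ) : BorelSpace (Path a b) := ⟨rfl⟩

/-- The closed quadrant `[0, ∞)²`. -/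
def quadrant : Set (ℝ × ℝ) := {p | 0 ≤ p.1 ∧ 0 ≤ p.2}

/-- The restriction of a path to a smaller time interval. -/
def restrictPath {a b c d : ℝ} (h : Set.Icc c d ⊆ Set.Icc a b) (f : Path a b) : Path c d :=
  f.comp (ContinuousMap.inclusion h)

/-- `β` is the law on `C([s, t], ℝ²)` of a Brownian motion `(A, B)` started from `z` at time `s`
with unit variances and correlation `α`: it is the continuous Gaussian process with mean `z` and
`cov(A_u, A_v) = cov(B_u, B_v) = min u v - s`, `cov(A_u, B_v) = α (min u v - s)`. -/
structure IsBrownianLaw (α s t : ℝ) (z : ℝ × ℝ) (β : Measure (Path s t)) : Prop where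
  gaussian : IsGaussianProcess (fun (u : Set.Icc s t) (f : Path s t) ↦ f u) β
  mean_fst : ∀ u : Set.Icc s t, ∫ f, (f u).1 ∂β = z.1
  mean_snd : ∀ u : Set.Icc s t, ∫ f, (f u).2 ∂β = z.2
  cov_fst : ∀ u v : Set.Icc s t,
    covariance (fun f : Path s t ↦ (f u).1) (fun f ↦ (f v).1) β = min (u : ℝ) v - s
  cov_snd : ∀ u v : Set.Icc s t,
    covariance (fun f : Path s t ↦ (f u).2) (fun f ↦ (f v).2) β = min (u : ℝ) v - s
  cov_fst_snd : ∀ u v : Set.Icc s t,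
    covariance (fun f : Path s t ↦ (f u).1) (fun f ↦ (f v).2) β = α * (min (u : ℝ) v - s)

/-- The path `u ↦ f u + (u - s) / (t - s) * (w - f t)`, which ends at `w` and has the same starting
point as `f`. -/
noncomputable def pinPath {s t : ℝ} (hst : s < t) (w : ℝ × ℝ) (f : Path s t) : Path s t where
  toFun u := f u + (((u : ℝ) - s) / (t - s)) • (w - f ⟨t, hst.le, le_rfl⟩)
  continuous_toFun := by fun_prop

/-- `ρ` is the law on `C([s, t], ℝ²)` of the Brownian bridge of correlation `α` from `z` at time `s`
to `w` at time `t`, that is, of the Brownian motion `W` with correlation `α` conditioned on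
`W_s = z` and `W_t = w`. For a Brownian motion `W` started from `z`, the process
`u ↦ W_u - (u - s) / (t - s) * W_t` is independent of `W_t`, so this conditional law is the law of
`u ↦ W_u + (u - s) / (t - s) * (w - W_t)`. -/
def IsBrownianBridgeLaw (α : ℝ) {s t : ℝ} (hst : s < t) (z w : ℝ × ℝ)
    (ρ : Measure (Path s t)) : Prop :=
  ∃ β : Measure (Path s t), IsBrownianLaw α s t z β ∧ ρ = β.map (pinPath hst w)

/-- The event that a path on `[s, t]` stays in the closed quadrant. -/
def quadrantPaths (s t : ℝ) : Set (Path s t) := {f | ∀ u, f u ∈ quadrant}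

/-- `ρ` is the law of the Brownian motion of correlation `α` on `[s, t]` conditioned to be at `z` at
time `s`, to be at `w` at time `t`, and to stay in the closed quadrant. (For `z`, `w` in the open
quadrant and `|α| < 1` the last event has positive probability for the bridge from `z` to `w`.) -/
def IsQuadrantBridgeLaw (α : ℝ) {s t : ℝ} (hst : s < t) (z w : ℝ × ℝ)
    (ρ : Measure (Path s t)) : Prop :=
  ∃ b : Measure (Path s t), IsBrownianBridgeLaw α hst z w b ∧
    ρ = ProbabilityTheory.cond b (quadrantPaths s t)

/-- The law `μ` of a continuous process `Z` on `[0, 1]` is that of the correlated Brownian excursion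
in the quadrant from `0` to `w`. -/
structure IsExcursionLaw (α : ℝ) (w : ℝ × ℝ) (μ : Measure (Path 0 1)) [IsFiniteMeasure μ] :
    Prop where
  start : ∀ᵐ Z ∂μ, Z ⟨0, le_rfl, zero_le_one⟩ = 0
  terminal : ∀ᵐ Z ∂μ, Z ⟨1, zero_le_one, le_rfl⟩ = w
  pos : ∀ (t : ℝ) (h0 : 0 < t) (h1 : t < 1),
    ∀ᵐ Z ∂μ, 0 < (Z ⟨t, h0.le, h1.le⟩).1 ∧ 0 < (Z ⟨t, h0.le, h1.le⟩).2
  /-- The conditional law of `Z` on `[s, t]` given `Z` on `[0, s]` and on `[t, 1]` is that of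
  correlated Brownian motion conditioned on the endpoints and on staying in the quadrant. -/
  resampling : ∀ (s t : ℝ) (h0 : 0 < s) (hst : s < t) (h1 : t < 1),
    let inside : Path 0 1 → Path s t := restrictPath (Set.Icc_subset_Icc h0.le h1.le)
    let outside : Path 0 1 → Path 0 s × Path t 1 := fun Z ↦
      (restrictPath (Set.Icc_subset_Icc le_rfl (hst.trans h1).le) Z,
        restrictPath (Set.Icc_subset_Icc (h0.trans hst).le le_rfl) Z)
    ∀ᵐ Z ∂μ, IsQuadrantBridgeLaw α hst
      (Z ⟨s, h0.le, (hst.trans h1).le⟩) (Z ⟨t, (h0.trans hst).le, h1.le⟩)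
      (condDistrib inside outside μ (outside Z))

end QuadrantExcursion

/-! The whole proof rests on one estimate for the Brownian bridge conditioned to stay in the
quadrant. Its law depends on its endpoints in a Lipschitz way, with the constant that a straight
segment would give: for points `z, z', w, w'` of the open quadrant, a cylinder function with weights
`L i` changes in mean by at most `∑ L i * ((1 - θ i) |z - z'| + θ i |w - w'|)`, where `θ i` is the
elapsed fraction of time and `|·|` is the Mahalanobis norm `mahal` of the correlation matrix
(`abs_integral_quadBridge_sub_le`). The bound does not blow up at the boundary of the quadrant,
where the conditioning becomes singular.

It comes from convexity. By Prékopa–Leindler, a Gaussian conditioned on a convex set has variances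
no larger than before (`MidpointIneq.lintegral_exp_mul_cond_le`). The derivative in the mean of one
planar Gaussian conditioned on the quadrant is a covariance, so it contracts in Wasserstein distance
with constant one (`abs_integral_siteLaw_sub_le`). On a time grid the conditioned bridge is
invariant under resampling a site given its two neighbours. Each such step replaces the transport
bound at that site by the mean of its neighbours (`TransportBound.update`), and iterating leaves the
harmonic, hence affine, profile (`TransportBound.affine`). Refining the grid gives the estimate.

Uniqueness: two excursion laws restricted to `[δ, 1 - δ]` are mixtures of conditioned bridges over
their values at `δ` and `1 - δ`. Under an independent coupling these values merge as `δ → 0`, since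
the paths are continuous with the same endpoints, so the Lipschitz bound forces equality
(`IsExcursionLaw.eq`).

Existence: the endpoints are pushed into the open quadrant by `(δ, δ)` and `δ` is sent to `0`. Three
uniform facts are needed. Tightness comes from fourth moments of increments: convexity bounds the
difference of two independent copies, and first moments are obtained by comparing with a loop based
well inside the quadrant and then by repeated halving (`LoopBound.lintegral_norm_pow_four_le`).
Positivity at interior times is kept in the limit, because a layer near the boundary has many
disjoint translates of comparable probability (`exp_mul_quadBridge_boundary_le`). The resampling
property passes to the limit because the mean of a Lipschitz cylinder function is a Lipschitz
function of the endpoints (`Resampled.of_tendsto`). -/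

open scoped ENNReal NNReal Topology

/-! ### Prékopa–Leindler for midpoints and uniform convexity of Gaussian measures -/

namespace QuadrantExcursion

/-- The one-dimensional Brunn–Minkowski inequality for midpoints. -/
theorem volume_add_volume_le_of_midpoint {A B C : Set ℝ} (hA : MeasurableSet A)
    (hB : MeasurableSet B) (hA' : A.Nonempty) (hB' : B.Nonempty)
    (h : ∀ x ∈ A, ∀ y ∈ B, (x + y) / 2 ∈ C) : volume A + volume B ≤ 2 * volume C := by
  have key : ∀ K K' : Set ℝ, K ⊆ A → K' ⊆ B → IsCompact K → IsCompact K' → K.Nonempty →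
      K'.Nonempty → volume K + volume K' ≤ 2 * volume C := by
    intro K K' hKA hKB hK hK' hKn hKn'
    have ha := hK.sSup_mem hKn
    have hb := hK'.sInf_mem hKn'
    set a := sSup K
    set b := sInf K'
    -- With `a` the top of `K` and `b` the bottom of `K'`, the translates `K + b` and `K' + a` both
    -- lie in `K + K' ⊆ 2C` and meet at most in the point `a + b`, so their volumes add.
    have h1 : volume K = volume ((fun x ↦ x + -b) ⁻¹' K) := by
      rw [measure_preimage_add_right]
    have h2 : volume K' = volume ((fun x ↦ x + -a) ⁻¹' K') := by
      rw [measure_preimage_add_right]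
    have hd : AEDisjoint volume ((fun x ↦ x + -b) ⁻¹' K) ((fun x ↦ x + -a) ⁻¹' K') := by
      refine measure_mono_null (t := {a + b}) ?_ (by simp)
      rintro x ⟨hx1, hx2⟩
      have h3 : x + -b ≤ a := le_csSup hK.bddAbove hx1
      have h4 : b ≤ x + -a := csInf_le hK'.bddBelow hx2
      simp only [Set.mem_singleton_iff]
      linarith
    have hm : MeasurableSet ((fun x ↦ x + -a) ⁻¹' K') :=
      (measurable_add_const _) hK'.measurableSet
    have hsub : ((fun x ↦ x + -b) ⁻¹' K) ∪ ((fun x ↦ x + -a) ⁻¹' K') ⊆ (fun x ↦ x * (2⁻¹ : ℝ)) ⁻¹' C := by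
      rintro x (hx | hx)
      · have := h _ (hKA hx) _ (hKB hb)
        simp only [Set.mem_preimage]
        convert this using 1; ring
      · have := h _ (hKA ha) _ (hKB hx)
        simp only [Set.mem_preimage]
        convert this using 1; ring
    rw [h1, h2, ← measure_union₀ hm.nullMeasurableSet hd]
    refine (measure_mono hsub).trans ?_
    rw [Real.volume_preimage_mul_right (by norm_num)]
    simp
  -- The inner suprema are `0` unless `K` is a compact subset of `D`, while `key` needs nonempty
  -- compacts; adding a point of `D`, or using that point alone, settles both.
  have aux : ∀ (D : Set ℝ), D.Nonempty → ∀ K : Set ℝ, ∃ K₁ ⊆ D, IsCompact K₁ ∧ K₁.Nonempty ∧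
      (⨆ (_ : K ⊆ D), ⨆ (_ : IsCompact K), volume K) ≤ volume K₁ := by
    rintro D ⟨x₀, hx₀⟩ K
    by_cases hK : K ⊆ D ∧ IsCompact K
    · exact ⟨insert x₀ K, Set.insert_subset hx₀ hK.1, hK.2.insert _, ⟨x₀, by simp⟩, by
        simpa [hK.1, hK.2] using measure_mono (Set.subset_insert x₀ K)⟩
    · refine ⟨{x₀}, by simpa using hx₀, isCompact_singleton, ⟨x₀, rfl⟩, ?_⟩
      simp only [iSup_le_iff]
      exact fun h1 h2 ↦ absurd ⟨h1, h2⟩ hK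
  rw [hA.measure_eq_iSup_isCompact, hB.measure_eq_iSup_isCompact]
  simp only [ENNReal.iSup_add, ENNReal.add_iSup, iSup_le_iff]
  intro K' K
  obtain ⟨K₁, h1, h2, h3, h4⟩ := aux A hA' K
  obtain ⟨K₂, h5, h6, h7, h8⟩ := aux B hB' K'
  exact (add_le_add h4 h8).trans (key _ _ h1 h5 h2 h6 h3 h7)

/-- The normalized one-dimensional Prékopa–Leindler inequality. -/
theorem lintegral_add_lintegral_le_of_midpoint {f g h : ℝ → ℝ} (hf : Measurable f)
    (hg : Measurable g) (hh : Measurable h) (hf0 : ∀ x, 0 ≤ f x) (hg0 : ∀ x, 0 ≤ g x)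
    (hh0 : ∀ x, 0 ≤ h x) (hf1 : ∀ x, f x ≤ 1) (hg1 : ∀ x, g x ≤ 1)
    (hfs : ∀ l < 1, ∃ x, l < f x) (hgs : ∀ l < 1, ∃ x, l < g x)
    (H : ∀ x y, f x * g y ≤ h ((x + y) / 2) ^ 2) :
    (∫⁻ x, ENNReal.ofReal (f x)) + ∫⁻ x, ENNReal.ofReal (g x) ≤
      2 * ∫⁻ x, ENNReal.ofReal (h x) := by
  rw [lintegral_eq_lintegral_meas_lt _ (.of_forall hf0) hf.aemeasurable,
    lintegral_eq_lintegral_meas_lt _ (.of_forall hg0) hg.aemeasurable,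
    lintegral_eq_lintegral_meas_lt _ (.of_forall hh0) hh.aemeasurable]
  have hmono : ∀ k : ℝ → ℝ, Measurable fun t ↦ volume {a | t < k a} := fun k ↦
    (Antitone.measurable fun s t hst ↦ measure_mono fun a (ha : t < k a) ↦ hst.trans_lt ha)
  rw [← lintegral_add_left (hmono f), ← lintegral_const_mul _ (hmono h)]
  refine setLIntegral_mono ((hmono h).const_mul _) fun t (ht : 0 < t) ↦ ?_
  -- Layer cake: below level `1` the superlevel sets of `f` and `g` are both nonempty, because both
  -- suprema are normalised to `1`, and their midpoints lie in that of `h`. From level `1` on they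
  -- are empty.
  rcases lt_or_ge t 1 with h1 | h1
  · refine volume_add_volume_le_of_midpoint (measurableSet_lt measurable_const hf)
      (measurableSet_lt measurable_const hg) (hfs t h1) (hgs t h1) ?_
    intro x (hx : t < f x) y (hy : t < g y)
    have h2 : t ^ 2 < h ((x + y) / 2) ^ 2 := by nlinarith [H x y]
    exact lt_of_pow_lt_pow_left₀ 2 (hh0 _) h2
  · have e1 : {a | t < f a} = ∅ := by
      ext a; simpa using (hf1 a).trans h1
    have e2 : {a | t < g a} = ∅ := by
      ext a; simpa using (hg1 a).trans h1
    simp [e1, e2]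

/-- The one-dimensional Prékopa–Leindler inequality for midpoints. -/
theorem lintegral_mul_lintegral_le_of_midpoint {F G H : ℝ → ℝ≥0∞} (hF : Measurable F)
    (hG : Measurable G) (hH : Measurable H) (h : ∀ x y, F x * G y ≤ H ((x + y) / 2) ^ 2) :
    (∫⁻ x, F x) * ∫⁻ x, G x ≤ (∫⁻ x, H x) ^ 2 := by
  -- Truncation makes the suprema of `F` and `G` finite, so that they can be normalised to `1`.
  have key : ∀ M : ℝ≥0, (∫⁻ x, min (F x) M) * ∫⁻ x, min (G x) M ≤ (∫⁻ x, H x) ^ 2 := by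
    intro M
    set F' : ℝ → ℝ≥0∞ := fun x ↦ min (F x) M
    set G' : ℝ → ℝ≥0∞ := fun x ↦ min (G x) M
    have hF' : Measurable F' := hF.min measurable_const
    have hG' : Measurable G' := hG.min measurable_const
    have hFM : ∀ x, F' x ≠ ∞ := fun x ↦ ((min_le_right _ _).trans_lt ENNReal.coe_lt_top).ne
    have hGM : ∀ x, G' x ≠ ∞ := fun x ↦ ((min_le_right _ _).trans_lt ENNReal.coe_lt_top).ne
    set a := ⨆ x, F' x with ha
    set b := ⨆ x, G' x with hb
    have ha' : a ≠ ∞ := ((iSup_le fun x ↦ min_le_right _ _).trans_lt (ENNReal.coe_lt_top (r := M))).ne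
    have hb' : b ≠ ∞ := ((iSup_le fun x ↦ min_le_right _ _).trans_lt (ENNReal.coe_lt_top (r := M))).ne
    rcases eq_or_ne a 0 with h0 | h0
    · have hz : lintegral volume F' = 0 := by
        rw [show F' = fun _ ↦ 0 from
          funext fun x ↦ le_antisymm ((le_iSup F' x).trans h0.le) zero_le, lintegral_zero]
      rw [hz, zero_mul]
      exact zero_le
    rcases eq_or_ne b 0 with h0' | h0'
    · have hz : lintegral volume G' = 0 := by
        rw [show G' = fun _ ↦ 0 from
          funext fun x ↦ le_antisymm ((le_iSup G' x).trans h0'.le) zero_le, lintegral_zero]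
      rw [hz, mul_zero]
      exact zero_le
    set A := a.toReal
    set B := b.toReal
    have hA : 0 < A := ENNReal.toReal_pos h0 ha'
    have hB : 0 < B := ENNReal.toReal_pos h0' hb'
    have hAB : 0 < Real.sqrt (A * B) := Real.sqrt_pos.2 (by positivity)
    have hsq : Real.sqrt (A * B) ^ 2 = A * B := Real.sq_sqrt (by positivity)
    set S := Real.sqrt (A * B)
    set f : ℝ → ℝ := fun x ↦ (F' x).toReal / A
    set g : ℝ → ℝ := fun x ↦ (G' x).toReal / B
    -- Cutting `H` at `S = √(AB)` makes it real-valued and costs nothing, since `F' x * G' y ≤ AB =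
    -- S²` always.
    set k : ℝ → ℝ := fun x ↦ (min (H x) (ENNReal.ofReal S)).toReal / S
    have hk : ∀ x, min (H x) (ENNReal.ofReal S) ≠ ∞ := fun x ↦
      ((min_le_right _ _).trans_lt ENNReal.ofReal_lt_top).ne
    have hFa : ∀ x, (F' x).toReal ≤ A := fun x ↦ ENNReal.toReal_mono ha' (le_iSup F' x)
    have hGb : ∀ x, (G' x).toReal ≤ B := fun x ↦ ENNReal.toReal_mono hb' (le_iSup G' x)
    have hsup : ∀ (Φ : ℝ → ℝ≥0∞), (⨆ x, Φ x) ≠ 0 → (⨆ x, Φ x) ≠ ∞ → (∀ x, Φ x ≠ ∞) → ∀ l < 1, ∃ x,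
        l < (Φ x).toReal / (⨆ x, Φ x).toReal := by
      intro Φ h0 h1 h2 l hl
      have hp : 0 < (⨆ x, Φ x).toReal := ENNReal.toReal_pos h0 h1
      have : ENNReal.ofReal (l * (⨆ x, Φ x).toReal) < ⨆ x, Φ x := by
        rw [← ENNReal.ofReal_toReal h1, ENNReal.ofReal_lt_ofReal_iff hp,
          ENNReal.toReal_ofReal hp.le]
        nlinarith
      obtain ⟨x, hx⟩ := lt_iSup_iff.1 this
      refine ⟨x, ?_⟩
      rw [lt_div_iff₀ hp]
      rcases le_or_gt 0 (l * (⨆ x, Φ x).toReal) with h3 | h3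
      · exact (ENNReal.ofReal_lt_iff_lt_toReal h3 (h2 x)).1 hx
      · exact h3.trans_le ENNReal.toReal_nonneg
    have main := lintegral_add_lintegral_le_of_midpoint (f := f) (g := g) (h := k)
      (by fun_prop) (by fun_prop) (by fun_prop) (fun x ↦ by positivity) (fun x ↦ by positivity)
      (fun x ↦ by positivity) (fun x ↦ (div_le_one hA).2 (hFa x))
      (fun x ↦ (div_le_one hB).2 (hGb x)) (hsup F' h0 ha' hFM) (hsup G' h0' hb' hGM) (by
        intro x y
        have e1 : f x * g y = ((F' x).toReal * (G' y).toReal) / S ^ 2 := by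
          simp only [f, g, hsq]; field_simp
        have e2 : k ((x + y) / 2) ^ 2 =
            ((min (H ((x + y) / 2)) (ENNReal.ofReal S)).toReal) ^ 2 / S ^ 2 := by
          simp only [k]; field_simp
        rw [e1, e2]
        gcongr
        rcases le_total (H ((x + y) / 2)) (ENNReal.ofReal S) with h3 | h3
        · rw [min_eq_left h3, ← ENNReal.toReal_mul, ← ENNReal.toReal_pow]
          refine ENNReal.toReal_mono ?_ ?_
          · exact ENNReal.pow_ne_top (h3.trans_lt ENNReal.ofReal_lt_top).ne
          · exact (mul_le_mul' (min_le_left _ _) (min_le_left _ _)).trans (h x y)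
        · rw [min_eq_right h3, ENNReal.toReal_ofReal hAB.le, hsq]
          exact mul_le_mul (hFa x) (hGb y) ENNReal.toReal_nonneg hA.le)
    have i1 : ∫⁻ x, ENNReal.ofReal (f x) = ENNReal.ofReal A⁻¹ * ∫⁻ x, F' x := by
      rw [← lintegral_const_mul _ hF']
      refine lintegral_congr fun x ↦ ?_
      simp only [f]
      rw [div_eq_inv_mul, ENNReal.ofReal_mul (by positivity), ENNReal.ofReal_toReal (hFM x)]
    have i2 : ∫⁻ x, ENNReal.ofReal (g x) = ENNReal.ofReal B⁻¹ * ∫⁻ x, G' x := by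
      rw [← lintegral_const_mul _ hG']
      refine lintegral_congr fun x ↦ ?_
      simp only [g]
      rw [div_eq_inv_mul, ENNReal.ofReal_mul (by positivity), ENNReal.ofReal_toReal (hGM x)]
    have i3 : ∫⁻ x, ENNReal.ofReal (k x) ≤ ENNReal.ofReal S⁻¹ * ∫⁻ x, H x := by
      rw [← lintegral_const_mul _ hH]
      refine lintegral_mono fun x ↦ ?_
      simp only [k]
      rw [div_eq_inv_mul, ENNReal.ofReal_mul (by positivity), ENNReal.ofReal_toReal (hk x)]
      gcongr
      exact min_le_left _ _
    rw [i1, i2] at main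
    replace main := main.trans (mul_le_mul_right i3 _)
    rcases eq_or_ne (∫⁻ x, H x) ∞ with h4 | h4
    · rw [h4]; simp
    have hAi : ENNReal.ofReal A⁻¹ ≠ 0 := by simpa using hA
    have hBi : ENNReal.ofReal B⁻¹ ≠ 0 := by simpa using hB
    have fin : (ENNReal.ofReal A⁻¹ * ∫⁻ x, F' x) + ENNReal.ofReal B⁻¹ * ∫⁻ x, G' x ≠ ∞ :=
      (main.trans_lt (ENNReal.mul_lt_top (by simp)
        (ENNReal.mul_lt_top ENNReal.ofReal_lt_top h4.lt_top))).ne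
    have hIF : ∫⁻ x, F' x ≠ ∞ := fun h5 ↦ by
      simp [h5, ENNReal.mul_top hAi] at fin
    have hIG : ∫⁻ x, G' x ≠ ∞ := fun h5 ↦ by
      simp [h5, ENNReal.mul_top hBi] at fin
    have r := ENNReal.toReal_mono (by finiteness) main
    rw [ENNReal.toReal_add (by finiteness) (by finiteness)] at r
    simp only [ENNReal.toReal_mul, ENNReal.toReal_ofReal (inv_nonneg.2 hA.le),
      ENNReal.toReal_ofReal (inv_nonneg.2 hB.le), ENNReal.toReal_ofReal (inv_nonneg.2 hAB.le),
      ENNReal.toReal_ofNat] at r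
    rw [← ENNReal.toReal_le_toReal (by finiteness) (by finiteness), ENNReal.toReal_mul,
      ENNReal.toReal_pow]
    set x := (∫⁻ x, F' x).toReal
    set y := (∫⁻ x, G' x).toReal
    set z := (∫⁻ x, H x).toReal
    have hx : 0 ≤ x := ENNReal.toReal_nonneg
    have hy : 0 ≤ y := ENNReal.toReal_nonneg
    have hz : 0 ≤ z := ENNReal.toReal_nonneg
    -- AM–GM turns the additive normalised inequality into the multiplicative one.
    have r2 : (A⁻¹ * x) * (B⁻¹ * y) ≤ (S⁻¹ * z) ^ 2 := by
      have p1 : 0 ≤ A⁻¹ * x := by positivity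
      have p2 : 0 ≤ B⁻¹ * y := by positivity
      have p3 : 0 ≤ S⁻¹ * z := by positivity
      nlinarith [sq_nonneg (A⁻¹ * x - B⁻¹ * y)]
    have r3 : x * y = (A * B) * ((A⁻¹ * x) * (B⁻¹ * y)) := by field_simp
    have r4 : z ^ 2 = (A * B) * (S⁻¹ * z) ^ 2 := by
      rw [← hsq]; field_simp
    rw [r3, r4]
    gcongr
  have tend : ∀ Φ : ℝ → ℝ≥0∞, Measurable Φ →
      Filter.Tendsto (fun n : ℕ ↦ ∫⁻ x, min (Φ x) ((n : ℝ≥0) : ℝ≥0∞)) Filter.atTop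
        (𝓝 (∫⁻ x, Φ x)) := by
    intro Φ hΦ
    refine lintegral_tendsto_of_tendsto_of_monotone
      (fun n ↦ (hΦ.min measurable_const).aemeasurable) ?_ ?_
    · refine .of_forall fun x m n hmn ↦ min_le_min_left _ (by simpa using hmn)
    · refine .of_forall fun x ↦ ?_
      have : Filter.Tendsto (fun n : ℕ ↦ min (Φ x) ((n : ℝ≥0) : ℝ≥0∞)) Filter.atTop
          (𝓝 (min (Φ x) ∞)) := by
        refine tendsto_const_nhds.min ?_
        simpa using ENNReal.tendsto_nat_nhds_top
      simpa using this
  rcases eq_or_ne (∫⁻ x, H x) ∞ with h4 | h4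
  · rw [h4]; simp
  rcases eq_or_ne (∫⁻ x, F x) 0 with h5 | h5
  · simp [h5]
  rcases eq_or_ne (∫⁻ x, G x) 0 with h6 | h6
  · simp [h6]
  refine le_of_tendsto (ENNReal.Tendsto.mul (tend F hF) (.inl h5) (tend G hG) (.inl h6))
    (.of_forall fun n ↦ ?_)
  exact key n

/-- `μ` satisfies the midpoint functional inequality with cost `c`: a Prékopa–Leindler inequality
in which the cost measures the uniform convexity of the potential of `μ`. -/
def MidpointIneq {S : Type*} [MeasurableSpace S] [AddCommGroup S] [Module ℝ S] (μ : Measure S)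
    (c : S → ℝ) : Prop :=
  ∀ F G H : S → ℝ≥0∞, Measurable F → Measurable G → Measurable H →
    (∀ x y, F x * G y ≤ ENNReal.ofReal (Real.exp (c (x - y))) * H ((1 / 2 : ℝ) • (x + y)) ^ 2) →
    (∫⁻ x, F x ∂μ) * ∫⁻ x, G x ∂μ ≤ (∫⁻ x, H x ∂μ) ^ 2

/-- By the parallelogram identity the Gaussian density satisfies `φ x * φ y * exp ((x - y)² / (4v))
= φ ((x + y) / 2)²`. Absorbing `φ` into the three functions reduces the claim to Lebesgue measure.
-/
theorem midpointIneq_gaussianReal {v : ℝ≥0} (hv : v ≠ 0) :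
    MidpointIneq (gaussianReal 0 v) fun d ↦ d ^ 2 / (4 * v) := by
  intro F G H hF hG hH h
  have hv' : (0 : ℝ) < v := by positivity
  rw [gaussianReal_of_var_ne_zero _ hv,
    lintegral_withDensity_eq_lintegral_mul _ (measurable_gaussianPDF 0 v) hF,
    lintegral_withDensity_eq_lintegral_mul _ (measurable_gaussianPDF 0 v) hG,
    lintegral_withDensity_eq_lintegral_mul _ (measurable_gaussianPDF 0 v) hH]
  refine lintegral_mul_lintegral_le_of_midpoint (by fun_prop) (by fun_prop) (by fun_prop) ?_
  intro x y
  have e : gaussianPDF 0 v x * gaussianPDF 0 v y * ENNReal.ofReal (Real.exp ((x - y) ^ 2 / (4 * v)))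
      = gaussianPDF 0 v ((x + y) / 2) ^ 2 := by
    simp only [gaussianPDF]
    rw [← ENNReal.ofReal_mul (gaussianPDFReal_nonneg _ _ _),
      ← ENNReal.ofReal_mul (mul_nonneg (gaussianPDFReal_nonneg _ _ _) (gaussianPDFReal_nonneg _ _ _)),
      ← ENNReal.ofReal_pow (gaussianPDFReal_nonneg _ _ _)]
    congr 1
    simp only [gaussianPDFReal]
    rw [mul_mul_mul_comm, mul_assoc, ← Real.exp_add, ← Real.exp_add, mul_pow, ← Real.exp_nat_mul,
      ← sq]
    congr 2
    field_simp
    ring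
  have e2 : ((1 / 2 : ℝ) • (x + y)) = (x + y) / 2 := by simp; ring
  calc (gaussianPDF 0 v * F) x * (gaussianPDF 0 v * G) y
      = (gaussianPDF 0 v x * gaussianPDF 0 v y) * (F x * G y) := by
        simp only [Pi.mul_apply]; ring
    _ ≤ (gaussianPDF 0 v x * gaussianPDF 0 v y) *
        (ENNReal.ofReal (Real.exp ((x - y) ^ 2 / (4 * v))) * H ((x + y) / 2) ^ 2) := by
        have := h x y
        rw [e2] at this
        gcongr
    _ = _ := by
        rw [← mul_assoc, e, Pi.mul_apply, mul_pow]

/-- The usual tensorisation: for fixed first coordinates `x, y` the inequality for `ν` is applied to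
slices, with `exp (c (x - y) / 2)` placed in the slice of `H`. The slice integrals then satisfy the
hypothesis for `μ`. -/
theorem MidpointIneq.prod {S S' : Type*} [MeasurableSpace S] [AddCommGroup S] [Module ℝ S]
    [MeasurableSpace S'] [AddCommGroup S'] [Module ℝ S'] {μ : Measure S} {ν : Measure S'}
    [SFinite μ] [SFinite ν] {c : S → ℝ} {c' : S' → ℝ} (hμ : MidpointIneq μ c)
    (hν : MidpointIneq ν c') : MidpointIneq (μ.prod ν) fun d ↦ c d.1 + c' d.2 := by
  intro F G H hF hG hH h
  rw [lintegral_prod _ hF.aemeasurable, lintegral_prod _ hG.aemeasurable,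
    lintegral_prod _ hH.aemeasurable]
  refine hμ _ _ _ hF.lintegral_prod_right' hG.lintegral_prod_right' hH.lintegral_prod_right' ?_
  intro x y
  set z := (1 / 2 : ℝ) • (x + y)
  set k := ENNReal.ofReal (Real.exp (c (x - y) / 2))
  have hk : k ^ 2 = ENNReal.ofReal (Real.exp (c (x - y))) := by
    simp only [k]
    rw [← ENNReal.ofReal_pow (Real.exp_nonneg _), ← Real.exp_nat_mul]
    congr 2; push_cast; ring
  have := hν (fun u ↦ F (x, u)) (fun u ↦ G (y, u)) (fun u ↦ k * H (z, u)) (by fun_prop)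
    (by fun_prop) (by fun_prop) (by
      intro u u'
      refine (h (x, u) (y, u')).trans (le_of_eq ?_)
      simp only [Prod.fst_sub, Prod.snd_sub, Prod.mk_add_mk, Prod.smul_mk]
      rw [Real.exp_add, ENNReal.ofReal_mul (Real.exp_nonneg _), mul_pow, hk]
      ring)
  rw [lintegral_const_mul _ (by fun_prop), mul_pow, hk] at this
  exact this

/-- Linear maps commute with midpoints and differences, so only the comparison of the two costs
matters. -/
theorem MidpointIneq.map {S S' : Type*} [MeasurableSpace S] [AddCommGroup S] [Module ℝ S]
    [MeasurableSpace S'] [AddCommGroup S'] [Module ℝ S'] {μ : Measure S}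
    {c : S → ℝ} {c' : S' → ℝ} (hμ : MidpointIneq μ c) (L : S →ₗ[ℝ] S') (hL : Measurable L)
    (hc : ∀ d, c' (L d) ≤ c d) : MidpointIneq (μ.map L) c' := by
  intro F G H hF hG hH h
  rw [lintegral_map hF hL, lintegral_map hG hL, lintegral_map hH hL]
  refine hμ _ _ _ (hF.comp hL) (hG.comp hL) (hH.comp hL) fun x y ↦ (h _ _).trans ?_
  rw [← map_sub, ← map_add, ← map_smul]
  gcongr
  exact hc _

theorem MidpointIneq.pi {S : Type*} [MeasurableSpace S] [AddCommGroup S] [Module ℝ S]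
    {μ : Measure S} [IsProbabilityMeasure μ] {c : S → ℝ} (hμ : MidpointIneq μ c) :
    ∀ n : ℕ, MidpointIneq (Measure.pi fun _ : Fin n ↦ μ) fun d ↦ ∑ i, c (d i) := by
  intro n
  induction n with
  | zero =>
    intro F G H hF hG hH h
    have := h 0 0
    rw [Measure.pi_of_empty _ 0]
    simp only [lintegral_dirac]
    simpa using this
  | succ n ih =>
    have mp := (measurePreserving_piFinSuccAbove (fun _ : Fin (n + 1) ↦ μ) 0).symm
    rw [← mp.map_eq]
    refine (hμ.prod ih).map
      { toFun := fun p ↦ (MeasurableEquiv.piFinSuccAbove (fun _ ↦ S) 0).symm p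
        map_add' := fun p q ↦ ?_
        map_smul' := fun r p ↦ ?_ } (MeasurableEquiv.measurable _) ?_
    · ext i; refine Fin.cases ?_ (fun j ↦ ?_) i <;> simp [MeasurableEquiv.piFinSuccAbove]
    · ext i; refine Fin.cases ?_ (fun j ↦ ?_) i <;> simp [MeasurableEquiv.piFinSuccAbove]
    · intro d
      simp [Fin.sum_univ_succ, MeasurableEquiv.piFinSuccAbove]

/-- Uniform convexity: the product of opposite exponential moments on a convex event. -/
theorem MidpointIneq.setLIntegral_exp_mul_le {S : Type*} [MeasurableSpace S] [AddCommGroup S]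
    [Module ℝ S] {μ : Measure S} {c : S → ℝ} (hμ : MidpointIneq μ c) {C : Set S}
    (hC : Convex ℝ C) (hCm : MeasurableSet C) {f : S → ℝ} (hf : Measurable f) {b : ℝ}
    (h : ∀ x y, f x - f y ≤ c (x - y) + b) :
    (∫⁻ x in C, ENNReal.ofReal (Real.exp (f x)) ∂μ) *
      ∫⁻ x in C, ENNReal.ofReal (Real.exp (-f x)) ∂μ ≤ ENNReal.ofReal (Real.exp b) * μ C ^ 2 := by
  -- The functions are `e^f`, `e^{-f}` and the constant `e^{b/2}`, all cut off to `C`. Convexity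
  -- keeps the midpoint in the support of the third one.
  have key := hμ (C.indicator fun x ↦ ENNReal.ofReal (Real.exp (f x)))
    (C.indicator fun x ↦ ENNReal.ofReal (Real.exp (-f x)))
    (C.indicator fun x ↦ ENNReal.ofReal (Real.exp (b / 2)))
    (Measurable.indicator (by fun_prop) hCm) (Measurable.indicator (by fun_prop) hCm)
    (Measurable.indicator (by fun_prop) hCm) (by
      intro x y
      by_cases hx : x ∈ C
      · by_cases hy : y ∈ C
        · have hz : (1 / 2 : ℝ) • (x + y) ∈ C := by
            rw [smul_add]
            exact hC hx hy (by norm_num) (by norm_num) (by norm_num)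
          simp only [Set.indicator_of_mem hx, Set.indicator_of_mem hy, Set.indicator_of_mem hz]
          rw [← ENNReal.ofReal_mul (Real.exp_nonneg _), ← ENNReal.ofReal_pow (Real.exp_nonneg _),
            ← ENNReal.ofReal_mul (Real.exp_nonneg _), ← Real.exp_add, ← Real.exp_nat_mul,
            ← Real.exp_add]
          refine ENNReal.ofReal_le_ofReal (Real.exp_le_exp.2 ?_)
          have := h x y
          push_cast
          linarith
        · simp [hy]
      · simp [hx])
  rw [lintegral_indicator hCm, lintegral_indicator hCm, lintegral_indicator hCm,
    setLIntegral_const, mul_pow, ← ENNReal.ofReal_pow (Real.exp_nonneg _), ← Real.exp_nat_mul]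
    at key
  convert key using 4
  push_cast; ring

end QuadrantExcursion

/-! ### Correlated Gaussian vectors in the plane and the Mahalanobis norm -/

namespace QuadrantExcursion

/-- The linear map sending a pair of `α`-correlated variables to uncorrelated ones. -/
noncomputable def decorrelate (α : ℝ) : (ℝ × ℝ) →L[ℝ] ℂ :=
  (ContinuousLinearMap.fst ℝ ℝ ℝ).smulRight (1 : ℂ) +
    ((√(1 - α ^ 2))⁻¹ • (ContinuousLinearMap.snd ℝ ℝ ℝ - α • ContinuousLinearMap.fst ℝ ℝ ℝ)).smulRight
      Complex.I

/-- The linear map sending a pair of independent variables to `α`-correlated ones. -/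
noncomputable def correlate (α : ℝ) : (ℝ × ℝ) →L[ℝ] (ℝ × ℝ) :=
  (ContinuousLinearMap.fst ℝ ℝ ℝ).prod
    (α • ContinuousLinearMap.fst ℝ ℝ ℝ + √(1 - α ^ 2) • ContinuousLinearMap.snd ℝ ℝ ℝ)

/-- The Mahalanobis norm of the correlation matrix. -/
noncomputable def mahal (α : ℝ) (p : ℝ × ℝ) : ℝ := ‖decorrelate α p‖

/-- The Mahalanobis inner product of the correlation matrix. -/
noncomputable def mahalInner (α : ℝ) (p q : ℝ × ℝ) : ℝ := inner ℝ (decorrelate α p) (decorrelate α q)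

variable {α : ℝ}

@[simp] theorem correlate_apply (α : ℝ) (p : ℝ × ℝ) :
    correlate α p = (p.1, α * p.1 + √(1 - α ^ 2) * p.2) := by
  simp [correlate]

theorem decorrelate_re (α : ℝ) (p : ℝ × ℝ) : (decorrelate α p).re = p.1 := by
  simp [decorrelate]

theorem decorrelate_im (α : ℝ) (p : ℝ × ℝ) :
    (decorrelate α p).im = (√(1 - α ^ 2))⁻¹ * (p.2 - α * p.1) := by
  simp [decorrelate]

theorem one_sub_sq_pos (hα : α ∈ Set.Ioo (-1 : ℝ) 1) : 0 < 1 - α ^ 2 := by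
  nlinarith [hα.1, hα.2]

theorem mahalInner_eq (α : ℝ) (p q : ℝ × ℝ) : mahalInner α p q = p.1 * q.1 +
    (√(1 - α ^ 2))⁻¹ ^ 2 * ((p.2 - α * p.1) * (q.2 - α * q.1)) := by
  rw [mahalInner, Complex.inner]
  simp [Complex.mul_re, decorrelate_re, decorrelate_im]
  ring

theorem mahal_sq (α : ℝ) (p : ℝ × ℝ) : mahal α p ^ 2 = mahalInner α p p := by
  rw [mahal, mahalInner, real_inner_self_eq_norm_sq]

theorem mahal_nonneg (α : ℝ) (p : ℝ × ℝ) : 0 ≤ mahal α p := norm_nonneg _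

@[simp] theorem mahal_zero (α : ℝ) : mahal α 0 = 0 := by simp [mahal]

theorem mahal_add_le (α : ℝ) (p q : ℝ × ℝ) : mahal α (p + q) ≤ mahal α p + mahal α q := by
  simpa [mahal] using norm_add_le _ _

theorem mahal_smul (α c : ℝ) (p : ℝ × ℝ) : mahal α (c • p) = |c| * mahal α p := by
  simp [mahal]

theorem mahal_sub_comm (α : ℝ) (p q : ℝ × ℝ) : mahal α (p - q) = mahal α (q - p) := by
  simp only [mahal, map_sub, norm_sub_rev]

@[fun_prop] theorem continuous_mahal (α : ℝ) : Continuous (mahal α) := by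
  unfold mahal; fun_prop

@[fun_prop] theorem measurable_mahal (α : ℝ) : Measurable (mahal α) := (continuous_mahal α).measurable

theorem mahal_le_mul_norm (α : ℝ) (p : ℝ × ℝ) : mahal α p ≤ ‖decorrelate α‖ * ‖p‖ :=
  (decorrelate α).le_opNorm p

/-- The quadratic form can be completed to a square around either coordinate, so it dominates the
square of each, hence the sup norm. -/
theorem norm_le_mahal (hα : α ∈ Set.Ioo (-1 : ℝ) 1) (p : ℝ × ℝ) : ‖p‖ ≤ mahal α p := by
  have h := one_sub_sq_pos hα
  have h1 := mahal_sq α p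
  rw [mahalInner_eq, inv_pow, Real.sq_sqrt h.le] at h1
  have e1 : mahal α p ^ 2 = p.1 ^ 2 + (1 - α ^ 2)⁻¹ * (p.2 - α * p.1) ^ 2 := by rw [h1]; ring
  have e2 : mahal α p ^ 2 = p.2 ^ 2 + (1 - α ^ 2)⁻¹ * (p.1 - α * p.2) ^ 2 := by
    rw [h1]; field_simp; ring
  have h0 := mahal_nonneg α p
  have hi : 0 < (1 - α ^ 2)⁻¹ := inv_pos.2 h
  rw [Prod.norm_def, max_le_iff]
  constructor
  · rw [Real.norm_eq_abs]
    refine abs_le_of_sq_le_sq ?_ h0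
    rw [e1]; nlinarith [mul_nonneg hi.le (sq_nonneg (p.2 - α * p.1))]
  · rw [Real.norm_eq_abs]
    refine abs_le_of_sq_le_sq ?_ h0
    rw [e2]; nlinarith [mul_nonneg hi.le (sq_nonneg (p.1 - α * p.2))]

theorem mahal_pos (hα : α ∈ Set.Ioo (-1 : ℝ) 1) {p : ℝ × ℝ} (hp : p ≠ 0) : 0 < mahal α p :=
  (norm_pos_iff.2 hp).trans_le (norm_le_mahal hα p)

theorem mahalInner_sub_right (α : ℝ) (p q r : ℝ × ℝ) :
    mahalInner α p (q - r) = mahalInner α p q - mahalInner α p r := by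
  simp [mahalInner, inner_sub_right]

theorem mahalInner_smul_left (α c : ℝ) (p q : ℝ × ℝ) :
    mahalInner α (c • p) q = c * mahalInner α p q := by
  simp [mahalInner]; ring

theorem abs_mahalInner_le (α : ℝ) (p q : ℝ × ℝ) : |mahalInner α p q| ≤ mahal α p * mahal α q :=
  abs_real_inner_le_norm _ _

@[fun_prop] theorem continuous_mahalInner (α : ℝ) (p : ℝ × ℝ) : Continuous (mahalInner α p) := by
  unfold mahalInner; fun_prop

theorem mahalInner_correlate (hα : α ∈ Set.Ioo (-1 : ℝ) 1) (p q : ℝ × ℝ) :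
    mahalInner α (correlate α p) (correlate α q) = p.1 * q.1 + p.2 * q.2 := by
  have h := Real.sqrt_pos.2 (one_sub_sq_pos hα)
  rw [mahalInner_eq]
  simp only [correlate_apply, add_sub_cancel_left]
  field_simp

theorem correlate_surjective (hα : α ∈ Set.Ioo (-1 : ℝ) 1) : Function.Surjective (correlate α) := by
  have h := Real.sqrt_pos.2 (one_sub_sq_pos hα)
  intro p
  refine ⟨(p.1, (√(1 - α ^ 2))⁻¹ * (p.2 - α * p.1)), ?_⟩
  ext
  · simp
  · simp only [correlate_apply]; field_simp; ring

/-- The centered Gaussian law on the plane with variances `v` and correlation `α`. -/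
noncomputable def corrGaussian (α : ℝ) (v : ℝ≥0) : Measure (ℝ × ℝ) :=
  ((gaussianReal 0 v).prod (gaussianReal 0 v)).map (correlate α)

instance (α : ℝ) (v : ℝ≥0) : IsProbabilityMeasure (corrGaussian α v) :=
  Measure.isProbabilityMeasure_map (by fun_prop)

/-- `correlate` is an isometry from the Euclidean to the Mahalanobis form, so the product cost is
carried over without loss. -/
theorem midpointIneq_corrGaussian (hα : α ∈ Set.Ioo (-1 : ℝ) 1) {v : ℝ≥0} (hv : v ≠ 0) :
    MidpointIneq (corrGaussian α v) fun d ↦ mahal α d ^ 2 / (4 * v) := by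
  have h := (midpointIneq_gaussianReal hv).prod (midpointIneq_gaussianReal hv)
  refine h.map (correlate α).toLinearMap (correlate α).continuous.measurable fun d ↦ le_of_eq ?_
  rw [mahal_sq]
  change mahalInner α (correlate α d) (correlate α d) / _ = _
  rw [mahalInner_correlate hα]
  ring

/-- The Cameron–Martin density of the correlated Gaussian law. -/
noncomputable def shiftDensity (α : ℝ) (v : ℝ≥0) (u x : ℝ × ℝ) : ℝ≥0∞ :=
  ENNReal.ofReal (Real.exp ((mahalInner α u x - mahal α u ^ 2 / 2) / v))

@[fun_prop] theorem measurable_shiftDensity (α : ℝ) (v : ℝ≥0) (u : ℝ × ℝ) :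
    Measurable (shiftDensity α v u) := by
  unfold shiftDensity; fun_prop

theorem gaussianReal_eq_withDensity {v : ℝ≥0} (hv : v ≠ 0) (a : ℝ) :
    gaussianReal a v = (gaussianReal 0 v).withDensity
      fun x ↦ ENNReal.ofReal (Real.exp ((a * x - a ^ 2 / 2) / v)) := by
  have hv' : (0 : ℝ) < v := by positivity
  rw [gaussianReal_of_var_ne_zero _ hv, gaussianReal_of_var_ne_zero _ hv, ← withDensity_mul _
    (measurable_gaussianPDF _ _) (by fun_prop)]
  congr 1
  ext x
  simp only [gaussianPDF, Pi.mul_apply]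
  rw [← ENNReal.ofReal_mul (gaussianPDFReal_nonneg _ _ _)]
  congr 1
  simp only [gaussianPDFReal]
  conv_rhs => rw [mul_assoc, ← Real.exp_add]
  congr 2
  field_simp
  ring

/-- Cameron–Martin for the plane: pulled back by `correlate`, a shift acts on independent
coordinates, and the two one-dimensional densities multiply. -/
theorem corrGaussian_map_add (hα : α ∈ Set.Ioo (-1 : ℝ) 1) {v : ℝ≥0} (hv : v ≠ 0) (u : ℝ × ℝ) :
    (corrGaussian α v).map (u + ·) = (corrGaussian α v).withDensity (shiftDensity α v u) := by
  obtain ⟨a, rfl⟩ := correlate_surjective hα u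
  have e1 : ((gaussianReal 0 v).prod (gaussianReal 0 v)).map (a + ·) =
      (gaussianReal a.1 v).prod (gaussianReal a.2 v) := by
    have : (fun p : ℝ × ℝ ↦ a + p) = Prod.map (a.1 + ·) (a.2 + ·) := by ext <;> simp
    rw [this, ← Measure.map_prod_map _ _ (by fun_prop) (by fun_prop), gaussianReal_map_const_add,
      gaussianReal_map_const_add, zero_add, zero_add]
  have e2 : (corrGaussian α v).map (correlate α a + ·) =
      ((gaussianReal a.1 v).prod (gaussianReal a.2 v)).map (correlate α) := by
    rw [← e1, corrGaussian, Measure.map_map (by fun_prop) (by fun_prop),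
      Measure.map_map (by fun_prop) (by fun_prop)]
    congr 1
    ext p <;> simp only [Function.comp, map_add]
  rw [e2, gaussianReal_eq_withDensity hv a.1, gaussianReal_eq_withDensity hv a.2,
    prod_withDensity (by fun_prop) (by fun_prop)]
  refine Measure.ext_of_lintegral _ fun f hf ↦ ?_
  rw [lintegral_map hf (by fun_prop), lintegral_withDensity_eq_lintegral_mul _ (by fun_prop)
    (by fun_prop), lintegral_withDensity_eq_lintegral_mul _ (by fun_prop) hf, corrGaussian,
    lintegral_map (by fun_prop) (by fun_prop)]
  refine lintegral_congr fun p ↦ ?_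
  simp only [Pi.mul_apply, shiftDensity, mahal_sq, mahalInner_correlate hα]
  rw [← ENNReal.ofReal_mul (Real.exp_nonneg _), ← Real.exp_add]
  congr 3
  ring

theorem corrGaussian_pos_of_isOpen (hα : α ∈ Set.Ioo (-1 : ℝ) 1) {v : ℝ≥0} (hv : v ≠ 0)
    {U : Set (ℝ × ℝ)} (hU : IsOpen U) (hne : U.Nonempty) : corrGaussian α v U ≠ 0 := by
  rw [corrGaussian, Measure.map_apply (by fun_prop) hU.measurableSet]
  intro h
  have hac : (volume : Measure (ℝ × ℝ)) ≪ (gaussianReal 0 v).prod (gaussianReal 0 v) :=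
    (gaussianReal_absolutelyContinuous' 0 hv).prod (gaussianReal_absolutelyContinuous' 0 hv)
  obtain ⟨p, hp⟩ := hne
  obtain ⟨q, rfl⟩ := correlate_surjective hα p
  exact ((hU.preimage (correlate α).continuous).measure_pos volume ⟨q, hp⟩).ne' (hac h)

theorem integrable_corrGaussian_linear_exp (v : ℝ≥0) (u : ℝ × ℝ) :
    Integrable (fun x ↦ Real.exp (u.1 * x.1 + u.2 * x.2)) (corrGaussian α v) := by
  rw [corrGaussian, integrable_map_measure (by fun_prop) (by fun_prop)]
  have := (integrable_exp_mul_gaussianReal (μ := 0) (v := v) (u.1 + u.2 * α)).mul_prod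
    (integrable_exp_mul_gaussianReal (μ := 0) (v := v) (u.2 * √(1 - α ^ 2)))
  refine this.congr (.of_forall fun p ↦ ?_)
  simp only [Function.comp, correlate_apply]
  rw [← Real.exp_add]
  congr 1; ring

theorem measurableSet_quadrant : MeasurableSet quadrant :=
  (isClosed_le continuous_const continuous_fst).inter
    (isClosed_le continuous_const continuous_snd) |>.measurableSet

theorem isClosed_quadrant : IsClosed quadrant :=
  (isClosed_le continuous_const continuous_fst).inter
    (isClosed_le continuous_const continuous_snd)

theorem convex_quadrant : Convex ℝ quadrant := by
  rintro p ⟨h1, h2⟩ q ⟨h3, h4⟩ a b ha hb -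
  exact ⟨by simp; positivity, by simp; positivity⟩

end QuadrantExcursion

/-! ### From exponential moments to moments of two independent copies -/

namespace QuadrantExcursion

variable {α : ℝ}

/-- All terms of the series of `cosh` are nonnegative, so any of them may be dropped. The quadratic
and the quartic term extract second and fourth moments from exponential ones. -/
theorem one_add_sq_le_cosh (d : ℝ) : 1 + d ^ 2 / 2 ≤ (Real.exp d + Real.exp (-d)) / 2 := by
  rw [← Real.cosh_eq]
  have := sum_le_hasSum {0, 1} (fun n _ ↦ by rw [pow_mul]; positivity) (Real.hasSum_cosh d)
  simpa using this

theorem pow_four_le_cosh (d : ℝ) : d ^ 4 / 24 ≤ (Real.exp d + Real.exp (-d)) / 2 := by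
  rw [← Real.cosh_eq]
  have := sum_le_hasSum {2} (fun n _ ↦ by rw [pow_mul]; positivity) (Real.hasSum_cosh d)
  simpa [Nat.factorial] using this

theorem cond_eq_smul_restrict {S : Type*} [MeasurableSpace S] (μ : Measure S) (C : Set S) :
    ProbabilityTheory.cond μ C = (μ C)⁻¹ • μ.restrict C := rfl

/-- The normalized form of `MidpointIneq.setLIntegral_exp_mul_le`. -/
theorem MidpointIneq.lintegral_exp_mul_cond_le {S : Type*} [MeasurableSpace S] [AddCommGroup S]
    [Module ℝ S] {μ : Measure S} [IsFiniteMeasure μ] {c : S → ℝ} (hμ : MidpointIneq μ c) {C : Set S}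
    (hC : Convex ℝ C) (hCm : MeasurableSet C) (hC0 : μ C ≠ 0) {f : S → ℝ} (hf : Measurable f)
    {b : ℝ} (h : ∀ x y, f x - f y ≤ c (x - y) + b) :
    (∫⁻ x, ENNReal.ofReal (Real.exp (f x)) ∂(ProbabilityTheory.cond μ C)) *
      ∫⁻ x, ENNReal.ofReal (Real.exp (-f x)) ∂(ProbabilityTheory.cond μ C) ≤
        ENNReal.ofReal (Real.exp b) := by
  rw [cond_eq_smul_restrict, lintegral_smul_measure, lintegral_smul_measure, smul_eq_mul,
    smul_eq_mul, mul_mul_mul_comm]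
  calc _ ≤ ((μ C)⁻¹ * (μ C)⁻¹) * (ENNReal.ofReal (Real.exp b) * μ C ^ 2) := by
        exact mul_le_mul_right (hμ.setLIntegral_exp_mul_le hC hCm hf h) _
    _ = ((μ C)⁻¹ * μ C) ^ 2 * ENNReal.ofReal (Real.exp b) := by ring
    _ = _ := by rw [ENNReal.inv_mul_cancel hC0 (measure_ne_top _ _)]; simp

section TwoCopies

variable {S : Type*} [MeasurableSpace S] {ν : Measure S} [IsProbabilityMeasure ν] {f : S → ℝ}
  {v : ℝ}

/-- The product of the opposite exponential moments is the exponential moment of `f p.1 - f p.2` for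
two independent copies; averaging over `ε` and `-ε` gives `cosh`. Working with two copies avoids
centring `f`. -/
theorem lintegral_cosh_le (hf : Measurable f)
    (h : ∀ ε : ℝ, (∫⁻ x, ENNReal.ofReal (Real.exp (ε * f x)) ∂ν) *
      ∫⁻ x, ENNReal.ofReal (Real.exp (-(ε * f x))) ∂ν ≤ ENNReal.ofReal (Real.exp (ε ^ 2 * v)))
    (ε : ℝ) : ∫⁻ p, ENNReal.ofReal ((Real.exp (ε * (f p.1 - f p.2)) +
      Real.exp (-(ε * (f p.1 - f p.2)))) / 2) ∂(ν.prod ν) ≤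
        ENNReal.ofReal (Real.exp (ε ^ 2 * v)) := by
  have key : ∀ ε : ℝ, ∫⁻ p, ENNReal.ofReal (Real.exp (ε * (f p.1 - f p.2))) ∂(ν.prod ν) ≤
      ENNReal.ofReal (Real.exp (ε ^ 2 * v)) := by
    intro ε
    refine le_trans (le_of_eq ?_) (h ε)
    rw [← lintegral_prod_mul (by fun_prop) (by fun_prop)]
    refine lintegral_congr fun p ↦ ?_
    rw [← ENNReal.ofReal_mul (Real.exp_nonneg _), ← Real.exp_add]
    congr 2; ring
  have e : ∀ p : S × S, ENNReal.ofReal ((Real.exp (ε * (f p.1 - f p.2)) +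
      Real.exp (-(ε * (f p.1 - f p.2)))) / 2) =
      2⁻¹ * (ENNReal.ofReal (Real.exp (ε * (f p.1 - f p.2))) +
        ENNReal.ofReal (Real.exp (-ε * (f p.1 - f p.2)))) := by
    intro p
    rw [← ENNReal.ofReal_add (by positivity) (by positivity),
      show (2⁻¹ : ℝ≥0∞) = ENNReal.ofReal 2⁻¹ by
        rw [ENNReal.ofReal_inv_of_pos (by norm_num)]; simp,
      ← ENNReal.ofReal_mul (by positivity)]
    congr 1
    rw [neg_mul]; ring
  simp_rw [e]
  rw [lintegral_const_mul _ (by fun_prop), lintegral_add_left (by fun_prop)]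
  have h1 := key ε
  have h2 := key (-ε)
  rw [neg_sq] at h2
  calc _ ≤ (2⁻¹ : ℝ≥0∞) * (ENNReal.ofReal (Real.exp (ε ^ 2 * v)) +
        ENNReal.ofReal (Real.exp (ε ^ 2 * v))) := by gcongr
    _ = _ := by rw [← two_mul, ← mul_assoc, ENNReal.inv_mul_cancel (by simp) (by simp), one_mul]

/-- The quadratic term of `cosh` gives the bound `2 (exp (ε² v) - 1) / ε²` for every `ε > 0`.
Letting `ε → 0` yields the sharp constant, which the contraction with constant one requires. -/
theorem lintegral_sub_sq_le (hf : Measurable f)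
    (h : ∀ ε : ℝ, (∫⁻ x, ENNReal.ofReal (Real.exp (ε * f x)) ∂ν) *
      ∫⁻ x, ENNReal.ofReal (Real.exp (-(ε * f x))) ∂ν ≤ ENNReal.ofReal (Real.exp (ε ^ 2 * v))) :
    ∫⁻ p, ENNReal.ofReal ((f p.1 - f p.2) ^ 2) ∂(ν.prod ν) ≤ ENNReal.ofReal (2 * v) := by
  have key : ∀ ε : ℝ, 0 < ε → ∫⁻ p, ENNReal.ofReal ((f p.1 - f p.2) ^ 2) ∂(ν.prod ν) ≤
      ENNReal.ofReal (2 * ((Real.exp (ε ^ 2 * v) - 1) / ε ^ 2)) := by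
    intro ε hε
    have h1 : ∫⁻ p, ENNReal.ofReal (1 + ε ^ 2 / 2 * (f p.1 - f p.2) ^ 2) ∂(ν.prod ν) ≤
        ENNReal.ofReal (Real.exp (ε ^ 2 * v)) := by
      refine le_trans (lintegral_mono fun p ↦ ENNReal.ofReal_le_ofReal ?_) (lintegral_cosh_le hf h ε)
      have := one_add_sq_le_cosh (ε * (f p.1 - f p.2))
      rw [mul_pow] at this
      linarith
    have e : ∀ p : S × S, ENNReal.ofReal (1 + ε ^ 2 / 2 * (f p.1 - f p.2) ^ 2) =
        1 + ENNReal.ofReal (ε ^ 2 / 2) * ENNReal.ofReal ((f p.1 - f p.2) ^ 2) := by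
      intro p
      rw [ENNReal.ofReal_add (by norm_num) (by positivity), ENNReal.ofReal_mul (by positivity)]
      simp
    simp_rw [e] at h1
    rw [lintegral_add_left (by fun_prop), lintegral_const_mul _ (by fun_prop)] at h1
    simp only [lintegral_const, measure_univ, mul_one] at h1
    set I := ∫⁻ p, ENNReal.ofReal ((f p.1 - f p.2) ^ 2) ∂(ν.prod ν)
    have hI : I ≠ ∞ := by
      intro hI
      rw [hI, ENNReal.mul_top (by simpa using by positivity)] at h1
      simp at h1
    rw [← ENNReal.ofReal_toReal hI] at h1 ⊢
    rw [← ENNReal.ofReal_mul (by positivity), ← ENNReal.ofReal_one,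
      ← ENNReal.ofReal_add (by norm_num) (by positivity),
      ENNReal.ofReal_le_ofReal_iff (by positivity)] at h1
    refine ENNReal.ofReal_le_ofReal ?_
    rw [← mul_div_assoc, le_div_iff₀ (by positivity)]
    linarith
  have lim : Filter.Tendsto (fun ε : ℝ ↦ ENNReal.ofReal (2 * ((Real.exp (ε ^ 2 * v) - 1) / ε ^ 2)))
      (𝓝[>] 0) (𝓝 (ENNReal.ofReal (2 * v))) := by
    refine ENNReal.tendsto_ofReal (Filter.Tendsto.const_mul 2 ?_)
    have hd : HasDerivAt (fun x : ℝ ↦ Real.exp (x * v)) v 0 := by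
      have := ((hasDerivAt_id (0 : ℝ)).mul_const v).exp
      simpa using this
    have hs := hd.tendsto_slope_zero_right
    have hsq : Filter.Tendsto (fun ε : ℝ ↦ ε ^ 2) (𝓝[>] 0) (𝓝[>] 0) := by
      refine tendsto_nhdsWithin_iff.2 ⟨?_, ?_⟩
      · have : Filter.Tendsto (fun ε : ℝ ↦ ε ^ 2) (𝓝 0) (𝓝 (0 ^ 2)) := (continuous_pow 2).tendsto 0
        rw [zero_pow two_ne_zero] at this
        exact this.mono_left nhdsWithin_le_nhds
      · filter_upwards [self_mem_nhdsWithin] with x hx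
        exact pow_pos (Set.mem_Ioi.1 hx) 2
    refine (hs.comp hsq).congr fun ε ↦ ?_
    simp [div_eq_inv_mul]
  exact ge_of_tendsto lim (by filter_upwards [self_mem_nhdsWithin] with ε hε using key ε hε)

/-- Only the order `v²` matters here, so the single value `ε = v^(-1/2)` suffices; the constant is
`24 e ≤ 72`. -/
theorem lintegral_sub_pow_four_le (hf : Measurable f) (hv : 0 < v)
    (h : ∀ ε : ℝ, (∫⁻ x, ENNReal.ofReal (Real.exp (ε * f x)) ∂ν) *
      ∫⁻ x, ENNReal.ofReal (Real.exp (-(ε * f x))) ∂ν ≤ ENNReal.ofReal (Real.exp (ε ^ 2 * v))) :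
    ∫⁻ p, ENNReal.ofReal ((f p.1 - f p.2) ^ 4) ∂(ν.prod ν) ≤ ENNReal.ofReal (72 * v ^ 2) := by
  set ε := (√v)⁻¹
  have hε : ε ^ 2 = v⁻¹ := by simp only [ε]; rw [inv_pow, Real.sq_sqrt hv.le]
  have hε4 : ε ^ 4 = (v⁻¹) ^ 2 := by rw [← hε]; ring
  have h1 : ∫⁻ p, ENNReal.ofReal (ε ^ 4 / 24) * ENNReal.ofReal ((f p.1 - f p.2) ^ 4) ∂(ν.prod ν) ≤
      ENNReal.ofReal (Real.exp (ε ^ 2 * v)) := by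
    refine le_trans (lintegral_mono fun p ↦ ?_) (lintegral_cosh_le hf h ε)
    rw [← ENNReal.ofReal_mul (by positivity)]
    refine ENNReal.ofReal_le_ofReal ?_
    have := pow_four_le_cosh (ε * (f p.1 - f p.2))
    rw [mul_pow] at this
    linarith
  rw [lintegral_const_mul _ (by fun_prop), hε, inv_mul_cancel₀ hv.ne', hε4] at h1
  calc ∫⁻ p, ENNReal.ofReal ((f p.1 - f p.2) ^ 4) ∂(ν.prod ν)
      = ENNReal.ofReal (24 * v ^ 2) * (ENNReal.ofReal (v⁻¹ ^ 2 / 24) *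
        ∫⁻ p, ENNReal.ofReal ((f p.1 - f p.2) ^ 4) ∂(ν.prod ν)) := by
        rw [← mul_assoc, ← ENNReal.ofReal_mul (by positivity)]
        rw [show 24 * v ^ 2 * (v⁻¹ ^ 2 / 24) = 1 by field_simp]
        simp
    _ ≤ ENNReal.ofReal (24 * v ^ 2) * ENNReal.ofReal (Real.exp 1) := by gcongr
    _ ≤ _ := by
        rw [← ENNReal.ofReal_mul (by positivity)]
        refine ENNReal.ofReal_le_ofReal ?_
        nlinarith [Real.exp_one_lt_d9, sq_nonneg v]

/-- Twice the covariance is the mean of `(f p.1 - f p.2) * (g p.1 - g p.2)` over two independent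
copies, and AM–GM with weights `b / a` and `a / b` plays the role of Cauchy–Schwarz. -/
theorem abs_integral_mul_sub_le {g : S → ℝ} (hf : Measurable f) (hg : Measurable g) {M a b : ℝ}
    (hM : ∀ x, |f x| ≤ M) (hgi : Integrable g ν) (ha : 0 < a) (hb : 0 < b)
    (h1 : ∫⁻ p, ENNReal.ofReal ((f p.1 - f p.2) ^ 2) ∂(ν.prod ν) ≤ ENNReal.ofReal (2 * a ^ 2))
    (h2 : ∫⁻ p, ENNReal.ofReal ((g p.1 - g p.2) ^ 2) ∂(ν.prod ν) ≤ ENNReal.ofReal (2 * b ^ 2)) :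
    |∫ x, f x * g x ∂ν - (∫ x, f x ∂ν) * ∫ x, g x ∂ν| ≤ a * b := by
  have hfi : Integrable f ν := .of_bound hf.aestronglyMeasurable M (.of_forall hM)
  have hfg : Integrable (fun x ↦ f x * g x) ν :=
    hgi.bdd_mul (c := M) hf.aestronglyMeasurable (.of_forall hM)
  have i1 : Integrable (fun p : S × S ↦ f p.1 * g p.1) (ν.prod ν) := hfg.comp_fst ν
  have i2 : Integrable (fun p : S × S ↦ f p.2 * g p.2) (ν.prod ν) := hfg.comp_snd ν
  have i3 : Integrable (fun p : S × S ↦ f p.1 * g p.2) (ν.prod ν) := hfi.mul_prod hgi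
  have i4 : Integrable (fun p : S × S ↦ g p.1 * f p.2) (ν.prod ν) := hgi.mul_prod hfi
  have e : ∫ p, (f p.1 - f p.2) * (g p.1 - g p.2) ∂(ν.prod ν) =
      2 * (∫ x, f x * g x ∂ν - (∫ x, f x ∂ν) * ∫ x, g x ∂ν) := by
    have e1 : ∀ p : S × S, (f p.1 - f p.2) * (g p.1 - g p.2) =
        ((f p.1 * g p.1) + (f p.2 * g p.2)) - ((f p.1 * g p.2) + (g p.1 * f p.2)) := by
      intro p; ring
    simp_rw [e1]
    have e2 := integral_sub (i1.add i2) (i3.add i4)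
    simp only [Pi.add_apply] at e2
    rw [e2, integral_add i1 i2, integral_add i3 i4,
      integral_prod_mul, integral_prod_mul, integral_fun_fst (fun x ↦ f x * g x),
      integral_fun_snd (fun x ↦ f x * g x)]
    simp
    ring
  have hm : Measurable fun p : S × S ↦ (f p.1 - f p.2) ^ 2 := by fun_prop
  have bound : ENNReal.ofReal |∫ p, (f p.1 - f p.2) * (g p.1 - g p.2) ∂(ν.prod ν)| ≤
      ENNReal.ofReal (2 * (a * b)) := by
    rw [← Real.enorm_eq_ofReal_abs]
    refine (enorm_integral_le_lintegral_enorm _).trans ?_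
    calc ∫⁻ p, ‖(f p.1 - f p.2) * (g p.1 - g p.2)‖ₑ ∂(ν.prod ν)
        ≤ ∫⁻ p, (ENNReal.ofReal (b / a / 2) * ENNReal.ofReal ((f p.1 - f p.2) ^ 2) +
          ENNReal.ofReal (a / b / 2) * ENNReal.ofReal ((g p.1 - g p.2) ^ 2)) ∂(ν.prod ν) := by
          refine lintegral_mono fun p ↦ ?_
          rw [← ENNReal.ofReal_mul (by positivity), ← ENNReal.ofReal_mul (by positivity),
            ← ENNReal.ofReal_add (by positivity) (by positivity), Real.enorm_eq_ofReal_abs]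
          refine ENNReal.ofReal_le_ofReal ?_
          set x := f p.1 - f p.2
          set y := g p.1 - g p.2
          have k : 0 ≤ (b * |x| - a * |y|) ^ 2 / (2 * (a * b)) := by positivity
          have k2 : (b * |x| - a * |y|) ^ 2 / (2 * (a * b)) =
              b / a / 2 * x ^ 2 + a / b / 2 * y ^ 2 - |x| * |y| := by
            rw [← sq_abs x, ← sq_abs y]; field_simp; ring
          rw [abs_mul]
          linarith
      _ ≤ ENNReal.ofReal (b / a / 2) * ENNReal.ofReal (2 * a ^ 2) +
          ENNReal.ofReal (a / b / 2) * ENNReal.ofReal (2 * b ^ 2) := by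
          rw [lintegral_add_left (by fun_prop), lintegral_const_mul _ (by fun_prop),
            lintegral_const_mul _ (by fun_prop)]
          gcongr
      _ = _ := by
          rw [← ENNReal.ofReal_mul (by positivity), ← ENNReal.ofReal_mul (by positivity),
            ← ENNReal.ofReal_add (by positivity) (by positivity)]
          congr 1
          field_simp
          ring
  rw [ENNReal.ofReal_le_ofReal_iff (by positivity), e, abs_mul, abs_two] at bound
  linarith

end TwoCopies

/-! ### The one-site law and its contraction in the mean -/

/-- The Gaussian law with mean `m` conditioned to lie in the quadrant. -/
noncomputable def siteLaw (α : ℝ) (v : ℝ≥0) (m : ℝ × ℝ) : Measure (ℝ × ℝ) :=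
  ProbabilityTheory.cond ((corrGaussian α v).map (m + ·)) quadrant

theorem MidpointIneq.map_const_add {S : Type*} [MeasurableSpace S] [AddCommGroup S]
    [Module ℝ S] [MeasurableAdd S] {μ : Measure S} {c : S → ℝ} (hμ : MidpointIneq μ c) (m : S) :
    MidpointIneq (μ.map (m + ·)) c := by
  intro F G H hF hG hH h
  have hm := measurable_const_add m
  rw [lintegral_map hF hm, lintegral_map hG hm, lintegral_map hH hm]
  refine hμ _ _ _ (hF.comp hm) (hG.comp hm) (hH.comp hm) fun x y ↦ (h _ _).trans (le_of_eq ?_)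
  have : (1 / 2 : ℝ) • (m + x + (m + y)) = m + (1 / 2 : ℝ) • (x + y) := by module
  rw [this, add_sub_add_left_eq_sub]

section Site

variable (hα : α ∈ Set.Ioo (-1 : ℝ) 1) {v : ℝ≥0} (hv : v ≠ 0)
include hα hv

theorem corrGaussian_map_quadrant_ne_zero (m : ℝ × ℝ) :
    (corrGaussian α v).map (m + ·) quadrant ≠ 0 := by
  rw [Measure.map_apply (by fun_prop) measurableSet_quadrant]
  intro h
  refine corrGaussian_pos_of_isOpen hα hv (U := {x | 0 < m.1 + x.1 ∧ 0 < m.2 + x.2}) ?_ ?_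
    (measure_mono_null ?_ h)
  · exact (isOpen_lt continuous_const (continuous_const.add continuous_fst)).inter
      (isOpen_lt continuous_const (continuous_const.add continuous_snd))
  · exact ⟨(1 - m.1, 1 - m.2), by simp⟩
  · rintro x ⟨h1, h2⟩
    exact ⟨h1.le, h2.le⟩

theorem isProbabilityMeasure_siteLaw (m : ℝ × ℝ) : IsProbabilityMeasure (siteLaw α v m) := by
  have : IsProbabilityMeasure ((corrGaussian α v).map (m + ·)) :=
    Measure.isProbabilityMeasure_map (by fun_prop)
  exact cond_isProbabilityMeasure (corrGaussian_map_quadrant_ne_zero hα hv m)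

/-- Conditioning on a convex set does not raise the Gaussian variance bound `L² v`. Completing the
square gives `|ε| L d ≤ d² / (4v) + ε² L² v`, which is the input of the exponential estimate. -/
theorem lintegral_sub_sq_siteLaw_le (m : ℝ × ℝ) {f : ℝ × ℝ → ℝ} (hf : Measurable f) {L : ℝ}
    (hL : ∀ x y, |f x - f y| ≤ L * mahal α (x - y)) :
    ∫⁻ p, ENNReal.ofReal ((f p.1 - f p.2) ^ 2) ∂((siteLaw α v m).prod (siteLaw α v m)) ≤
      ENNReal.ofReal (2 * (L ^ 2 * v)) := by
  have := isProbabilityMeasure_siteLaw hα hv m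
  have : IsProbabilityMeasure ((corrGaussian α v).map (m + ·)) :=
    Measure.isProbabilityMeasure_map (by fun_prop)
  refine lintegral_sub_sq_le hf fun ε ↦ ?_
  refine ((midpointIneq_corrGaussian hα hv).map_const_add m).lintegral_exp_mul_cond_le
    convex_quadrant measurableSet_quadrant (corrGaussian_map_quadrant_ne_zero hα hv m)
    (by fun_prop) fun x y ↦ ?_
  have hv' : (0 : ℝ) < v := by positivity
  have h1 : ε * f x - ε * f y ≤ |ε| * (L * mahal α (x - y)) := by
    rw [← mul_sub]
    refine (le_abs_self _).trans ?_
    rw [abs_mul]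
    gcongr
    exact hL x y
  have h2 : 0 ≤ (mahal α (x - y) - 2 * v * (|ε| * L)) ^ 2 / (4 * v) := by positivity
  have h3 : (mahal α (x - y) - 2 * v * (|ε| * L)) ^ 2 / (4 * v) =
      mahal α (x - y) ^ 2 / (4 * v) + ε ^ 2 * (L ^ 2 * v) - |ε| * (L * mahal α (x - y)) := by
    rw [← sq_abs ε]; field_simp; ring
  linarith

/-- Moving the mean by `t • u` becomes an exponential tilt of a fixed law on a fixed domain, which
makes the dependence on `t` smooth. The prefactor cancels on normalisation. -/
theorem setIntegral_map_corrGaussian (m u : ℝ × ℝ) (t : ℝ) {f : ℝ × ℝ → ℝ} (hf : Measurable f) :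
    ∫ x in quadrant, f x ∂((corrGaussian α v).map ((m + t • u) + ·)) =
      Real.exp (-(t ^ 2 * mahal α u ^ 2 / 2 / v)) * ∫ y in (m + ·) ⁻¹' quadrant,
        f (m + y) * Real.exp (t * (mahalInner α u y / v)) ∂(corrGaussian α v) := by
  have e : (corrGaussian α v).map ((m + t • u) + ·) =
      ((corrGaussian α v).withDensity (shiftDensity α v (t • u))).map (m + ·) := by
    rw [← corrGaussian_map_add hα hv, Measure.map_map (by fun_prop) (by fun_prop)]
    congr 1
    ext x <;> simp [add_assoc]
  have hC : MeasurableSet ((fun x : ℝ × ℝ ↦ m + x) ⁻¹' quadrant) :=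
    (by fun_prop : Measurable fun x : ℝ × ℝ ↦ m + x) measurableSet_quadrant
  rw [e, setIntegral_map measurableSet_quadrant hf.aestronglyMeasurable (by fun_prop),
    setIntegral_withDensity_eq_setIntegral_toReal_smul (measurable_shiftDensity α v (t • u))
      (.of_forall fun x ↦ (ENNReal.ofReal_lt_top : shiftDensity α v (t • u) x < ∞)) _ hC, ← integral_const_mul]
  refine integral_congr_ae (.of_forall fun y ↦ ?_)
  simp only [shiftDensity, ENNReal.toReal_ofReal (Real.exp_nonneg _), smul_eq_mul, mahal_smul,
    mahalInner_smul_left]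
  rw [mul_left_comm, ← Real.exp_add, mul_comm]
  congr 2
  rw [mul_pow, sq_abs]
  ring

theorem integral_siteLaw_eq (m u : ℝ × ℝ) (t : ℝ) {f : ℝ × ℝ → ℝ} (hf : Measurable f) :
    ∫ x, f x ∂(siteLaw α v (m + t • u)) =
      (∫ y in (m + ·) ⁻¹' quadrant, f (m + y) * Real.exp (t * (mahalInner α u y / v))
        ∂(corrGaussian α v)) / ∫ y in (m + ·) ⁻¹' quadrant,
        Real.exp (t * (mahalInner α u y / v)) ∂(corrGaussian α v) := by
  rw [siteLaw, cond_eq_smul_restrict, integral_smul_measure, ENNReal.toReal_inv, smul_eq_mul,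
    setIntegral_map_corrGaussian hα hv m u t hf]
  have h1 : ((corrGaussian α v).map ((m + t • u) + ·) quadrant).toReal =
      ∫ x in quadrant, (1 : ℝ) ∂((corrGaussian α v).map ((m + t • u) + ·)) := by
    simp [Measure.real]
  rw [h1, setIntegral_map_corrGaussian hα hv m u t measurable_const, inv_mul_eq_div,
    mul_div_mul_left _ _ (Real.exp_ne_zero _)]
  simp

omit hα hv in
theorem integrable_exp_mahalInner (u : ℝ × ℝ) (v : ℝ≥0) (t : ℝ) :
    Integrable (fun y ↦ Real.exp (t * (mahalInner α u y))) (corrGaussian α v) := by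
  obtain ⟨a, ha⟩ : ∃ a : ℝ × ℝ, ∀ y, t * (mahalInner α u y) = a.1 * y.1 + a.2 * y.2 := by
    refine ⟨(t * (u.1 - (√(1 - α ^ 2))⁻¹ ^ 2 * (u.2 - α * u.1) * α),
      t * ((√(1 - α ^ 2))⁻¹ ^ 2 * (u.2 - α * u.1))), fun y ↦ ?_⟩
    rw [mahalInner_eq]; ring
  simp_rw [ha]
  exact integrable_corrGaussian_linear_exp v a

omit hα hv in
theorem integrable_exp_abs_mahalInner (u : ℝ × ℝ) (v : ℝ≥0) (t : ℝ) :
    Integrable (fun y ↦ Real.exp (t * |mahalInner α u y|)) (corrGaussian α v) := by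
  refine ((integrable_exp_mahalInner (α := α) u v t).add
    (integrable_exp_mahalInner (α := α) u v (-t))).mono' (by fun_prop) (.of_forall fun y ↦ ?_)
  rw [Real.norm_eq_abs, Real.abs_exp]
  simp only [Pi.add_apply]
  rcases abs_cases (mahalInner α u y) with ⟨h, -⟩ | ⟨h, -⟩ <;> rw [h]
  · linarith [Real.exp_pos (-t * mahalInner α u y)]
  · rw [mul_neg, neg_mul]; linarith [Real.exp_pos (t * mahalInner α u y)]

/-- The derivative of the mean of `f` along an exponential tilt is the covariance of `f` with the
tilting variable. -/
theorem hasDerivAt_integral_siteLaw (m u : ℝ × ℝ) {f : ℝ × ℝ → ℝ} (hf : Measurable f) {M : ℝ}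
    (hM : ∀ x, |f x| ≤ M) :
    HasDerivAt (fun t : ℝ ↦ ∫ x, f x ∂(siteLaw α v (m + t • u)))
      (∫ x, f x * (mahalInner α u (x - m) / v) ∂(siteLaw α v m) -
        (∫ x, f x ∂(siteLaw α v m)) * ∫ x, mahalInner α u (x - m) / v ∂(siteLaw α v m)) 0 := by
  have hv' : (0 : ℝ) < v := by positivity
  set ν := (corrGaussian α v).restrict ((m + ·) ⁻¹' quadrant)
  have hν : ∫ y, (1 : ℝ) ∂ν ≠ 0 := by
    have := corrGaussian_map_quadrant_ne_zero hα hv m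
    rw [Measure.map_apply (by fun_prop) measurableSet_quadrant] at this
    simp only [ν, integral_const, smul_eq_mul, mul_one, Measure.real, Measure.restrict_apply_univ]
    exact ENNReal.toReal_ne_zero.2 ⟨this, measure_ne_top _ _⟩
  -- With `z` the tilting variable, the derivative for `|t| < 1` is at most `|M| |z| e^{|z|} ≤ |M|
  -- e^{2|z|}`, whence the factor `2 / v`.
  have hb : Integrable (fun y ↦ |M| * Real.exp (2 / v * |mahalInner α u y|)) ν :=
    ((integrable_exp_abs_mahalInner (α := α) u v _).const_mul _).restrict
  have main : ∀ h : ℝ × ℝ → ℝ, Measurable h → (∀ x, |h x| ≤ |M|) →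
      HasDerivAt (fun t : ℝ ↦ ∫ y, h y * Real.exp (t * (mahalInner α u y / v)) ∂ν)
        (∫ y, h y * (mahalInner α u y / v) ∂ν) 0 := by
    intro h hh hhM
    have := (hasDerivAt_integral_of_dominated_loc_of_deriv_le (μ := ν) (𝕜 := ℝ) (x₀ := 0)
      (F := fun t y ↦ h y * Real.exp (t * (mahalInner α u y / v)))
      (F' := fun t y ↦ h y * ((mahalInner α u y / v) * Real.exp (t * (mahalInner α u y / v))))
      (s := Set.Ioo (-1) 1) (Ioo_mem_nhds (by norm_num) (by norm_num))
      (.of_forall fun t ↦ (by fun_prop : Measurable _).aestronglyMeasurable)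
      (by
        refine Integrable.of_bound (C := |M|) (by fun_prop) (.of_forall fun y ↦ ?_)
        simpa using hhM y)
      ((by fun_prop : Measurable _).aestronglyMeasurable)
      (bound := fun y ↦ |M| * Real.exp (2 / v * |mahalInner α u y|))
      (.of_forall fun y t ht ↦ ?_) hb (.of_forall fun y t _ ↦ ?_)).2
    · simpa using this
    · rw [norm_mul, norm_mul, Real.norm_eq_abs, Real.norm_eq_abs, Real.norm_eq_abs, Real.abs_exp]
      refine mul_le_mul (hhM y) ?_ (by positivity) (by positivity)
      set z := mahalInner α u y / v
      have e : 2 / v * |mahalInner α u y| = |z| + |z| := by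
        simp only [z, abs_div, abs_of_pos hv']; ring
      rw [e, Real.exp_add]
      have k1 : |z| ≤ Real.exp |z| := by linarith [Real.add_one_le_exp |z|]
      refine mul_le_mul k1 (Real.exp_le_exp.2 ?_) (Real.exp_nonneg _) (Real.exp_nonneg _)
      refine (le_abs_self _).trans ?_
      rw [abs_mul]
      have : |t| ≤ 1 := abs_le.2 ⟨ht.1.le, ht.2.le⟩
      nlinarith [abs_nonneg z]
    · have h1 := ((hasDerivAt_id t).mul_const (mahalInner α u y / v)).exp.const_mul (h y)
      simp only [id, one_mul] at h1
      refine h1.congr_deriv ?_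
      ring
  -- The derivative of the denominator is `main` for the constant `|M|` divided by `|M|`, so `M = 0`
  -- is set apart.
  rcases eq_or_ne M 0 with hM0 | hM0
  · have hf0 : f = 0 := funext fun x ↦ by simpa [hM0] using hM x
    simp [hf0, hasDerivAt_const]
  have d1 := main (fun y ↦ f (m + y)) (by fun_prop) fun x ↦ (hM _).trans (le_abs_self _)
  have d2 := (main (fun y ↦ |M|) (by fun_prop) fun x ↦ by simp).div_const |M|
  have hM' : |M| ≠ 0 := by simpa using hM0
  simp only [integral_const_mul, mul_div_cancel_left₀ _ hM'] at d2
  have d : HasDerivAt (fun t ↦ (∫ y, f (m + y) * Real.exp (t * (mahalInner α u y / v)) ∂ν) /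
      ∫ y, Real.exp (t * (mahalInner α u y / v)) ∂ν) _ 0 := d1.div d2 (by simpa using hν)
  have e0 : ∀ {g : ℝ × ℝ → ℝ}, Measurable g → ∫ x, g x ∂(siteLaw α v m) =
      (∫ y, g (m + y) ∂ν) / ∫ y, (1 : ℝ) ∂ν := by
    intro g hg
    have := integral_siteLaw_eq hα hv m u 0 hg
    simpa [ν] using this
  have efun : (fun t : ℝ ↦ ∫ x, f x ∂(siteLaw α v (m + t • u))) = fun t ↦
      (∫ y, f (m + y) * Real.exp (t * (mahalInner α u y / v)) ∂ν) /
        ∫ y, Real.exp (t * (mahalInner α u y / v)) ∂ν :=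
    funext fun t ↦ integral_siteLaw_eq hα hv m u t hf
  rw [efun]
  refine d.congr_deriv ?_
  rw [e0 (by fun_prop), e0 hf, e0 (by fun_prop)]
  simp only [add_sub_cancel_left, zero_mul, Real.exp_zero, mul_one]
  field_simp

/-- Exact Wasserstein contraction of a Gaussian conditioned to lie in the quadrant. -/
theorem abs_integral_siteLaw_sub_le {f : ℝ × ℝ → ℝ} (hf : Measurable f) {M L : ℝ}
    (hM : ∀ x, |f x| ≤ M) (hL0 : 0 ≤ L) (hL : ∀ x y, |f x - f y| ≤ L * mahal α (x - y))
    (m m' : ℝ × ℝ) : |∫ x, f x ∂(siteLaw α v m) - ∫ x, f x ∂(siteLaw α v m')| ≤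
      L * mahal α (m - m') := by
  have hv' : (0 : ℝ) < v := by positivity
  rcases eq_or_ne m m' with rfl | hne
  · simp
  set u := m - m'
  have hu : 0 < mahal α u := mahal_pos hα (sub_ne_zero.2 hne)
  refine le_of_forall_pos_le_add fun δ hδ ↦ ?_
  -- The Cauchy–Schwarz step needs a strictly positive constant; this choice costs only `δ` over the
  -- whole segment.
  set L' := L + δ / mahal α u
  have hL' : 0 < L' := by positivity
  have hLL : ∀ x y, |f x - f y| ≤ L' * mahal α (x - y) := fun x y ↦ (hL x y).trans
    (mul_le_mul_of_nonneg_right (le_add_of_nonneg_right (by positivity)) (mahal_nonneg _ _))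
  -- The standard deviations are at most `L' √v` for `f` and `mahal α u / √v` for the tilting
  -- variable. The factors `√v` cancel, so the contraction constant is exactly one for every
  -- variance.
  have hcov : ∀ a : ℝ × ℝ, |∫ x, f x * (mahalInner α u (x - a) / v) ∂(siteLaw α v a) -
        (∫ x, f x ∂(siteLaw α v a)) * ∫ x, mahalInner α u (x - a) / v ∂(siteLaw α v a)| ≤
        L' * mahal α u := by
    intro a
    have := isProbabilityMeasure_siteLaw hα hv a
    have hgi : Integrable (fun x ↦ mahalInner α u (x - a) / v) (siteLaw α v a) := by
      rw [siteLaw, cond_eq_smul_restrict]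
      refine Integrable.smul_measure ?_ (by
        simpa using corrGaussian_map_quadrant_ne_zero hα hv a)
      refine Integrable.restrict ?_
      rw [integrable_map_measure (by fun_prop) (by fun_prop)]
      refine ((integrable_exp_abs_mahalInner (α := α) u v 1).div_const v).mono' (by fun_prop)
        (.of_forall fun y ↦ ?_)
      simp only [Function.comp, add_sub_cancel_left, norm_div, Real.norm_eq_abs, NNReal.abs_eq, one_mul]
      gcongr
      linarith [Real.add_one_le_exp |mahalInner α u y|]
    have h1 := lintegral_sub_sq_siteLaw_le hα hv a hf hLL
    have h2 := lintegral_sub_sq_siteLaw_le hα hv a (f := fun x ↦ mahalInner α u (x - a) / v)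
      (by fun_prop) (L := mahal α u / v) (by
        intro x y
        rw [← sub_div, ← mahalInner_sub_right, abs_div, abs_of_pos hv', sub_sub_sub_cancel_right,
          div_mul_eq_mul_div]
        gcongr
        exact abs_mahalInner_le _ _ _)
    have key := abs_integral_mul_sub_le hf (by fun_prop) hM hgi (a := L' * √v)
      (b := mahal α u / √v) (by positivity) (by positivity)
      (by rw [mul_pow, Real.sq_sqrt hv'.le]; exact h1)
      (by
        refine h2.trans (le_of_eq ?_)
        rw [div_pow, div_pow, Real.sq_sqrt hv'.le]
        congr 2; field_simp)
    refine key.trans (le_of_eq ?_)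
    have : √(v : ℝ) ≠ 0 := (Real.sqrt_pos.2 hv').ne'
    field_simp
  set φ : ℝ → ℝ := fun t ↦ ∫ x, f x ∂(siteLaw α v (m' + t • u))
  have hφ : ∀ t, ∃ d, HasDerivAt φ d t ∧ |d| ≤ L' * mahal α u := by
    intro t
    refine ⟨_, ?_, hcov (m' + t • u)⟩
    have h0 := hasDerivAt_integral_siteLaw hα hv (m' + t • u) u hf hM
    rw [← sub_self t] at h0
    refine (h0.comp_sub_const t t).congr_of_eventuallyEq (.of_forall fun s ↦ ?_)
    simp only [φ]
    congr 2
    module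
  choose d hd hd' using hφ
  have mv := (convex_Icc (0 : ℝ) 1).norm_image_sub_le_of_norm_hasDerivWithin_le (f := φ) (f' := d)
    (C := L' * mahal α u) (fun t _ ↦ (hd t).hasDerivWithinAt) (fun t _ ↦ hd' t)
    (Set.left_mem_Icc.2 zero_le_one) (Set.right_mem_Icc.2 zero_le_one)
  simp only [φ, one_smul, zero_smul, add_zero, sub_zero, norm_one, mul_one, u,
    add_sub_cancel, Real.norm_eq_abs] at mv
  refine mv.trans (le_of_eq ?_)
  change (L + δ / mahal α u) * mahal α u = L * mahal α u + δ
  field_simp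

end Site

end QuadrantExcursion

/-! ### Correlated Gaussian processes through characteristic functions -/

namespace QuadrantExcursion

/-- The Euclidean pairing on the plane. -/
def pairing (a x : ℝ × ℝ) : ℝ := a.1 * x.1 + a.2 * x.2

/-- The covariance form of a pair of `α`-correlated variables of unit variance. -/
def corrForm (α : ℝ) (a b : ℝ × ℝ) : ℝ := a.1 * b.1 + a.2 * b.2 + α * (a.1 * b.2 + a.2 * b.1)

theorem pairing_add_right (a x y : ℝ × ℝ) : pairing a (x + y) = pairing a x + pairing a y := by
  simp [pairing]; ring

theorem pairing_smul_left (c : ℝ) (a x : ℝ × ℝ) : pairing (c • a) x = c * pairing a x := by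
  simp [pairing]; ring

theorem pairing_smul_right (c : ℝ) (a x : ℝ × ℝ) : pairing a (c • x) = c * pairing a x := by
  simp [pairing]; ring

theorem pairing_sum_left {ι : Type*} (s : Finset ι) (a : ι → ℝ × ℝ) (x : ℝ × ℝ) :
    pairing (∑ i ∈ s, a i) x = ∑ i ∈ s, pairing (a i) x := by
  simp [pairing, Prod.fst_sum, Prod.snd_sum, Finset.sum_mul, Finset.sum_add_distrib]

theorem pairing_sum_right {ι : Type*} (s : Finset ι) (a : ℝ × ℝ) (x : ι → ℝ × ℝ) :
    pairing a (∑ i ∈ s, x i) = ∑ i ∈ s, pairing a (x i) := by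
  simp [pairing, Prod.fst_sum, Prod.snd_sum, Finset.mul_sum, Finset.sum_add_distrib]

@[fun_prop] theorem continuous_pairing (a : ℝ × ℝ) : Continuous (pairing a) := by
  unfold pairing; fun_prop

@[fun_prop] theorem measurable_pairing (a : ℝ × ℝ) : Measurable (pairing a) :=
  (continuous_pairing a).measurable

theorem corrForm_smul_smul (α c d : ℝ) (a b : ℝ × ℝ) :
    corrForm α (c • a) (d • b) = c * d * corrForm α a b := by
  simp [corrForm]; ring

theorem corrForm_comm (α : ℝ) (a b : ℝ × ℝ) : corrForm α a b = corrForm α b a := by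
  simp [corrForm]; ring

theorem corrForm_sum_sum (α : ℝ) {ι κ : Type*} (s : Finset ι) (t : Finset κ) (a : ι → ℝ × ℝ)
    (b : κ → ℝ × ℝ) :
    corrForm α (∑ i ∈ s, a i) (∑ j ∈ t, b j) = ∑ i ∈ s, ∑ j ∈ t, corrForm α (a i) (b j) := by
  simp only [corrForm, Prod.fst_sum, Prod.snd_sum]
  rw [Finset.sum_mul_sum, Finset.sum_mul_sum, Finset.sum_mul_sum, Finset.sum_mul_sum]
  simp only [Finset.mul_sum, Finset.sum_add_distrib, mul_add]

/-- `X` is a centered Gaussian process in the plane whose coordinates both have covariance kernel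
`K` and whose cross covariance is `α K`; this is expressed through characteristic functions. -/
structure CorrGauss (α : ℝ) {S Ω : Type*} [MeasurableSpace Ω] (K : S → S → ℝ)
    (X : S → Ω → ℝ × ℝ) (P : Measure Ω) : Prop where
  measurable : ∀ u, Measurable (X u)
  charFun : ∀ {ι : Type} [Fintype ι] (u : ι → S) (a : ι → ℝ × ℝ),
    ∫ ω, Complex.exp ((∑ i, pairing (a i) (X (u i) ω) : ℝ) * Complex.I) ∂P =
      Complex.exp ((-(∑ i, ∑ j, corrForm α (a i) (a j) * K (u i) (u j)) / 2 : ℝ))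

namespace CorrGauss

variable {α : ℝ} {S Ω : Type*} [MeasurableSpace Ω] {K : S → S → ℝ} {X : S → Ω → ℝ × ℝ}
  {P : Measure Ω}

/-- The characteristic function of the empty family is the total mass. -/
theorem isProbabilityMeasure (h : CorrGauss α K X P) : IsProbabilityMeasure P := by
  have := h.charFun (ι := Empty) (fun i ↦ i.elim) (fun i ↦ i.elim)
  simp only [Finset.univ_eq_empty, Finset.sum_empty, Complex.ofReal_zero, zero_mul,
    Complex.exp_zero, neg_zero, zero_div, integral_const, mul_one,
    Complex.real_smul] at this
  have h1 : P.real Set.univ = 1 := by exact_mod_cast this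
  refine ⟨?_⟩
  rw [measureReal_def, ENNReal.toReal_eq_one_iff] at h1
  exact h1

theorem comp {S' : Type*} (h : CorrGauss α K X P) (g : S' → S) {K' : S' → S' → ℝ}
    {Y : S' → Ω → ℝ × ℝ} (hY : ∀ u ω, Y u ω = X (g u) ω) (hK : ∀ u v, K' u v = K (g u) (g v)) :
    CorrGauss α K' Y P where
  measurable u := by rw [show Y u = X (g u) from funext (hY u)]; exact h.measurable _
  charFun u a := by simp only [hY, hK]; exact h.charFun (fun i ↦ g (u i)) a

/-- Linear images of a process of independent-coordinate type are of the same type. -/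
theorem sum {S' : Type*} {A : Type} [Fintype A] (h : CorrGauss α K X P) (c : S' → A → ℝ)
    (p : S' → A → S) {K' : S' → S' → ℝ} {Y : S' → Ω → ℝ × ℝ}
    (hY : ∀ u ω, Y u ω = ∑ b, c u b • X (p u b) ω)
    (hK : ∀ u v, K' u v = ∑ b, ∑ d, c u b * c v d * K (p u b) (p v d)) :
    CorrGauss α K' Y P where
  measurable u := by
    rw [show Y u = fun ω ↦ ∑ b, c u b • X (p u b) ω from funext (hY u)]
    exact Finset.measurable_sum _ fun b _ ↦ (h.measurable (p u b)).const_smul (c u b)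
  charFun {ι} _ u a := by
    have := h.charFun (ι := ι × A) (fun q ↦ p (u q.1) q.2) (fun q ↦ c (u q.1) q.2 • a q.1)
    simp only [Fintype.sum_prod_type, pairing_smul_left, corrForm_smul_smul] at this
    simp only [hY, pairing_sum_right, pairing_smul_right, hK]
    rw [this]
    congr 5
    funext i
    rw [Finset.sum_comm]
    refine Finset.sum_congr rfl fun j _ ↦ ?_
    rw [Finset.mul_sum]
    refine Finset.sum_congr rfl fun b _ ↦ ?_
    rw [Finset.mul_sum]
    exact Finset.sum_congr rfl fun d _ ↦ by ring

theorem strongDual_pi_apply {ι : Type*} [Fintype ι] [DecidableEq ι] (L : StrongDual ℝ (ι → ℝ × ℝ))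
    (x : ι → ℝ × ℝ) : L x =
      ∑ i, pairing (L (Pi.single i (1, 0)), L (Pi.single i (0, 1))) (x i) := by
  have hx : x = ∑ i, ((x i).1 • (Pi.single i (1, 0) : ι → ℝ × ℝ) +
      (x i).2 • (Pi.single i (0, 1) : ι → ℝ × ℝ)) := by
    ext j
    · simp [Finset.sum_apply, Pi.single_apply, Finset.sum_add_distrib]
    · simp [Finset.sum_apply, Pi.single_apply, Finset.sum_add_distrib]
  conv_lhs => rw [hx]
  simp only [map_sum, map_add, map_smul, smul_eq_mul, pairing]
  exact Finset.sum_congr rfl fun i _ ↦ by ring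

/-- The finite-dimensional distributions are determined by the kernel. -/
theorem map_eq {Ω' : Type*} [MeasurableSpace Ω'] {X' : S → Ω' → ℝ × ℝ} {P' : Measure Ω'}
    (h : CorrGauss α K X P) (h' : CorrGauss α K X' P') {ι : Type} [Fintype ι] (u : ι → S) :
    P.map (fun ω i ↦ X (u i) ω) = P'.map (fun ω i ↦ X' (u i) ω) := by
  classical
  have := h.isProbabilityMeasure
  have := h'.isProbabilityMeasure
  have m1 : Measurable fun ω i ↦ X (u i) ω := measurable_pi_lambda _ fun i ↦ h.measurable _
  have m2 : Measurable fun ω i ↦ X' (u i) ω := measurable_pi_lambda _ fun i ↦ h'.measurable _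
  refine Measure.ext_of_charFunDual (funext fun L ↦ ?_)
  rw [charFunDual_apply, charFunDual_apply, integral_map m1.aemeasurable
    (by fun_prop), integral_map m2.aemeasurable (by fun_prop)]
  obtain ⟨A, hA⟩ : ∃ A : ι → ℝ × ℝ, ∀ x, L x = ∑ i, pairing (A i) (x i) :=
    ⟨_, strongDual_pi_apply L⟩
  simp only [hA]
  rw [h.charFun, h'.charFun]

/-- Two independent families form a process with block diagonal kernel. -/
theorem prod {S' Ω' : Type*} [MeasurableSpace Ω'] {K' : S' → S' → ℝ} {X' : S' → Ω' → ℝ × ℝ}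
    {P' : Measure Ω'} (h : CorrGauss α K X P) (h' : CorrGauss α K' X' P') :
    CorrGauss α (Sum.elim (fun u ↦ Sum.elim (K u) fun _ ↦ 0) fun u ↦ Sum.elim (fun _ ↦ 0) (K' u))
      (Sum.elim (fun u (ω : Ω × Ω') ↦ X u ω.1) fun u ω ↦ X' u ω.2) (P.prod P') where
  measurable := by
    have := h.measurable
    have := h'.measurable
    rintro (u | u) <;> simp only [Sum.elim_inl, Sum.elim_inr] <;> fun_prop
  charFun {ι} _ u a := by
    have := h.isProbabilityMeasure
    have := h'.isProbabilityMeasure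
    classical
    let I := {i // (u i).isLeft}
    let J := {i // ¬ (u i).isLeft}
    let p : I → S := fun i ↦ (u i).getLeft i.2
    let q : J → S' := fun i ↦ (u i).getRight (by simpa using i.2)
    have hp : ∀ i : I, u i = Sum.inl (p i) := fun i ↦ (Sum.inl_getLeft _ _).symm
    have hq : ∀ i : J, u i = Sum.inr (q i) := fun i ↦ (Sum.inr_getRight _ _).symm
    have key : ∀ f : ι → ℝ, ∑ i, f i = ∑ i : I, f i + ∑ i : J, f i := fun f ↦
      (Fintype.sum_subtype_add_sum_subtype (fun i ↦ ((u i).isLeft : Prop)) f).symm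
    simp only [key, hp, hq, Sum.elim_inl, Sum.elim_inr, mul_zero, Finset.sum_const_zero, add_zero,
      zero_add]
    simp only [Complex.ofReal_add, add_mul, Complex.exp_add]
    rw [integral_prod_mul (fun ω ↦ Complex.exp ((∑ i : I, pairing (a i) (X (p i) ω) : ℝ) * Complex.I))
      (fun ω ↦ Complex.exp ((∑ i : J, pairing (a i) (X' (q i) ω) : ℝ) * Complex.I)), h.charFun,
      h'.charFun, ← Complex.exp_add]
    congr 1
    push_cast
    ring

/-- A characteristic function has modulus at most one, so positivity of the form need not be part of
the definition. -/
theorem sum_nonneg (h : CorrGauss α K X P) {ι : Type} [Fintype ι] (u : ι → S) (a : ι → ℝ × ℝ) :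
    0 ≤ ∑ i, ∑ j, corrForm α (a i) (a j) * K (u i) (u j) := by
  have := h.isProbabilityMeasure
  set V := ∑ i, ∑ j, corrForm α (a i) (a j) * K (u i) (u j)
  have h1 : ‖Complex.exp ((-V / 2 : ℝ))‖ ≤ 1 := by
    rw [← h.charFun u a]
    refine (norm_integral_le_of_norm_le_const (C := 1) (.of_forall fun ω ↦ ?_)).trans (by simp)
    rw [Complex.norm_exp_ofReal_mul_I]
  rw [Complex.norm_exp, Complex.ofReal_re, Real.exp_le_one_iff] at h1
  linarith

/-- Linear functionals have Gaussian laws. -/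
theorem map_pairing_eq (h : CorrGauss α K X P) {ι : Type} [Fintype ι] (u : ι → S) (a : ι → ℝ × ℝ) :
    P.map (fun ω ↦ ∑ i, pairing (a i) (X (u i) ω)) =
      gaussianReal 0 (∑ i, ∑ j, corrForm α (a i) (a j) * K (u i) (u j)).toNNReal := by
  have := h.isProbabilityMeasure
  have hm := h.measurable
  have hV0 := h.sum_nonneg u a
  set V := ∑ i, ∑ j, corrForm α (a i) (a j) * K (u i) (u j) with hV
  have : IsProbabilityMeasure (P.map (fun ω ↦ ∑ i, pairing (a i) (X (u i) ω))) :=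
    Measure.isProbabilityMeasure_map (by fun_prop)
  refine Measure.ext_of_charFun (funext fun t ↦ ?_)
  rw [charFun_gaussianReal, charFun_apply_real, integral_map (by fun_prop) (by fun_prop)]
  have := h.charFun u (fun i ↦ t • a i)
  simp only [pairing_smul_left, ← Finset.mul_sum, Complex.ofReal_mul, corrForm_smul_smul,
    mul_assoc] at this
  simp only [mul_assoc]
  rw [this, ← hV]
  congr 1
  rw [Real.coe_toNNReal _ hV0]
  push_cast
  ring

end CorrGauss

/-- The identity is a Gaussian variable under `corrGaussian`. -/
theorem corrGauss_corrGaussian {α : ℝ} (hα : α ∈ Set.Ioo (-1 : ℝ) 1) (v : ℝ≥0) :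
    CorrGauss α (fun _ _ : Unit ↦ (v : ℝ)) (fun _ ↦ id) (corrGaussian α v) where
  measurable _ := measurable_id
  charFun {ι} _ u a := by
    simp only [id_eq, ← pairing_sum_left, ← Finset.sum_mul, ← corrForm_sum_sum]
    set b := ∑ i, a i
    rw [corrGaussian, integral_map (by fun_prop) (by fun_prop)]
    have e : ∀ x : ℝ × ℝ, Complex.exp ((pairing b (correlate α x) : ℝ) * Complex.I) =
        Complex.exp ((b.1 + b.2 * α : ℝ) * x.1 * Complex.I) *
          Complex.exp ((b.2 * √(1 - α ^ 2) : ℝ) * x.2 * Complex.I) := by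
      intro x
      rw [← Complex.exp_add]
      simp only [pairing, correlate_apply]
      congr 1; push_cast; ring
    simp_rw [e]
    rw [integral_prod_mul (fun x : ℝ ↦ Complex.exp ((b.1 + b.2 * α : ℝ) * x * Complex.I))
      (fun x : ℝ ↦ Complex.exp ((b.2 * √(1 - α ^ 2) : ℝ) * x * Complex.I)),
      ← charFun_apply_real, ← charFun_apply_real, charFun_gaussianReal, charFun_gaussianReal,
      ← Complex.exp_add]
    congr 1
    have h := Real.sq_sqrt (one_sub_sq_pos hα).le
    simp only [Complex.ofReal_zero, mul_zero, zero_mul, zero_sub]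
    rw [corrForm]
    have : ((-((b.1 * b.1 + b.2 * b.2 + α * (b.1 * b.2 + b.2 * b.1)) * v) / 2 : ℝ) : ℂ) =
      ((-(v * (b.1 + b.2 * α) ^ 2 / 2) + -(v * (b.2 ^ 2 * √(1 - α ^ 2) ^ 2) / 2) : ℝ) : ℂ) := by
      rw [h]; congr 1; ring
    rw [this]; push_cast; ring

/-- The coordinates are independent Gaussian variables under a product of `corrGaussian`. -/
theorem corrGauss_pi {α : ℝ} (hα : α ∈ Set.Ioo (-1 : ℝ) 1) (v : ℝ≥0) (n : ℕ) :
    CorrGauss α (fun i j : Fin n ↦ if i = j then (v : ℝ) else 0) (fun i (ω : Fin n → ℝ × ℝ) ↦ ω i)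
      (Measure.pi fun _ ↦ corrGaussian α v) where
  measurable u := measurable_pi_apply u
  charFun {ι} _ u a := by
    classical
    have e : ∀ ω : Fin n → ℝ × ℝ, ∑ i, pairing (a i) (ω (u i)) =
        ∑ k, pairing (∑ i with u i = k, a i) (ω k) := by
      intro ω
      simp only [pairing_sum_left]
      rw [← Finset.sum_fiberwise Finset.univ u]
      refine Finset.sum_congr rfl fun k _ ↦ Finset.sum_congr rfl fun i hi ↦ ?_
      rw [(Finset.mem_filter.1 hi).2]
    simp only [e, Complex.ofReal_sum, Finset.sum_mul, Complex.exp_sum]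
    rw [integral_fintype_prod_eq_prod (f := fun k (x : ℝ × ℝ) ↦
      Complex.exp ((pairing (∑ i with u i = k, a i) x : ℝ) * Complex.I))]
    have h1 : ∀ b, ∫ x, Complex.exp ((pairing b x : ℝ) * Complex.I) ∂(corrGaussian α v) =
        Complex.exp ((-(corrForm α b b * v) / 2 : ℝ)) := by
      intro b
      have := (corrGauss_corrGaussian hα v).charFun (ι := Unit) (fun _ ↦ ()) (fun _ ↦ b)
      simpa using this
    simp only [h1]
    rw [← Complex.exp_sum, ← Complex.ofReal_sum, ← Finset.sum_div, Finset.sum_neg_distrib]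
    congr 4
    simp only [corrForm_sum_sum, Finset.sum_mul]
    rw [← Finset.sum_fiberwise Finset.univ u]
    refine Finset.sum_congr rfl fun k _ ↦ Finset.sum_congr rfl fun i hi ↦ ?_
    rw [(Finset.mem_filter.1 hi).2, Finset.sum_filter]
    refine Finset.sum_congr rfl fun j _ ↦ ?_
    by_cases hk : u j = k
    · simp [hk]
    · simp [hk, Ne.symm hk]

theorem CorrGauss.map_eval_eq {α : ℝ} (hα : α ∈ Set.Ioo (-1 : ℝ) 1) {S Ω : Type*}
    [MeasurableSpace Ω] {K : S → S → ℝ} {X : S → Ω → ℝ × ℝ} {P : Measure Ω} (h : CorrGauss α K X P)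
    (u : S) {v : ℝ≥0} (hv : K u u = v) : P.map (X u) = corrGaussian α v := by
  have h1 : CorrGauss α (fun _ _ : Unit ↦ (v : ℝ)) (fun _ ↦ X u) P :=
    h.comp (fun _ ↦ u) (fun _ _ ↦ rfl) (fun _ _ ↦ hv.symm)
  have := h1.map_eq (corrGauss_corrGaussian hα v) (ι := Unit) id
  have h2 := congrArg (fun μ ↦ Measure.map (fun x : Unit → ℝ × ℝ ↦ x ()) μ) this
  have hm := h.measurable u
  rw [Measure.map_map (by fun_prop) (by fun_prop), Measure.map_map (by fun_prop) (by fun_prop)] at h2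
  simpa [Function.comp_def] using h2

end QuadrantExcursion

/-! ### Gaussian laws on path space and the Brownian kernel -/

namespace QuadrantExcursion

theorem measurable_eval {a b : ℝ} (u : Set.Icc a b) : Measurable fun f : Path a b ↦ f u :=
  (ContinuousEvalConst.continuous_eval_const u).measurable

instance (a b : ℝ) : PolishSpace (Path a b) := inferInstance

/-- A finite measure on path space is determined by its finite-dimensional distributions. -/
theorem path_measure_ext {a b : ℝ} {μ ν : Measure (Path a b)} [IsFiniteMeasure μ]
    (h : ∀ {ι : Type} [Fintype ι] (u : ι → Set.Icc a b),
      μ.map (fun f i ↦ f (u i)) = ν.map (fun f i ↦ f (u i))) : μ = ν := by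
  -- Restriction to countably many dense times is a continuous injection between Polish spaces,
  -- hence a measurable embedding. This transfers the question to a countable product.
  obtain ⟨D, hDc, hDd⟩ := TopologicalSpace.exists_countable_dense (Set.Icc a b)
  have := hDc.to_subtype
  let e : Path a b → (D → ℝ × ℝ) := fun f i ↦ f i
  have hec : Continuous e := continuous_pi fun i ↦ ContinuousEvalConst.continuous_eval_const _
  have hei : Function.Injective e := fun f g hfg ↦ by
    refine DFunLike.coe_injective (Continuous.ext_on hDd f.continuous g.continuous ?_)
    exact fun x hx ↦ congrFun hfg ⟨x, hx⟩
  have hem : MeasurableEmbedding e := hec.measurableEmbedding hei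
  rw [← hem.comap_map μ, ← hem.comap_map ν]
  congr 1
  let P : (I : Finset D) → Measure (∀ _ : I, ℝ × ℝ) := fun I ↦ (μ.map e).map I.restrict
  have : ∀ I, IsFiniteMeasure (P I) := fun I ↦ by
    simp only [P]; infer_instance
  refine IsProjectiveLimit.unique (P := P) (fun I ↦ rfl) fun I ↦ ?_
  simp only [P]
  have hr : Measurable (I.restrict : (D → ℝ × ℝ) → (I → ℝ × ℝ)) := by fun_prop
  rw [Measure.map_map hr hem.measurable, Measure.map_map hr hem.measurable]
  exact (h fun i : I ↦ (i : D).1).symm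

theorem CorrGauss.path_measure_eq {α a b : ℝ} {K : Set.Icc a b → Set.Icc a b → ℝ}
    {μ ν : Measure (Path a b)} (hμ : CorrGauss α K (fun u f ↦ f u) μ)
    (hν : CorrGauss α K (fun u f ↦ f u) ν) : μ = ν := by
  have := hμ.isProbabilityMeasure
  exact path_measure_ext fun u ↦ hμ.map_eq hν u

/-- A process with values in path space which has the kernel of a law on path space has this law. -/
theorem CorrGauss.map_path_eq {α a b : ℝ} {K : Set.Icc a b → Set.Icc a b → ℝ} {Ω : Type*}
    [MeasurableSpace Ω] {P : Measure Ω} {Z : Ω → Path a b} (hZ : Measurable Z)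
    (h : CorrGauss α K (fun u ω ↦ Z ω u) P) : CorrGauss α K (fun u f ↦ f u) (P.map Z) where
  measurable u := measurable_eval u
  charFun u c := by
    have hm : ∀ i, Measurable fun f : Path a b ↦ pairing (c i) (f (u i)) :=
      fun i ↦ (measurable_pairing _).comp (measurable_eval _)
    rw [integral_map hZ.aemeasurable (Measurable.aestronglyMeasurable (by fun_prop))]
    exact h.charFun u c

/-- A linear functional of finitely many values is a real Gaussian variable whose mean and variance
follow from bilinearity; its characteristic function at `1` is the required one. -/
theorem corrGauss_of_isGaussianProcess {α : ℝ} {S Ω : Type*} [MeasurableSpace Ω] {K : S → S → ℝ}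
    {X : S → Ω → ℝ × ℝ} {P : Measure Ω} {z : ℝ × ℝ} (hX : IsGaussianProcess X P)
    (hm : ∀ u, Measurable (X u)) (h1 : ∀ u, ∫ ω, (X u ω).1 ∂P = z.1)
    (h2 : ∀ u, ∫ ω, (X u ω).2 ∂P = z.2)
    (h11 : ∀ u v, covariance (fun ω ↦ (X u ω).1) (fun ω ↦ (X v ω).1) P = K u v)
    (h22 : ∀ u v, covariance (fun ω ↦ (X u ω).2) (fun ω ↦ (X v ω).2) P = K u v)
    (h12 : ∀ u v, covariance (fun ω ↦ (X u ω).1) (fun ω ↦ (X v ω).2) P = α * K u v)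
    (hK : ∀ u v, K u v = K v u) : CorrGauss α K (fun u ω ↦ X u ω - z) P where
  measurable u := (hm u).sub_const z
  charFun {ι} _ u a := by
    have := hX.isProbabilityMeasure
    let L : (↥(Finset.univ : Finset ι) → ℝ × ℝ) →L[ℝ] ℝ := ∑ i : ι,
      ((a i).1 • (ContinuousLinearMap.fst ℝ ℝ ℝ) + (a i).2 • ContinuousLinearMap.snd ℝ ℝ ℝ) ∘L
        ContinuousLinearMap.proj (⟨i, Finset.mem_univ i⟩ : ↥(Finset.univ : Finset ι))
    have hG : HasGaussianLaw (fun ω ↦ ∑ i, pairing (a i) (X (u i) ω)) P := by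
      have := ((hX.comp_right u).hasGaussianLaw Finset.univ).map_fun L
      refine this.congr (.of_forall fun ω ↦ ?_)
      simp [L, pairing]
    have hmem : ∀ i, MemLp (X i) 2 P := fun i ↦ (hX.hasGaussianLaw_eval i).memLp_two
    have hmem1 : ∀ i, MemLp (fun ω ↦ (X i ω).1) 2 P := fun i ↦
      ((hX.hasGaussianLaw_eval i).map_fun (ContinuousLinearMap.fst ℝ ℝ ℝ)).memLp_two
    have hmem2 : ∀ i, MemLp (fun ω ↦ (X i ω).2) 2 P := fun i ↦
      ((hX.hasGaussianLaw_eval i).map_fun (ContinuousLinearMap.snd ℝ ℝ ℝ)).memLp_two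
    have hmemp : ∀ i, MemLp (fun ω ↦ pairing (a i) (X (u i) ω)) 2 P := fun i ↦
      ((hmem1 _).const_mul _).add ((hmem2 _).const_mul _)
    have hmean : ∫ ω, ∑ i, pairing (a i) (X (u i) ω) ∂P = ∑ i, pairing (a i) z := by
      rw [integral_finsetSum _ fun i _ ↦ (hmemp i).integrable (by norm_num)]
      refine Finset.sum_congr rfl fun i _ ↦ ?_
      simp only [pairing]
      rw [integral_add (((hmem1 _).integrable (by norm_num)).const_mul _)
        (((hmem2 _).integrable (by norm_num)).const_mul _), integral_const_mul, integral_const_mul,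
        h1, h2]
    have hcov : ∀ i j, covariance (fun ω ↦ pairing (a i) (X (u i) ω))
        (fun ω ↦ pairing (a j) (X (u j) ω)) P = corrForm α (a i) (a j) * K (u i) (u j) := by
      intro i j
      have e : ∀ i, (fun ω ↦ pairing (a i) (X (u i) ω)) =
        ((a i).1 • fun ω ↦ (X (u i) ω).1) + ((a i).2 • fun ω ↦ (X (u i) ω).2) := fun i ↦ rfl
      rw [e, e, covariance_add_left ((hmem1 _).const_smul _) ((hmem2 _).const_smul _)
        (((hmem1 _).const_smul _).add ((hmem2 _).const_smul _)),
        covariance_add_right ((hmem1 _).const_smul _) ((hmem1 _).const_smul _)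
          ((hmem2 _).const_smul _),
        covariance_add_right ((hmem2 _).const_smul _) ((hmem1 _).const_smul _)
          ((hmem2 _).const_smul _)]
      simp only [covariance_smul_left, covariance_smul_right, h11, h22, h12]
      rw [covariance_comm, h12, hK (u j), corrForm]
      ring
    have hvar : Var[fun ω ↦ ∑ i, pairing (a i) (X (u i) ω); P] =
        ∑ i, ∑ j, corrForm α (a i) (a j) * K (u i) (u j) := by
      rw [← covariance_self (by fun_prop), covariance_fun_sum_fun_sum hmemp hmemp]
      simp only [hcov]
    have hch := congrArg (fun μ ↦ MeasureTheory.charFun μ 1) hG.map_eq_gaussianReal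
    simp only at hch
    rw [charFun_gaussianReal, charFun_apply_real, integral_map (by fun_prop) (by fun_prop), hmean,
      hvar, Real.coe_toNNReal _ (by rw [← hvar]; exact variance_nonneg _ _)] at hch
    have e : ∀ ω, Complex.exp ((∑ i, pairing (a i) (X (u i) ω - z) : ℝ) * Complex.I) =
        Complex.exp (-(∑ i, pairing (a i) z : ℝ) * Complex.I) *
          Complex.exp ((1 : ℝ) * (∑ i, pairing (a i) (X (u i) ω) : ℝ) * Complex.I) := by
      intro ω
      rw [← Complex.exp_add]
      congr 1
      have : ∀ i, pairing (a i) (X (u i) ω - z) = pairing (a i) (X (u i) ω) - pairing (a i) z := by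
        intro i; simp [pairing]; ring
      simp only [this, Finset.sum_sub_distrib]
      push_cast; ring
    simp only [e]
    rw [integral_const_mul, hch, ← Complex.exp_add]
    congr 1
    push_cast
    ring

namespace CorrGauss

variable {α : ℝ} {S Ω : Type*} [MeasurableSpace Ω] {K : S → S → ℝ} {X : S → Ω → ℝ × ℝ}
  {P : Measure Ω}

theorem hasGaussianLaw_pairing (h : CorrGauss α K X P) {ι : Type} [Fintype ι] (u : ι → S)
    (a : ι → ℝ × ℝ) : HasGaussianLaw (fun ω ↦ ∑ i, pairing (a i) (X (u i) ω)) P := by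
  refine ⟨?_⟩
  rw [h.map_pairing_eq]
  infer_instance

theorem isGaussianProcess_add_const (h : CorrGauss α K X P) (z : ℝ × ℝ) :
    IsGaussianProcess (fun u ω ↦ X u ω + z) P := by
  classical
  -- `CorrGauss` only tests index types in `Type`, while `S` may live in another universe, so finite
  -- subsets of `S` are reindexed by `Fin`.
  suffices H : ∀ {κ : Type} [Fintype κ] (u : κ → S),
      HasGaussianLaw (fun ω i ↦ X (u i) ω + z) P by
    refine ⟨fun I ↦ ?_⟩
    let e := Fintype.equivFin I
    have := H (κ := Fin (Fintype.card I)) (fun i ↦ (e.symm i).1)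
    let L : (Fin (Fintype.card I) → ℝ × ℝ) →L[ℝ] (I → ℝ × ℝ) :=
      ContinuousLinearMap.pi fun i ↦ ContinuousLinearMap.proj (e i)
    refine (this.map_fun L).congr (.of_forall fun ω ↦ ?_)
    funext i
    simp [L]
  intro κ _ u
  have := h.isProbabilityMeasure
  have hm := h.measurable
  have hm' : Measurable fun ω (i : κ) ↦ X (u i) ω + z :=
    measurable_pi_lambda _ fun i ↦ (hm _).add_const z
  refine ⟨⟨fun L ↦ ?_⟩⟩
  obtain ⟨A, hA⟩ : ∃ A : κ → ℝ × ℝ, ∀ x, L x = ∑ i, pairing (A i) (x i) :=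
    ⟨_, CorrGauss.strongDual_pi_apply L⟩
  have hG : HasGaussianLaw (fun ω ↦ L fun i ↦ X (u i) ω + z) P := by
    refine ⟨?_⟩
    have e : (fun ω ↦ L fun i ↦ X (u i) ω + z) =
        (· + ∑ i, pairing (A i) z) ∘ fun ω ↦ ∑ i, pairing (A i) (X (u i) ω) := by
      funext ω
      simp [hA, pairing_add_right, Finset.sum_add_distrib]
    have hmm : Measurable fun ω ↦ ∑ i, pairing (A i) (X (u i) ω) :=
      Finset.measurable_sum _ fun i _ ↦ (measurable_pairing _).comp (hm _)
    rw [e, ← Measure.map_map (by fun_prop) hmm, h.map_pairing_eq, gaussianReal_map_add_const]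
    infer_instance
  rw [Measure.map_map (by fun_prop) hm', integral_map hm'.aemeasurable (by fun_prop),
    variance_map (by fun_prop) hm'.aemeasurable]
  exact hG.map_eq_gaussianReal

theorem memLp_pairing (h : CorrGauss α K X P) (a : ℝ × ℝ) (u : S) :
    MemLp (fun ω ↦ pairing a (X u ω)) 2 P := by
  simpa using (h.hasGaussianLaw_pairing (fun _ : Unit ↦ u) (fun _ ↦ a)).memLp_two

theorem integral_pairing (h : CorrGauss α K X P) (a : ℝ × ℝ) (u : S) :
    ∫ ω, pairing a (X u ω) ∂P = 0 := by
  have := h.map_pairing_eq (fun _ : Unit ↦ u) (fun _ ↦ a)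
  simp only [Finset.univ_unique, Finset.sum_singleton] at this
  have h2 := congrArg (fun μ : Measure ℝ ↦ ∫ x, x ∂μ) this
  have hmm : Measurable fun ω ↦ pairing a (X u ω) := (measurable_pairing _).comp (h.measurable _)
  rwa [integral_map hmm.aemeasurable (by fun_prop),
    integral_id_gaussianReal] at h2

/-- Polarisation: the variances of both terms and of their sum are known from their Gaussian laws,
the sum being the family indexed by `Bool`. -/
theorem covariance_pairing (h : CorrGauss α K X P) (hK : ∀ u v, K u v = K v u) (a b : ℝ × ℝ)
    (u v : S) : covariance (fun ω ↦ pairing a (X u ω)) (fun ω ↦ pairing b (X v ω)) P =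
      corrForm α a b * K u v := by
  have := h.isProbabilityMeasure
  have hvar : ∀ {ι : Type} [Fintype ι] (u : ι → S) (a : ι → ℝ × ℝ),
      Var[fun ω ↦ ∑ i, pairing (a i) (X (u i) ω); P] =
        ∑ i, ∑ j, corrForm α (a i) (a j) * K (u i) (u j) := by
    intro ι _ u a
    have hmm : Measurable fun ω ↦ ∑ i, pairing (a i) (X (u i) ω) :=
      Finset.measurable_sum _ fun i _ ↦ (measurable_pairing _).comp (h.measurable _)
    have h2 := congrArg (fun μ : Measure ℝ ↦ Var[id; μ]) (h.map_pairing_eq u a)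
    rw [variance_map (by fun_prop) hmm.aemeasurable, variance_id_gaussianReal,
      Real.coe_toNNReal _ (h.sum_nonneg u a)] at h2
    exact h2
  have h1 := hvar (fun _ : Unit ↦ u) (fun _ ↦ a)
  have h2 := hvar (fun _ : Unit ↦ v) (fun _ ↦ b)
  have h3 := hvar (fun c : Bool ↦ if c then u else v) (fun c ↦ if c then a else b)
  simp only [Finset.univ_unique, Finset.sum_singleton, Fintype.sum_bool, if_true] at h1 h2 h3
  simp only [Bool.false_eq_true, if_false] at h3
  have h4 := variance_add (h.memLp_pairing a u) (h.memLp_pairing b v)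
  have e : ((fun ω ↦ pairing a (X u ω)) + fun ω ↦ pairing b (X v ω)) =
    fun ω ↦ pairing a (X u ω) + pairing b (X v ω) := rfl
  rw [e, h3, h1, h2, corrForm_comm α b a, hK v u] at h4
  linarith

end CorrGauss

/-- The kernel of Brownian motion started at time `s`. -/
noncomputable def brownianKernel (s t : ℝ) (u v : Set.Icc s t) : ℝ := min (u : ℝ) v - s

/-- Together with the converse `CorrGauss.isBrownianLaw`, this reduces identities between Brownian
laws to identities between kernels. -/
theorem IsBrownianLaw.corrGauss {α s t : ℝ} {z : ℝ × ℝ} {β : Measure (Path s t)}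
    (h : IsBrownianLaw α s t z β) :
    CorrGauss α (brownianKernel s t) (fun u f ↦ f u - z) β :=
  corrGauss_of_isGaussianProcess h.gaussian measurable_eval h.mean_fst h.mean_snd h.cov_fst
    h.cov_snd h.cov_fst_snd fun u v ↦ by simp [brownianKernel, min_comm]

theorem CorrGauss.isBrownianLaw {α s t : ℝ} {z : ℝ × ℝ} {β : Measure (Path s t)}
    (h : CorrGauss α (brownianKernel s t) (fun u f ↦ f u - z) β) : IsBrownianLaw α s t z β := by
  have := h.isProbabilityMeasure
  have hK : ∀ u v, brownianKernel s t u v = brownianKernel s t v u :=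
    fun u v ↦ by simp [brownianKernel, min_comm]
  have e1 : ∀ (u : Set.Icc s t) (f : Path s t), (f u).1 = pairing (1, 0) (f u - z) + z.1 := by
    intro u f; simp [pairing]
  have e2 : ∀ (u : Set.Icc s t) (f : Path s t), (f u).2 = pairing (0, 1) (f u - z) + z.2 := by
    intro u f; simp [pairing]
  have hi : ∀ a u, Integrable (fun f : Path s t ↦ pairing a (f u - z)) β :=
    fun a u ↦ (h.memLp_pairing a u).integrable (by norm_num)
  refine ⟨by simpa using h.isGaussianProcess_add_const z, fun u ↦ ?_, fun u ↦ ?_, fun u v ↦ ?_,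
    fun u v ↦ ?_, fun u v ↦ ?_⟩ <;> simp only [e1, e2]
  · rw [integral_add (hi _ u) (integrable_const _), h.integral_pairing]; simp
  · rw [integral_add (hi _ u) (integrable_const _), h.integral_pairing]; simp
  · rw [covariance_add_const_left (hi _ u), covariance_add_const_right (hi _ v),
      h.covariance_pairing hK]
    simp [corrForm, brownianKernel]
  · rw [covariance_add_const_left (hi _ u), covariance_add_const_right (hi _ v),
      h.covariance_pairing hK]
    simp [corrForm, brownianKernel]
  · rw [covariance_add_const_left (hi _ u), covariance_add_const_right (hi _ v),
      h.covariance_pairing hK]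
    simp [corrForm, brownianKernel]

end QuadrantExcursion

/-! ### Dyadic chaining and Kolmogorov tightness -/

namespace QuadrantExcursion

section Modulus

variable {E : Type*} [NormedAddCommGroup E] {f : ℝ → E} {A r : ℝ}

/-- Passing to the next level doubles the index of the dyadic point below `u` and adds `0` or `1`,
so the two points agree or are neighbours at level `n + 1`. -/
theorem norm_sub_floor_succ_le (hA : 0 ≤ A) (hr0 : 0 < r)
    (h : ∀ n k : ℕ, k < 2 ^ n → ‖f ((k + 1) / 2 ^ n) - f (k / 2 ^ n)‖ ≤ A * r ^ n) {u : ℝ}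
    (hu : u ∈ Set.Icc (0 : ℝ) 1) (n : ℕ) :
    ‖f (⌊u * 2 ^ (n + 1)⌋₊ / 2 ^ (n + 1)) - f (⌊u * 2 ^ n⌋₊ / 2 ^ n)‖ ≤ A * r ^ (n + 1) := by
  set m := ⌊u * 2 ^ n⌋₊
  have hpos : (0 : ℝ) < 2 ^ n := by positivity
  have h1 : (m : ℝ) ≤ u * 2 ^ n := Nat.floor_le (mul_nonneg hu.1 hpos.le)
  have h2 : u * 2 ^ n < m + 1 := Nat.lt_floor_add_one _
  have e : u * 2 ^ (n + 1) = 2 * (u * 2 ^ n) := by ring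
  have hpi : (m : ℝ) / 2 ^ n = ((2 * m : ℕ) : ℝ) / 2 ^ (n + 1) := by
    push_cast; rw [pow_succ]; field_simp
  have h3 : 2 * m ≤ ⌊u * 2 ^ (n + 1)⌋₊ := by
    refine Nat.le_floor ?_
    push_cast; linarith
  have h4 : ⌊u * 2 ^ (n + 1)⌋₊ < 2 * m + 2 := by
    rw [Nat.floor_lt (by have := mul_nonneg hu.1 hpos.le; linarith)]
    push_cast; linarith
  rw [hpi]
  rcases (show ⌊u * 2 ^ (n + 1)⌋₊ = 2 * m ∨ ⌊u * 2 ^ (n + 1)⌋₊ = 2 * m + 1 by omega) with h5 | h5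
  · rw [h5]; simp; positivity
  · have h6 : 2 * m < 2 ^ (n + 1) := by
      have : ((2 * m + 1 : ℕ) : ℝ) ≤ 2 ^ (n + 1) := by
        rw [← h5]
        refine (Nat.floor_le (by have := mul_nonneg hu.1 hpos.le; linarith)).trans ?_
        exact mul_le_of_le_one_left (by positivity) hu.2
      have : 2 * m + 1 ≤ 2 ^ (n + 1) := by exact_mod_cast this
      omega
    have := h (n + 1) (2 * m) h6
    rw [h5]
    convert this using 4
    push_cast; ring

theorem norm_sub_floor_le (hA : 0 ≤ A) (hr0 : 0 < r) (hr1 : r < 1) (hf : Continuous f)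
    (h : ∀ n k : ℕ, k < 2 ^ n → ‖f ((k + 1) / 2 ^ n) - f (k / 2 ^ n)‖ ≤ A * r ^ n) {u : ℝ}
    (hu : u ∈ Set.Icc (0 : ℝ) 1) (n : ℕ) :
    ‖f u - f (⌊u * 2 ^ n⌋₊ / 2 ^ n)‖ ≤ A * r ^ n / (1 - r) := by
  have h1r : 0 < 1 - r := sub_pos.2 hr1
  -- Keeping the tail of the geometric series with a minus sign lets the induction close; it is
  -- dropped once `m → ∞`.
  have key : ∀ m : ℕ, ‖f (⌊u * 2 ^ (n + m)⌋₊ / 2 ^ (n + m)) - f (⌊u * 2 ^ n⌋₊ / 2 ^ n)‖ ≤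
      A * r ^ n / (1 - r) - A * r ^ (n + m) / (1 - r) := by
    intro m
    induction m with
    | zero => simp
    | succ m ih =>
      have h1 := norm_sub_floor_succ_le hA hr0 h hu (n + m)
      have h2 := norm_sub_le_norm_sub_add_norm_sub (f (⌊u * 2 ^ (n + m + 1)⌋₊ / 2 ^ (n + m + 1)))
        (f (⌊u * 2 ^ (n + m)⌋₊ / 2 ^ (n + m))) (f (⌊u * 2 ^ n⌋₊ / 2 ^ n))
      have h3 : A * r ^ (n + m + 1) ≤ A * r ^ (n + m) / (1 - r) - A * r ^ (n + m + 1) / (1 - r) := by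
        have : A * r ^ (n + m) / (1 - r) - A * r ^ (n + m + 1) / (1 - r) = A * r ^ (n + m) := by
          rw [pow_succ]; field_simp
        rw [this, pow_succ]
        have := mul_nonneg hA (pow_nonneg hr0.le (n + m))
        nlinarith
      rw [← add_assoc]
      linarith
  have hlim : Filter.Tendsto (fun m : ℕ ↦ (⌊u * 2 ^ (n + m)⌋₊ : ℝ) / 2 ^ (n + m)) .atTop (𝓝 u) := by
    have h1 : Filter.Tendsto (fun m : ℕ ↦ (2 : ℝ) ^ (n + m)) .atTop .atTop :=
      (tendsto_pow_atTop_atTop_of_one_lt one_lt_two).comp (Filter.tendsto_add_atTop_nat n |>.congr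
        fun m ↦ add_comm _ _)
    exact (tendsto_nat_floor_mul_div_atTop hu.1).comp h1
  refine le_of_tendsto (((hf.tendsto u).comp hlim).sub_const _).norm (.of_forall fun m ↦ ?_)
  refine (key m).trans (sub_le_self _ ?_)
  positivity

/-- Geometric decay of dyadic increments gives a modulus of continuity. -/
theorem norm_sub_le_of_dyadic (hA : 0 ≤ A) (hr0 : 0 < r) (hr1 : r < 1) (hf : Continuous f)
    (h : ∀ n k : ℕ, k < 2 ^ n → ‖f ((k + 1) / 2 ^ n) - f (k / 2 ^ n)‖ ≤ A * r ^ n) {u v : ℝ}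
    (hu : u ∈ Set.Icc (0 : ℝ) 1) (hv : v ∈ Set.Icc (0 : ℝ) 1) {n : ℕ}
    (huv : |u - v| ≤ 1 / 2 ^ n) : ‖f u - f v‖ ≤ (1 + 2 / (1 - r)) * (A * r ^ n) := by
  wlog hle : u ≤ v generalizing u v
  · rw [norm_sub_rev]
    exact this hv hu (by rwa [abs_sub_comm]) (le_of_not_ge hle)
  have hpos : (0 : ℝ) < 2 ^ n := by positivity
  have h1 := norm_sub_floor_le hA hr0 hr1 hf h hu n
  have h2 := norm_sub_floor_le hA hr0 hr1 hf h hv n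
  have h3 : ‖f (⌊v * 2 ^ n⌋₊ / 2 ^ n) - f (⌊u * 2 ^ n⌋₊ / 2 ^ n)‖ ≤ A * r ^ n := by
    have hm1 : ⌊u * 2 ^ n⌋₊ ≤ ⌊v * 2 ^ n⌋₊ := Nat.floor_mono (by gcongr)
    have hm2 : ⌊v * 2 ^ n⌋₊ ≤ ⌊u * 2 ^ n⌋₊ + 1 := by
      rw [← Nat.floor_add_one (mul_nonneg hu.1 hpos.le)]
      refine Nat.floor_mono ?_
      rw [abs_sub_comm, abs_of_nonneg (sub_nonneg.2 hle), le_div_iff₀ hpos] at huv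
      linarith
    rcases (show ⌊v * 2 ^ n⌋₊ = ⌊u * 2 ^ n⌋₊ ∨ ⌊v * 2 ^ n⌋₊ = ⌊u * 2 ^ n⌋₊ + 1 by omega)
      with h5 | h5
    · rw [h5]; simp; positivity
    · rw [h5]
      have h6 : ⌊u * 2 ^ n⌋₊ < 2 ^ n := by
        have : ((⌊u * 2 ^ n⌋₊ + 1 : ℕ) : ℝ) ≤ 2 ^ n := by
          rw [← h5]
          exact (Nat.floor_le (mul_nonneg hv.1 hpos.le)).trans
            (mul_le_of_le_one_left (by positivity) hv.2)
        have : ⌊u * 2 ^ n⌋₊ + 1 ≤ 2 ^ n := by exact_mod_cast this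
        omega
      push_cast
      exact h n _ h6
  have h4 : ‖f u - f v‖ ≤ ‖f u - f (⌊u * 2 ^ n⌋₊ / 2 ^ n)‖ +
      ‖f (⌊v * 2 ^ n⌋₊ / 2 ^ n) - f (⌊u * 2 ^ n⌋₊ / 2 ^ n)‖ +
        ‖f v - f (⌊v * 2 ^ n⌋₊ / 2 ^ n)‖ := by
    have : f u - f v = (f u - f (⌊u * 2 ^ n⌋₊ / 2 ^ n)) -
      (f (⌊v * 2 ^ n⌋₊ / 2 ^ n) - f (⌊u * 2 ^ n⌋₊ / 2 ^ n)) -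
        (f v - f (⌊v * 2 ^ n⌋₊ / 2 ^ n)) := by abel
    rw [this]
    exact (norm_sub_le _ _).trans (add_le_add (norm_sub_le _ _) le_rfl)
  have : (1 + 2 / (1 - r)) * (A * r ^ n) = A * r ^ n / (1 - r) + A * r ^ n + A * r ^ n / (1 - r) := by
    ring
  linarith

end Modulus

/-- The point of the unit interval nearest to `x`. -/
noncomputable def unitPt (x : ℝ) : Set.Icc (0 : ℝ) 1 := Set.projIcc 0 1 zero_le_one x

theorem unitPt_coe (u : Set.Icc (0 : ℝ) 1) : unitPt u = u := Set.projIcc_val _ u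

theorem continuous_unitPt : Continuous unitPt :=
  continuous_projIcc (h := zero_le_one)

/-- The set of paths on the unit interval whose dyadic increments decay geometrically. -/
def dyadicPaths (R A r : ℝ) : Set (Path 0 1) :=
  {f | ‖f (unitPt 0)‖ ≤ R ∧ ∀ n k : ℕ, k < 2 ^ n →
    ‖f (unitPt ((k + 1) / 2 ^ n)) - f (unitPt (k / 2 ^ n))‖ ≤ A * r ^ n}

/-- Chaining gives these paths a common modulus of continuity and a common bound, so Arzelà–Ascoli
applies to the larger closed set of functions with that modulus. -/
theorem exists_isCompact_dyadicPaths_subset {R A r : ℝ} (hA : 0 ≤ A) (hr0 : 0 < r) (hr1 : r < 1) :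
    ∃ K : Set (Path 0 1), IsCompact K ∧ dyadicPaths R A r ⊆ K := by
  set B := (1 + 2 / (1 - r)) * A with hB
  have hB0 : 0 ≤ B := by have : 0 < 1 - r := sub_pos.2 hr1; positivity
  let S' : Set (Set.Icc (0 : ℝ) 1 → ℝ × ℝ) := {g | ‖g (unitPt 0)‖ ≤ R ∧
    ∀ (n : ℕ) (u v : Set.Icc (0 : ℝ) 1), |(u : ℝ) - v| ≤ 1 / 2 ^ n → ‖g u - g v‖ ≤ B * r ^ n}
  have hEq : UniformEquicontinuous (fun (g : S') (u : Set.Icc (0 : ℝ) 1) ↦ g.1 u) := by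
    refine Metric.uniformEquicontinuous_iff.2 fun ε hε ↦ ?_
    have hlim : Filter.Tendsto (fun n : ℕ ↦ B * r ^ n) .atTop (𝓝 (B * 0)) :=
      (tendsto_pow_atTop_nhds_zero_of_lt_one hr0.le hr1).const_mul B
    rw [mul_zero] at hlim
    obtain ⟨n, hn⟩ := (hlim.eventually (gt_mem_nhds hε)).exists
    refine ⟨1 / 2 ^ n, by positivity, fun u v huv g ↦ ?_⟩
    rw [dist_eq_norm]
    rw [Subtype.dist_eq, Real.dist_eq] at huv
    exact (g.2.2 n u v huv.le).trans_lt hn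
  refine ⟨{f | (f : Set.Icc (0 : ℝ) 1 → ℝ × ℝ) ∈ S'},
    ArzelaAscoli.isCompact_of_equicontinuous _ ?_ ?_, ?_⟩
  -- The modulus already forces continuity, so `S'`, a set of arbitrary functions cut out by closed
  -- conditions, is exactly the image of the set of paths.
  · have himg : ContinuousMap.toFun '' {f : Path 0 1 | (f : Set.Icc (0 : ℝ) 1 → ℝ × ℝ) ∈ S'} = S' := by
      ext g
      constructor
      · rintro ⟨f, hf, rfl⟩
        exact hf
      · intro hg
        exact ⟨⟨g, (hEq.uniformContinuous ⟨g, hg⟩).continuous⟩, hg, rfl⟩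
    rw [himg]
    refine IsCompact.of_isClosed_subset
      (isCompact_univ_pi fun _ ↦ isCompact_closedBall (0 : ℝ × ℝ) (R + B)) ?_ ?_
    · simp only [S', Set.ofPred_and, Set.ofPred_forall]
      refine (isClosed_le (continuous_apply _).norm continuous_const).inter
        (isClosed_iInter fun n ↦ isClosed_iInter fun u ↦ isClosed_iInter fun v ↦
          isClosed_iInter fun _ ↦ isClosed_le
            ((continuous_apply u).sub (continuous_apply v)).norm continuous_const)
    · intro g hg u _
      have h1 := hg.2 0 u (unitPt 0) (by
        have : ((unitPt 0 : Set.Icc (0 : ℝ) 1) : ℝ) = 0 := by simp [unitPt]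
        rw [this, sub_zero, abs_of_nonneg u.2.1, pow_zero, div_one]
        exact u.2.2)
      rw [mem_closedBall_zero_iff]
      have h2 := norm_add_le (g u - g (unitPt 0)) (g (unitPt 0))
      rw [sub_add_cancel] at h2
      rw [pow_zero, mul_one] at h1
      linarith [hg.1]
  · exact (hEq.comp fun f : {f : Path 0 1 | (f : Set.Icc (0 : ℝ) 1 → ℝ × ℝ) ∈ S'} ↦
      (⟨f.1, f.2⟩ : S')).equicontinuous
  · rintro f ⟨h1, h2⟩
    refine ⟨h1, fun n u v huv ↦ ?_⟩
    have := norm_sub_le_of_dyadic hA hr0 hr1 (f := fun x ↦ f (unitPt x))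
      (f.continuous.comp continuous_unitPt) h2 u.2 v.2 huv
    simp only [unitPt_coe] at this
    rw [hB, mul_assoc]
    exact this

/-- Kolmogorov's bound on the probability of large dyadic increments. -/
theorem measure_compl_dyadicPaths_le {μ : Measure (Path 0 1)} {R C A : ℝ} (hC : 0 ≤ C) (hA : 0 < A)
    (h0 : ∀ᵐ f ∂μ, ‖f (unitPt 0)‖ ≤ R)
    (h : ∀ u v : Set.Icc (0 : ℝ) 1,
      ∫⁻ f, ENNReal.ofReal (‖f u - f v‖ ^ 4) ∂μ ≤ ENNReal.ofReal (C * ((u : ℝ) - v) ^ 2)) :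
    μ (dyadicPaths R A (9 / 10))ᶜ ≤ ENNReal.ofReal (C / A ^ 4 * 5) := by
  set bad : ℕ → ℕ → Set (Path 0 1) := fun n k ↦
    {f | A * (9 / 10) ^ n ≤ ‖f (unitPt ((k + 1) / 2 ^ n)) - f (unitPt (k / 2 ^ n))‖}
  -- Markov's inequality at the fourth power. Summing the `2 ^ n` intervals of level `n` gives the
  -- ratio `2 * (1/4) * (10/9)⁴ < 4/5`; the rate `9/10` is chosen close enough to `1` for this, and
  -- `∑ (4/5)^n = 5`.
  have hbad : ∀ n k : ℕ, k < 2 ^ n → μ (bad n k) ≤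
      ENNReal.ofReal (C / A ^ 4 * ((1 / 4) ^ n * (10000 / 6561) ^ n)) := by
    intro n k hk
    have hpos : (0 : ℝ) < 2 ^ n := by positivity
    have hm : Measurable fun f : Path 0 1 ↦
        ENNReal.ofReal (‖f (unitPt ((k + 1) / 2 ^ n)) - f (unitPt (k / 2 ^ n))‖ ^ 4) :=
      ((((measurable_eval _).sub (measurable_eval _)).norm).pow_const 4).ennreal_ofReal
    have hAn : 0 < (A * (9 / 10) ^ n) ^ 4 := by positivity
    have h1 := mul_meas_ge_le_lintegral (μ := μ) hm (ENNReal.ofReal ((A * (9 / 10) ^ n) ^ 4))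
    have hk1 : ((k : ℝ) + 1) ≤ 2 ^ n := by exact_mod_cast hk
    have hu1 : ((unitPt ((k + 1) / 2 ^ n) : Set.Icc (0 : ℝ) 1) : ℝ) = (k + 1) / 2 ^ n := by
      have : ((k : ℝ) + 1) / 2 ^ n ∈ Set.Icc (0 : ℝ) 1 :=
        ⟨by positivity, (div_le_one hpos).2 hk1⟩
      rw [unitPt, Set.projIcc_of_mem _ this]
    have hu2 : ((unitPt (k / 2 ^ n) : Set.Icc (0 : ℝ) 1) : ℝ) = k / 2 ^ n := by
      have : (k : ℝ) / 2 ^ n ∈ Set.Icc (0 : ℝ) 1 :=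
        ⟨by positivity, (div_le_one hpos).2 (by linarith)⟩
      rw [unitPt, Set.projIcc_of_mem _ this]
    have h2 := h1.trans (h _ _)
    have hsub : bad n k ⊆ {f : Path 0 1 | ENNReal.ofReal ((A * (9 / 10) ^ n) ^ 4) ≤
        ENNReal.ofReal (‖f (unitPt ((k + 1) / 2 ^ n)) - f (unitPt (k / 2 ^ n))‖ ^ 4)} := by
      intro f hf
      have : A * (9 / 10) ^ n ≤ ‖f (unitPt ((k + 1) / 2 ^ n)) - f (unitPt (k / 2 ^ n))‖ := hf
      exact ENNReal.ofReal_le_ofReal (by gcongr)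
    have h3 := (mul_le_mul_right (measure_mono (μ := μ) hsub)
      (ENNReal.ofReal ((A * (9 / 10) ^ n) ^ 4))).trans h2
    have e : C / A ^ 4 * ((1 / 4) ^ n * (10000 / 6561) ^ n) =
        C * ((((unitPt ((k + 1) / 2 ^ n) : Set.Icc (0 : ℝ) 1) : ℝ)) -
          ((unitPt (k / 2 ^ n) : Set.Icc (0 : ℝ) 1) : ℝ)) ^ 2 / (A * (9 / 10) ^ n) ^ 4 := by
      have e1 : (1 / 2 ^ n : ℝ) ^ 2 = (1 / 4) ^ n := by
        rw [div_pow, one_pow, ← pow_mul, mul_comm n 2, pow_mul, one_div_pow]; norm_num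
      have e2 : (A * (9 / 10) ^ n) ^ 4 = A ^ 4 * (6561 / 10000) ^ n := by
        rw [mul_pow, ← pow_mul, mul_comm n 4, pow_mul]; norm_num
      have e3 : (10000 / 6561 : ℝ) ^ n = ((6561 / 10000) ^ n)⁻¹ := by rw [← inv_pow]; norm_num
      rw [hu1, hu2, ← sub_div, add_sub_cancel_left, e1, e2, e3]
      field_simp
    rw [e, ENNReal.ofReal_div_of_pos hAn]
    rw [ENNReal.le_div_iff_mul_le (Or.inl (by simpa using hAn)) (Or.inl ENNReal.ofReal_ne_top),
      mul_comm]
    exact h3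
  have hsub : (dyadicPaths R A (9 / 10))ᶜ ⊆ {f : Path 0 1 | ¬ ‖f (unitPt 0)‖ ≤ R} ∪
      ⋃ n : ℕ, ⋃ k ∈ Finset.range (2 ^ n), bad n k := by
    intro f hf
    by_cases h1 : ‖f (unitPt 0)‖ ≤ R
    · right
      simp only [dyadicPaths, Set.mem_compl_iff, Set.mem_ofPred_eq, not_and, not_forall, not_le] at hf
      obtain ⟨n, k, hk, hlt⟩ := hf h1
      simp only [Set.mem_iUnion]
      exact ⟨n, k, Finset.mem_range.2 hk, hlt.le⟩
    · exact Or.inl h1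
  refine (measure_mono hsub).trans ((measure_union_le _ _).trans ?_)
  rw [ae_iff.1 h0, zero_add]
  have hq : ∀ n : ℕ, μ (⋃ k ∈ Finset.range (2 ^ n), bad n k) ≤
      ENNReal.ofReal (C / A ^ 4 * (4 / 5) ^ n) := by
    intro n
    refine (measure_biUnion_finset_le _ _).trans ((Finset.sum_le_sum fun k hk ↦
      hbad n k (Finset.mem_range.1 hk)).trans ?_)
    rw [Finset.sum_const, Finset.card_range, nsmul_eq_mul, ← ENNReal.ofReal_natCast,
      ← ENNReal.ofReal_mul (by positivity)]
    refine ENNReal.ofReal_le_ofReal ?_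
    have : ((2 ^ n : ℕ) : ℝ) * (C / A ^ 4 * ((1 / 4) ^ n * (10000 / 6561) ^ n)) =
        C / A ^ 4 * (2 * (1 / 4 * (10000 / 6561))) ^ n := by
      push_cast; rw [mul_pow, mul_pow]; ring
    rw [this]
    gcongr
    norm_num
  refine (measure_iUnion_le _).trans ((ENNReal.tsum_le_tsum hq).trans ?_)
  have hsum : HasSum (fun n : ℕ ↦ C / A ^ 4 * (4 / 5 : ℝ) ^ n) (C / A ^ 4 * 5) := by
    have := (hasSum_geometric_of_lt_one (r := (4 / 5 : ℝ)) (by norm_num) (by norm_num)).mul_left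
      (C / A ^ 4)
    norm_num at this ⊢
    exact this
  rw [← ENNReal.ofReal_tsum_of_nonneg (fun n ↦ by positivity) hsum.summable, hsum.tsum_eq]

/-- Kolmogorov's tightness criterion, in the form of the existence of limit points. -/
theorem exists_tendsto_of_moment_le (μ : ℕ → ProbabilityMeasure (Path 0 1)) {R C : ℝ}
    (hC : 0 ≤ C) (h0 : ∀ n, ∀ᵐ f ∂(μ n : Measure (Path 0 1)), ‖f (unitPt 0)‖ ≤ R)
    (h : ∀ n (u v : Set.Icc (0 : ℝ) 1), ∫⁻ f, ENNReal.ofReal (‖f u - f v‖ ^ 4)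
      ∂(μ n : Measure (Path 0 1)) ≤ ENNReal.ofReal (C * ((u : ℝ) - v) ^ 2)) :
    ∃ ν : ProbabilityMeasure (Path 0 1),
      Filter.Tendsto μ (Filter.hyperfilter ℕ : Filter ℕ) (𝓝 ν) := by
  have ht : IsTightMeasureSet
      {((ν : ProbabilityMeasure (Path 0 1)) : Measure (Path 0 1)) | ν ∈ Set.range μ} := by
    refine isTightMeasureSet_iff_exists_isCompact_measure_compl_le.2 fun ε hε ↦ ?_
    have hlim : Filter.Tendsto (fun A : ℝ ↦ ENNReal.ofReal (C / A ^ 4 * 5)) .atTop (𝓝 0) := by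
      rw [← ENNReal.ofReal_zero]
      refine ENNReal.tendsto_ofReal ?_
      rw [show (0 : ℝ) = 0 * 5 by simp]
      exact (tendsto_const_nhds.div_atTop (Filter.tendsto_pow_atTop (by norm_num))).mul_const 5
    obtain ⟨A, hA, hA0⟩ := ((hlim.eventually (gt_mem_nhds hε)).and
      (Filter.eventually_gt_atTop 0)).exists
    obtain ⟨K, hK, hsub⟩ := exists_isCompact_dyadicPaths_subset (R := R) hA0.le
      (r := 9 / 10) (by norm_num) (by norm_num)
    refine ⟨K, hK, ?_⟩
    rintro _ ⟨ν, ⟨n, rfl⟩, rfl⟩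
    exact (measure_mono (Set.compl_subset_compl.2 hsub)).trans
      ((measure_compl_dyadicPaths_le hC hA0 (h0 n) (h n)).trans hA.le)
  -- A limit along an ultrafilter replaces the extraction of a convergent subsequence.
  obtain ⟨ν, -, hν⟩ := (isCompact_closure_of_isTightMeasureSet ht).ultrafilter_le_nhds
    ((Filter.hyperfilter ℕ).map μ) (by
      rw [Ultrafilter.coe_map, Filter.le_principal_iff, Filter.mem_map]
      exact Filter.Eventually.of_forall fun n ↦ subset_closure ⟨n, rfl⟩)
  exact ⟨ν, hν⟩

end QuadrantExcursion

/-! ### Construction of correlated Brownian motion -/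

namespace QuadrantExcursion

/-- The truncation of a real number to the unit interval. -/
noncomputable def clamp (x : ℝ) : ℝ := max 0 (min 1 x)

theorem clamp_nonneg (x : ℝ) : 0 ≤ clamp x := le_max_left _ _

theorem clamp_le_one (x : ℝ) : clamp x ≤ 1 := max_le zero_le_one (min_le_left _ _)

theorem clamp_mono : Monotone clamp := fun _ _ h ↦ max_le_max le_rfl (min_le_min le_rfl h)

@[fun_prop] theorem continuous_clamp : Continuous clamp := by unfold clamp; fun_prop

theorem clamp_of_one_le {x : ℝ} (h : 1 ≤ x) : clamp x = 1 := by simp [clamp, h]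

theorem sum_clamp {x : ℝ} (hx : 0 ≤ x) (N : ℕ) :
    ∑ k ∈ Finset.range N, clamp (x - k) = min x N := by
  induction N with
  | zero => simp [hx]
  | succ N ih =>
    rw [Finset.sum_range_succ, ih, clamp]
    push_cast
    rcases le_total x N with h | h
    · rw [min_eq_left h, min_eq_right (by linarith), max_eq_left (by linarith),
        min_eq_left (by linarith), add_zero]
    · rw [min_eq_right h]
      rcases le_total x (N + 1) with h2 | h2
      · rw [min_eq_right (by linarith), max_eq_right (by linarith), min_eq_left h2]; ring
      · rw [min_eq_left (by linarith), max_eq_right (by norm_num), min_eq_right h2]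

theorem sum_clamp_mul_clamp_le {x y : ℝ} (hx : 0 ≤ x) (N : ℕ) :
    ∑ k ∈ Finset.range N, clamp (x - k) * clamp (y - k) ≤ x :=
  (Finset.sum_le_sum fun (k : ℕ) _ ↦ mul_le_of_le_one_right (clamp_nonneg (x - (k : ℝ)))
    (clamp_le_one (y - (k : ℝ)))).trans ((sum_clamp hx N).trans_le (min_le_left _ _))

/-- The `⌊x⌋` terms with `k + 1 ≤ x` all equal one. The loss of at most one disappears after
division by the number of steps, so the walk kernel tends to `min u v`. -/
theorem le_sum_clamp_mul_clamp {x y : ℝ} (hx : 0 ≤ x) (hxy : x ≤ y) (N : ℕ) (hN : x ≤ N) :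
    x - 1 ≤ ∑ k ∈ Finset.range N, clamp (x - k) * clamp (y - k) := by
  have h1 : ∑ k ∈ Finset.range N, (if k < ⌊x⌋₊ then (1 : ℝ) else 0) ≤
      ∑ k ∈ Finset.range N, clamp (x - k) * clamp (y - k) := by
    refine Finset.sum_le_sum fun k _ ↦ ?_
    split_ifs with h
    · have : (k : ℝ) + 1 ≤ x := by
        have h2 : ((k + 1 : ℕ) : ℝ) ≤ ⌊x⌋₊ := by exact_mod_cast h
        have h3 := Nat.floor_le hx
        push_cast at h2
        linarith
      rw [clamp_of_one_le (by linarith), clamp_of_one_le (by linarith), one_mul]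
    · exact mul_nonneg (clamp_nonneg _) (clamp_nonneg _)
  refine le_trans ?_ h1
  have hfl : ⌊x⌋₊ ≤ N := Nat.floor_le_of_le hN
  have : (Finset.range N).filter (· < ⌊x⌋₊) = Finset.range ⌊x⌋₊ := by
    ext k; simp only [Finset.mem_filter, Finset.mem_range]; omega
  rw [← Finset.sum_filter, this]
  simp only [Finset.sum_const, Finset.card_range, nsmul_eq_mul, mul_one]
  linarith [Nat.lt_floor_add_one x]

/-- The interpolated random walk with `N` steps. -/
noncomputable def walkPath (N : ℕ) (ξ : Fin N → ℝ × ℝ) : Path 0 1 where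
  toFun u := ∑ k : Fin N, (clamp (N * u - k) / √N) • ξ k
  continuous_toFun := by fun_prop

theorem continuous_walkPath (N : ℕ) : Continuous (walkPath N) := by
  refine ContinuousMap.continuous_of_continuous_uncurry _ ?_
  simp only [walkPath, ContinuousMap.coe_mk, Function.uncurry_def]
  fun_prop

/-- The kernel of the interpolated random walk. -/
noncomputable def walkKernel (N : ℕ) (u v : Set.Icc (0 : ℝ) 1) : ℝ :=
  (∑ k ∈ Finset.range N, clamp (N * u - k) * clamp (N * v - k)) / N

variable {α : ℝ}

theorem corrGauss_walkPath (hα : α ∈ Set.Ioo (-1 : ℝ) 1) (N : ℕ) :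
    CorrGauss α (walkKernel N) (fun u f ↦ f u)
      ((Measure.pi fun _ : Fin N ↦ corrGaussian α 1).map (walkPath N)) := by
  refine CorrGauss.map_path_eq (continuous_walkPath N).measurable
    ((corrGauss_pi hα 1 N).sum (fun (u : Set.Icc (0 : ℝ) 1) (k : Fin N) ↦
      clamp (N * (u : ℝ) - (k : ℝ)) / √N)
      (fun _ k ↦ k) (fun u ω ↦ rfl) fun u v ↦ ?_)
  rw [walkKernel, Finset.sum_div, Finset.sum_range]
  refine Finset.sum_congr rfl fun k _ ↦ ?_
  have h : √(N : ℝ) * √N = N := Real.mul_self_sqrt (Nat.cast_nonneg N)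
  simp only [NNReal.coe_one, mul_ite, mul_one, mul_zero, Finset.sum_ite_eq, Finset.mem_univ, if_true]
  rw [div_mul_div_comm, h]

theorem walkKernel_comm (N : ℕ) (u v) : walkKernel N u v = walkKernel N v u := by
  simp [walkKernel, mul_comm]

theorem tendsto_walkKernel (u v : Set.Icc (0 : ℝ) 1) :
    Filter.Tendsto (fun N : ℕ ↦ walkKernel (N + 1) u v) .atTop (𝓝 (min (u : ℝ) v)) := by
  wlog huv : (u : ℝ) ≤ v generalizing u v
  · rw [min_comm]
    simp_rw [walkKernel_comm _ u v]
    exact this v u (le_of_not_ge huv)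
  rw [min_eq_left huv]
  have h0 : Filter.Tendsto (fun N : ℕ ↦ (u : ℝ) - 1 / ((N : ℝ) + 1)) .atTop (𝓝 (u - 0)) :=
    tendsto_const_nhds.sub tendsto_one_div_add_atTop_nhds_zero_nat
  rw [sub_zero] at h0
  refine tendsto_of_tendsto_of_tendsto_of_le_of_le h0 tendsto_const_nhds (fun N ↦ ?_) fun N ↦ ?_
  · have hN : (0 : ℝ) < (N : ℝ) + 1 := by positivity
    simp only [walkKernel, Nat.cast_add, Nat.cast_one]
    rw [le_div_iff₀ hN, sub_mul, div_mul_cancel₀ _ hN.ne', mul_comm]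
    exact le_sum_clamp_mul_clamp (mul_nonneg hN.le u.2.1) (by gcongr) (N + 1) (by
      push_cast; exact mul_le_of_le_one_right hN.le u.2.2)
  · have hN : (0 : ℝ) < (N : ℝ) + 1 := by positivity
    simp only [walkKernel, Nat.cast_add, Nat.cast_one]
    rw [div_le_iff₀ hN, mul_comm (u : ℝ)]
    exact sum_clamp_mul_clamp_le (mul_nonneg hN.le u.2.1) (N + 1)

/-- The clamp differences lie in `[0, 1]`, hence dominate their squares, and their sum is `N (u -
v)`. -/
theorem walkKernel_increment_le {N : ℕ} (hN : N ≠ 0) (u v : Set.Icc (0 : ℝ) 1) :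
    walkKernel N u u - 2 * walkKernel N u v + walkKernel N v v ≤ |(u : ℝ) - v| := by
  wlog huv : (v : ℝ) ≤ u generalizing u v
  · have := this v u (le_of_not_ge huv)
    rw [walkKernel_comm N u v, abs_sub_comm]; linarith
  have hN' : (0 : ℝ) < N := by positivity
  rw [abs_of_nonneg (sub_nonneg.2 huv)]
  have e : walkKernel N u u - 2 * walkKernel N u v + walkKernel N v v =
      (∑ k ∈ Finset.range N, (clamp (N * u - k) - clamp (N * v - k)) ^ 2) / N := by
    have : ∑ k ∈ Finset.range N, (clamp (N * u - k) - clamp (N * v - k)) ^ 2 =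
        ∑ k ∈ Finset.range N, (clamp (N * u - k) * clamp (N * u - k)) -
          2 * ∑ k ∈ Finset.range N, (clamp (N * u - k) * clamp (N * v - k)) +
          ∑ k ∈ Finset.range N, (clamp (N * v - k) * clamp (N * v - k)) := by
      rw [Finset.mul_sum, ← Finset.sum_sub_distrib, ← Finset.sum_add_distrib]
      exact Finset.sum_congr rfl fun k _ ↦ by ring
    rw [this]; simp only [walkKernel]; ring
  rw [e, div_le_iff₀ hN']
  have hle : ∀ x ∈ Set.Icc (0 : ℝ) 1, (N : ℝ) * x ≤ N := fun x hx ↦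
    mul_le_of_le_one_right hN'.le hx.2
  have h1 : ∑ k ∈ Finset.range N, (clamp (N * u - k) - clamp (N * v - k)) ^ 2 ≤
      ∑ k ∈ Finset.range N, (clamp (N * u - k) - clamp (N * v - k)) := by
    refine Finset.sum_le_sum fun k _ ↦ ?_
    have h2 : 0 ≤ clamp (N * u - k) - clamp (N * v - k) := sub_nonneg.2 (clamp_mono (by gcongr))
    have h3 : clamp (N * u - k) - clamp (N * v - k) ≤ 1 := by
      linarith [clamp_le_one (N * u - k), clamp_nonneg (N * v - k)]
    nlinarith
  refine h1.trans (le_of_eq ?_)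
  rw [Finset.sum_sub_distrib, sum_clamp (mul_nonneg hN'.le u.2.1),
    sum_clamp (mul_nonneg hN'.le v.2.1), min_eq_left (hle u u.2), min_eq_left (hle v v.2)]
  ring

/-- The fourth moment of a standard correlated Gaussian vector. -/
noncomputable def fourthMoment (α : ℝ) : ℝ := ∫ x, ‖x‖ ^ 4 ∂(corrGaussian α 1)

theorem fourthMoment_nonneg (α : ℝ) : 0 ≤ fourthMoment α :=
  integral_nonneg fun _ ↦ by positivity

theorem corrGaussian_eq_map_smul (hα : α ∈ Set.Ioo (-1 : ℝ) 1) (v : ℝ≥0) :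
    corrGaussian α v = (corrGaussian α 1).map (fun x ↦ √(v : ℝ) • x) := by
  have h : CorrGauss α (fun _ _ : Unit ↦ (v : ℝ)) (fun _ (x : ℝ × ℝ) ↦ √(v : ℝ) • x)
      (corrGaussian α 1) :=
    (corrGauss_corrGaussian hα 1).sum (A := Unit) (fun _ _ ↦ √(v : ℝ)) (fun _ _ ↦ ())
      (fun _ _ ↦ by simp) fun _ _ ↦ by simp
  exact (h.map_eval_eq hα () rfl).symm

theorem hasGaussianLaw_corrGaussian (hα : α ∈ Set.Ioo (-1 : ℝ) 1) (v : ℝ≥0) :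
    HasGaussianLaw id (corrGaussian α v) := by
  simpa [Function.id_def] using
    ((corrGauss_corrGaussian hα v).isGaussianProcess_add_const 0).hasGaussianLaw_eval ()

theorem lintegral_norm_pow_four_corrGaussian (hα : α ∈ Set.Ioo (-1 : ℝ) 1) (v : ℝ≥0) :
    ∫⁻ x, ENNReal.ofReal (‖x‖ ^ 4) ∂(corrGaussian α v) =
      ENNReal.ofReal (fourthMoment α * v ^ 2) := by
  have hi : Integrable (fun x : ℝ × ℝ ↦ ‖x‖ ^ 4) (corrGaussian α 1) := by
    have := ((hasGaussianLaw_corrGaussian hα 1).memLp (p := 4) (by norm_num)).integrable_norm_pow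
      (by norm_num)
    simpa using this
  rw [corrGaussian_eq_map_smul hα, lintegral_map (by fun_prop) (by fun_prop)]
  simp only [norm_smul, mul_pow, Real.norm_eq_abs, abs_of_nonneg (Real.sqrt_nonneg _)]
  have e : √(v : ℝ) ^ 4 = v ^ 2 := by
    rw [show 4 = 2 * 2 by norm_num, pow_mul, Real.sq_sqrt (NNReal.coe_nonneg v)]
  simp only [e, ENNReal.ofReal_mul (show (0 : ℝ) ≤ v ^ 2 by positivity)]
  rw [lintegral_const_mul _ (by fun_prop), ← ofReal_integral_eq_lintegral_ofReal hi
    (.of_forall fun x ↦ by positivity), ← ENNReal.ofReal_mul (by positivity), mul_comm]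
  rfl

/-- Increments of a Gaussian process whose variance is bounded by `v`. -/
theorem CorrGauss.lintegral_sub_pow_four_le (hα : α ∈ Set.Ioo (-1 : ℝ) 1) {S Ω : Type*}
    [MeasurableSpace Ω] {K : S → S → ℝ} {X : S → Ω → ℝ × ℝ} {P : Measure Ω}
    (h : CorrGauss α K X P) (a b : S) {v : ℝ} (hK : K a b = K b a)
    (hv : K a a - 2 * K a b + K b b ≤ v) :
    ∫⁻ ω, ENNReal.ofReal (‖X a ω - X b ω‖ ^ 4) ∂P ≤ ENNReal.ofReal (fourthMoment α * v ^ 2) := by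
  have h1 : CorrGauss α (fun _ _ : Unit ↦ K a a - 2 * K a b + K b b)
      (fun _ ω ↦ X a ω - X b ω) P :=
    h.sum (A := Bool) (fun _ c ↦ if c then 1 else -1) (fun _ c ↦ if c then a else b)
      (fun _ ω ↦ by simp [sub_eq_add_neg]) fun _ _ ↦ by simp [← hK]; ring
  have h0 : 0 ≤ K a a - 2 * K a b + K b b := by
    simpa [corrForm] using h1.sum_nonneg (fun _ : Unit ↦ ()) (fun _ ↦ (1, 0))
  have h2 := h1.map_eval_eq hα () (v := ⟨_, h0⟩) rfl
  have h3 := lintegral_norm_pow_four_corrGaussian hα ⟨_, h0⟩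
  rw [← h2, lintegral_map (by fun_prop) (h1.measurable ())] at h3
  rw [h3]
  refine ENNReal.ofReal_le_ofReal ?_
  have := fourthMoment_nonneg α
  gcongr
  exact hv

/-- Pointwise limits of kernels along weak limits of path laws. -/
theorem CorrGauss.of_tendsto {a b : ℝ} {K : Set.Icc a b → Set.Icc a b → ℝ} {ι : Type*}
    {l : Filter ι} [l.NeBot]
    {K' : ι → Set.Icc a b → Set.Icc a b → ℝ} {μ : ι → ProbabilityMeasure (Path a b)}
    {ν : ProbabilityMeasure (Path a b)} (hμ : Filter.Tendsto μ l (𝓝 ν))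
    (h : ∀ n, CorrGauss α (K' n) (fun u f ↦ f u) (μ n : Measure (Path a b)))
    (hK : ∀ u v, Filter.Tendsto (fun n ↦ K' n u v) l (𝓝 (K u v))) :
    CorrGauss α K (fun u f ↦ f u) (ν : Measure (Path a b)) where
  measurable := measurable_eval
  charFun {κ} _ u c := by
    have hc : Continuous fun f : Path a b ↦
        Complex.exp ((∑ i, pairing (c i) (f (u i)) : ℝ) * Complex.I) := by
      refine Complex.continuous_exp.comp ((Complex.continuous_ofReal.comp ?_).mul continuous_const)
      exact continuous_finsetSum _ fun i _ ↦
        (continuous_pairing _).comp (ContinuousEvalConst.continuous_eval_const _)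
    let F : BoundedContinuousFunction (Path a b) ℂ := BoundedContinuousFunction.ofNormedAddCommGroup
      _ hc 1 fun f ↦ (Complex.norm_exp_ofReal_mul_I _).le
    have h1 := (ProbabilityMeasure.tendsto_iff_forall_integral_rclike_tendsto ℂ).1 hμ F
    refine tendsto_nhds_unique h1 ?_
    have h2 : ∀ n, ∫ f, F f ∂(μ n : Measure (Path a b)) = _ := fun n ↦ (h n).charFun u c
    simp_rw [h2]
    refine (Complex.continuous_exp.tendsto _).comp ((Complex.continuous_ofReal.tendsto _).comp ?_)
    refine (Filter.Tendsto.neg ?_).div_const 2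
    exact tendsto_finsetSum _ fun i _ ↦ tendsto_finsetSum _ fun j _ ↦ (hK _ _).const_mul _

/-- The interpolated walks with Gaussian steps are themselves Gaussian, so no central limit theorem
is needed: they are tight, and any limit point is Gaussian with the limiting kernel. -/
theorem exists_brownian_unit (hα : α ∈ Set.Ioo (-1 : ℝ) 1) :
    ∃ μ : Measure (Path 0 1), CorrGauss α (fun u v : Set.Icc (0 : ℝ) 1 ↦ min (u : ℝ) v)
      (fun u f ↦ f u) μ := by
  have hG := fun N : ℕ ↦ corrGauss_walkPath hα (N + 1)
  let μ : ℕ → ProbabilityMeasure (Path 0 1) := fun N ↦ ⟨_, (hG N).isProbabilityMeasure⟩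
  obtain ⟨ν, hν⟩ := exists_tendsto_of_moment_le μ (R := 0) (fourthMoment_nonneg α)
    (fun N ↦ by
      refine (ae_map_iff (continuous_walkPath _).measurable.aemeasurable
        (measurableSet_le (measurable_eval _).norm measurable_const)).2 (.of_forall fun ω ↦ ?_)
      have : ∀ k : ℕ, clamp (-(k : ℝ)) = 0 := fun k ↦ by simp [clamp]
      simp [walkPath, unitPt, this])
    (fun N u v ↦ by
      have := (hG N).lintegral_sub_pow_four_le hα u v (walkKernel_comm _ _ _)
        (walkKernel_increment_le (Nat.succ_ne_zero N) u v)
      rwa [sq_abs] at this)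
  exact ⟨ν, CorrGauss.of_tendsto hν hG fun u v ↦ (tendsto_walkKernel u v).mono_left
    Nat.hyperfilter_le_atTop⟩

end QuadrantExcursion

/-! ### Brownian loops and bridges -/

namespace QuadrantExcursion

variable {α s t : ℝ}

/-- The proportion of the interval `[s, t]` elapsed at time `u`. -/
noncomputable def frac (s t u : ℝ) : ℝ := (u - s) / (t - s)

@[fun_prop] theorem continuous_frac (s t : ℝ) : Continuous (frac s t) := by unfold frac; fun_prop

theorem frac_mem (hst : s < t) {u : ℝ} (hu : u ∈ Set.Icc s t) : frac s t u ∈ Set.Icc (0 : ℝ) 1 :=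
  ⟨div_nonneg (sub_nonneg.2 hu.1) (sub_pos.2 hst).le,
    (div_le_one (sub_pos.2 hst)).2 (sub_le_sub_right hu.2 s)⟩

theorem unitPt_val {x : ℝ} (h : x ∈ Set.Icc (0 : ℝ) 1) : (unitPt x : ℝ) = x := by
  rw [unitPt, Set.projIcc_of_mem _ h]

/-- The covariance kernel of the Brownian loop on `[s, t]`. -/
noncomputable def loopKernel (s t : ℝ) (u v : Set.Icc s t) : ℝ :=
  (min (u : ℝ) v - s) * (t - max (u : ℝ) v) / (t - s)

theorem loopKernel_comm (u v : Set.Icc s t) : loopKernel s t u v = loopKernel s t v u := by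
  simp [loopKernel, min_comm, max_comm]

/-- Brownian scaling of a path from the unit interval to `[s, t]`. -/
noncomputable def scalePath (s t : ℝ) (f : Path 0 1) : Path s t where
  toFun u := √(t - s) • f (unitPt (frac s t u))
  continuous_toFun := by
    have := continuous_unitPt
    fun_prop

theorem continuous_scalePath (s t : ℝ) : Continuous (scalePath s t) := by
  refine ContinuousMap.continuous_of_continuous_uncurry _ ?_
  have := continuous_unitPt
  simp only [scalePath, ContinuousMap.coe_mk, Function.uncurry_def]
  fun_prop

/-- The path `u ↦ f u - (u - s) / (t - s) * f t`, on the unit interval. -/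
noncomputable def loopPath (f : Path 0 1) : Path 0 1 where
  toFun u := f u - (u : ℝ) • f (unitPt 1)

theorem continuous_loopPath : Continuous loopPath := by
  refine ContinuousMap.continuous_of_continuous_uncurry _ ?_
  simp only [loopPath, ContinuousMap.coe_mk, Function.uncurry_def]
  fun_prop

theorem corrGauss_scalePath (hst : s < t) {μ : Measure (Path 0 1)}
    (h : CorrGauss α (loopKernel 0 1) (fun u f ↦ f u) μ) :
    CorrGauss α (loopKernel s t) (fun u f ↦ f u) (μ.map (scalePath s t)) := by
  have hT := sub_pos.2 hst
  refine CorrGauss.map_path_eq (continuous_scalePath s t).measurable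
    (h.sum (A := Unit) (fun _ _ ↦ √(t - s)) (fun (u : Set.Icc s t) _ ↦ unitPt (frac s t u))
      (fun u ω ↦ by simp [scalePath]) fun u v ↦ ?_)
  simp only [Finset.univ_unique, Finset.sum_singleton, loopKernel,
    unitPt_val (frac_mem hst u.2), unitPt_val (frac_mem hst v.2)]
  rw [Real.mul_self_sqrt hT.le]
  have hm : min (frac s t u) (frac s t v) = frac s t (min u v) :=
    (Monotone.map_min (f := frac s t) fun x y h ↦ by unfold frac; gcongr).symm
  have hM : max (frac s t u) (frac s t v) = frac s t (max u v) :=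
    (Monotone.map_max (f := frac s t) fun x y h ↦ by unfold frac; gcongr).symm
  rw [hm, hM]
  simp only [frac]
  field_simp
  ring

theorem exists_loop (hα : α ∈ Set.Ioo (-1 : ℝ) 1) (hst : s < t) :
    ∃ μ : Measure (Path s t), CorrGauss α (loopKernel s t) (fun u f ↦ f u) μ := by
  obtain ⟨μ, hμ⟩ := exists_brownian_unit hα
  refine ⟨_, corrGauss_scalePath hst (μ := μ.map loopPath) (CorrGauss.map_path_eq
    continuous_loopPath.measurable (hμ.sum (A := Bool)
      (fun (u : Set.Icc (0 : ℝ) 1) c ↦ if c then 1 else -(u : ℝ))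
      (fun (u : Set.Icc (0 : ℝ) 1) c ↦ if c then u else unitPt 1)
      (fun u ω ↦ by simp [loopPath, sub_eq_add_neg]) fun u v ↦ ?_))⟩
  have h1 : ((unitPt 1 : Set.Icc (0 : ℝ) 1) : ℝ) = 1 := unitPt_val ⟨zero_le_one, le_rfl⟩
  simp only [Fintype.sum_bool, if_true, Bool.false_eq_true, if_false, h1, loopKernel]
  rcases le_total (u : ℝ) v with h | h
  · rw [min_eq_left h, max_eq_right h, min_eq_left u.2.2, min_eq_right v.2.2, min_self]; ring
  · rw [min_eq_right h, max_eq_left h, min_eq_left u.2.2, min_eq_right v.2.2, min_self]; ring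

/-- The law of the Brownian loop on `[s, t]`. -/
noncomputable def loopLaw (α s t : ℝ) : Measure (Path s t) :=
  Classical.epsilon fun μ ↦ CorrGauss α (loopKernel s t) (fun u f ↦ f u) μ

theorem corrGauss_loopLaw (hα : α ∈ Set.Ioo (-1 : ℝ) 1) (hst : s < t) :
    CorrGauss α (loopKernel s t) (fun u f ↦ f u) (loopLaw α s t) :=
  Classical.epsilon_spec (exists_loop hα hst)

theorem loopLaw_eq_map (hα : α ∈ Set.Ioo (-1 : ℝ) 1) (hst : s < t) :
    loopLaw α s t = (loopLaw α 0 1).map (scalePath s t) :=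
  (corrGauss_loopLaw hα hst).path_measure_eq
    (corrGauss_scalePath hst (corrGauss_loopLaw hα zero_lt_one))

/-- The segment from `z` at time `s` to `w` at time `t`. -/
noncomputable def linePath (s t : ℝ) (z w : ℝ × ℝ) : Path s t where
  toFun u := z + frac s t u • (w - z)

/-- The law of the Brownian bridge from `z` at time `s` to `w` at time `t`. -/
noncomputable def bridgeLaw (α s t : ℝ) (z w : ℝ × ℝ) : Measure (Path s t) :=
  (loopLaw α s t).map (linePath s t z w + ·)

theorem measurable_linePath_add (z w : ℝ × ℝ) :
    Measurable fun f : Path s t ↦ linePath s t z w + f :=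
  (continuous_const.add continuous_id).measurable

theorem isProbabilityMeasure_bridgeLaw (hα : α ∈ Set.Ioo (-1 : ℝ) 1) (hst : s < t) (z w : ℝ × ℝ) :
    IsProbabilityMeasure (bridgeLaw α s t z w) := by
  have := (corrGauss_loopLaw hα hst).isProbabilityMeasure
  exact Measure.isProbabilityMeasure_map (measurable_linePath_add z w).aemeasurable

theorem continuous_pinPath (hst : s < t) (w : ℝ × ℝ) : Continuous (pinPath hst w) := by
  refine ContinuousMap.continuous_of_continuous_uncurry _ ?_
  simp only [pinPath, ContinuousMap.coe_mk, Function.uncurry_def]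
  fun_prop

/-- After subtraction of the segment, the pinned path is centred with the loop kernel whatever the
endpoints are, so its law is the fixed `loopLaw`. -/
theorem IsBrownianLaw.map_pinPath (hα : α ∈ Set.Ioo (-1 : ℝ) 1) (hst : s < t) {z w : ℝ × ℝ}
    {β : Measure (Path s t)} (h : IsBrownianLaw α s t z β) :
    β.map (pinPath hst w) = bridgeLaw α s t z w := by
  have hT := (sub_pos.2 hst).ne'
  let tt : Set.Icc s t := ⟨t, hst.le, le_rfl⟩
  let Z : Path s t → Path s t := fun f ↦ pinPath hst w f - linePath s t z w
  have hZ : Measurable Z := ((continuous_pinPath hst w).sub continuous_const).measurable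
  have h1 : CorrGauss α (loopKernel s t) (fun u f ↦ f u) (β.map Z) := by
    refine CorrGauss.map_path_eq hZ (h.corrGauss.sum (A := Bool)
      (fun (u : Set.Icc s t) c ↦ if c then 1 else -frac s t u)
      (fun (u : Set.Icc s t) c ↦ if c then u else tt)
      (fun u f ↦ ?_) fun u v ↦ ?_)
    · simp only [Z, ContinuousMap.sub_apply, pinPath, linePath, ContinuousMap.coe_mk,
        Fintype.sum_bool, if_true, Bool.false_eq_true, if_false, tt, frac]
      module
    · simp only [Fintype.sum_bool, if_true, Bool.false_eq_true, if_false, brownianKernel,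
        loopKernel, tt, frac]
      rcases le_total (u : ℝ) v with h | h
      · rw [min_eq_left h, max_eq_right h, min_eq_left u.2.2, min_eq_right v.2.2, min_self]
        field_simp; ring
      · rw [min_eq_right h, max_eq_left h, min_eq_left u.2.2, min_eq_right v.2.2, min_self]
        field_simp; ring
  rw [bridgeLaw, (corrGauss_loopLaw hα hst).path_measure_eq h1,
    Measure.map_map (measurable_linePath_add z w) hZ]
  congr 1
  funext f
  simp [Z]

theorem exists_isBrownianLaw (hα : α ∈ Set.Ioo (-1 : ℝ) 1) (hst : s < t) (z : ℝ × ℝ) :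
    ∃ β, IsBrownianLaw α s t z β := by
  obtain ⟨μ, hμ⟩ := exists_brownian_unit hα
  have hT := sub_pos.2 hst
  let Z : Path 0 1 → Path s t := fun f ↦ scalePath s t f + ContinuousMap.const _ z
  have hZ : Measurable Z := ((continuous_scalePath s t).add continuous_const).measurable
  refine ⟨μ.map Z, CorrGauss.isBrownianLaw ?_⟩
  have h1 : CorrGauss α (brownianKernel s t) (fun u f ↦ scalePath s t f u) μ := by
    refine hμ.sum (A := Unit) (fun _ _ ↦ √(t - s)) (fun (u : Set.Icc s t) _ ↦ unitPt (frac s t u))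
      (fun u ω ↦ by simp [scalePath]) fun u v ↦ ?_
    simp only [Finset.univ_unique, Finset.sum_singleton, brownianKernel,
      unitPt_val (frac_mem hst u.2), unitPt_val (frac_mem hst v.2)]
    rw [Real.mul_self_sqrt hT.le]
    have hm : min (frac s t u) (frac s t v) = frac s t (min u v) :=
      (Monotone.map_min (f := frac s t) fun x y h ↦ by unfold frac; gcongr).symm
    rw [hm]; simp only [frac]; field_simp
  refine ⟨fun u ↦ (measurable_eval u).sub_const z, fun u a ↦ ?_⟩
  have hm : ∀ i, Measurable fun f : Path s t ↦ pairing (a i) (f (u i) - z) :=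
    fun i ↦ (measurable_pairing _).comp ((measurable_eval _).sub_const z)
  rw [integral_map hZ.aemeasurable (Measurable.aestronglyMeasurable (by fun_prop)), ← h1.charFun u a]
  simp [Z]

/-- The relational definition describes exactly one measure; from here on bridges are handled as a
function of their endpoints. -/
theorem isBrownianBridgeLaw_iff (hα : α ∈ Set.Ioo (-1 : ℝ) 1) (hst : s < t) {z w : ℝ × ℝ}
    {ρ : Measure (Path s t)} : IsBrownianBridgeLaw α hst z w ρ ↔ ρ = bridgeLaw α s t z w := by
  constructor
  · rintro ⟨β, hβ, rfl⟩
    exact hβ.map_pinPath hα hst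
  · rintro rfl
    obtain ⟨β, hβ⟩ := exists_isBrownianLaw hα hst z
    exact ⟨β, hβ, (hβ.map_pinPath hα hst).symm⟩

/-! ### Conditioned bridges and positivity of the conditioning event -/

/-- The law of the Brownian bridge conditioned on staying in the quadrant. -/
noncomputable def quadBridge (α s t : ℝ) (z w : ℝ × ℝ) : Measure (Path s t) :=
  ProbabilityTheory.cond (bridgeLaw α s t z w) (quadrantPaths s t)

theorem isQuadrantBridgeLaw_iff (hα : α ∈ Set.Ioo (-1 : ℝ) 1) (hst : s < t) {z w : ℝ × ℝ}
    {ρ : Measure (Path s t)} : IsQuadrantBridgeLaw α hst z w ρ ↔ ρ = quadBridge α s t z w := by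
  simp [IsQuadrantBridgeLaw, isBrownianBridgeLaw_iff hα hst, quadBridge]

theorem isClosed_quadrantPaths (s t : ℝ) : IsClosed (quadrantPaths s t) := by
  simp only [quadrantPaths, Set.ofPred_forall]
  exact isClosed_iInter fun u ↦
    isClosed_quadrant.preimage (ContinuousEvalConst.continuous_eval_const u)

theorem measurableSet_quadrantPaths (s t : ℝ) : MeasurableSet (quadrantPaths s t) :=
  (isClosed_quadrantPaths s t).measurableSet

/-- Small balls have positive probability under the law of the Brownian loop. -/
theorem loopLaw_ball_ne_zero (hα : α ∈ Set.Ioo (-1 : ℝ) 1) (hst : s < t) {ε : ℝ} (hε : 0 < ε) :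
    loopLaw α s t (Metric.ball 0 ε) ≠ 0 := by
  have hL := corrGauss_loopLaw hα hst
  have := hL.isProbabilityMeasure
  obtain ⟨D, hDc, hDd⟩ := TopologicalSpace.exists_countable_dense (Path s t)
  obtain ⟨g, hg⟩ : ∃ g : Path s t, loopLaw α s t (Metric.ball g (ε / 2)) ≠ 0 := by
    by_contra! hcon
    have h1 : loopLaw α s t (⋃ g ∈ D, Metric.ball g (ε / 2)) = 0 :=
      (measure_biUnion_null_iff hDc).2 fun g _ ↦ hcon g
    rw [show (⋃ g ∈ D, Metric.ball g (ε / 2)) = Set.univ from ?_, measure_univ] at h1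
    · exact one_ne_zero h1
    · refine Set.eq_univ_of_forall fun f ↦ ?_
      obtain ⟨g, hgD, hg⟩ := Metric.mem_closure_iff.1 (hDd f) (ε / 2) (by positivity)
      exact Set.mem_biUnion hgD hg
  -- By rotation invariance `(f₁ - f₂) / √2` is again a loop. Separability gives some ball of radius
  -- `ε / 2` positive mass, and two independent loops in that ball differ by less than `ε`.
  have h2 : CorrGauss α (loopKernel s t) (fun u (p : Path s t × Path s t) ↦
      ((√2)⁻¹ • (p.1 - p.2)) u) ((loopLaw α s t).prod (loopLaw α s t)) := by
    refine (hL.prod hL).sum (A := Bool) (fun _ c ↦ if c then (√2)⁻¹ else -(√2)⁻¹)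
      (fun u c ↦ if c then Sum.inl u else Sum.inr u)
      (fun u f ↦ by simp [sub_eq_add_neg]) fun u v ↦ ?_
    simp only [Fintype.sum_bool, if_true, Bool.false_eq_true, if_false, Sum.elim_inl, Sum.elim_inr]
    have : (√2)⁻¹ * (√2)⁻¹ = (1 / 2 : ℝ) := by rw [← mul_inv, Real.mul_self_sqrt (by norm_num)]; norm_num
    linear_combination (-2 * loopKernel s t u v) * this
  have hm : Measurable fun p : Path s t × Path s t ↦ (√2)⁻¹ • (p.1 - p.2) :=
    Continuous.measurable (by fun_prop)
  rw [hL.path_measure_eq (CorrGauss.map_path_eq hm h2), Measure.map_apply hm Metric.isOpen_ball.measurableSet]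
  intro h0
  have h3 : (loopLaw α s t).prod (loopLaw α s t) (Metric.ball g (ε / 2) ×ˢ Metric.ball g (ε / 2)) = 0 := by
    refine measure_mono_null ?_ h0
    rintro ⟨f1, f2⟩ ⟨hf1, hf2⟩
    rw [Metric.mem_ball] at hf1 hf2
    simp only [Set.mem_preimage, mem_ball_zero_iff, norm_smul]
    have h4 : ‖f1 - f2‖ < ε := by
      rw [← dist_eq_norm]
      linarith [dist_triangle_right f1 f2 g]
    have h5 : ‖(√2)⁻¹‖ ≤ 1 := by
      rw [Real.norm_eq_abs, abs_of_nonneg (by positivity)]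
      exact inv_le_one_of_one_le₀ (Real.one_le_sqrt.2 (by norm_num))
    nlinarith [norm_nonneg (f1 - f2), norm_nonneg (√2)⁻¹]
  rw [Measure.prod_prod, mul_self_eq_zero] at h3
  exact hg h3

theorem linePath_mem (hst : s < t) {S : Set (ℝ × ℝ)} (hS : Convex ℝ S) {z w : ℝ × ℝ} (hz : z ∈ S)
    (hw : w ∈ S) (u : Set.Icc s t) : linePath s t z w u ∈ S :=
  hS.add_smul_sub_mem hz hw (frac_mem hst u.2)

/-- The open quadrant. -/
def openQuadrant : Set (ℝ × ℝ) := {p | 0 < p.1 ∧ 0 < p.2}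

/-- Along the segment both coordinates stay above the smallest coordinate `ε` of the endpoints, so a
loop of size below `ε` cannot leave the quadrant. -/
theorem bridgeLaw_quadrantPaths_ne_zero (hα : α ∈ Set.Ioo (-1 : ℝ) 1) (hst : s < t) {z w : ℝ × ℝ}
    (hz : z ∈ openQuadrant) (hw : w ∈ openQuadrant) :
    bridgeLaw α s t z w (quadrantPaths s t) ≠ 0 := by
  rw [bridgeLaw, Measure.map_apply (measurable_linePath_add z w) (measurableSet_quadrantPaths s t)]
  set ε := min (min z.1 z.2) (min w.1 w.2) with hεd
  have hε : 0 < ε := lt_min (lt_min hz.1 hz.2) (lt_min hw.1 hw.2)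
  intro h0
  refine loopLaw_ball_ne_zero hα hst hε (measure_mono_null ?_ h0)
  intro f hf u
  rw [mem_ball_zero_iff] at hf
  have h1 : ‖f u‖ < ε := (f.norm_coe_le_norm u).trans_lt hf
  have hc : Convex ℝ {p : ℝ × ℝ | ε ≤ p.1 ∧ ε ≤ p.2} := by
    rintro p ⟨h1, h2⟩ q ⟨h3, h4⟩ a b ha hb hab
    constructor
    · simp only [Prod.fst_add, Prod.smul_fst, smul_eq_mul]; nlinarith
    · simp only [Prod.snd_add, Prod.smul_snd, smul_eq_mul]; nlinarith
  have h2 := linePath_mem hst hc (z := z) (w := w)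
    ⟨(min_le_left _ _).trans (min_le_left _ _), (min_le_left _ _).trans (min_le_right _ _)⟩
    ⟨(min_le_right _ _).trans (min_le_left _ _), (min_le_right _ _).trans (min_le_right _ _)⟩ u
  rw [Prod.norm_def, max_lt_iff, Real.norm_eq_abs, Real.norm_eq_abs, abs_lt, abs_lt] at h1
  constructor
  · simp only [ContinuousMap.add_apply, Prod.fst_add]; linarith [h2.1, h1.1.1]
  · simp only [ContinuousMap.add_apply, Prod.snd_add]; linarith [h2.2, h1.2.1]

theorem isProbabilityMeasure_quadBridge (hα : α ∈ Set.Ioo (-1 : ℝ) 1) (hst : s < t) {z w : ℝ × ℝ}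
    (hz : z ∈ openQuadrant) (hw : w ∈ openQuadrant) :
    IsProbabilityMeasure (quadBridge α s t z w) := by
  have := isProbabilityMeasure_bridgeLaw hα hst z w
  exact cond_isProbabilityMeasure (bridgeLaw_quadrantPaths_ne_zero hα hst hz hw)

/-- On the unit interval large balls exhaust the space; Brownian scaling makes the same `K` work on
every interval. -/
theorem exists_loopLaw_closedBall_ge (hα : α ∈ Set.Ioo (-1 : ℝ) 1) :
    ∃ K : ℝ, 0 < K ∧ ∀ s t : ℝ, s < t →
      1 / 2 ≤ loopLaw α s t (Metric.closedBall 0 (K * √(t - s))) := by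
  have := (corrGauss_loopLaw hα zero_lt_one).isProbabilityMeasure
  have hlim : Filter.Tendsto (fun n : ℕ ↦ loopLaw α 0 1 (Metric.closedBall 0 n)) .atTop
      (𝓝 (loopLaw α 0 1 (⋃ n : ℕ, Metric.closedBall 0 n))) :=
    tendsto_measure_iUnion_atTop fun m n h ↦ Metric.closedBall_subset_closedBall (by exact_mod_cast h)
  rw [Metric.iUnion_closedBall_nat, measure_univ] at hlim
  obtain ⟨n, hn, hn0⟩ := ((hlim.eventually (lt_mem_nhds (a := (1 / 2 : ℝ≥0∞))
    (by simp))).and (Filter.eventually_gt_atTop 0)).exists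
  refine ⟨n, by exact_mod_cast hn0, fun s t hst ↦ hn.le.trans ?_⟩
  rw [loopLaw_eq_map hα hst, Measure.map_apply (continuous_scalePath s t).measurable
    Metric.isClosed_closedBall.measurableSet]
  refine measure_mono fun f hf ↦ ?_
  rw [mem_closedBall_zero_iff] at hf
  rw [Set.mem_preimage, mem_closedBall_zero_iff, ContinuousMap.norm_le _ (by positivity)]
  intro u
  simp only [scalePath, ContinuousMap.coe_mk, norm_smul, Real.norm_eq_abs,
    abs_of_nonneg (Real.sqrt_nonneg _)]
  rw [mul_comm]
  gcongr
  exact (f.norm_coe_le_norm _).trans hf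

end QuadrantExcursion

/-! ### Heat-bath dynamics and transport bounds on a grid -/

namespace QuadrantExcursion

variable {α : ℝ}

/-- The midpoint of the neighbours of site `k`. -/
noncomputable def midNbr (k : ℕ) (x : ℕ → ℝ × ℝ) : ℝ × ℝ := (1 / 2 : ℝ) • (x (k - 1) + x (k + 1))

@[fun_prop] theorem measurable_midNbr (k : ℕ) : Measurable (midNbr k) := by
  unfold midNbr; fun_prop

theorem midNbr_update {k : ℕ} (hk : 0 < k) (x : ℕ → ℝ × ℝ) (y : ℝ × ℝ) :
    midNbr k (Function.update x k y) = midNbr k x := by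
  rw [midNbr, Function.update_of_ne (by omega), Function.update_of_ne (by omega), midNbr]

/-- Resampling site `k` from its conditional law given its neighbours and the quadrant. -/
noncomputable def heatBath (α : ℝ) (v : ℝ≥0) (k : ℕ) (F : (ℕ → ℝ × ℝ) → ℝ) (x : ℕ → ℝ × ℝ) : ℝ :=
  ∫ y, F (Function.update x k y) ∂(siteLaw α v (midNbr k x))

/-- In this quotient the integrating measure does not depend on `m`, so measurability of the heat
bath follows from that of parametric integrals. -/
theorem integral_siteLaw (α : ℝ) (v : ℝ≥0) (m : ℝ × ℝ) {f : ℝ × ℝ → ℝ} (hf : Measurable f) :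
    ∫ y, f y ∂(siteLaw α v m) = (∫ ξ, quadrant.indicator f (m + ξ) ∂(corrGaussian α v)) /
      ∫ ξ, quadrant.indicator (fun _ ↦ 1) (m + ξ) ∂(corrGaussian α v) := by
  have h1 : ∀ g : ℝ × ℝ → ℝ, Measurable g → ∫ ξ, quadrant.indicator g (m + ξ) ∂(corrGaussian α v) =
      ∫ y in quadrant, g y ∂((corrGaussian α v).map (m + ·)) := by
    intro g hg
    rw [← integral_indicator measurableSet_quadrant, integral_map (by fun_prop)
      (hg.indicator measurableSet_quadrant).aestronglyMeasurable]
  rw [h1 f hf, h1 _ measurable_const, siteLaw, cond_eq_smul_restrict, integral_smul_measure,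
    ENNReal.toReal_inv, smul_eq_mul, setIntegral_const, smul_eq_mul, mul_one, measureReal_def,
    div_eq_inv_mul]

theorem measurable_heatBath (α : ℝ) (v : ℝ≥0) (k : ℕ) {F : (ℕ → ℝ × ℝ) → ℝ} (hF : Measurable F) :
    Measurable (heatBath α v k F) := by
  have h1 : ∀ G : (ℕ → ℝ × ℝ) → ℝ, Measurable G → Measurable fun x : ℕ → ℝ × ℝ ↦
      ∫ ξ, quadrant.indicator (fun y ↦ G (Function.update x k y)) (midNbr k x + ξ)
        ∂(corrGaussian α v) := by
    intro G hG
    have hm : Measurable fun p : (ℕ → ℝ × ℝ) × (ℝ × ℝ) ↦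
        quadrant.indicator (fun y ↦ G (Function.update p.1 k y)) (midNbr k p.1 + p.2) := by
      have e : (fun p : (ℕ → ℝ × ℝ) × (ℝ × ℝ) ↦
        quadrant.indicator (fun y ↦ G (Function.update p.1 k y)) (midNbr k p.1 + p.2)) =
        ((fun p : (ℕ → ℝ × ℝ) × (ℝ × ℝ) ↦ midNbr k p.1 + p.2) ⁻¹' quadrant).indicator
          fun p ↦ G (Function.update p.1 k (midNbr k p.1 + p.2)) := rfl
      rw [e]
      refine Measurable.indicator (hG.comp ?_) (measurableSet_quadrant.preimage (by fun_prop))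
      refine measurable_pi_iff.2 fun j ↦ ?_
      by_cases h : j = k
      · subst h; simp only [Function.update_self]; fun_prop
      · simp only [Function.update_of_ne h]; fun_prop
    exact hm.stronglyMeasurable.integral_prod_right.measurable
  have e : heatBath α v k F = fun x ↦
      (∫ ξ, quadrant.indicator (fun y ↦ F (Function.update x k y)) (midNbr k x + ξ)
        ∂(corrGaussian α v)) / ∫ ξ, quadrant.indicator (fun _ ↦ 1) (midNbr k x + ξ)
        ∂(corrGaussian α v) := by
    funext x
    exact integral_siteLaw α v _ (hF.comp (by fun_prop))
  rw [e]
  exact (h1 F hF).div (h1 (fun _ ↦ 1) measurable_const)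

/-- The event that the first `N` sites are in the quadrant. -/
def gridQuadrant (N : ℕ) : Set (ℕ → ℝ × ℝ) := {x | ∀ j ≤ N, x j ∈ quadrant}

theorem measurableSet_gridQuadrant (N : ℕ) : MeasurableSet (gridQuadrant N) := by
  simp only [gridQuadrant, Set.ofPred_forall]
  exact .iInter fun j ↦ .iInter fun _ ↦ measurableSet_quadrant.preimage (measurable_pi_apply j)

section Invariance

variable {v : ℝ≥0} {N k : ℕ} {B : Measure (ℕ → ℝ × ℝ)}

theorem heatBath_update (hk : 0 < k) (F : (ℕ → ℝ × ℝ) → ℝ) (x : ℕ → ℝ × ℝ) (y : ℝ × ℝ) :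
    heatBath α v k F (Function.update x k y) = heatBath α v k F x := by
  simp only [heatBath, midNbr_update hk, Function.update_idem]

theorem abs_heatBath_le (hα : α ∈ Set.Ioo (-1 : ℝ) 1) (hv : v ≠ 0) {F : (ℕ → ℝ × ℝ) → ℝ} {M : ℝ}
    (hM : ∀ x, |F x| ≤ M) (x : ℕ → ℝ × ℝ) : |heatBath α v k F x| ≤ M := by
  have := isProbabilityMeasure_siteLaw hα hv (midNbr k x)
  have h := norm_integral_le_of_norm_le_const (μ := siteLaw α v (midNbr k x)) (C := M)
    (f := fun y ↦ F (Function.update x k y)) (.of_forall fun y ↦ hM (Function.update x k y))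
  simpa [heatBath] using h

/-- By `hB`, site `k` is under `B` the mean of its neighbours plus independent noise. Integrating
the noise out turns the integral of any `G` over the event into one that sees `G` only through its
heat bath, and the heat bath is idempotent. -/
theorem setIntegral_heatBath (hα : α ∈ Set.Ioo (-1 : ℝ) 1) (hv : v ≠ 0) [IsProbabilityMeasure B]
    (hk : 0 < k) (hkN : k ≤ N)
    (hB : (B.prod (corrGaussian α v)).map (fun p ↦ Function.update p.1 k (midNbr k p.1 + p.2)) = B)
    {F : (ℕ → ℝ × ℝ) → ℝ} (hF : Measurable F) {M : ℝ} (hM : ∀ x, |F x| ≤ M) :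
    ∫ x in gridQuadrant N, heatBath α v k F x ∂B = ∫ x in gridQuadrant N, F x ∂B := by
  have hΦ : Measurable fun p : (ℕ → ℝ × ℝ) × (ℝ × ℝ) ↦
      Function.update p.1 k (midNbr k p.1 + p.2) := by
    refine measurable_pi_iff.2 fun j ↦ ?_
    by_cases h : j = k
    · subst h; simp only [Function.update_self]; fun_prop
    · simp only [Function.update_of_ne h]; fun_prop
  -- This event ignores site `k`, so it is unaffected by the resampling; the constraint at `k` goes
  -- into the normalising factor.
  let A' : Set (ℕ → ℝ × ℝ) := {x | ∀ j ≤ N, j ≠ k → x j ∈ quadrant}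
  have key : ∀ G : (ℕ → ℝ × ℝ) → ℝ, Measurable G → (∀ x, |G x| ≤ M) →
      ∫ x in gridQuadrant N, G x ∂B = ∫ x, A'.indicator (fun x ↦
        (∫ ξ, quadrant.indicator (fun _ ↦ 1) (midNbr k x + ξ) ∂(corrGaussian α v)) *
          heatBath α v k G x) x ∂B := by
    intro G hG hGM
    have hGi : Measurable ((gridQuadrant N).indicator G) :=
      hG.indicator (measurableSet_gridQuadrant N)
    rw [← integral_indicator (measurableSet_gridQuadrant N)]
    conv_lhs => rw [← hB]
    rw [integral_map hΦ.aemeasurable hGi.aestronglyMeasurable, integral_prod]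
    · refine integral_congr_ae (.of_forall fun x ↦ ?_)
      simp only
      by_cases hx : x ∈ A'
      · rw [Set.indicator_of_mem hx]
        have hne : ∫ ξ, quadrant.indicator (fun _ ↦ (1 : ℝ)) (midNbr k x + ξ) ∂(corrGaussian α v) ≠ 0 := by
          have := corrGaussian_map_quadrant_ne_zero hα hv (midNbr k x)
          have hpr : IsProbabilityMeasure ((corrGaussian α v).map (midNbr k x + ·)) :=
            Measure.isProbabilityMeasure_map (by fun_prop)
          rw [← integral_map (μ := corrGaussian α v) (φ := (midNbr k x + ·)) (by fun_prop)
            ((measurable_const.indicator measurableSet_quadrant).aestronglyMeasurable),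
            integral_indicator measurableSet_quadrant, setIntegral_const, smul_eq_mul, mul_one,
            measureReal_def]
          exact ENNReal.toReal_ne_zero.2 ⟨this, measure_ne_top _ _⟩
        have hGx : Measurable fun y ↦ G (Function.update x k y) := hG.comp (by fun_prop)
        rw [heatBath, integral_siteLaw α v _ hGx, mul_div_cancel₀ _ hne]
        refine integral_congr_ae (.of_forall fun ξ ↦ ?_)
        simp only [Set.indicator]
        congr 1
        refine propext ⟨fun h ↦ by simpa using h k hkN, fun h j hj ↦ ?_⟩
        by_cases hjk : j = k
        · subst hjk; simpa using h
        · rw [Function.update_of_ne hjk]; exact hx j hj hjk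
      · rw [Set.indicator_of_notMem hx]
        refine integral_eq_zero_of_ae (.of_forall fun ξ ↦ ?_)
        refine Set.indicator_of_notMem (fun h ↦ hx fun j hj hjk ↦ ?_) _
        have := h j hj
        rwa [Function.update_of_ne hjk] at this
    · refine .of_bound (hGi.comp hΦ).aestronglyMeasurable M (.of_forall fun p ↦ ?_)
      rw [Real.norm_eq_abs]
      simp only [Set.indicator]
      split_ifs
      · exact hGM _
      · rw [abs_zero]; exact (abs_nonneg _).trans (hGM 0)
  have hh : ∀ x, heatBath α v k (heatBath α v k F) x = heatBath α v k F x := by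
    intro x
    have := isProbabilityMeasure_siteLaw hα hv (midNbr k x)
    conv_lhs => rw [heatBath]
    simp [heatBath_update hk]
  rw [key _ (measurable_heatBath α v k hF) (abs_heatBath_le hα hv hM), key _ hF hM]
  simp only [hh]

end Invariance

/-- `F` is bounded and Lipschitz with constant `L k` in the `k`-th site, for `k ≤ N`. -/
structure SiteLipschitz (α : ℝ) (N : ℕ) (L : ℕ → ℝ) (F : (ℕ → ℝ × ℝ) → ℝ) : Prop where
  measurable : Measurable F
  bounded : ∃ M, ∀ x, |F x| ≤ M
  nonneg : ∀ k, 0 ≤ L k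
  lipschitz : ∀ x y, |F x - F y| ≤ ∑ k ∈ Finset.range (N + 1), L k * mahal α (x k - y k)

theorem sum_update_range {N k : ℕ} (hk : k < N) (f : ℕ → ℝ) (c : ℝ) :
    ∑ j ∈ Finset.range N, Function.update f k c j =
      ∑ j ∈ Finset.range N, f j - f k + c := by
  rw [Finset.sum_update_of_mem (Finset.mem_range.2 hk), ← Finset.sum_erase_eq_sub
    (Finset.mem_range.2 hk), Finset.sdiff_singleton_eq_erase, add_comm]

/-- The effect on Lipschitz constants of resampling site `k`. -/
noncomputable def spread (k : ℕ) (L : ℕ → ℝ) (j : ℕ) : ℝ :=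
  Function.update L k 0 j + if j = k - 1 ∨ j = k + 1 then L k / 2 else 0

/-- The action on Lipschitz constants is the transpose of replacing `a k` by the mean of its
neighbours. This duality moves the heat bath from test functions to transport bounds. -/
theorem sum_spread {N k : ℕ} (hk : 0 < k) (hkN : k < N) (L a : ℕ → ℝ) :
    ∑ j ∈ Finset.range (N + 1), spread k L j * a j = ∑ j ∈ Finset.range (N + 1),
      L j * Function.update a k ((a (k - 1) + a (k + 1)) / 2) j := by
  have e1 : ∀ j, spread k L j * a j = Function.update (fun j ↦ L j * a j) k 0 j +
      ((if j = k - 1 then L k / 2 * a j else 0) + if j = k + 1 then L k / 2 * a j else 0) := by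
    intro j
    simp only [spread, Function.update_apply]
    rcases eq_or_ne j k with rfl | h1
    · have h2 : j ≠ j - 1 := by omega
      simp [h2]
    rw [if_neg h1, if_neg h1]
    by_cases h2 : j = k - 1
    · rw [if_pos (Or.inl h2), if_pos h2, if_neg (by omega)]; ring
    · by_cases h3 : j = k + 1
      · rw [if_pos (Or.inr h3), if_neg h2, if_pos h3]; ring
      · rw [if_neg (by tauto), if_neg h2, if_neg h3]; ring
  have e2 : ∀ j, L j * Function.update a k ((a (k - 1) + a (k + 1)) / 2) j =
      Function.update (fun j ↦ L j * a j) k (L k * ((a (k - 1) + a (k + 1)) / 2)) j := by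
    intro j
    simp only [Function.update_apply]
    split_ifs with h
    · rw [h]
    · rfl
  simp only [e1, e2, Finset.sum_add_distrib]
  rw [sum_update_range (by omega), sum_update_range (by omega), Finset.sum_ite_eq',
    Finset.sum_ite_eq', if_pos (Finset.mem_range.2 (by omega)), if_pos (Finset.mem_range.2 (by omega))]
  ring

/-- The resampled value no longer depends on the old site `k`. Its law depends on the neighbours
through their midpoint, and contraction with constant one charges `L k / 2` to each of them. -/
theorem SiteLipschitz.heatBath (hα : α ∈ Set.Ioo (-1 : ℝ) 1) {v : ℝ≥0} (hv : v ≠ 0) {N k : ℕ}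
    (hk : 0 < k) (hkN : k < N) {L : ℕ → ℝ} {F : (ℕ → ℝ × ℝ) → ℝ} (h : SiteLipschitz α N L F) :
    SiteLipschitz α N (spread k L) (heatBath α v k F) := by
  obtain ⟨M, hM⟩ := h.bounded
  refine ⟨measurable_heatBath α v k h.measurable, ⟨M, abs_heatBath_le hα hv hM⟩, fun j ↦ ?_,
    fun x y ↦ ?_⟩
  · simp only [spread, Function.update_apply]
    have := h.nonneg j
    have := h.nonneg k
    split_ifs <;> positivity
  have hp1 := isProbabilityMeasure_siteLaw hα hv (midNbr k x)
  have hp2 := isProbabilityMeasure_siteLaw hα hv (midNbr k y)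
  have hmeas : ∀ x : ℕ → ℝ × ℝ, Measurable fun u ↦ F (Function.update x k u) :=
    fun x ↦ h.measurable.comp (by fun_prop)
  have h1 : |∫ u, F (Function.update x k u) ∂(siteLaw α v (midNbr k x)) -
      ∫ u, F (Function.update x k u) ∂(siteLaw α v (midNbr k y))| ≤
        L k * mahal α (midNbr k x - midNbr k y) := by
    refine abs_integral_siteLaw_sub_le hα hv (hmeas x) (fun u ↦ hM _) (h.nonneg k) (fun u w ↦ ?_) _ _
    refine (h.lipschitz _ _).trans (le_of_eq ?_)
    rw [Finset.sum_eq_single_of_mem k (Finset.mem_range.2 (by omega))]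
    · simp
    · intro j _ hj
      simp [Function.update_of_ne hj]
  have h2 : |∫ u, F (Function.update x k u) ∂(siteLaw α v (midNbr k y)) -
      ∫ u, F (Function.update y k u) ∂(siteLaw α v (midNbr k y))| ≤
        ∑ j ∈ Finset.range (N + 1), Function.update (fun j ↦ L j * mahal α (x j - y j)) k 0 j := by
    rw [← integral_sub (.of_bound (hmeas x).aestronglyMeasurable M (.of_forall fun u ↦ hM _))
      (.of_bound (hmeas y).aestronglyMeasurable M (.of_forall fun u ↦ hM _))]
    refine (norm_integral_le_of_norm_le_const (μ := siteLaw α v (midNbr k y))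
      (f := fun u ↦ F (Function.update x k u) - F (Function.update y k u)) (C := ∑ j ∈ Finset.range (N + 1),
      Function.update (fun j ↦ L j * mahal α (x j - y j)) k 0 j) (.of_forall fun u ↦ ?_)).trans ?_
    · refine (h.lipschitz _ _).trans (Finset.sum_le_sum fun j _ ↦ ?_)
      by_cases hj : j = k
      · subst hj; simp
      · simp [Function.update_of_ne hj]
    · simp
  have h3 : mahal α (midNbr k x - midNbr k y) ≤
      (mahal α (x (k - 1) - y (k - 1)) + mahal α (x (k + 1) - y (k + 1))) / 2 := by
    have e : midNbr k x - midNbr k y =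
        (1 / 2 : ℝ) • ((x (k - 1) - y (k - 1)) + (x (k + 1) - y (k + 1))) := by
      simp only [midNbr]; module
    rw [e, mahal_smul, abs_of_pos (by norm_num)]
    linarith [mahal_add_le α (x (k - 1) - y (k - 1)) (x (k + 1) - y (k + 1))]
  rw [sum_spread hk hkN L fun j ↦ mahal α (x j - y j)]
  have e2 : ∀ j, L j * Function.update (fun j ↦ mahal α (x j - y j)) k
      ((mahal α (x (k - 1) - y (k - 1)) + mahal α (x (k + 1) - y (k + 1))) / 2) j =
      Function.update (fun j ↦ L j * mahal α (x j - y j)) k (L k *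
        ((mahal α (x (k - 1) - y (k - 1)) + mahal α (x (k + 1) - y (k + 1))) / 2)) j := by
    intro j
    simp only [Function.update_apply]
    split_ifs with h
    · rw [h]
    · rfl
  simp only [e2]
  rw [sum_update_range (by omega)]
  rw [sum_update_range (by omega)] at h2
  have h4 := mul_le_mul_of_nonneg_left h3 (h.nonneg k)
  have h5 := abs_sub_le (QuadrantExcursion.heatBath α v k F x)
    (∫ u, F (Function.update x k u) ∂(siteLaw α v (midNbr k y)))
    (QuadrantExcursion.heatBath α v k F y)
  simp only [QuadrantExcursion.heatBath] at h5 ⊢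
  linarith

/-- The transport bound `∑ L k * a k` holds between `μ` and `μ'` for all site-Lipschitz functions. -/
def TransportBound (α : ℝ) (N : ℕ) (μ μ' : Measure (ℕ → ℝ × ℝ)) (a : ℕ → ℝ) : Prop :=
  ∀ L F, SiteLipschitz α N L F →
    |∫ x, F x ∂μ - ∫ x, F x ∂μ'| ≤ ∑ k ∈ Finset.range (N + 1), L k * a k

/-- `μ` is invariant under resampling any interior site. -/
def HeatInvariant (α : ℝ) (v : ℝ≥0) (N : ℕ) (μ : Measure (ℕ → ℝ × ℝ)) : Prop :=
  ∀ k, 0 < k → k < N → ∀ F : (ℕ → ℝ × ℝ) → ℝ, Measurable F → (∃ M, ∀ x, |F x| ≤ M) →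
    ∫ x, heatBath α v k F x ∂μ = ∫ x, F x ∂μ

namespace TransportBound

variable {N : ℕ} {μ μ' : Measure (ℕ → ℝ × ℝ)} {a b : ℕ → ℝ} {v : ℝ≥0}

theorem mono (h : TransportBound α N μ μ' a) (hab : ∀ k ≤ N, a k ≤ b k) :
    TransportBound α N μ μ' b := fun L F hF ↦ (h L F hF).trans <|
  Finset.sum_le_sum fun k hk ↦ mul_le_mul_of_nonneg_left
    (hab k (Nat.lt_succ_iff.1 (Finset.mem_range.1 hk))) (hF.nonneg k)

/-- Both laws are invariant, so a test function may be replaced by its heat bath on either side at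
once. -/
theorem update (hα : α ∈ Set.Ioo (-1 : ℝ) 1) (hv : v ≠ 0) (hμ : HeatInvariant α v N μ)
    (hμ' : HeatInvariant α v N μ') (h : TransportBound α N μ μ' a) {k : ℕ} (hk : 0 < k)
    (hkN : k < N) :
    TransportBound α N μ μ' (Function.update a k ((a (k - 1) + a (k + 1)) / 2)) := by
  intro L F hF
  rw [← hμ k hk hkN F hF.measurable hF.bounded, ← hμ' k hk hkN F hF.measurable hF.bounded,
    ← sum_spread hk hkN]
  exact h _ _ (hF.heatBath hα hv hk hkN)

/-- The affine part is unchanged by averaging, while `k (N - k)` drops by exactly one. A sweep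
through the interior sites in increasing order therefore gains `c` at each, which is at least the
fraction `1 / N²` of `c k (N - k)`. -/
theorem sweep (hα : α ∈ Set.Ioo (-1 : ℝ) 1) (hv : v ≠ 0) (hμ : HeatInvariant α v N μ)
    (hμ' : HeatInvariant α v N μ') {A D c : ℝ} (hc : 0 ≤ c)
    (h : TransportBound α N μ μ' fun k ↦ A + D * k + c * (k * (N - k))) :
    TransportBound α N μ μ' fun k ↦ A + D * k + c * (1 - 1 / N ^ 2) * (k * (N - k)) := by
  have key : ∀ m ≤ N, TransportBound α N μ μ' fun k ↦ A + D * k + c * (k * (N - k)) -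
      if 0 < k ∧ k < m then c else 0 := by
    intro m
    induction m with
    | zero => intro _; simpa using h
    | succ m ih =>
      intro hm
      rcases Nat.eq_zero_or_pos m with rfl | hm0
      · refine h.mono fun k _ ↦ ?_
        rw [if_neg (by omega), sub_zero]
      refine ((ih (by omega)).update hα hv hμ hμ' hm0 (by omega)).mono fun k hk ↦ ?_
      rw [Function.update_apply]
      split_ifs with h1 h2 h3 h4 h5 h6 h7 h8
      · subst h1
        have e : ((k - 1 : ℕ) : ℝ) = k - 1 := by rw [Nat.cast_sub hm0, Nat.cast_one]
        rw [e]; push_cast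
        nlinarith
      all_goals first | (exfalso; omega) | skip
      all_goals first | linarith | skip
      all_goals (subst h1; rw [Nat.cast_sub hm0, Nat.cast_one]; push_cast; nlinarith)
  refine (key N le_rfl).mono fun k hk ↦ ?_
  have hk' : (k : ℝ) ≤ N := by exact_mod_cast hk
  have hk0 : (0 : ℝ) ≤ k := Nat.cast_nonneg k
  have hNk : (k : ℝ) * (N - k) ≤ N ^ 2 := by nlinarith
  split_ifs with h1
  · have hN : (0 : ℝ) < N ^ 2 := by
      have : 0 < N := by omega
      positivity
    have h2 : (k : ℝ) * (N - k) / N ^ 2 ≤ 1 := (div_le_one hN).2 hNk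
    have h3 := mul_le_mul_of_nonneg_left h2 hc
    have e : c * (1 - 1 / (N : ℝ) ^ 2) * (k * (N - k)) =
      c * (k * (N - k)) - c * (k * (N - k) / N ^ 2) := by ring
    rw [e]; linarith
  · have : (k : ℝ) * (N - k) = 0 := by
      rcases Nat.eq_zero_or_pos k with rfl | h0
      · simp
      · have : k = N := by omega
        rw [this]; simp
    rw [this]; simp

/-- Iterating the heat bath gives the harmonic (affine) transport bound. -/
theorem affine (hα : α ∈ Set.Ioo (-1 : ℝ) 1) (hv : v ≠ 0) (hN : N ≠ 0) (hμ : HeatInvariant α v N μ)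
    (hμ' : HeatInvariant α v N μ') {A D : ℝ} (h : TransportBound α N μ μ' a) (h0 : a 0 ≤ A)
    (h1 : a N ≤ A + D * N) : TransportBound α N μ μ' fun k ↦ A + D * k := by
  -- Since `k (N - k) ≥ 1` at interior sites, any bound with the right boundary values is dominated
  -- by such a profile; repeated sweeps then send `c` to zero geometrically.
  obtain ⟨c, hc0, hc⟩ : ∃ c : ℝ, 0 ≤ c ∧ ∀ k ≤ N, a k ≤ A + D * k + c * (k * (N - k)) := by
    refine ⟨∑ k ∈ Finset.range (N + 1), |a k - (A + D * k)|,
      Finset.sum_nonneg fun _ _ ↦ abs_nonneg _, fun k hk ↦ ?_⟩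
    rcases Nat.eq_zero_or_pos k with rfl | hk0
    · simpa using h0
    rcases hk.eq_or_lt with rfl | hkN
    · simpa using h1
    have h2 : |a k - (A + D * k)| ≤ ∑ k ∈ Finset.range (N + 1), |a k - (A + D * k)| :=
      Finset.single_le_sum (f := fun k : ℕ ↦ |a k - (A + D * k)|) (fun _ _ ↦ abs_nonneg _)
        (Finset.mem_range.2 (by omega))
    have h3 : (1 : ℝ) ≤ k * (N - k) := by
      have h4 : (1 : ℝ) ≤ k := by exact_mod_cast hk0
      have h5 : (k : ℝ) + 1 ≤ N := by exact_mod_cast hkN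
      nlinarith
    have h4 := le_abs_self (a k - (A + D * k))
    have h5 := mul_le_mul_of_nonneg_left h3 ((abs_nonneg _).trans h2)
    linarith
  have hq0 : 0 ≤ 1 - 1 / (N : ℝ) ^ 2 := by
    have : (1 : ℝ) ≤ N ^ 2 := by
      have : (1 : ℝ) ≤ N := by exact_mod_cast Nat.one_le_iff_ne_zero.2 hN
      nlinarith
    rw [sub_nonneg, div_le_one (by positivity)]
    exact this
  have hq1 : 1 - 1 / (N : ℝ) ^ 2 < 1 := by
    have : (0 : ℝ) < 1 / N ^ 2 := by positivity
    linarith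
  have key : ∀ n : ℕ, TransportBound α N μ μ' fun k ↦
      A + D * k + c * (1 - 1 / (N : ℝ) ^ 2) ^ n * (k * (N - k)) := by
    intro n
    induction n with
    | zero => simpa using h.mono hc
    | succ n ih =>
      have := ih.sweep hα hv hμ hμ' (by positivity)
      simpa only [pow_succ, mul_assoc] using this
  intro L F hF
  refine ge_of_tendsto' (x := Filter.atTop) ?_ (fun n ↦ key n L F hF)
  have hlim := tendsto_pow_atTop_nhds_zero_of_lt_one hq0 hq1
  refine tendsto_finsetSum _ fun k _ ↦ Filter.Tendsto.const_mul _ ?_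
  have := ((hlim.const_mul c).mul_const ((k : ℝ) * (N - k))).const_add (A + D * k)
  simpa using this

end TransportBound

end QuadrantExcursion

/-! ### Bridges restricted to a grid -/

namespace QuadrantExcursion

variable {α s t : ℝ}

/-- The law of a process with countable or uncountable index set is determined by the kernel. -/
theorem CorrGauss.map_pi_eq {S : Type} {Ω Ω' : Type*} [MeasurableSpace Ω] [MeasurableSpace Ω']
    {K : S → S → ℝ} {X : S → Ω → ℝ × ℝ} {P : Measure Ω} {X' : S → Ω' → ℝ × ℝ} {P' : Measure Ω'}
    (h : CorrGauss α K X P) (h' : CorrGauss α K X' P') :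
    P.map (fun ω u ↦ X u ω) = P'.map (fun ω u ↦ X' u ω) := by
  have := h.isProbabilityMeasure
  have m1 : Measurable fun ω u ↦ X u ω := measurable_pi_lambda _ h.measurable
  have m2 : Measurable fun ω u ↦ X' u ω := measurable_pi_lambda _ h'.measurable
  let Q : (I : Finset S) → Measure (∀ _ : I, ℝ × ℝ) := fun I ↦
    (P.map (fun ω u ↦ X u ω)).map I.restrict
  have : ∀ I, IsFiniteMeasure (Q I) := fun I ↦ by
    simp only [Q]; infer_instance
  refine IsProjectiveLimit.unique (P := Q) (fun I ↦ rfl) fun I ↦ ?_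
  simp only [Q]
  have hr : Measurable (I.restrict : (S → ℝ × ℝ) → (I → ℝ × ℝ)) := by fun_prop
  rw [Measure.map_map hr m1, Measure.map_map hr m2]
  exact (h.map_eq h' fun i : I ↦ (i : S)).symm

/-- The `k`-th point of the uniform grid of mesh `(t - s) / N` on `[s, t]`. -/
noncomputable def gridPt (hst : s < t) (N k : ℕ) : Set.Icc s t :=
  ⟨s + (t - s) * (((min k N : ℕ) : ℝ) / N), by
    have h0 := sub_pos.2 hst
    have h1 : ((min k N : ℕ) : ℝ) / N ≤ 1 :=
      div_le_one_of_le₀ (by exact_mod_cast min_le_right k N) (Nat.cast_nonneg N)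
    have h2 : 0 ≤ ((min k N : ℕ) : ℝ) / N := by positivity
    constructor <;> nlinarith⟩

/-- Restriction of a path to the grid. -/
noncomputable def gridPath (hst : s < t) (N : ℕ) (f : Path s t) (k : ℕ) : ℝ × ℝ := f (gridPt hst N k)

theorem measurable_gridPath (hst : s < t) (N : ℕ) : Measurable (gridPath hst N) :=
  measurable_pi_lambda _ fun _ ↦ measurable_eval _

/-- The bridge restricted to a grid. -/
noncomputable def gridLaw (α : ℝ) (hst : s < t) (N : ℕ) (z w : ℝ × ℝ) : Measure (ℕ → ℝ × ℝ) :=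
  (bridgeLaw α s t z w).map (gridPath hst N)

theorem isProbabilityMeasure_gridLaw (hα : α ∈ Set.Ioo (-1 : ℝ) 1) (hst : s < t) (N : ℕ)
    (z w : ℝ × ℝ) : IsProbabilityMeasure (gridLaw α hst N z w) := by
  have := isProbabilityMeasure_bridgeLaw hα hst z w
  exact Measure.isProbabilityMeasure_map (measurable_gridPath hst N).aemeasurable

/-- The variance of a grid point given its neighbours. -/
noncomputable def gridVar (s t : ℝ) (N : ℕ) : ℝ≥0 := ((t - s) / (2 * N)).toNNReal

theorem loopKernel_gridPt (hst : s < t) {N : ℕ} (hN : N ≠ 0) (i j : ℕ) :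
    loopKernel s t (gridPt hst N i) (gridPt hst N j) =
      (t - s) * ((((min i N : ℕ) : ℝ) ⊓ (min j N : ℕ)) *
        (N - ((min i N : ℕ) : ℝ) ⊔ (min j N : ℕ))) / N ^ 2 := by
  have hT := sub_pos.2 hst
  have hN' : (0 : ℝ) < N := by positivity
  have hmono : Monotone fun x : ℝ ↦ s + (t - s) * (x / N) := fun x y h ↦ by
    have : x / N ≤ y / N := by gcongr
    simp only; nlinarith
  simp only [loopKernel, gridPt]
  rw [← hmono.map_min (a := ((min i N : ℕ) : ℝ)), ← hmono.map_max (a := ((min i N : ℕ) : ℝ))]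
  field_simp
  ring

/-- The kernel is affine in one variable on either side of the other, so away from the diagonal it
equals its neighbour mean. Hence the deviation of site `k` from the midpoint of its neighbours is
uncorrelated with all sites `j ≠ k`. -/
theorem loopKernel_gridPt_mid (hst : s < t) {N k : ℕ} (hk : 0 < k) (hkN : k < N) {j : ℕ}
    (hj : j ≠ k) :
    1 / 2 * loopKernel s t (gridPt hst N (k - 1)) (gridPt hst N j) +
      1 / 2 * loopKernel s t (gridPt hst N (k + 1)) (gridPt hst N j) =
        loopKernel s t (gridPt hst N k) (gridPt hst N j) := by
  have hN : N ≠ 0 := by omega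
  simp only [loopKernel_gridPt hst hN]
  rw [min_eq_left (show k - 1 ≤ N by omega), min_eq_left (show k + 1 ≤ N by omega),
    min_eq_left hkN.le, Nat.cast_sub hk]
  push_cast
  set j' := min j N with hj'
  rcases lt_or_ge j' k with h | h
  · have h1 : (j' : ℝ) + 1 ≤ k := by exact_mod_cast h
    rw [← Nat.cast_min, ← hj', min_eq_right (by linarith), min_eq_right (by linarith),
      min_eq_right (by linarith), max_eq_left (by linarith), max_eq_left (by linarith),
      max_eq_left (by linarith)]
    ring
  · have h2 : k + 1 ≤ j' := by omega
    have h1 : (k : ℝ) + 1 ≤ j' := by exact_mod_cast h2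
    rw [← Nat.cast_min, ← hj', min_eq_left (by linarith), min_eq_left (by linarith),
      min_eq_left (by linarith), max_eq_right (by linarith), max_eq_right (by linarith),
      max_eq_right (by linarith)]
    ring

/-- The diagonal defect `(t - s) / (2N)` is the variance of a site given its neighbours. -/
theorem loopKernel_gridPt_self (hst : s < t) {N k : ℕ} (hk : 0 < k) (hkN : k < N) :
    1 / 4 * loopKernel s t (gridPt hst N (k - 1)) (gridPt hst N (k - 1)) +
      1 / 2 * loopKernel s t (gridPt hst N (k - 1)) (gridPt hst N (k + 1)) +
      1 / 4 * loopKernel s t (gridPt hst N (k + 1)) (gridPt hst N (k + 1)) + (t - s) / (2 * N) =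
        loopKernel s t (gridPt hst N k) (gridPt hst N k) := by
  have hN : N ≠ 0 := by omega
  have hN' : (N : ℝ) ≠ 0 := by exact_mod_cast hN
  simp only [loopKernel_gridPt hst hN]
  rw [min_eq_left (show k - 1 ≤ N by omega), min_eq_left (show k + 1 ≤ N by omega),
    min_eq_left hkN.le, Nat.cast_sub hk]
  push_cast
  rw [min_self, max_self, min_self, max_self, min_self, max_self, min_eq_left (by linarith),
    max_eq_right (by linarith)]
  field_simp
  ring

theorem frac_gridPt (hst : s < t) {N k : ℕ} (hkN : k ≤ N) :
    frac s t (gridPt hst N k) = k / N := by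
  have hT := (sub_pos.2 hst).ne'
  simp only [frac, gridPt, min_eq_left hkN]
  field_simp
  ring

/-- This is the Markov property of the loop on the grid, obtained by comparing Gaussian kernels. The
deterministic segment is affine, so it equals its own neighbour mean and factors out. -/
theorem map_update_gridLaw (hα : α ∈ Set.Ioo (-1 : ℝ) 1) (hst : s < t) {N k : ℕ} (hk : 0 < k)
    (hkN : k < N) (z w : ℝ × ℝ) :
    ((gridLaw α hst N z w).prod (corrGaussian α (gridVar s t N))).map
      (fun p ↦ Function.update p.1 k (midNbr k p.1 + p.2)) = gridLaw α hst N z w := by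
  have hL := corrGauss_loopLaw hα hst
  have := hL.isProbabilityMeasure
  have hT := sub_pos.2 hst
  have hΦ : Measurable fun p : (ℕ → ℝ × ℝ) × (ℝ × ℝ) ↦
      Function.update p.1 k (midNbr k p.1 + p.2) := by
    refine measurable_pi_iff.2 fun j ↦ ?_
    by_cases h : j = k
    · subst h; simp only [Function.update_self]; fun_prop
    · simp only [Function.update_of_ne h]; fun_prop
  let l : ℕ → ℝ × ℝ := fun j ↦ linePath s t z w (gridPt hst N j)
  have hl : midNbr k l = l k := by
    simp only [midNbr, l, linePath, ContinuousMap.coe_mk]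
    rw [frac_gridPt hst (by omega), frac_gridPt hst (by omega), frac_gridPt hst hkN.le,
      Nat.cast_sub hk]
    push_cast
    module
  have hl' : ∀ x, midNbr k (l + x) = l k + midNbr k x := fun x ↦ by
    rw [← hl]; simp only [midNbr, Pi.add_apply]; module
  have e1 : gridLaw α hst N z w = (loopLaw α s t).map fun f ↦ l + gridPath hst N f := by
    rw [gridLaw, bridgeLaw, Measure.map_map (measurable_gridPath hst N) (measurable_linePath_add z w)]
    rfl
  have hG : Measurable fun f ↦ l + gridPath hst N f := (measurable_gridPath hst N).const_add l
  let Y : ℕ → Path s t × (ℝ × ℝ) → ℝ × ℝ := fun j p ↦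
    Function.update (gridPath hst N p.1) k (midNbr k (gridPath hst N p.1) + p.2) j
  have hY : CorrGauss α (fun i j ↦ loopKernel s t (gridPt hst N i) (gridPt hst N j)) Y
      ((loopLaw α s t).prod (corrGaussian α (gridVar s t N))) := by
    -- The three slots are the two neighbours and the noise; sites other than `k` use only the
    -- first, the others carrying weight zero.
    refine (hL.prod (corrGauss_corrGaussian hα (gridVar s t N))).sum (A := Fin 3)
      (fun j ↦ if j = k then ![1 / 2, 1 / 2, 1] else ![1, 0, 0])
      (fun j ↦ if j = k then ![Sum.inl (gridPt hst N (k - 1)), Sum.inl (gridPt hst N (k + 1)),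
        Sum.inr ()] else ![Sum.inl (gridPt hst N j), Sum.inr (), Sum.inr ()])
      (fun j p ↦ ?_) fun i j ↦ ?_
    · by_cases h : j = k
      · subst h
        simp [Y, Fin.sum_univ_three, midNbr, gridPath]
      · simp [Y, Fin.sum_univ_three, h, gridPath]
    · have hv : (gridVar s t N : ℝ) = (t - s) / (2 * N) :=
        Real.coe_toNNReal _ (by positivity)
      by_cases hi : i = k <;> by_cases hj : j = k
      · subst hi; subst hj
        rw [← loopKernel_gridPt_self hst hk hkN]
        simp only [Fin.sum_univ_three, if_true]
        simp [hv, loopKernel_comm (gridPt hst N (j + 1)) (gridPt hst N (j - 1))]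
        ring
      · subst hi
        rw [← loopKernel_gridPt_mid hst hk hkN hj]
        simp [Fin.sum_univ_three, hj]
      · subst hj
        rw [loopKernel_comm, ← loopKernel_gridPt_mid hst hk hkN hi]
        simp [Fin.sum_univ_three, hi, loopKernel_comm (gridPt hst N i)]
      · simp [Fin.sum_univ_three, hi, hj]
  have e2 := hY.map_pi_eq (hL.comp (gridPt hst N) (Y := fun j f ↦ gridPath hst N f j)
    (fun _ _ ↦ rfl) fun _ _ ↦ rfl)
  have hYm : Measurable fun p j ↦ Y j p := measurable_pi_lambda _ hY.measurable
  rw [e1]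
  conv_lhs => rw [← Measure.map_id (μ := corrGaussian α (gridVar s t N))]
  rw [Measure.map_prod_map _ _ hG measurable_id, Measure.map_map hΦ (hG.prodMap measurable_id)]
  have e3 : (loopLaw α s t).map (fun f ↦ l + gridPath hst N f) =
      ((loopLaw α s t).map (gridPath hst N)).map (l + ·) := by
    rw [Measure.map_map (measurable_const_add l) (measurable_gridPath hst N)]; rfl
  rw [e3]
  change _ = ((loopLaw α s t).map (fun f j ↦ gridPath hst N f j)).map (l + ·)
  rw [← e2, Measure.map_map (measurable_const_add l) hYm]
  congr 1
  funext p
  funext j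
  by_cases h : j = k
  · subst h
    simp only [Function.comp_apply, Function.update_self, Y, Pi.add_apply]
    change midNbr j (l + gridPath hst N p.1) + p.2 = _
    rw [hl', add_assoc]
  · simp [Y, h]

/-- The bridge on a grid conditioned to stay in the quadrant. -/
noncomputable def gridBridge (α : ℝ) (hst : s < t) (N : ℕ) (z w : ℝ × ℝ) : Measure (ℕ → ℝ × ℝ) :=
  ProbabilityTheory.cond (gridLaw α hst N z w) (gridQuadrant N)

theorem gridLaw_gridQuadrant_ne_zero (hα : α ∈ Set.Ioo (-1 : ℝ) 1) (hst : s < t) (N : ℕ)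
    {z w : ℝ × ℝ} (hz : z ∈ openQuadrant) (hw : w ∈ openQuadrant) :
    gridLaw α hst N z w (gridQuadrant N) ≠ 0 := by
  rw [gridLaw, Measure.map_apply (measurable_gridPath hst N) (measurableSet_gridQuadrant N)]
  refine fun h ↦ bridgeLaw_quadrantPaths_ne_zero hα hst hz hw (measure_mono_null ?_ h)
  exact fun f hf j _ ↦ hf _

theorem isProbabilityMeasure_gridBridge (hα : α ∈ Set.Ioo (-1 : ℝ) 1) (hst : s < t) (N : ℕ)
    {z w : ℝ × ℝ} (hz : z ∈ openQuadrant) (hw : w ∈ openQuadrant) :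
    IsProbabilityMeasure (gridBridge α hst N z w) := by
  have := isProbabilityMeasure_gridLaw hα hst N z w
  exact cond_isProbabilityMeasure (gridLaw_gridQuadrant_ne_zero hα hst N hz hw)

theorem gridVar_ne_zero (hst : s < t) {N : ℕ} (hN : N ≠ 0) : gridVar s t N ≠ 0 := by
  have hT := sub_pos.2 hst
  have : 0 < (t - s) / (2 * N) := by positivity
  simpa [gridVar] using this

theorem heatInvariant_gridBridge (hα : α ∈ Set.Ioo (-1 : ℝ) 1) (hst : s < t) {N : ℕ} (hN : N ≠ 0)
    (z w : ℝ × ℝ) : HeatInvariant α (gridVar s t N) N (gridBridge α hst N z w) := by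
  rintro k hk hkN F hF ⟨M, hM⟩
  have := isProbabilityMeasure_gridLaw hα hst N z w
  simp only [gridBridge, cond_eq_smul_restrict, integral_smul_measure]
  rw [setIntegral_heatBath hα (gridVar_ne_zero hst hN) hk hkN.le
    (map_update_gridLaw hα hst hk hkN z w) hF hM]

theorem integrable_eval_bridgeLaw (hα : α ∈ Set.Ioo (-1 : ℝ) 1) (hst : s < t) (z w : ℝ × ℝ)
    (u : Set.Icc s t) : Integrable (fun f ↦ f u) (bridgeLaw α s t z w) := by
  have hL := corrGauss_loopLaw hα hst
  rw [bridgeLaw, integrable_map_measure (measurable_eval u).aestronglyMeasurable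
    (measurable_linePath_add z w).aemeasurable]
  have := (hL.isGaussianProcess_add_const (linePath s t z w u)).hasGaussianLaw_eval u
  refine this.integrable.congr (.of_forall fun f ↦ ?_)
  simp [add_comm]

theorem bridgeLaw_endpoint (hα : α ∈ Set.Ioo (-1 : ℝ) 1) (hst : s < t) (z w : ℝ × ℝ)
    {u : Set.Icc s t} (hu : loopKernel s t u u = 0) :
    ∀ᵐ f ∂(bridgeLaw α s t z w), f u = linePath s t z w u := by
  have hL := corrGauss_loopLaw hα hst
  rw [bridgeLaw, ae_map_iff (measurable_linePath_add z w).aemeasurable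
    (measurableSet_eq_fun (measurable_eval u) measurable_const)]
  have h1 := hL.map_eval_eq hα u (v := 0) hu
  have h2 : corrGaussian α 0 = Measure.dirac 0 := by
    rw [corrGaussian, gaussianReal_zero_var, Measure.dirac_prod_dirac, Measure.map_dirac' (correlate α).continuous.measurable]
    simp; rfl
  rw [h2] at h1
  have h3 : ∀ᵐ x ∂(Measure.dirac (0 : ℝ × ℝ)), x = 0 := by
    rw [ae_dirac_eq]; rfl
  rw [← h1] at h3
  filter_upwards [ae_of_ae_map (hL.measurable u).aemeasurable h3] with f hf
  simp [hf]

theorem bridgeLaw_start (hα : α ∈ Set.Ioo (-1 : ℝ) 1) (hst : s < t) (z w : ℝ × ℝ)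
    {u : Set.Icc s t} (hu : (u : ℝ) = s) : ∀ᵐ f ∂(bridgeLaw α s t z w), f u = z := by
  filter_upwards [bridgeLaw_endpoint hα hst z w (u := u) (by simp [loopKernel, hu])] with f hf
  rw [hf]; simp [linePath, frac, hu]

theorem bridgeLaw_terminal (hα : α ∈ Set.Ioo (-1 : ℝ) 1) (hst : s < t) (z w : ℝ × ℝ)
    {u : Set.Icc s t} (hu : (u : ℝ) = t) : ∀ᵐ f ∂(bridgeLaw α s t z w), f u = w := by
  filter_upwards [bridgeLaw_endpoint hα hst z w (u := u) (by simp [loopKernel, hu])] with f hf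
  rw [hf]; simp [linePath, frac, hu, div_self (sub_pos.2 hst).ne']

/-- Independent coupling gives a crude but finite bound which is exact at the two fixed end sites;
heat-bath invariance improves it to the affine interpolation of those end values. -/
theorem TransportBound.gridBridge (hα : α ∈ Set.Ioo (-1 : ℝ) 1) (hst : s < t) {N : ℕ} (hN : N ≠ 0)
    {z w z' w' : ℝ × ℝ} (hz : z ∈ openQuadrant) (hw : w ∈ openQuadrant) (hz' : z' ∈ openQuadrant)
    (hw' : w' ∈ openQuadrant) :
    TransportBound α N (gridBridge α hst N z w) (gridBridge α hst N z' w') fun k ↦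
      mahal α (z - z') + (mahal α (w - w') - mahal α (z - z')) / N * k := by
  have hN' : (N : ℝ) ≠ 0 := by exact_mod_cast hN
  have hac : ∀ z w, QuadrantExcursion.gridBridge α hst N z w ≪ gridLaw α hst N z w :=
    fun z w ↦ cond_absolutelyContinuous
  have hint : ∀ {z w}, z ∈ openQuadrant → w ∈ openQuadrant → ∀ k,
      Integrable (fun x : ℕ → ℝ × ℝ ↦ x k) (QuadrantExcursion.gridBridge α hst N z w) := by
    intro z w hz hw k
    have := isProbabilityMeasure_gridLaw hα hst N z w
    rw [QuadrantExcursion.gridBridge, cond_eq_smul_restrict]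
    refine Integrable.smul_measure ?_ (ENNReal.inv_ne_top.2 (gridLaw_gridQuadrant_ne_zero hα hst N hz hw))
    refine Integrable.restrict ?_
    rw [gridLaw, integrable_map_measure (measurable_pi_apply k).aestronglyMeasurable
      (measurable_gridPath hst N).aemeasurable]
    exact integrable_eval_bridgeLaw hα hst z w _
  have hend : ∀ z w, (∀ᵐ x ∂(QuadrantExcursion.gridBridge α hst N z w), x 0 = z) ∧
      ∀ᵐ x ∂(QuadrantExcursion.gridBridge α hst N z w), x N = w := by
    intro z w
    constructor
    · refine (hac z w).ae_le ((ae_map_iff (measurable_gridPath hst N).aemeasurable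
        (measurableSet_eq_fun (measurable_pi_apply 0) measurable_const)).2 ?_)
      exact bridgeLaw_start hα hst z w (by simp [gridPt])
    · refine (hac z w).ae_le ((ae_map_iff (measurable_gridPath hst N).aemeasurable
        (measurableSet_eq_fun (measurable_pi_apply N) measurable_const)).2 ?_)
      exact bridgeLaw_terminal hα hst z w (by simp [gridPt, hN'])
  have h1 := isProbabilityMeasure_gridBridge hα hst N hz hw
  have h2 := isProbabilityMeasure_gridBridge hα hst N hz' hw'
  set μ := QuadrantExcursion.gridBridge α hst N z w with hμ
  set μ' := QuadrantExcursion.gridBridge α hst N z' w' with hμ'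
  have hi : ∀ k, Integrable (fun p : (ℕ → ℝ × ℝ) × (ℕ → ℝ × ℝ) ↦ mahal α (p.1 k - p.2 k))
      (μ.prod μ') := fun k ↦ by
    refine (((((hint hz hw k).comp_fst μ').sub ((hint hz' hw' k).comp_snd μ)).norm).const_mul
      ‖decorrelate α‖).mono' (by fun_prop) (.of_forall fun p ↦ ?_)
    rw [Real.norm_eq_abs, abs_of_nonneg (mahal_nonneg _ _)]
    exact mahal_le_mul_norm α _
  have hinit : TransportBound α N μ μ' fun k ↦ ∫ p, mahal α (p.1 k - p.2 k) ∂(μ.prod μ') := by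
    intro L F hF
    obtain ⟨M, hM⟩ := hF.bounded
    have i1 : Integrable F μ := .of_bound hF.measurable.aestronglyMeasurable M (.of_forall hM)
    have i2 : Integrable F μ' := .of_bound hF.measurable.aestronglyMeasurable M (.of_forall hM)
    have e1 : ∫ x, F x ∂μ - ∫ x, F x ∂μ' = ∫ p, (F p.1 - F p.2) ∂(μ.prod μ') := by
      rw [integral_sub (i1.comp_fst μ') (i2.comp_snd μ), integral_fun_fst, integral_fun_snd]
      simp
    simp only [← integral_const_mul]
    rw [e1, ← integral_finsetSum _ fun k _ ↦ (hi k).const_mul _]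
    refine (norm_integral_le_integral_norm _).trans (integral_mono_of_nonneg
      (.of_forall fun p ↦ norm_nonneg (F p.1 - F p.2)) (integrable_finsetSum _ fun k _ ↦ (hi k).const_mul _)
      (.of_forall fun p ↦ ?_))
    exact hF.lipschitz _ _
  refine hinit.affine hα (gridVar_ne_zero hst hN) hN (heatInvariant_gridBridge hα hst hN z w)
    (heatInvariant_gridBridge hα hst hN z' w') ?_ ?_
  · refine le_of_eq ((integral_congr_ae (g := fun _ ↦ mahal α (z - z')) ?_).trans (by simp))
    filter_upwards [Measure.quasiMeasurePreserving_fst.ae (hend z w).1,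
      Measure.quasiMeasurePreserving_snd.ae (hend z' w').1] with p hp1 hp2
    rw [hp1, hp2]
  · rw [div_mul_cancel₀ _ hN', add_sub_cancel]
    refine le_of_eq ((integral_congr_ae (g := fun _ ↦ mahal α (w - w')) ?_).trans (by simp))
    filter_upwards [Measure.quasiMeasurePreserving_fst.ae (hend z w).2,
      Measure.quasiMeasurePreserving_snd.ae (hend z' w').2] with p hp1 hp2
    rw [hp1, hp2]

end QuadrantExcursion

/-! ### Refining the grid: Lipschitz dependence on the endpoints -/

namespace QuadrantExcursion

variable {α s t : ℝ}

/-- The index of the last grid point before time `u`. -/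
noncomputable def gridIdx (s t : ℝ) (N : ℕ) (u : ℝ) : ℕ := ⌊frac s t u * N⌋₊

theorem gridIdx_le (hst : s < t) (N : ℕ) (u : Set.Icc s t) : gridIdx s t N u ≤ N :=
  Nat.floor_le_of_le (mul_le_of_le_one_left (Nat.cast_nonneg N) (frac_mem hst u.2).2)

theorem tendsto_gridIdx_div (hst : s < t) (u : Set.Icc s t) :
    Filter.Tendsto (fun N : ℕ ↦ (gridIdx s t N u : ℝ) / N) .atTop (𝓝 (frac s t u)) :=
  (tendsto_nat_floor_mul_div_atTop (frac_mem hst u.2).1).comp tendsto_natCast_atTop_atTop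

theorem tendsto_gridPt (hst : s < t) (u : Set.Icc s t) :
    Filter.Tendsto (fun N : ℕ ↦ gridPt hst N (gridIdx s t N u)) .atTop (𝓝 u) := by
  have hT := (sub_pos.2 hst).ne'
  rw [tendsto_subtype_rng]
  have h1 := ((tendsto_gridIdx_div hst u).const_mul (t - s)).const_add s
  have e : s + (t - s) * frac s t u = u := by simp only [frac]; field_simp; ring
  rw [e] at h1
  refine h1.congr fun N ↦ ?_
  simp only [gridPt, min_eq_left (gridIdx_le hst N u)]

/-- The event that a path is in the quadrant at all grid times. -/
def gridPaths (hst : s < t) (N : ℕ) : Set (Path s t) := gridPath hst N ⁻¹' gridQuadrant N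

theorem measurableSet_gridPaths (hst : s < t) (N : ℕ) : MeasurableSet (gridPaths hst N) :=
  (measurableSet_gridQuadrant N).preimage (measurable_gridPath hst N)

theorem quadrantPaths_subset_gridPaths (hst : s < t) (N : ℕ) :
    quadrantPaths s t ⊆ gridPaths hst N := fun _ hf _ _ ↦ hf _

/-- The quadrant is closed, so a continuous path that leaves it does so on an open set of times,
which a fine grid detects. -/
theorem eventually_mem_gridPaths_iff (hst : s < t) (f : Path s t) :
    ∀ᶠ N in .atTop, (f ∈ gridPaths hst N ↔ f ∈ quadrantPaths s t) := by
  by_cases hf : f ∈ quadrantPaths s t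
  · exact .of_forall fun N ↦ ⟨fun _ ↦ hf, fun h ↦ quadrantPaths_subset_gridPaths hst N h⟩
  · obtain ⟨u, hu⟩ : ∃ u, f u ∉ quadrant := by
      by_contra! hcon
      exact hf hcon
    have h1 : ∀ᶠ N in .atTop, f (gridPt hst N (gridIdx s t N u)) ∉ quadrant :=
      ((f.continuous.tendsto u).comp (tendsto_gridPt hst u)).eventually
        (isClosed_quadrant.isOpen_compl.mem_nhds hu)
    filter_upwards [h1] with N hN
    exact ⟨fun h ↦ (hN (h _ (gridIdx_le hst N u))).elim, fun h ↦ (hf h).elim⟩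

theorem tendsto_setIntegral_gridPaths (hst : s < t) {b : Measure (Path s t)} [IsFiniteMeasure b]
    {G : ℕ → Path s t → ℝ} {G' : Path s t → ℝ} {M : ℝ} (hG : ∀ N, Measurable (G N))
    (hM : ∀ N f, |G N f| ≤ M)
    (hlim : ∀ f, Filter.Tendsto (fun N ↦ G N f) .atTop (𝓝 (G' f))) :
    Filter.Tendsto (fun N ↦ ∫ f in gridPaths hst N, G N f ∂b) .atTop
      (𝓝 (∫ f in quadrantPaths s t, G' f ∂b)) := by
  simp only [← integral_indicator (measurableSet_gridPaths hst _),
    ← integral_indicator (measurableSet_quadrantPaths s t)]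
  have hM0 : 0 ≤ M := (abs_nonneg _).trans (hM 0 0)
  refine tendsto_integral_of_dominated_convergence (fun _ ↦ M)
    (fun N ↦ ((hG N).indicator (measurableSet_gridPaths hst N)).aestronglyMeasurable)
    (integrable_const M) (fun N ↦ .of_forall fun f ↦ ?_) (.of_forall fun f ↦ ?_)
  · rw [Real.norm_eq_abs]
    simp only [Set.indicator]
    split_ifs
    · exact hM N f
    · rwa [abs_zero]
  · have h1 : ∀ᶠ N in .atTop, (quadrantPaths s t).indicator (G N) f =
        (gridPaths hst N).indicator (G N) f := by
      filter_upwards [eventually_mem_gridPaths_iff hst f] with N hN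
      by_cases hf : f ∈ quadrantPaths s t
      · rw [Set.indicator_of_mem hf, Set.indicator_of_mem (hN.2 hf)]
      · rw [Set.indicator_of_notMem hf, Set.indicator_of_notMem fun h ↦ hf (hN.1 h)]
    refine Filter.Tendsto.congr' h1 ?_
    simp only [Set.indicator]
    split_ifs
    · exact hlim f
    · exact tendsto_const_nhds

theorem integral_gridBridge (hst : s < t) (N : ℕ) (z w : ℝ × ℝ) {F : (ℕ → ℝ × ℝ) → ℝ}
    (hF : Measurable F) : ∫ x, F x ∂(gridBridge α hst N z w) =
      (∫ f in gridPaths hst N, F (gridPath hst N f) ∂(bridgeLaw α s t z w)) /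
        ∫ _ in gridPaths hst N, 1 ∂(bridgeLaw α s t z w) := by
  rw [gridBridge, cond_eq_smul_restrict, integral_smul_measure, gridLaw,
    setIntegral_map (measurableSet_gridQuadrant N) hF.aestronglyMeasurable
      (measurable_gridPath hst N).aemeasurable, setIntegral_const, measureReal_def,
    Measure.map_apply (measurable_gridPath hst N) (measurableSet_gridQuadrant N),
    ENNReal.toReal_inv, smul_eq_mul, smul_eq_mul, mul_one, div_eq_inv_mul]
  rfl

theorem integral_quadBridge (z w : ℝ × ℝ) (F : Path s t → ℝ) :
    ∫ f, F f ∂(quadBridge α s t z w) = (∫ f in quadrantPaths s t, F f ∂(bridgeLaw α s t z w)) /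
      ∫ _ in quadrantPaths s t, 1 ∂(bridgeLaw α s t z w) := by
  rw [quadBridge, cond_eq_smul_restrict, integral_smul_measure, setIntegral_const, measureReal_def,
    ENNReal.toReal_inv, smul_eq_mul, smul_eq_mul, mul_one, div_eq_inv_mul]

/-- Cylinder functions of the grid bridges converge. -/
theorem tendsto_integral_gridBridge (hα : α ∈ Set.Ioo (-1 : ℝ) 1) (hst : s < t) {z w : ℝ × ℝ}
    (hz : z ∈ openQuadrant) (hw : w ∈ openQuadrant) {ι : Type*} [Finite ι] (u : ι → Set.Icc s t)
    {F : (ι → ℝ × ℝ) → ℝ} (hF : Continuous F) {M : ℝ} (hM : ∀ x, |F x| ≤ M) :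
    Filter.Tendsto (fun N ↦ ∫ x, F (fun i ↦ x (gridIdx s t N (u i))) ∂(gridBridge α hst N z w))
      .atTop (𝓝 (∫ f, F (fun i ↦ f (u i)) ∂(quadBridge α s t z w))) := by
  have := isProbabilityMeasure_bridgeLaw hα hst z w
  have hFm : ∀ N, Measurable fun x : ℕ → ℝ × ℝ ↦ F fun i ↦ x (gridIdx s t N (u i)) :=
    fun N ↦ hF.measurable.comp (by fun_prop)
  rw [integral_quadBridge]
  simp_rw [fun N ↦ integral_gridBridge (α := α) hst N z w (hFm N)]
  refine Filter.Tendsto.div (tendsto_setIntegral_gridPaths hst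
    (fun N ↦ (hFm N).comp (measurable_gridPath hst N)) (fun N f ↦ hM _) fun f ↦ ?_)
    (tendsto_setIntegral_gridPaths hst (M := 1) (fun N ↦ measurable_const) (fun N f ↦ by simp)
      fun f ↦ tendsto_const_nhds) ?_
  · refine (hF.tendsto _).comp (tendsto_pi_nhds.2 fun i ↦ ?_)
    exact (f.continuous.tendsto (u i)).comp (tendsto_gridPt hst (u i))
  · rw [setIntegral_const, smul_eq_mul, mul_one, measureReal_def]
    exact ENNReal.toReal_ne_zero.2 ⟨bridgeLaw_quadrantPaths_ne_zero hα hst hz hw, measure_ne_top _ _⟩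

theorem continuous_of_abs_sub_le_mahal {ι : Type*} [Fintype ι] {F : (ι → ℝ × ℝ) → ℝ} {L : ι → ℝ}
    (hL : ∀ x y, |F x - F y| ≤ ∑ i, L i * mahal α (x i - y i)) : Continuous F := by
  refine continuous_iff_continuousAt.2 fun x ↦ ?_
  rw [ContinuousAt, tendsto_iff_dist_tendsto_zero]
  refine squeeze_zero (fun _ ↦ dist_nonneg) (fun y ↦ hL y x) ?_
  have : Continuous fun y : ι → ℝ × ℝ ↦ ∑ i, L i * mahal α (y i - x i) := by fun_prop
  simpa using this.tendsto x

/-- The laws of the conditioned bridges depend on the endpoints in a Lipschitz way. -/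
theorem abs_integral_quadBridge_sub_le (hα : α ∈ Set.Ioo (-1 : ℝ) 1) (hst : s < t)
    {z w z' w' : ℝ × ℝ} (hz : z ∈ openQuadrant) (hw : w ∈ openQuadrant) (hz' : z' ∈ openQuadrant)
    (hw' : w' ∈ openQuadrant) {ι : Type*} [Fintype ι] (u : ι → Set.Icc s t)
    {F : (ι → ℝ × ℝ) → ℝ} {M : ℝ} (hM : ∀ x, |F x| ≤ M) {L : ι → ℝ} (hL0 : ∀ i, 0 ≤ L i)
    (hL : ∀ x y, |F x - F y| ≤ ∑ i, L i * mahal α (x i - y i)) :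
    |∫ f, F (fun i ↦ f (u i)) ∂(quadBridge α s t z w) -
      ∫ f, F (fun i ↦ f (u i)) ∂(quadBridge α s t z' w')| ≤
        ∑ i, L i * ((1 - frac s t (u i)) * mahal α (z - z') +
          frac s t (u i) * mahal α (w - w')) := by
  classical
  have hF := continuous_of_abs_sub_le_mahal hL
  have hlim : Filter.Tendsto (fun N : ℕ ↦ ∑ i, L i * (mahal α (z - z') +
      (mahal α (w - w') - mahal α (z - z')) * ((gridIdx s t N (u i) : ℝ) / N))) .atTop
      (𝓝 (∑ i, L i * (mahal α (z - z') +
        (mahal α (w - w') - mahal α (z - z')) * frac s t (u i)))) :=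
    tendsto_finsetSum _ fun i _ ↦
      (((tendsto_gridIdx_div hst (u i)).const_mul _).const_add _).const_mul _
  have e : ∑ i, L i * ((1 - frac s t (u i)) * mahal α (z - z') + frac s t (u i) * mahal α (w - w')) =
      ∑ i, L i * (mahal α (z - z') + (mahal α (w - w') - mahal α (z - z')) * frac s t (u i)) :=
    Finset.sum_congr rfl fun i _ ↦ by ring
  rw [e]
  refine le_of_tendsto_of_tendsto (((tendsto_integral_gridBridge hα hst hz hw u hF hM).sub
    (tendsto_integral_gridBridge hα hst hz' hw' u hF hM)).abs) hlim ?_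
  filter_upwards [Filter.eventually_ne_atTop 0] with N hN
  -- Several times `u i` may fall on the same grid site, so their Lipschitz weights are added.
  have hcoef : ∀ c : ℕ → ℝ, ∑ k ∈ Finset.range (N + 1),
      (∑ i, if gridIdx s t N (u i) = k then L i else 0) * c k =
        ∑ i, L i * c (gridIdx s t N (u i)) := by
    intro c
    simp only [Finset.sum_mul, ite_mul, zero_mul]
    rw [Finset.sum_comm]
    refine Finset.sum_congr rfl fun i _ ↦ ?_
    rw [Finset.sum_ite_eq, if_pos (Finset.mem_range.2 (Nat.lt_succ_of_le (gridIdx_le hst N (u i))))]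
  have hS : SiteLipschitz α N (fun k ↦ ∑ i, if gridIdx s t N (u i) = k then L i else 0)
      fun x ↦ F fun i ↦ x (gridIdx s t N (u i)) := by
    refine ⟨hF.measurable.comp (by fun_prop), ⟨M, fun x ↦ hM _⟩, fun k ↦ ?_, fun x y ↦ ?_⟩
    · exact Finset.sum_nonneg fun i _ ↦ by split_ifs <;> simp [hL0]
    · rw [hcoef fun k ↦ mahal α (x k - y k)]
      exact hL _ _
  refine (TransportBound.gridBridge hα hst hN hz hw hz' hw' _ _ hS).trans (le_of_eq ?_)
  rw [hcoef]
  exact Finset.sum_congr rfl fun i _ ↦ by ring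

end QuadrantExcursion

/-! ### Exponential moments of increments of conditioned bridges -/

namespace QuadrantExcursion

variable {α s t : ℝ}

/-- The weight of the `m`-th increment in the value of a discrete loop at time `k`. -/
noncomputable def loopCoeff (N k m : ℕ) : ℝ :=
  (if m < min k N then 1 else 0) - ((min k N : ℕ) : ℝ) / N

theorem sum_loopCoeff_mul {N : ℕ} (hN : N ≠ 0) (i j : ℕ) :
    ∑ m : Fin N, loopCoeff N i m * loopCoeff N j m =
      ((min i N : ℕ) : ℝ) ⊓ (min j N : ℕ) - ((min i N : ℕ) : ℝ) * (min j N : ℕ) / N := by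
  have hN' : (N : ℝ) ≠ 0 := by exact_mod_cast hN
  have h1 : ∀ k ≤ N, ∑ m : Fin N, (if (m : ℕ) < k then (1 : ℝ) else 0) = k := by
    intro k hk
    rw [Fin.sum_univ_eq_sum_range fun m ↦ if m < k then (1 : ℝ) else 0, Finset.sum_boole]
    congr 1
    rw [show (Finset.range N).filter (· < k) = Finset.range k by ext; simp; omega,
      Finset.card_range]
  have e : ∀ m : Fin N, loopCoeff N i m * loopCoeff N j m =
      (if (m : ℕ) < min (min i N) (min j N) then (1 : ℝ) else 0) -
        ((min i N : ℕ) : ℝ) / N * (if (m : ℕ) < min j N then (1 : ℝ) else 0) -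
        ((min j N : ℕ) : ℝ) / N * (if (m : ℕ) < min i N then (1 : ℝ) else 0) +
        ((min i N : ℕ) : ℝ) / N * (((min j N : ℕ) : ℝ) / N) := by
    intro m
    simp only [loopCoeff, lt_min_iff (b := min i N)]
    by_cases hi : (m : ℕ) < min i N <;> by_cases hj : (m : ℕ) < min j N <;>
      simp only [hi, hj, if_true, if_false, and_self, and_true, and_false] <;> ring
  simp only [e, Finset.sum_add_distrib, Finset.sum_sub_distrib, ← Finset.mul_sum]
  rw [h1 _ (min_le_right _ _), h1 _ (min_le_right _ _),
    h1 _ ((min_le_left _ _).trans (min_le_right _ _))]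
  simp only [Finset.sum_const, Finset.card_univ, Fintype.card_fin, nsmul_eq_mul]
  rw [Nat.cast_min (α := ℝ) (min i N)]
  field_simp
  ring

/-- The sum is exactly `|j - i| - (j - i)² / N`, the variance of a loop increment in units of one
step. -/
theorem sum_loopCoeff_sub_sq_le {N : ℕ} (hN : N ≠ 0) (i j : ℕ) (hi : i ≤ N) (hj : j ≤ N) :
    ∑ m : Fin N, (loopCoeff N j m - loopCoeff N i m) ^ 2 ≤ |(j : ℝ) - i| := by
  have hN' : (0 : ℝ) < N := by positivity
  have e : ∀ m : Fin N, (loopCoeff N j m - loopCoeff N i m) ^ 2 =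
      loopCoeff N j m * loopCoeff N j m - 2 * (loopCoeff N i m * loopCoeff N j m) +
        loopCoeff N i m * loopCoeff N i m := fun m ↦ by ring
  simp only [e, Finset.sum_add_distrib, Finset.sum_sub_distrib, ← Finset.mul_sum,
    sum_loopCoeff_mul hN, min_self, min_eq_left hi, min_eq_left hj]
  have h1 : 0 ≤ ((j : ℝ) - i) ^ 2 / N := by positivity
  have h2 : (j : ℝ) - j * j / N - 2 * (((i : ℝ) ⊓ j) - i * j / N) + (i - i * i / N) =
      (j + i - 2 * ((i : ℝ) ⊓ j)) - ((j : ℝ) - i) ^ 2 / N := by ring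
  rw [h2]
  rcases le_total (i : ℝ) j with h | h
  · rw [min_eq_left h, abs_of_nonneg (by linarith)]; linarith
  · rw [min_eq_right h, abs_of_nonpos (by linarith)]; linarith

/-- The bridge on a grid, built from independent increments. -/
noncomputable def gridOfIncrements (hst : s < t) (N : ℕ) (z w : ℝ × ℝ) (ξ : Fin N → ℝ × ℝ) (k : ℕ) :
    ℝ × ℝ :=
  linePath s t z w (gridPt hst N k) + ∑ m : Fin N, loopCoeff N k m • ξ m

theorem measurable_gridOfIncrements (hst : s < t) (N : ℕ) (z w : ℝ × ℝ) :
    Measurable (gridOfIncrements hst N z w) := by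
  unfold gridOfIncrements; fun_prop

/-- Writing the bridge as an affine image of independent increments makes the tensorised midpoint
inequality available. -/
theorem gridLaw_eq_map_gridOfIncrements (hα : α ∈ Set.Ioo (-1 : ℝ) 1) (hst : s < t) {N : ℕ}
    (hN : N ≠ 0) (z w : ℝ × ℝ) {δ : ℝ≥0} (hδ : (δ : ℝ) = (t - s) / N) :
    gridLaw α hst N z w =
      (Measure.pi fun _ : Fin N ↦ corrGaussian α δ).map (gridOfIncrements hst N z w) := by
  have hN' : (N : ℝ) ≠ 0 := by exact_mod_cast hN
  have hL := corrGauss_loopLaw hα hst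
  have h1 : CorrGauss α (fun i j ↦ loopKernel s t (gridPt hst N i) (gridPt hst N j))
      (fun k (ξ : Fin N → ℝ × ℝ) ↦ ∑ m : Fin N, loopCoeff N k m • ξ m)
      (Measure.pi fun _ : Fin N ↦ corrGaussian α δ) := by
    refine (corrGauss_pi hα δ N).sum (A := Fin N) (fun k m ↦ loopCoeff N k m) (fun k m ↦ m)
      (fun _ _ ↦ rfl) fun i j ↦ ?_
    simp only [mul_ite, mul_zero, Finset.sum_ite_eq, Finset.mem_univ, if_true, ← Finset.sum_mul,
      sum_loopCoeff_mul hN, loopKernel_gridPt hst hN, hδ]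
    have := min_mul_max ((min i N : ℕ) : ℝ) ((min j N : ℕ) : ℝ)
    field_simp
    linear_combination (-(t - s)) * this
  have h2 := (hL.comp (gridPt hst N) (Y := fun k f ↦ gridPath hst N f k) (fun _ _ ↦ rfl)
    fun _ _ ↦ rfl).map_pi_eq h1
  let l : ℕ → ℝ × ℝ := fun j ↦ linePath s t z w (gridPt hst N j)
  have e1 : gridLaw α hst N z w = ((loopLaw α s t).map fun f ↦ gridPath hst N f).map (l + ·) := by
    rw [gridLaw, bridgeLaw, Measure.map_map (measurable_gridPath hst N) (measurable_linePath_add z w),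
      Measure.map_map (measurable_const_add l) (measurable_gridPath hst N)]
    rfl
  rw [e1]
  change ((loopLaw α s t).map fun f k ↦ gridPath hst N f k).map (l + ·) = _
  rw [h2, Measure.map_map (measurable_const_add l) (by fun_prop)]
  rfl

theorem convex_gridQuadrant (N : ℕ) : Convex ℝ (gridQuadrant N) := by
  intro x hx y hy a b ha hb hab k hk
  exact convex_quadrant (hx k hk) (hy k hk) ha hb hab

/-- Exponential moments of increments of conditioned grid bridges, in product form. -/
theorem setLIntegral_exp_mul_gridLaw_le (hα : α ∈ Set.Ioo (-1 : ℝ) 1) (hst : s < t) {N : ℕ}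
    (hN : N ≠ 0) (z w : ℝ × ℝ) {a : ℝ × ℝ} (ha : ∀ x, |pairing a x| ≤ mahal α x) (ε : ℝ)
    {i j : ℕ} (hi : i ≤ N) (hj : j ≤ N) :
    (∫⁻ x in gridQuadrant N, ENNReal.ofReal (Real.exp (ε * pairing a (x j - x i)))
      ∂(gridLaw α hst N z w)) * ∫⁻ x in gridQuadrant N,
        ENNReal.ofReal (Real.exp (-(ε * pairing a (x j - x i)))) ∂(gridLaw α hst N z w) ≤
      ENNReal.ofReal (Real.exp (ε ^ 2 * ((t - s) / N * |(j : ℝ) - i|))) *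
        gridLaw α hst N z w (gridQuadrant N) ^ 2 := by
  have hT := sub_pos.2 hst
  have hN' : (0 : ℝ) < N := by positivity
  have hδ0 : 0 < (t - s) / N := by positivity
  set δ : ℝ≥0 := ((t - s) / N).toNNReal with hδd
  have hδ : (δ : ℝ) = (t - s) / N := Real.coe_toNNReal _ hδ0.le
  have hδn : δ ≠ 0 := by rw [← NNReal.coe_ne_zero, hδ]; exact hδ0.ne'
  have hm := measurable_gridOfIncrements hst N z w
  have hp := measurable_pairing a
  have hQ := measurableSet_gridQuadrant N
  rw [gridLaw_eq_map_gridOfIncrements hα hst hN z w hδ, setLIntegral_map hQ (by fun_prop) hm,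
    setLIntegral_map hQ (by fun_prop) hm, Measure.map_apply hm hQ]
  have hlin : ∀ ξ ξ', gridOfIncrements hst N z w ξ - gridOfIncrements hst N z w ξ' =
      fun k ↦ ∑ m : Fin N, loopCoeff N k m • (ξ - ξ') m := fun ξ ξ' ↦ by
    funext k
    simp [gridOfIncrements, smul_sub]
  refine MidpointIneq.setLIntegral_exp_mul_le ((midpointIneq_corrGaussian hα hδn).pi N)
    ?_ (hQ.preimage hm) (f := fun ξ ↦ ε * pairing a (gridOfIncrements hst N z w ξ j -
      gridOfIncrements hst N z w ξ i)) (by fun_prop) fun ξ ξ' ↦ ?_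
  · intro ξ hξ ξ' hξ' p q hp hq hpq
    have : gridOfIncrements hst N z w (p • ξ + q • ξ') =
        p • gridOfIncrements hst N z w ξ + q • gridOfIncrements hst N z w ξ' := by
      funext k
      have e1 : linePath s t z w (gridPt hst N k) = p • linePath s t z w (gridPt hst N k) +
        q • linePath s t z w (gridPt hst N k) := by rw [← add_smul, hpq, one_smul]
      simp only [gridOfIncrements, Pi.add_apply, Pi.smul_apply, smul_add, Finset.sum_add_distrib,
        Finset.smul_sum]
      conv_lhs => rw [e1]
      simp only [smul_comm p, smul_comm q]
      abel
    rw [Set.mem_preimage, this]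
    exact convex_gridQuadrant N hξ hξ' hp hq hpq
  · have h1 := sum_loopCoeff_sub_sq_le hN i j hi hj
    have e1 : gridOfIncrements hst N z w ξ j - gridOfIncrements hst N z w ξ i -
        (gridOfIncrements hst N z w ξ' j - gridOfIncrements hst N z w ξ' i) =
        ∑ m : Fin N, (loopCoeff N j m - loopCoeff N i m) • (ξ - ξ') m := by
      have h2 := congrFun (hlin ξ ξ') j
      have h3 := congrFun (hlin ξ ξ') i
      simp only [Pi.sub_apply] at h2 h3
      simp only [sub_smul, Finset.sum_sub_distrib, Pi.sub_apply]
      rw [← h2, ← h3]; abel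
    have e2 : ∀ x y, ε * pairing a x - ε * pairing a y = ε * pairing a (x - y) := fun x y ↦ by
      simp only [pairing, Prod.fst_sub, Prod.snd_sub]; ring
    rw [e2, e1, pairing_sum_right, Finset.mul_sum]
    -- Completing the square absorbs each increment into its own quadratic cost; the remainders add
    -- up to `ε² δ` times the variance sum above.
    have h4 : ∀ m : Fin N, ε * pairing a ((loopCoeff N j m - loopCoeff N i m) • (ξ - ξ') m) ≤
        mahal α ((ξ - ξ') m) ^ 2 / (4 * δ) +
          ε ^ 2 * (δ * (loopCoeff N j m - loopCoeff N i m) ^ 2) := by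
      intro m
      set d := loopCoeff N j m - loopCoeff N i m
      set x := (ξ - ξ') m
      rw [pairing_smul_right]
      have h5 : ε * (d * pairing a x) ≤ |ε * d| * mahal α x := by
        calc ε * (d * pairing a x) ≤ |ε * d * pairing a x| := by rw [← mul_assoc]; exact le_abs_self _
          _ = |ε * d| * |pairing a x| := abs_mul _ _
          _ ≤ _ := by gcongr; exact ha x
      have h6 : |ε * d| * mahal α x ≤ mahal α x ^ 2 / (4 * δ) + δ * |ε * d| ^ 2 := by
        have h7 : 0 < (δ : ℝ) := by rw [hδ]; exact hδ0
        rw [div_add' _ _ _ (by positivity), le_div_iff₀ (by positivity)]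
        nlinarith [sq_nonneg (mahal α x - 2 * δ * |ε * d|)]
      rw [sq_abs] at h6
      linarith
    refine (Finset.sum_le_sum fun m _ ↦ h4 m).trans ?_
    rw [Finset.sum_add_distrib, ← Finset.mul_sum, ← Finset.mul_sum, hδ]
    gcongr

/-- The grid estimates pass to the limit. The integrands are unbounded, so Fatou is used on the
left, over the smaller event of staying in the quadrant at all times; on the right the probabilities
of the grid events converge. -/
theorem lintegral_exp_mul_quadBridge_le (hα : α ∈ Set.Ioo (-1 : ℝ) 1) (hst : s < t) {z w : ℝ × ℝ}
    (hz : z ∈ openQuadrant) (hw : w ∈ openQuadrant)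
    {a : ℝ × ℝ} (ha : ∀ x, |pairing a x| ≤ mahal α x) (ε : ℝ) (u v : Set.Icc s t) :
    (∫⁻ f, ENNReal.ofReal (Real.exp (ε * pairing a (f u - f v))) ∂(quadBridge α s t z w)) *
      ∫⁻ f, ENNReal.ofReal (Real.exp (-(ε * pairing a (f u - f v)))) ∂(quadBridge α s t z w) ≤
        ENNReal.ofReal (Real.exp (ε ^ 2 * |(u : ℝ) - v|)) := by
  have := isProbabilityMeasure_bridgeLaw hα hst z w
  have hT := sub_pos.2 hst
  set b := bridgeLaw α s t z w with hb
  have hb0 := bridgeLaw_quadrantPaths_ne_zero hα hst hz hw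
  have hcp := continuous_pairing a
  let I : ℕ → Set.Icc s t → ℕ := fun N x ↦ gridIdx s t N x
  let g : ℕ → Path s t → ℝ := fun N f ↦
    ε * pairing a (f (gridPt hst N (I N u)) - f (gridPt hst N (I N v)))
  have hg : ∀ N, Measurable (g N) := fun N ↦
    ((hcp.measurable).comp ((measurable_eval _).sub (measurable_eval _))).const_mul _
  have hlim : ∀ f : Path s t, Filter.Tendsto (fun N ↦ g N f) .atTop
      (𝓝 (ε * pairing a (f u - f v))) := fun f ↦ by
    refine ((hcp.tendsto _).comp (Filter.Tendsto.sub ?_ ?_)).const_mul ε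
    · exact (f.continuous.tendsto u).comp (tendsto_gridPt hst u)
    · exact (f.continuous.tendsto v).comp (tendsto_gridPt hst v)
  have key : ∀ N, N ≠ 0 → (∫⁻ f in gridPaths hst N, ENNReal.ofReal (Real.exp (g N f)) ∂b) *
      ∫⁻ f in gridPaths hst N, ENNReal.ofReal (Real.exp (-(g N f))) ∂b ≤
        ENNReal.ofReal (Real.exp (ε ^ 2 * ((t - s) / N * |(I N u : ℝ) - I N v|))) *
          b (gridPaths hst N) ^ 2 := by
    intro N hN
    have h1 := setLIntegral_exp_mul_gridLaw_le hα hst hN z w ha ε (gridIdx_le hst N v)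
      (gridIdx_le hst N u)
    have hQ := measurableSet_gridQuadrant N
    have hm := measurable_gridPath hst N
    have hp := hcp.measurable
    rwa [gridLaw, setLIntegral_map hQ (by fun_prop) hm, setLIntegral_map hQ (by fun_prop) hm,
      Measure.map_apply hm hQ] at h1
  let Q := quadrantPaths s t
  have hQm := measurableSet_quadrantPaths s t
  have hlimR : Filter.Tendsto (fun N : ℕ ↦
      ENNReal.ofReal (Real.exp (ε ^ 2 * ((t - s) / N * |(I N u : ℝ) - I N v|))) *
          b (gridPaths hst N) ^ 2) .atTop
      (𝓝 (ENNReal.ofReal (Real.exp (ε ^ 2 * |(u : ℝ) - v|)) * b Q ^ 2)) := by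
    refine ENNReal.Tendsto.mul ?_ (.inl (by positivity)) (ENNReal.Tendsto.pow ?_)
      (.inr ENNReal.ofReal_ne_top)
    · refine ENNReal.tendsto_ofReal ((Real.continuous_exp.tendsto _).comp
        (Filter.Tendsto.const_mul _ ?_))
      have h1 := (((tendsto_gridIdx_div hst u).sub (tendsto_gridIdx_div hst v)).abs).const_mul (t - s)
      have e : (t - s) * |frac s t u - frac s t v| = |(u : ℝ) - v| := by
        conv_lhs => rw [← abs_of_pos hT, ← abs_mul]
        congr 1
        simp only [frac]; field_simp; ring
      rw [e] at h1
      refine h1.congr fun N ↦ ?_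
      rw [← sub_div, abs_div, Nat.abs_cast]
      ring
    · have h1 := tendsto_setIntegral_gridPaths hst (b := b) (G := fun _ _ ↦ 1) (G' := fun _ ↦ 1)
        (M := 1) (fun _ ↦ measurable_const) (by simp) fun _ ↦ tendsto_const_nhds
      simp only [setIntegral_const, smul_eq_mul, mul_one, measureReal_def] at h1
      exact (ENNReal.tendsto_toReal_iff (fun _ ↦ measure_ne_top _ _) (measure_ne_top _ _)).1 h1
  have hset : (∫⁻ f in Q, ENNReal.ofReal (Real.exp (ε * pairing a (f u - f v))) ∂b) *
      ∫⁻ f in Q, ENNReal.ofReal (Real.exp (-(ε * pairing a (f u - f v)))) ∂b ≤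
        ENNReal.ofReal (Real.exp (ε ^ 2 * |(u : ℝ) - v|)) * b Q ^ 2 := by
    have hmu : Measurable fun f : Path s t ↦ ε * pairing a (f u - f v) :=
      ((hcp.measurable).comp ((measurable_eval _).sub (measurable_eval _))).const_mul _
    -- As one integral over the product measure, the product of the two moments needs a single
    -- application of Fatou.
    rw [← lintegral_prod_mul (by fun_prop) (by fun_prop)]
    refine le_trans ?_ hlimR.liminf_eq.le
    refine le_trans ?_ (Filter.liminf_le_liminf (u := fun N ↦
      (∫⁻ f in Q, ENNReal.ofReal (Real.exp (g N f)) ∂b) *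
        ∫⁻ f in Q, ENNReal.ofReal (Real.exp (-(g N f))) ∂b) ?_)
    · have e : ∀ N, (∫⁻ f in Q, ENNReal.ofReal (Real.exp (g N f)) ∂b) *
        ∫⁻ f in Q, ENNReal.ofReal (Real.exp (-(g N f))) ∂b =
          ∫⁻ p, ENNReal.ofReal (Real.exp (g N p.1)) * ENNReal.ofReal (Real.exp (-(g N p.2)))
            ∂((b.restrict Q).prod (b.restrict Q)) := fun N ↦
        (lintegral_prod_mul (by have := hg N; fun_prop) (by have := hg N; fun_prop)).symm
      simp only [e]
      refine le_trans (lintegral_mono fun p ↦ ?_) (lintegral_liminf_le fun N ↦ by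
        have := hg N; fun_prop)
      refine (Filter.Tendsto.liminf_eq ?_).ge
      refine ENNReal.Tendsto.mul (ENNReal.tendsto_ofReal ((Real.continuous_exp.tendsto _).comp
        (hlim p.1))) (.inr ENNReal.ofReal_ne_top) (ENNReal.tendsto_ofReal
          ((Real.continuous_exp.tendsto _).comp (hlim p.2).neg)) (.inr ENNReal.ofReal_ne_top)
    · filter_upwards [Filter.eventually_ne_atTop 0] with N hN
      refine le_trans ?_ (key N hN)
      gcongr <;> exact quadrantPaths_subset_gridPaths hst N
  rw [quadBridge, cond_eq_smul_restrict, lintegral_smul_measure, lintegral_smul_measure, smul_eq_mul,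
    smul_eq_mul, mul_mul_mul_comm]
  refine (mul_le_mul_right hset _).trans (le_of_eq ?_)
  rw [mul_left_comm, pow_two (b Q), mul_mul_mul_comm, ENNReal.inv_mul_cancel hb0
    (measure_ne_top _ _), one_mul, mul_one]

theorem lintegral_pairing_sub_pow_four_le (hα : α ∈ Set.Ioo (-1 : ℝ) 1) (hst : s < t) {z w : ℝ × ℝ}
    (hz : z ∈ openQuadrant) (hw : w ∈ openQuadrant)
    {a : ℝ × ℝ} (ha : ∀ x, |pairing a x| ≤ mahal α x) (u v : Set.Icc s t) :
    ∫⁻ p, ENNReal.ofReal ((pairing a (p.1 u - p.1 v) - pairing a (p.2 u - p.2 v)) ^ 4)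
      ∂((quadBridge α s t z w).prod (quadBridge α s t z w)) ≤
        ENNReal.ofReal (72 * ((u : ℝ) - v) ^ 2) := by
  rcases eq_or_ne u v with rfl | huv
  · simp
  have := isProbabilityMeasure_quadBridge hα hst hz hw
  have h1 : 0 < |(u : ℝ) - v| := abs_pos.2 (sub_ne_zero.2 fun h ↦ huv (Subtype.ext h))
  rw [← sq_abs]
  exact lintegral_sub_pow_four_le (f := fun f : Path s t ↦ pairing a (f u - f v))
    ((measurable_pairing a).comp ((measurable_eval _).sub (measurable_eval _))) h1
    fun ε ↦ lintegral_exp_mul_quadBridge_le hα hst hz hw ha ε u v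

end QuadrantExcursion

/-! ### Splicing paths and the Gibbs property -/

namespace QuadrantExcursion

variable {α s t S T : ℝ}

theorem restrictPath_apply {a b c d : ℝ} (h : Set.Icc c d ⊆ Set.Icc a b) (f : Path a b)
    (u : Set.Icc c d) : restrictPath h f u = f ⟨u, h u.2⟩ := rfl

/-- The difference between a path and the segment with the same endpoints. -/
noncomputable def loopPart (hst : s < t) (g : Path s t) : Path s t :=
  g - linePath s t (g ⟨s, le_rfl, hst.le⟩) (g ⟨t, hst.le, le_rfl⟩)

theorem loopPart_apply (hst : s < t) (g : Path s t) (u : Set.Icc s t) :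
    loopPart hst g u = g u - (g ⟨s, le_rfl, hst.le⟩ + frac s t u •
      (g ⟨t, hst.le, le_rfl⟩ - g ⟨s, le_rfl, hst.le⟩)) := rfl

theorem loopPart_start (hst : s < t) (g : Path s t) : loopPart hst g ⟨s, le_rfl, hst.le⟩ = 0 := by
  simp [loopPart_apply, frac]

theorem loopPart_terminal (hst : s < t) (g : Path s t) : loopPart hst g ⟨t, hst.le, le_rfl⟩ = 0 := by
  simp [loopPart_apply, frac, div_self (sub_pos.2 hst).ne']

/-- Replace the loop part of `f` on the subinterval `[s, t]` by that of `g`. -/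
noncomputable def splice (hS : S ≤ s) (hst : s < t) (hT : t ≤ T) (f : Path S T) (g : Path s t) :
    Path S T where
  -- Outside `[s, t]` the projected time is an endpoint, where both loop parts vanish, so continuity
  -- needs no gluing.
  toFun u := f u + (loopPart hst g (Set.projIcc s t hst.le u) -
    loopPart hst (restrictPath (Set.Icc_subset_Icc hS hT) f) (Set.projIcc s t hst.le u))
  continuous_toFun := by
    have := continuous_projIcc (h := hst.le)
    fun_prop

variable (hS : S ≤ s) (hst : s < t) (hT : t ≤ T)

theorem continuous_splice :
    Continuous fun p : Path S T × Path s t ↦ splice hS hst hT p.1 p.2 := by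
  refine ContinuousMap.continuous_of_continuous_uncurry _ ?_
  have := continuous_projIcc (h := hst.le)
  simp only [splice, loopPart_apply, restrictPath_apply, ContinuousMap.coe_mk,
    Function.uncurry_def]
  fun_prop

theorem splice_apply_of_le (f : Path S T) (g : Path s t) {u : Set.Icc S T} (hu : (u : ℝ) ≤ s) :
    splice hS hst hT f g u = f u := by
  simp only [splice, ContinuousMap.coe_mk, Set.projIcc_of_le_left _ hu, loopPart_start, sub_zero,
    add_zero]

theorem splice_apply_of_ge (f : Path S T) (g : Path s t) {u : Set.Icc S T} (hu : t ≤ u) :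
    splice hS hst hT f g u = f u := by
  simp only [splice, ContinuousMap.coe_mk, Set.projIcc_of_right_le _ hu, loopPart_terminal,
    sub_zero, add_zero]

theorem splice_apply_of_mem (f : Path S T) (g : Path s t) {u : Set.Icc S T}
    (hu : (u : ℝ) ∈ Set.Icc s t) : splice hS hst hT f g u =
      linePath s t (f ⟨s, hS, hst.le.trans hT⟩) (f ⟨t, hS.trans hst.le, hT⟩) ⟨u, hu⟩ +
        loopPart hst g ⟨u, hu⟩ := by
  simp only [splice, ContinuousMap.coe_mk, Set.projIcc_of_mem _ hu]
  rw [loopPart_apply _ (restrictPath _ _)]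
  simp only [restrictPath_apply, linePath, ContinuousMap.coe_mk]
  abel

theorem loopKernel_of_le {u v : Set.Icc s t} (h : (u : ℝ) ≤ v) :
    loopKernel s t u v = (u - s) * (t - v) / (t - s) := by
  rw [loopKernel, min_eq_left h, max_eq_right h]

theorem loopKernel_of_ge {u v : Set.Icc s t} (h : (v : ℝ) ≤ u) :
    loopKernel s t u v = (v - s) * (t - u) / (t - s) := by
  rw [loopKernel, min_eq_right h, max_eq_left h]

/-- Brownian loops may be resampled on subintervals. -/
theorem map_splice_loopLaw (hα : α ∈ Set.Ioo (-1 : ℝ) 1) :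
    ((loopLaw α S T).prod (loopLaw α s t)).map (fun p ↦ splice hS hst hT p.1 p.2) =
      loopLaw α S T := by
  have hST : S < T := (hS.trans_lt hst).trans_le hT
  have h1 := sub_pos.2 hst
  have h2 := sub_pos.2 hST
  let lo : Set.Icc S T := ⟨s, hS, hst.le.trans hT⟩
  let hi : Set.Icc S T := ⟨t, hS.trans hst.le, hT⟩
  let lo' : Set.Icc s t := ⟨s, le_rfl, hst.le⟩
  let hi' : Set.Icc s t := ⟨t, hst.le, le_rfl⟩
  let π : ℝ → Set.Icc s t := Set.projIcc s t hst.le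
  classical
  refine (CorrGauss.map_path_eq (continuous_splice hS hst hT).measurable
    (((corrGauss_loopLaw hα hST).prod (corrGauss_loopLaw hα hst)).sum (A := Fin 5)
    (fun (u : Set.Icc S T) ↦ if (u : ℝ) ∈ Set.Icc s t then ![1 - frac s t u, frac s t u, 1, -(1 - frac s t u),
      -frac s t u] else ![1, 0, 0, 0, 0])
    (fun (u : Set.Icc S T) ↦ if (u : ℝ) ∈ Set.Icc s t then ![Sum.inl lo, Sum.inl hi,
      Sum.inr (π u), Sum.inr lo', Sum.inr hi'] else ![Sum.inl u, Sum.inl u, Sum.inl u, Sum.inl u,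
      Sum.inl u]) (fun u p ↦ ?_) fun u v ↦ ?_)).path_measure_eq (corrGauss_loopLaw hα hST)
  · by_cases hu : (u : ℝ) ∈ Set.Icc s t
    · rw [splice_apply_of_mem hS hst hT _ _ hu]
      simp only [hu, if_true, Fin.sum_univ_five]
      simp only [linePath, loopPart_apply, ContinuousMap.coe_mk, Matrix.cons_val, Sum.elim_inl,
        Sum.elim_inr, π, Set.projIcc_of_mem _ hu, lo, hi, lo', hi']
      module
    · simp only [hu, if_false, Fin.sum_univ_five]
      simp only [Matrix.cons_val, Sum.elim_inl, one_smul, zero_smul, add_zero]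
      rcases lt_or_ge (u : ℝ) s with h | h
      · exact splice_apply_of_le hS hst hT _ _ h.le
      · exact splice_apply_of_ge hS hst hT _ _ (not_lt.1 fun h' ↦ hu ⟨h, h'.le⟩)
  · have hlo : ∀ x : Set.Icc s t, (lo' : ℝ) ≤ x := fun x ↦ x.2.1
    have hhi : ∀ x : Set.Icc s t, (x : ℝ) ≤ hi' := fun x ↦ x.2.2
    have k1 : ∀ x, loopKernel s t lo' x = 0 := fun x ↦ by
      rw [loopKernel_of_le (hlo x)]; simp [lo']
    have k2 : ∀ x, loopKernel s t x lo' = 0 := fun x ↦ by rw [loopKernel_comm, k1]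
    have k3 : ∀ x, loopKernel s t x hi' = 0 := fun x ↦ by
      rw [loopKernel_of_le (hhi x)]; simp [hi']
    have k4 : ∀ x, loopKernel s t hi' x = 0 := fun x ↦ by rw [loopKernel_comm, k3]
    have hlh : (lo : ℝ) ≤ hi := hst.le
    -- Against a time outside `[s, t]` the kernel is affine on `[s, t]`, so interpolating the end
    -- values gives the right covariance. For two times inside, the missing part is the kernel of
    -- the independent inner loop.
    have hmix : ∀ x y : Set.Icc S T, (x : ℝ) ∈ Set.Icc s t → (y : ℝ) ∉ Set.Icc s t →
        loopKernel S T x y = (1 - frac s t x) * loopKernel S T lo y +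
          frac s t x * loopKernel S T hi y := by
      intro x y hx hy
      rcases lt_or_ge (y : ℝ) s with h | h
      · rw [loopKernel_of_ge (h.le.trans hx.1), loopKernel_of_ge (u := lo) h.le,
          loopKernel_of_ge (u := hi) (h.le.trans hst.le)]
        simp only [frac, lo, hi]; field_simp; ring
      · have h' : t ≤ y := not_lt.1 fun h' ↦ hy ⟨h, h'.le⟩
        rw [loopKernel_of_le (hx.2.trans h'), loopKernel_of_le (u := lo) h,
          loopKernel_of_le (u := hi) h']
        simp only [frac, lo, hi]; field_simp; ring
    by_cases hu : (u : ℝ) ∈ Set.Icc s t <;> by_cases hv : (v : ℝ) ∈ Set.Icc s t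
    · simp only [hu, hv, if_true, Fin.sum_univ_five]
      simp only [Matrix.cons_val, Sum.elim_inl, Sum.elim_inr, k1, k2, k3, k4, π,
        Set.projIcc_of_mem _ hu, Set.projIcc_of_mem _ hv]
      rw [loopKernel_of_le (le_refl (lo : ℝ)), loopKernel_of_le (le_refl (hi : ℝ)),
        loopKernel_of_le hlh, loopKernel_of_ge hlh]
      rcases le_total (u : ℝ) v with h | h
      · rw [loopKernel_of_le h, loopKernel_of_le (u := ⟨(u : ℝ), hu⟩) h]
        simp only [frac, lo, hi]; field_simp; ring
      · rw [loopKernel_of_ge h, loopKernel_of_ge (u := ⟨(u : ℝ), hu⟩) h]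
        simp only [frac, lo, hi]; field_simp; ring
    · simp only [hu, hv, if_true, if_false, Fin.sum_univ_five]
      simp only [Matrix.cons_val, Sum.elim_inl, Sum.elim_inr, hmix u v hu hv]
      ring
    · simp only [hu, hv, if_true, if_false, Fin.sum_univ_five]
      simp only [Matrix.cons_val, Sum.elim_inl, Sum.elim_inr]
      rw [loopKernel_comm, hmix v u hv hu, loopKernel_comm lo, loopKernel_comm hi]
      ring
    · simp only [hu, hv, if_false, Fin.sum_univ_five]
      simp only [Matrix.cons_val, Sum.elim_inl]
      ring

theorem loopPart_linePath (z w : ℝ × ℝ) : loopPart hst (linePath s t z w) = 0 := by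
  ext1 u
  simp only [loopPart_apply, linePath, ContinuousMap.coe_mk, ContinuousMap.zero_apply]
  have h0 : frac s t s = 0 := by simp [frac]
  have h1 : frac s t t = 1 := div_self (sub_pos.2 hst).ne'
  rw [h0, h1]
  module

theorem restrictPath_linePath (z w : ℝ × ℝ) :
    restrictPath (Set.Icc_subset_Icc hS hT) (linePath S T z w) =
      linePath s t (linePath S T z w ⟨s, hS, hst.le.trans hT⟩)
        (linePath S T z w ⟨t, hS.trans hst.le, hT⟩) := by
  have h1 := (sub_pos.2 hst).ne'
  have h2 := (sub_pos.2 ((hS.trans_lt hst).trans_le hT)).ne'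
  ext1 u
  simp only [restrictPath_apply, linePath, ContinuousMap.coe_mk]
  have : frac S T u = frac S T s + frac s t u * (frac S T t - frac S T s) := by
    simp only [frac]; field_simp; ring
  rw [this]
  module

theorem loopPart_add (f g : Path s t) : loopPart hst (f + g) = loopPart hst f + loopPart hst g := by
  ext1 u
  simp only [loopPart_apply, ContinuousMap.add_apply]
  module

theorem splice_linePath_add (z w : ℝ × ℝ) (f : Path S T) (g : Path s t) :
    splice hS hst hT (linePath S T z w + f) g = linePath S T z w + splice hS hst hT f g := by
  have h : loopPart hst (restrictPath (Set.Icc_subset_Icc hS hT) (linePath S T z w + f)) =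
      loopPart hst (restrictPath (Set.Icc_subset_Icc hS hT) f) := by
    have e : restrictPath (Set.Icc_subset_Icc hS hT) (linePath S T z w + f) =
      restrictPath (Set.Icc_subset_Icc hS hT) (linePath S T z w) +
        restrictPath (Set.Icc_subset_Icc hS hT) f := rfl
    rw [e, loopPart_add, restrictPath_linePath hS hst hT, loopPart_linePath, zero_add]
  ext1 u
  simp only [splice, ContinuousMap.coe_mk, ContinuousMap.add_apply, h]
  abel

/-- Brownian bridges may be resampled on subintervals. -/
theorem map_splice_bridgeLaw (hα : α ∈ Set.Ioo (-1 : ℝ) 1) (z w : ℝ × ℝ) :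
    ((bridgeLaw α S T z w).prod (loopLaw α s t)).map (fun p ↦ splice hS hst hT p.1 p.2) =
      bridgeLaw α S T z w := by
  have hST : S < T := (hS.trans_lt hst).trans_le hT
  have i1 := (corrGauss_loopLaw hα hst).isProbabilityMeasure
  have i2 := (corrGauss_loopLaw hα hST).isProbabilityMeasure
  have hm := (continuous_splice hS hst hT).measurable
  have hl := measurable_linePath_add (s := S) (t := T) z w
  rw [bridgeLaw]
  conv_lhs => rw [← Measure.map_id (μ := loopLaw α s t)]
  rw [Measure.map_prod_map _ _ hl measurable_id, Measure.map_map hm (hl.prodMap measurable_id)]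
  conv_rhs => rw [← map_splice_loopLaw hS hst hT hα]
  rw [Measure.map_map hl hm]
  congr 1
  funext p
  exact splice_linePath_add hS hst hT z w p.1 p.2

theorem measurable_bridgeLaw_apply (hα : α ∈ Set.Ioo (-1 : ℝ) 1) {B : Set (Path s t)}
    (hB : MeasurableSet B) (hst : s < t) :
    Measurable fun p : (ℝ × ℝ) × (ℝ × ℝ) ↦ bridgeLaw α s t p.1 p.2 B := by
  have := (corrGauss_loopLaw hα hst).isProbabilityMeasure
  have hc : Continuous fun q : ((ℝ × ℝ) × (ℝ × ℝ)) × Path s t ↦ linePath s t q.1.1 q.1.2 + q.2 := by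
    refine ContinuousMap.continuous_of_continuous_uncurry _ ?_
    simp only [linePath, ContinuousMap.add_apply, ContinuousMap.coe_mk, Function.uncurry_def]
    fun_prop
  have h1 := measurable_measure_prodMk_left (ν := loopLaw α s t) (hc.measurable hB)
  convert h1 using 2 with p
  rw [bridgeLaw, Measure.map_apply (measurable_linePath_add _ _) hB]
  rfl

theorem measurable_quadBridge (hα : α ∈ Set.Ioo (-1 : ℝ) 1) (hst : s < t) :
    Measurable fun p : (ℝ × ℝ) × (ℝ × ℝ) ↦ quadBridge α s t p.1 p.2 := by
  refine Measure.measurable_of_measurable_coe _ fun B hB ↦ ?_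
  have hQ := measurableSet_quadrantPaths s t
  simp only [quadBridge, cond_apply hQ]
  exact (measurable_bridgeLaw_apply hα hQ hst).inv.mul (measurable_bridgeLaw_apply hα (hQ.inter hB) hst)

/-- The kernel of conditioned bridges, as a function of the two endpoints. -/
noncomputable def quadKernel (hα : α ∈ Set.Ioo (-1 : ℝ) 1) (hst : s < t) :
    Kernel ((ℝ × ℝ) × (ℝ × ℝ)) (Path s t) :=
  ⟨fun p ↦ quadBridge α s t p.1 p.2, measurable_quadBridge hα hst⟩

/-- The kernel is not Markov: an endpoint outside the closed quadrant makes the conditioning event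
null and the conditioned measure zero. -/
instance (hα : α ∈ Set.Ioo (-1 : ℝ) 1) (hst : s < t) : IsFiniteKernel (quadKernel hα hst) := by
  refine ⟨1, ENNReal.one_lt_top, fun p ↦ ?_⟩
  change ProbabilityTheory.cond _ _ _ ≤ 1
  have := isProbabilityMeasure_bridgeLaw hα hst p.1 p.2
  rw [cond_apply (measurableSet_quadrantPaths s t), Set.inter_univ]
  exact ENNReal.inv_mul_le_one _

theorem setLIntegral_bridgeLaw (hα : α ∈ Set.Ioo (-1 : ℝ) 1) (hst : s < t) (z w : ℝ × ℝ)
    (φ : Path s t → ℝ≥0∞) : ∫⁻ f in quadrantPaths s t, φ f ∂(bridgeLaw α s t z w) =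
      bridgeLaw α s t z w (quadrantPaths s t) * ∫⁻ f, φ f ∂(quadBridge α s t z w) := by
  have := isProbabilityMeasure_bridgeLaw hα hst z w
  rw [quadBridge, cond_eq_smul_restrict, lintegral_smul_measure, smul_eq_mul, ← mul_assoc]
  rcases eq_or_ne (bridgeLaw α s t z w (quadrantPaths s t)) 0 with h | h
  · rw [setLIntegral_measure_zero _ _ h, h, zero_mul, zero_mul]
  · rw [ENNReal.mul_inv_cancel h (measure_ne_top _ _), one_mul]

/-- The parts of a path before time `s` and after time `t`. -/
def outerPath (hS : S ≤ s) (hst : s < t) (hT : t ≤ T) (f : Path S T) : Path S s × Path t T :=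
  (restrictPath (Set.Icc_subset_Icc le_rfl (hst.le.trans hT)) f,
    restrictPath (Set.Icc_subset_Icc (hS.trans hst.le) le_rfl) f)

theorem continuous_restrictPath {a b c d : ℝ} (h : Set.Icc c d ⊆ Set.Icc a b) :
    Continuous (restrictPath h) :=
  ContinuousMap.continuous_precomp _

theorem continuous_outerPath : Continuous (outerPath hS hst hT) :=
  (continuous_restrictPath _).prodMk (continuous_restrictPath _)

theorem outerPath_splice (f : Path S T) (g : Path s t) :
    outerPath hS hst hT (splice hS hst hT f g) = outerPath hS hst hT f := by
  refine Prod.ext ?_ ?_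
  · ext1 u
    exact splice_apply_of_le hS hst hT f g (u := ⟨u, u.2.1, u.2.2.trans (hst.le.trans hT)⟩) u.2.2
  · ext1 u
    exact splice_apply_of_ge hS hst hT f g (u := ⟨u, (hS.trans hst.le).trans u.2.1, u.2.2⟩) u.2.1

theorem restrictPath_splice (f : Path S T) (g : Path s t) :
    restrictPath (Set.Icc_subset_Icc hS hT) (splice hS hst hT f g) =
      linePath s t (f ⟨s, hS, hst.le.trans hT⟩) (f ⟨t, hS.trans hst.le, hT⟩) +
        loopPart hst g := by
  ext1 u
  exact splice_apply_of_mem hS hst hT f g (u := ⟨u, hS.trans u.2.1, u.2.2.trans hT⟩) u.2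

theorem loopPart_ae_eq (hα : α ∈ Set.Ioo (-1 : ℝ) 1) :
    ∀ᵐ g ∂(loopLaw α s t), loopPart hst g = g := by
  have e : bridgeLaw α s t 0 0 = loopLaw α s t := by
    rw [bridgeLaw]
    conv_rhs => rw [← Measure.map_id (μ := loopLaw α s t)]
    congr 1
    funext f
    ext1 u
    simp [linePath]
  have h1 := bridgeLaw_start hα hst 0 0 (u := ⟨s, le_rfl, hst.le⟩) rfl
  have h2 := bridgeLaw_terminal hα hst 0 0 (u := ⟨t, hst.le, le_rfl⟩) rfl
  rw [e] at h1 h2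
  filter_upwards [h1, h2] with g hg1 hg2
  ext1 u
  simp [loopPart_apply, hg1, hg2]

/-- The event that the outer parts of a path are in the quadrant. -/
def outerQuadrant (S s t T : ℝ) : Set (Path S s × Path t T) :=
  quadrantPaths S s ×ˢ quadrantPaths t T

theorem mem_quadrantPaths_iff (f : Path S T) : f ∈ quadrantPaths S T ↔
    outerPath hS hst hT f ∈ outerQuadrant S s t T ∧
      restrictPath (Set.Icc_subset_Icc hS hT) f ∈ quadrantPaths s t := by
  constructor
  · exact fun h ↦ ⟨⟨fun u ↦ h _, fun u ↦ h _⟩, fun u ↦ h _⟩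
  · rintro ⟨⟨h1, h2⟩, h3⟩ u
    rcases le_total (u : ℝ) s with h | h
    · exact h1 ⟨u, u.2.1, h⟩
    rcases le_total (u : ℝ) t with h' | h'
    · exact h3 ⟨u, h, h'⟩
    · exact h2 ⟨u, h', u.2.2⟩

/-- Splicing in an independent loop preserves the bridge. Staying in the quadrant splits into a
condition on the outer parts, which splicing does not touch, and one on the inner part, which is
integrated out. -/
theorem setLIntegral_bridgeLaw_resample (hα : α ∈ Set.Ioo (-1 : ℝ) 1) (z w : ℝ × ℝ)
    {Ψ : (Path S s × Path t T) × Path s t → ℝ≥0∞} (hΨ : Measurable Ψ) :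
    ∫⁻ f in quadrantPaths S T, Ψ (outerPath hS hst hT f,
        restrictPath (Set.Icc_subset_Icc hS hT) f) ∂(bridgeLaw α S T z w) =
      ∫⁻ f, (outerPath hS hst hT ⁻¹' outerQuadrant S s t T).indicator (fun f ↦
        ∫⁻ g in quadrantPaths s t, Ψ (outerPath hS hst hT f, g)
          ∂(bridgeLaw α s t (f ⟨s, hS, hst.le.trans hT⟩) (f ⟨t, hS.trans hst.le, hT⟩))) f
        ∂(bridgeLaw α S T z w) := by
  have hST : S < T := (hS.trans_lt hst).trans_le hT
  have i1 := (corrGauss_loopLaw hα hst).isProbabilityMeasure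
  have i2 := isProbabilityMeasure_bridgeLaw hα hST z w
  have hQ := measurableSet_quadrantPaths S T
  have hQ' := measurableSet_quadrantPaths s t
  have hm := (continuous_splice hS hst hT).measurable
  have ho := (continuous_outerPath hS hst hT).measurable
  have hr := (continuous_restrictPath (Set.Icc_subset_Icc hS hT)).measurable
  have hΨ' : Measurable fun f ↦ Ψ (outerPath hS hst hT f,
      restrictPath (Set.Icc_subset_Icc hS hT) f) := hΨ.comp (ho.prodMk hr)
  rw [← lintegral_indicator hQ]
  conv_lhs => rw [← map_splice_bridgeLaw hS hst hT hα]
  rw [lintegral_map (hΨ'.indicator hQ) hm]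
  refine (lintegral_prod _ ((hΨ'.indicator hQ).comp hm).aemeasurable).trans
    (lintegral_congr fun f ↦ ?_)
  by_cases hf : outerPath hS hst hT f ∈ outerQuadrant S s t T
  · have hΨf : Measurable fun g ↦ Ψ (outerPath hS hst hT f, g) := hΨ.comp (by fun_prop)
    rw [Set.indicator_of_mem (by exact hf), ← lintegral_indicator hQ', bridgeLaw]
    refine (lintegral_congr_ae ?_).trans
      (lintegral_map (hΨf.indicator hQ') (measurable_linePath_add _ _)).symm
    filter_upwards [loopPart_ae_eq hst hα] with g hg
    have hiff : splice hS hst hT f g ∈ quadrantPaths S T ↔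
        linePath s t (f ⟨s, hS, hst.le.trans hT⟩) (f ⟨t, hS.trans hst.le, hT⟩) + g ∈
          quadrantPaths s t := by
      rw [mem_quadrantPaths_iff hS hst hT, outerPath_splice, restrictPath_splice, hg]
      exact and_iff_right hf
    simp only [Set.indicator, outerPath_splice, restrictPath_splice, hg, Function.comp_apply]
    split_ifs with h1 h2 h2
    exacts [rfl, (h2 (hiff.1 h1)).elim, (h1 (hiff.2 h2)).elim, rfl]
  · rw [Set.indicator_of_notMem (by exact hf)]
    refine (lintegral_congr fun g ↦ ?_).trans lintegral_zero
    refine Set.indicator_of_notMem (fun h ↦ hf ?_) _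
    rw [← outerPath_splice hS hst hT f g]
    exact ((mem_quadrantPaths_iff hS hst hT _).1 h).1

/-- The Gibbs property of the conditioned bridges. -/
theorem lintegral_quadBridge_resample (hα : α ∈ Set.Ioo (-1 : ℝ) 1) (z w : ℝ × ℝ)
    {Ψ : (Path S s × Path t T) × Path s t → ℝ≥0∞} (hΨ : Measurable Ψ) :
    ∫⁻ f, Ψ (outerPath hS hst hT f, restrictPath (Set.Icc_subset_Icc hS hT) f)
        ∂(quadBridge α S T z w) =
      ∫⁻ f, ∫⁻ g, Ψ (outerPath hS hst hT f, g)
        ∂(quadBridge α s t (f ⟨s, hS, hst.le.trans hT⟩) (f ⟨t, hS.trans hst.le, hT⟩))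
        ∂(quadBridge α S T z w) := by
  let e : Path S s × Path t T → (ℝ × ℝ) × (ℝ × ℝ) := fun o ↦
    (o.1 ⟨s, hS, le_rfl⟩, o.2 ⟨t, le_rfl, hT⟩)
  have he : Measurable e :=
    ((measurable_eval _).comp measurable_fst).prodMk ((measurable_eval _).comp measurable_snd)
  -- The same identity is applied to `Ψ` and to its conditional mean `Ψ'`, which sees only the outer
  -- parts; both yield the mass of the inner event times the inner mean.
  let Ψ' : (Path S s × Path t T) × Path s t → ℝ≥0∞ := fun p ↦
    ∫⁻ g, Ψ (p.1, g) ∂((quadKernel hα hst).comap e he p.1)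
  have hΨ' : Measurable Ψ' :=
    (Measurable.lintegral_kernel_prod_right' (κ := (quadKernel hα hst).comap e he) hΨ).comp
      measurable_fst
  have h1 := setLIntegral_bridgeLaw_resample hS hst hT hα z w hΨ
  have h2 := setLIntegral_bridgeLaw_resample hS hst hT hα z w hΨ'
  have h3 : ∫⁻ f in quadrantPaths S T, Ψ (outerPath hS hst hT f,
        restrictPath (Set.Icc_subset_Icc hS hT) f) ∂(bridgeLaw α S T z w) =
      ∫⁻ f in quadrantPaths S T, Ψ' (outerPath hS hst hT f,
        restrictPath (Set.Icc_subset_Icc hS hT) f) ∂(bridgeLaw α S T z w) := by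
    rw [h1, h2]
    refine lintegral_congr fun f ↦ ?_
    congr 1
    funext f
    refine (setLIntegral_bridgeLaw hα hst _ _ _).trans ((mul_comm _ _).trans ?_)
    exact (setLIntegral_const _ (Ψ' (outerPath hS hst hT f, 0))).symm
  rw [quadBridge, cond_eq_smul_restrict, lintegral_smul_measure, lintegral_smul_measure, h3]
  rfl

end QuadrantExcursion

/-! ### First moments of conditioned loops, and positivity -/

namespace QuadrantExcursion

variable {α s t S T : ℝ}

theorem lintegral_ofReal_le_of_min {Ω : Type*} [MeasurableSpace Ω] {μ : Measure Ω} {X : Ω → ℝ}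
    (hX : Measurable X) {B : ℝ≥0∞}
    (h : ∀ M : ℕ, ∫⁻ ω, ENNReal.ofReal (min (X ω) M) ∂μ ≤ B) :
    ∫⁻ ω, ENNReal.ofReal (X ω) ∂μ ≤ B := by
  refine le_of_tendsto' (lintegral_tendsto_of_tendsto_of_monotone
    (f := fun (M : ℕ) ω ↦ ENNReal.ofReal (min (X ω) M)) (fun M ↦ by fun_prop)
    (.of_forall fun ω m n hmn ↦ ?_) (.of_forall fun ω ↦ ?_)) h
  · exact ENNReal.ofReal_le_ofReal (min_le_min le_rfl (by exact_mod_cast hmn))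
  · refine tendsto_const_nhds.congr' ?_
    obtain ⟨n, hn⟩ := exists_nat_ge (X ω)
    filter_upwards [Filter.eventually_ge_atTop n] with m hm
    rw [min_eq_left (hn.trans (by exact_mod_cast hm))]

/-- The distance to `c` is `1`-Lipschitz but unbounded, so the endpoint estimate is applied to its
truncations. -/
theorem lintegral_mahal_quadBridge_le (hα : α ∈ Set.Ioo (-1 : ℝ) 1) (hst : s < t)
    {z w z' w' : ℝ × ℝ} (hz : z ∈ openQuadrant) (hw : w ∈ openQuadrant) (hz' : z' ∈ openQuadrant)
    (hw' : w' ∈ openQuadrant) (u : Set.Icc s t) (c : ℝ × ℝ) :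
    ∫⁻ f, ENNReal.ofReal (mahal α (f u - c)) ∂(quadBridge α s t z w) ≤
      ∫⁻ f, ENNReal.ofReal (mahal α (f u - c)) ∂(quadBridge α s t z' w') +
        ENNReal.ofReal ((1 - frac s t u) * mahal α (z - z') + frac s t u * mahal α (w - w')) := by
  have i1 := isProbabilityMeasure_quadBridge hα hst hz hw
  have i2 := isProbabilityMeasure_quadBridge hα hst hz' hw'
  have hfr := frac_mem hst u.2
  have hmu : Measurable fun f : Path s t ↦ mahal α (f u - c) :=
    (measurable_mahal α).comp ((measurable_eval u).sub_const c)
  have hR : 0 ≤ (1 - frac s t u) * mahal α (z - z') + frac s t u * mahal α (w - w') :=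
    add_nonneg (mul_nonneg (sub_nonneg.2 hfr.2) (mahal_nonneg _ _))
      (mul_nonneg hfr.1 (mahal_nonneg _ _))
  refine lintegral_ofReal_le_of_min hmu fun M ↦ ?_
  have hb : ∀ x : ℝ × ℝ, |min (mahal α x) M| ≤ M := fun x ↦ by
    rw [abs_of_nonneg (le_min (mahal_nonneg _ _) (Nat.cast_nonneg M))]
    exact min_le_right _ _
  have h0 : ∀ x : ℝ × ℝ, 0 ≤ min (mahal α x) (M : ℝ) := fun x ↦
    le_min (mahal_nonneg _ _) (Nat.cast_nonneg M)
  have key := abs_integral_quadBridge_sub_le hα hst hz hw hz' hw' (ι := Unit) (fun _ ↦ u)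
    (F := fun x ↦ min (mahal α (x () - c)) M) (M := M) (fun x ↦ hb _) (L := fun _ ↦ 1)
    (fun _ ↦ zero_le_one) fun x y ↦ by
      simp only [Finset.univ_unique, Finset.sum_singleton, one_mul]
      refine (abs_min_sub_min_le_max _ _ _ _).trans (max_le (abs_sub_le_iff.2 ⟨?_, ?_⟩)
        (by simp [mahal_nonneg]))
      · have := mahal_add_le α (x () - y ()) (y () - c)
        rw [sub_add_sub_cancel] at this
        linarith!
      · have := mahal_add_le α (y () - x ()) (x () - c)
        rw [sub_add_sub_cancel, mahal_sub_comm α (y ()) (x ())] at this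
        linarith!
  simp only [Finset.univ_unique, Finset.sum_singleton, one_mul] at key
  have hi : ∀ (μ : Measure (Path s t)) [IsProbabilityMeasure μ],
      ∫⁻ f, ENNReal.ofReal (min (mahal α (f u - c)) M) ∂μ =
        ENNReal.ofReal (∫ f, min (mahal α (f u - c)) M ∂μ) := fun μ _ ↦
    (ofReal_integral_eq_lintegral_ofReal (.of_bound (hmu.min measurable_const).aestronglyMeasurable M (.of_forall fun f ↦ hb _))
      (.of_forall fun f ↦ h0 _)).symm
  calc ∫⁻ f, ENNReal.ofReal (min (mahal α (f u - c)) M) ∂(quadBridge α s t z w)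
      ≤ ENNReal.ofReal (∫ f, min (mahal α (f u - c)) M ∂(quadBridge α s t z' w') +
        ((1 - frac s t u) * mahal α (z - z') + frac s t u * mahal α (w - w'))) := by
        rw [hi]
        exact ENNReal.ofReal_le_ofReal (by linarith [(abs_le.1 key).2])
    _ = _ := by
        rw [ENNReal.ofReal_add (integral_nonneg fun f ↦ h0 _) hR, ← hi]
    _ ≤ _ := by
        gcongr with f
        exact min_le_left _ _

theorem loopKernel_self_le (hst : s < t) (u : Set.Icc s t) : loopKernel s t u u ≤ t - s := by
  have h := sub_pos.2 hst
  rw [loopKernel, min_self, max_self, div_le_iff₀ h]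
  nlinarith [u.2.1, u.2.2]

theorem loopKernel_self_nonneg (hst : s < t) (u : Set.Icc s t) : 0 ≤ loopKernel s t u u := by
  rw [loopKernel, min_self, max_self]
  exact div_nonneg (mul_nonneg (sub_nonneg.2 u.2.1) (sub_nonneg.2 u.2.2)) (sub_pos.2 hst).le

theorem exists_lintegral_mahal_loopLaw_le (hα : α ∈ Set.Ioo (-1 : ℝ) 1) :
    ∃ C : ℝ, 0 ≤ C ∧ ∀ s t : ℝ, s < t → ∀ u : Set.Icc s t,
      ∫⁻ f, ENNReal.ofReal (mahal α (f u)) ∂(loopLaw α s t) ≤ ENNReal.ofReal (C * √(t - s)) := by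
  have hi : Integrable (fun x : ℝ × ℝ ↦ mahal α x) (corrGaussian α 1) := by
    have h1 : Integrable id (corrGaussian α 1) := (hasGaussianLaw_corrGaussian hα 1).integrable
    refine (h1.norm.const_mul ‖decorrelate α‖).mono' (measurable_mahal α).aestronglyMeasurable
      (.of_forall fun x ↦ ?_)
    rw [Real.norm_eq_abs, abs_of_nonneg (mahal_nonneg _ _)]
    exact mahal_le_mul_norm α x
  refine ⟨∫ x, mahal α x ∂(corrGaussian α 1), integral_nonneg fun x ↦ mahal_nonneg _ _,
    fun s t hst u ↦ ?_⟩
  have hL := corrGauss_loopLaw hα hst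
  have hm := measurable_mahal α
  set v : ℝ≥0 := ⟨loopKernel s t u u, loopKernel_self_nonneg hst u⟩
  rw [← lintegral_map (f := fun x ↦ ENNReal.ofReal (mahal α x)) (by fun_prop) (measurable_eval u)]
  change ∫⁻ x, _ ∂((loopLaw α s t).map fun f ↦ f u) ≤ _
  rw [hL.map_eval_eq hα u (v := v) rfl, corrGaussian_eq_map_smul hα,
    lintegral_map (by fun_prop) (by fun_prop)]
  simp only [mahal_smul, abs_of_nonneg (Real.sqrt_nonneg _)]
  rw [← ofReal_integral_eq_lintegral_ofReal (hi.const_mul _)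
    (.of_forall fun x ↦ mul_nonneg (Real.sqrt_nonneg _) (mahal_nonneg _ _)), integral_const_mul,
    mul_comm]
  refine ENNReal.ofReal_le_ofReal (mul_le_mul_of_nonneg_left (Real.sqrt_le_sqrt
    (loopKernel_self_le hst u)) (integral_nonneg fun x ↦ mahal_nonneg _ _))

/-- The point is uniformity in `z` up to the boundary. Moved diagonally inward by `K √(t - s)`, the
loop stays in the quadrant with probability at least `1/2`, so conditioning at most doubles its
moments; moving back costs the same order by Lipschitz dependence. -/
theorem exists_lintegral_mahal_quadBridge_self_le (hα : α ∈ Set.Ioo (-1 : ℝ) 1) :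
    ∃ C : ℝ, 0 ≤ C ∧ ∀ s t : ℝ, s < t → ∀ z ∈ openQuadrant, ∀ u : Set.Icc s t,
      ∫⁻ f, ENNReal.ofReal (mahal α (f u - z)) ∂(quadBridge α s t z z) ≤
        ENNReal.ofReal (C * √(t - s)) := by
  obtain ⟨K, hK, hball⟩ := exists_loopLaw_closedBall_ge hα
  obtain ⟨C, hC, hloop⟩ := exists_lintegral_mahal_loopLaw_le hα
  set e : ℝ × ℝ := (1, 1)
  have he := mahal_nonneg α e
  refine ⟨2 * (C + K * mahal α e) + K * mahal α e, by positivity, fun s t hst z hz u ↦ ?_⟩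
  have hT := Real.sqrt_pos.2 (sub_pos.2 hst)
  set r := √(t - s)
  set z' : ℝ × ℝ := z + (K * r) • e with hz'd
  have hKr : 0 < K * r := by positivity
  have hz' : z' ∈ openQuadrant := by
    refine ⟨?_, ?_⟩
    · simp only [z', e, Prod.fst_add, Prod.smul_fst, smul_eq_mul, mul_one]; linarith [hz.1]
    · simp only [z', e, Prod.snd_add, Prod.smul_snd, smul_eq_mul, mul_one]; linarith [hz.2]
  have hdist : mahal α (z' - z) = K * r * mahal α e := by
    rw [hz'd, add_sub_cancel_left, mahal_smul, abs_of_pos hKr]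
  have h1 := lintegral_mahal_quadBridge_le hα hst hz hz hz' hz' u z
  rw [mahal_sub_comm α z z', ← add_mul, sub_add_cancel, one_mul, hdist] at h1
  have i1 := isProbabilityMeasure_bridgeLaw hα hst z' z'
  have i2 := (corrGauss_loopLaw hα hst).isProbabilityMeasure
  have hline : ∀ f : Path s t, ∀ x, (linePath s t z' z' + f) x = z' + f x := fun f x ↦ by
    simp [linePath]
  have hQ : 1 / 2 ≤ bridgeLaw α s t z' z' (quadrantPaths s t) := by
    rw [bridgeLaw, Measure.map_apply (measurable_linePath_add _ _) (measurableSet_quadrantPaths s t)]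
    refine (hball s t hst).trans (measure_mono fun f hf x ↦ ?_)
    rw [mem_closedBall_zero_iff] at hf
    have h3 := (f.norm_coe_le_norm x).trans hf
    rw [Prod.norm_def, max_le_iff, Real.norm_eq_abs, Real.norm_eq_abs, abs_le, abs_le] at h3
    rw [hline]
    constructor
    · simp only [z', e, Prod.fst_add, Prod.smul_fst, smul_eq_mul, mul_one]; linarith [hz.1, h3.1.1]
    · simp only [z', e, Prod.snd_add, Prod.smul_snd, smul_eq_mul, mul_one]; linarith [hz.2, h3.2.1]
  have hm : Measurable fun f : Path s t ↦ ENNReal.ofReal (mahal α (f u - z)) :=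
    ((measurable_mahal α).comp ((measurable_eval u).sub_const z)).ennreal_ofReal
  have h2 : ∫⁻ f, ENNReal.ofReal (mahal α (f u - z)) ∂(quadBridge α s t z' z') ≤
      ENNReal.ofReal (2 * ((C + K * mahal α e) * r)) := by
    rw [quadBridge, cond_eq_smul_restrict, lintegral_smul_measure, smul_eq_mul,
      ENNReal.ofReal_mul (by norm_num)]
    have h3 : (bridgeLaw α s t z' z' (quadrantPaths s t))⁻¹ ≤ ENNReal.ofReal 2 := by
      rw [ENNReal.inv_le_iff_inv_le]
      refine le_trans (le_of_eq ?_) hQ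
      rw [ENNReal.ofReal_ofNat]; simp
    refine mul_le_mul' h3 ((setLIntegral_le_lintegral _ _).trans ?_)
    rw [bridgeLaw, lintegral_map hm (measurable_linePath_add _ _)]
    simp only [hline]
    calc ∫⁻ f, ENNReal.ofReal (mahal α (z' + f u - z)) ∂(loopLaw α s t)
        ≤ ∫⁻ f, (ENNReal.ofReal (K * r * mahal α e) + ENNReal.ofReal (mahal α (f u)))
          ∂(loopLaw α s t) := by
          refine lintegral_mono fun f ↦ ?_
          rw [← ENNReal.ofReal_add (by positivity) (mahal_nonneg _ _)]
          refine ENNReal.ofReal_le_ofReal ?_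
          rw [← hdist, add_sub_right_comm]
          exact mahal_add_le _ _ _
      _ ≤ ENNReal.ofReal (K * r * mahal α e) + ENNReal.ofReal (C * r) := by
          rw [lintegral_add_left measurable_const, lintegral_const, measure_univ, mul_one]
          gcongr
          exact hloop s t hst u
      _ = _ := by
          rw [← ENNReal.ofReal_add (by positivity) (by positivity)]
          congr 1; ring
  refine h1.trans ((add_le_add_left h2 _).trans (le_of_eq ?_))
  rw [← ENNReal.ofReal_add (by positivity) (by positivity)]
  congr 1; ring

theorem bridgeLaw_eval_ne (hα : α ∈ Set.Ioo (-1 : ℝ) 1) (hst : s < t) (z w : ℝ × ℝ)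
    {u : Set.Icc s t} (hu : (u : ℝ) ∈ Set.Ioo s t) {a : ℝ × ℝ} (ha : 0 < corrForm α a a) (c : ℝ) :
    ∀ᵐ f ∂(bridgeLaw α s t z w), pairing a (f u) ≠ c := by
  have h := sub_pos.2 hst
  have hL := (corrGauss_loopLaw hα hst).map_pairing_eq (ι := Unit) (fun _ ↦ u) fun _ ↦ a
  simp only [Finset.univ_unique, Finset.sum_singleton] at hL
  have hK : 0 < loopKernel s t u u := by
    rw [loopKernel, min_self, max_self]
    exact div_pos (mul_pos (sub_pos.2 hu.1) (sub_pos.2 hu.2)) h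
  have hv : (corrForm α a a * loopKernel s t u u).toNNReal ≠ 0 := by
    simpa using mul_pos ha hK
  have hmp : Measurable fun f : Path s t ↦ pairing a (f u) :=
    (measurable_pairing a).comp (measurable_eval u)
  have hna := nullSingletonClass_gaussianReal (μ := 0) hv
  rw [← hL] at hna
  have hms : MeasurableSet {f : Path s t | pairing a (f u) ≠ c} :=
    (hmp (measurableSet_singleton c)).compl
  rw [bridgeLaw, ae_map_iff (measurable_linePath_add z w).aemeasurable hms]
  have h1 : ∀ᵐ x ∂((loopLaw α s t).map fun f ↦ pairing a (f u)),
      x ≠ c - pairing a (linePath s t z w u) := by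
    simp [ae_iff, measure_singleton]
  filter_upwards [ae_of_ae_map hmp.aemeasurable h1] with f hf hc
  refine hf ?_
  rw [← hc, ContinuousMap.add_apply, pairing_add_right]
  ring

theorem quadBridge_absolutelyContinuous (z w : ℝ × ℝ) :
    quadBridge α s t z w ≪ bridgeLaw α s t z w := cond_absolutelyContinuous

theorem quadBridge_start (hα : α ∈ Set.Ioo (-1 : ℝ) 1) (hst : s < t) (z w : ℝ × ℝ)
    {u : Set.Icc s t} (hu : (u : ℝ) = s) : ∀ᵐ f ∂(quadBridge α s t z w), f u = z :=
  (quadBridge_absolutelyContinuous z w).ae_le (bridgeLaw_start hα hst z w hu)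

theorem quadBridge_terminal (hα : α ∈ Set.Ioo (-1 : ℝ) 1) (hst : s < t) (z w : ℝ × ℝ)
    {u : Set.Icc s t} (hu : (u : ℝ) = t) : ∀ᵐ f ∂(quadBridge α s t z w), f u = w :=
  (quadBridge_absolutelyContinuous z w).ae_le (bridgeLaw_terminal hα hst z w hu)

/-- At interior times each coordinate of the free bridge is a nondegenerate Gaussian and so almost
surely nonzero; the endpoints are in the open quadrant by assumption. -/
theorem quadBridge_mem_openQuadrant (hα : α ∈ Set.Ioo (-1 : ℝ) 1) (hst : s < t) {z w : ℝ × ℝ}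
    (hz : z ∈ openQuadrant) (hw : w ∈ openQuadrant) (u : Set.Icc s t) :
    ∀ᵐ f ∂(quadBridge α s t z w), f u ∈ openQuadrant := by
  rcases u.2.1.eq_or_lt with h | h
  · filter_upwards [quadBridge_start hα hst z w h.symm] with f hf
    rwa [hf]
  rcases u.2.2.eq_or_lt with h' | h'
  · filter_upwards [quadBridge_terminal hα hst z w h'] with f hf
    rwa [hf]
  have h1 := (quadBridge_absolutelyContinuous z w).ae_le
    (bridgeLaw_eval_ne hα hst z w ⟨h, h'⟩ (a := (1, 0)) (by simp [corrForm]) 0)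
  have h2 := (quadBridge_absolutelyContinuous z w).ae_le
    (bridgeLaw_eval_ne hα hst z w ⟨h, h'⟩ (a := (0, 1)) (by simp [corrForm]) 0)
  have h3 : ∀ᵐ f ∂(quadBridge α s t z w), f ∈ quadrantPaths s t :=
    ae_cond_mem (measurableSet_quadrantPaths s t)
  filter_upwards [h1, h2, h3] with f hf1 hf2 hf3
  simp only [pairing, one_mul, zero_mul, add_zero, zero_add] at hf1 hf2
  exact ⟨lt_of_le_of_ne (hf3 u).1 hf1.symm, lt_of_le_of_ne (hf3 u).2 hf2.symm⟩

end QuadrantExcursion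

/-! ### Uniform moments of increments -/

namespace QuadrantExcursion

variable {α s t S T : ℝ}

/-- The constant `C` bounds the first moments of the displacement of all conditioned loops. -/
def LoopBound (α C : ℝ) : Prop :=
  ∀ s t : ℝ, s < t → ∀ z ∈ openQuadrant, ∀ u : Set.Icc s t,
    ∫⁻ f, ENNReal.ofReal (mahal α (f u - z)) ∂(quadBridge α s t z z) ≤
      ENNReal.ofReal (C * √(t - s))

theorem LoopBound.start (hα : α ∈ Set.Ioo (-1 : ℝ) 1) {C : ℝ} (h : LoopBound α C) (hC : 0 ≤ C)
    (hst : s < t) {z w : ℝ × ℝ} (hz : z ∈ openQuadrant) (hw : w ∈ openQuadrant)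
    (u : Set.Icc s t) :
    ∫⁻ f, ENNReal.ofReal (mahal α (f u - z)) ∂(quadBridge α s t z w) ≤
      ENNReal.ofReal (C * √(t - s) + frac s t u * mahal α (w - z)) := by
  refine (lintegral_mahal_quadBridge_le hα hst hz hw hz hz u z).trans ?_
  rw [sub_self, mahal_zero, mul_zero, zero_add, ENNReal.ofReal_add (by positivity)
    (mul_nonneg (frac_mem hst u.2).1 (mahal_nonneg _ _))]
  gcongr
  exact h s t hst z hz u

theorem LoopBound.terminal (hα : α ∈ Set.Ioo (-1 : ℝ) 1) {C : ℝ} (h : LoopBound α C) (hC : 0 ≤ C)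
    (hst : s < t) {z w : ℝ × ℝ} (hz : z ∈ openQuadrant) (hw : w ∈ openQuadrant)
    (u : Set.Icc s t) :
    ∫⁻ f, ENNReal.ofReal (mahal α (f u - w)) ∂(quadBridge α s t z w) ≤
      ENNReal.ofReal (C * √(t - s) + (1 - frac s t u) * mahal α (w - z)) := by
  refine (lintegral_mahal_quadBridge_le hα hst hz hw hw hw u w).trans ?_
  rw [sub_self, mahal_zero, mul_zero, add_zero, mahal_sub_comm α z w,
    ENNReal.ofReal_add (by positivity)
      (mul_nonneg (sub_nonneg.2 (frac_mem hst u.2).2) (mahal_nonneg _ _))]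
  gcongr
  exact h s t hst w hw u

/-- The first moments of the increments over the two halves of an interval are controlled by that
over the interval. -/
theorem LoopBound.halves (hα : α ∈ Set.Ioo (-1 : ℝ) 1) {C : ℝ} (h : LoopBound α C) (hC : 0 ≤ C)
    (hST : S < T) {z w : ℝ × ℝ} (hz : z ∈ openQuadrant) (hw : w ∈ openQuadrant)
    {a m b : Set.Icc S T} (hab : (a : ℝ) < b) (hm : (m : ℝ) = (a + b) / 2) {D : ℝ}
    (hD : ∫⁻ f, ENNReal.ofReal (mahal α (f b - f a)) ∂(quadBridge α S T z w) ≤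
      ENNReal.ofReal D) (hD0 : 0 ≤ D) :
    ∫⁻ f, ENNReal.ofReal (mahal α (f m - f a)) ∂(quadBridge α S T z w) ≤
        ENNReal.ofReal (D / 2 + C * √(b - a)) ∧
      ∫⁻ f, ENNReal.ofReal (mahal α (f b - f m)) ∂(quadBridge α S T z w) ≤
        ENNReal.ofReal (D / 2 + C * √(b - a)) := by
  have i1 := isProbabilityMeasure_quadBridge hα hST hz hw
  have hba := sub_pos.2 hab
  have hmm : (m : ℝ) ∈ Set.Icc (a : ℝ) b := by rw [hm]; constructor <;> linarith
  let lo : Set.Icc (a : ℝ) b := ⟨a, le_rfl, hab.le⟩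
  let hi : Set.Icc (a : ℝ) b := ⟨b, hab.le, le_rfl⟩
  let mi : Set.Icc (a : ℝ) b := ⟨m, hmm⟩
  have hfr : frac (a : ℝ) b mi = 1 / 2 := by
    simp only [frac, mi, hm]; field_simp; ring
  have hmeas : ∀ x y : Set.Icc (a : ℝ) b, Measurable fun p : (Path S a × Path b T) × Path a b ↦
      ENNReal.ofReal (mahal α (p.2 x - p.2 y)) := fun x y ↦
    ((measurable_mahal α).comp (((measurable_eval x).comp measurable_snd).sub
      ((measurable_eval y).comp measurable_snd))).ennreal_ofReal
  have hfin : ∫⁻ f, (ENNReal.ofReal (C * √(b - a)) + ENNReal.ofReal (1 / 2) *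
      ENNReal.ofReal (mahal α (f b - f a))) ∂(quadBridge α S T z w) ≤
        ENNReal.ofReal (D / 2 + C * √(b - a)) := by
    have hmba : Measurable fun f : Path S T ↦ ENNReal.ofReal (mahal α (f b - f a)) :=
      ((measurable_mahal α).comp ((measurable_eval b).sub (measurable_eval a))).ennreal_ofReal
    rw [lintegral_add_left measurable_const, lintegral_const, measure_univ, mul_one,
      lintegral_const_mul _ hmba]
    refine (add_le_add_right (mul_le_mul_right hD _) _).trans (le_of_eq ?_)
    rw [← ENNReal.ofReal_mul (by norm_num), ← ENNReal.ofReal_add (by positivity) (by positivity)]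
    congr 1; ring
  have hae : ∀ᵐ f ∂(quadBridge α S T z w), f a ∈ openQuadrant ∧ f b ∈ openQuadrant :=
    (quadBridge_mem_openQuadrant hα hST hz hw a).and (quadBridge_mem_openQuadrant hα hST hz hw b)
  have hsplit : ∀ x : ℝ × ℝ, ENNReal.ofReal (C * √(b - a) + 1 / 2 * mahal α x) =
      ENNReal.ofReal (C * √(b - a)) + ENNReal.ofReal (1 / 2) * ENNReal.ofReal (mahal α x) :=
    fun x ↦ by
      rw [ENNReal.ofReal_add (by positivity) (mul_nonneg (by norm_num) (mahal_nonneg _ _)),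
        ENNReal.ofReal_mul (p := 1 / 2) (by norm_num)]
  constructor
  -- Given the path outside `(a, b)`, the inside is a conditioned bridge from `f a` to `f b`, whose
  -- midpoint is on average within `C √(b - a)` plus half the distance of the ends.
  · refine (lintegral_quadBridge_resample a.2.1 hab b.2.2 hα z w (hmeas mi lo)).le.trans
      (le_trans (lintegral_mono_ae ?_) hfin)
    filter_upwards [hae] with f hf
    rw [← hsplit]
    have h1 := h.start hα hC hab hf.1 hf.2 mi
    rw [hfr] at h1
    refine le_trans (lintegral_congr_ae ?_).le h1
    filter_upwards [quadBridge_start hα hab (f a) (f b) (u := lo) rfl] with g hg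
    rw [hg]
  · refine (lintegral_quadBridge_resample a.2.1 hab b.2.2 hα z w (hmeas hi mi)).le.trans
      (le_trans (lintegral_mono_ae ?_) hfin)
    filter_upwards [hae] with f hf
    rw [← hsplit]
    have h1 := h.terminal hα hC hab hf.1 hf.2 mi
    rw [hfr, show (1 : ℝ) - 1 / 2 = 1 / 2 by norm_num] at h1
    refine le_trans (lintegral_congr_ae ?_).le h1
    filter_upwards [quadBridge_terminal hα hab (f a) (f b) (u := hi) rfl] with g hg
    rw [hg, mahal_sub_comm]

/-- First moments of increments of the conditioned bridges. -/
theorem LoopBound.lintegral_sub_le (hα : α ∈ Set.Ioo (-1 : ℝ) 1) {C : ℝ} (h : LoopBound α C)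
    (hC : 0 ≤ C) {z w : ℝ × ℝ} (hz : z ∈ openQuadrant) (hw : w ∈ openQuadrant) {R : ℝ}
    (hR : mahal α (w - z) ≤ R) {a b : Set.Icc (0 : ℝ) 1} (hab : (a : ℝ) < b) :
    ∫⁻ f, ENNReal.ofReal (mahal α (f b - f a)) ∂(quadBridge α 0 1 z w) ≤
      ENNReal.ofReal ((6 * C + 4 * R) * √(b - a)) := by
  have i1 := isProbabilityMeasure_quadBridge hα zero_lt_one hz hw
  have hR0 : 0 ≤ R := (mahal_nonneg _ _).trans hR
  -- Halving requires `(K / 2 + C) √2 ≤ K`, for which `K ≥ 6C` suffices as `√2 ≤ 3/2`; intervals of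
  -- length at least `1/3` require `2 (C + R) ≤ K / 2`.
  set K := 6 * C + 4 * R with hK
  have hK0 : 0 ≤ K := by positivity
  have hbase : ∀ a b : Set.Icc (0 : ℝ) 1, 1 / 3 ≤ (b : ℝ) - a →
      ∫⁻ f, ENNReal.ofReal (mahal α (f b - f a)) ∂(quadBridge α 0 1 z w) ≤
        ENNReal.ofReal (K * √(b - a)) := by
    intro a b hab
    have h1 : ∀ u : Set.Icc (0 : ℝ) 1, ∫⁻ f, ENNReal.ofReal (mahal α (f u - z))
        ∂(quadBridge α 0 1 z w) ≤ ENNReal.ofReal (C + R) := by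
      intro u
      refine (h.start hα hC zero_lt_one hz hw u).trans (ENNReal.ofReal_le_ofReal ?_)
      rw [sub_zero, Real.sqrt_one, mul_one]
      have := frac_mem zero_lt_one u.2
      nlinarith [this.1, this.2, mahal_nonneg α (w - z)]
    have hmu : ∀ u : Set.Icc (0 : ℝ) 1, Measurable fun f : Path 0 1 ↦
        ENNReal.ofReal (mahal α (f u - z)) := fun u ↦
      ((measurable_mahal α).comp ((measurable_eval u).sub_const z)).ennreal_ofReal
    calc ∫⁻ f, ENNReal.ofReal (mahal α (f b - f a)) ∂(quadBridge α 0 1 z w)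
        ≤ ∫⁻ f, (ENNReal.ofReal (mahal α (f b - z)) + ENNReal.ofReal (mahal α (f a - z)))
          ∂(quadBridge α 0 1 z w) := by
          refine lintegral_mono fun f ↦ ?_
          rw [← ENNReal.ofReal_add (mahal_nonneg _ _) (mahal_nonneg _ _)]
          refine ENNReal.ofReal_le_ofReal ?_
          have := mahal_add_le α (f b - z) (z - f a)
          rwa [sub_add_sub_cancel, mahal_sub_comm α z] at this
      _ ≤ ENNReal.ofReal (C + R) + ENNReal.ofReal (C + R) := by
          rw [lintegral_add_left (hmu b)]
          exact add_le_add (h1 b) (h1 a)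
      _ ≤ _ := by
          rw [← ENNReal.ofReal_add (by positivity) (by positivity)]
          refine ENNReal.ofReal_le_ofReal ?_
          have h2 : 1 / 2 ≤ √((b : ℝ) - a) := Real.le_sqrt_of_sq_le (by linarith)
          nlinarith
  have key : ∀ n : ℕ, ∀ a b : Set.Icc (0 : ℝ) 1, 1 / 3 / 2 ^ n ≤ (b : ℝ) - a →
      ∫⁻ f, ENNReal.ofReal (mahal α (f b - f a)) ∂(quadBridge α 0 1 z w) ≤
        ENNReal.ofReal (K * √(b - a)) := by
    intro n
    induction n with
    | zero => intro a b hab; exact hbase a b (by simpa using hab)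
    | succ n ih =>
      intro a b hab
      rcases le_or_gt (1 / 3) ((b : ℝ) - a) with h3 | h3
      · exact hbase a b h3
      have hpos : 0 < (b : ℝ) - a := lt_of_lt_of_le (by positivity) hab
      have h2n : 1 / 3 / 2 ^ n ≤ 2 * ((b : ℝ) - a) := by
        rw [pow_succ, ← div_div, div_le_iff₀ (by norm_num)] at hab; linarith
      have hfinal : K * √(2 * ((b : ℝ) - a)) / 2 + C * √(2 * ((b : ℝ) - a)) ≤ K * √(b - a) := by
        rw [Real.sqrt_mul (by norm_num)]
        have h4 : √2 ≤ 3 / 2 := Real.sqrt_le_iff.2 ⟨by norm_num, by norm_num⟩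
        have h5 : (K / 2 + C) * √2 ≤ K := by
          calc (K / 2 + C) * √2 ≤ (K / 2 + C) * (3 / 2) := by gcongr
            _ ≤ K := by rw [hK]; linarith
        nlinarith [Real.sqrt_nonneg ((b : ℝ) - a)]
      -- An interval shorter than `1/3` can be doubled to the right or to the left within `[0, 1]`,
      -- and is then one half of the doubled interval.
      rcases le_or_gt (2 * (b : ℝ) - a) 1 with h4 | h4
      · let b' : Set.Icc (0 : ℝ) 1 := ⟨2 * b - a, by linarith [a.2.1, b.2.1], h4⟩
        have e : (b' : ℝ) - a = 2 * (b - a) := by simp only [b']; ring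
        have h5 := ih a b' (by rw [e]; exact h2n)
        have h6 := (h.halves hα hC zero_lt_one hz hw (a := a) (m := b) (b := b') (by linarith)
          (by simp only [b']; ring) h5 (by positivity)).1
        rw [e] at h6
        exact h6.trans (ENNReal.ofReal_le_ofReal hfinal)
      · let a' : Set.Icc (0 : ℝ) 1 := ⟨2 * a - b, by linarith, by linarith [a.2.2]⟩
        have e : (b : ℝ) - a' = 2 * (b - a) := by simp only [a']; ring
        have h5 := ih a' b (by rw [e]; exact h2n)
        have h6 := (h.halves hα hC zero_lt_one hz hw (a := a') (m := a) (b := b) (by linarith)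
          (by simp only [a']; ring) h5 (by positivity)).2
        rw [e] at h6
        exact h6.trans (ENNReal.ofReal_le_ofReal hfinal)
  have hpos := sub_pos.2 hab
  obtain ⟨n, hn⟩ := exists_pow_lt_of_lt_one hpos (show (1 / 2 : ℝ) < 1 by norm_num)
  refine key n a b (le_trans ?_ hn.le)
  rw [div_pow, one_pow]
  have : (0 : ℝ) < 2 ^ n := by positivity
  gcongr
  norm_num

theorem LoopBound.lintegral_abs_sub_le (hα : α ∈ Set.Ioo (-1 : ℝ) 1) {C : ℝ} (h : LoopBound α C)
    (hC : 0 ≤ C) {z w : ℝ × ℝ} (hz : z ∈ openQuadrant) (hw : w ∈ openQuadrant) {R : ℝ}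
    (hR : mahal α (w - z) ≤ R) (a b : Set.Icc (0 : ℝ) 1) :
    ∫⁻ f, ENNReal.ofReal (mahal α (f b - f a)) ∂(quadBridge α 0 1 z w) ≤
      ENNReal.ofReal ((6 * C + 4 * R) * √|b - a|) := by
  rcases lt_trichotomy (a : ℝ) b with hab | hab | hab
  · rw [abs_of_pos (sub_pos.2 hab)]
    exact h.lintegral_sub_le hα hC hz hw hR hab
  · have : a = b := Subtype.ext hab
    subst this
    simp [mahal_zero]
  · rw [abs_sub_comm, abs_of_pos (sub_pos.2 hab)]
    refine le_trans (lintegral_congr fun f ↦ ?_).le (h.lintegral_sub_le hα hC hz hw hR hab)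
    rw [mahal_sub_comm]

/-- A random variable whose two-copy fourth moment and first moment are controlled has a controlled
fourth moment. -/
theorem lintegral_pow_four_le_of_two_copy {Ω : Type*} [MeasurableSpace Ω] {ν : Measure Ω}
    [IsProbabilityMeasure ν] {X : Ω → ℝ} (hX : Measurable X) {c : ℝ} (hc : 0 < c) {A : ℝ}
    (hA : 0 ≤ A)
    (h1 : ∫⁻ ω, ENNReal.ofReal |X ω| ∂ν ≤ ENNReal.ofReal c)
    (h4 : ∫⁻ p, ENNReal.ofReal ((X p.1 - X p.2) ^ 4) ∂(ν.prod ν) ≤ ENNReal.ofReal A) :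
    ∫⁻ ω, ENNReal.ofReal (X ω ^ 4) ∂ν ≤ ENNReal.ofReal (16 * A + 256 * c ^ 4) := by
  -- By Markov this event has probability at least `1/2`. When the second copy lies in it, `X⁴` is
  -- controlled by the fourth power of the difference plus a constant.
  let B : Set Ω := {ω | |X ω| ≤ 2 * c}
  have hB : MeasurableSet B := measurableSet_le hX.abs measurable_const
  have hBc : ν Bᶜ ≤ 1 / 2 := by
    have h2 := mul_meas_ge_le_lintegral₀ (μ := ν) (f := fun ω ↦ ENNReal.ofReal |X ω|)
      (by fun_prop) (ENNReal.ofReal (2 * c))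
    have h3 : ENNReal.ofReal (2 * c) * ν Bᶜ ≤ ENNReal.ofReal c := by
      refine le_trans (mul_le_mul_right (measure_mono fun ω hω ↦ ?_) _) (h2.trans h1)
      exact ENNReal.ofReal_le_ofReal (not_le.1 (show ¬ |X ω| ≤ 2 * c from hω)).le
    rw [ENNReal.ofReal_mul (by norm_num), ENNReal.ofReal_ofNat, mul_right_comm] at h3
    have h4 : (2 * ν Bᶜ) * ENNReal.ofReal c ≤ 1 * ENNReal.ofReal c := by rwa [one_mul]
    have h5 := (ENNReal.mul_le_mul_iff_left (by simpa using hc) ENNReal.ofReal_ne_top).1 h4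
    rwa [ENNReal.le_div_iff_mul_le (.inl (by norm_num)) (.inl (by norm_num)), mul_comm]
  have hB2 : 1 / 2 ≤ ν B := by
    have h2 := prob_add_prob_compl (μ := ν) hB
    by_contra! hlt
    have h3 : ν B + ν Bᶜ < 1 / 2 + 1 / 2 := ENNReal.add_lt_add_of_lt_of_le
      (measure_ne_top _ _) hlt hBc
    rw [h2, ENNReal.add_halves] at h3
    exact lt_irrefl _ h3
  have h5 : (∫⁻ ω, ENNReal.ofReal (X ω ^ 4) ∂ν) * ν B ≤ ENNReal.ofReal (8 * A + 128 * c ^ 4) := by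
    have h6 : ν B = ∫⁻ ω, B.indicator 1 ω ∂ν := (lintegral_indicator_one hB).symm
    rw [h6, ← lintegral_prod_mul (f := fun ω ↦ ENNReal.ofReal (X ω ^ 4)) (by fun_prop)
      ((measurable_one.indicator hB).aemeasurable)]
    calc ∫⁻ p, ENNReal.ofReal (X p.1 ^ 4) * B.indicator 1 p.2 ∂(ν.prod ν)
        ≤ ∫⁻ p, (ENNReal.ofReal 8 * ENNReal.ofReal ((X p.1 - X p.2) ^ 4) +
          ENNReal.ofReal (128 * c ^ 4)) ∂(ν.prod ν) := by
          refine lintegral_mono fun p ↦ ?_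
          by_cases hp : p.2 ∈ B
          · rw [Set.indicator_of_mem hp, Pi.one_apply, mul_one,
              ← ENNReal.ofReal_mul (by norm_num), ← ENNReal.ofReal_add (by positivity)
                (by positivity)]
            refine ENNReal.ofReal_le_ofReal ?_
            have h7 : |X p.2| ^ 4 ≤ (2 * c) ^ 4 := pow_le_pow_left₀ (abs_nonneg _) hp 4
            rw [(by decide : Even 4).pow_abs] at h7
            have h8 : X p.1 ^ 4 ≤ 8 * ((X p.1 - X p.2) ^ 4 + X p.2 ^ 4) := by
              set d := X p.1 - X p.2 with hd
              have e : X p.1 = d + X p.2 := by rw [hd]; ring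
              have h9 : (d + X p.2) ^ 2 ≤ 2 * (d ^ 2 + X p.2 ^ 2) := by
                nlinarith [sq_nonneg (d - X p.2)]
              calc X p.1 ^ 4 = ((d + X p.2) ^ 2) ^ 2 := by rw [e]; ring
                _ ≤ (2 * (d ^ 2 + X p.2 ^ 2)) ^ 2 := by gcongr
                _ ≤ _ := by nlinarith [sq_nonneg (d ^ 2 - X p.2 ^ 2)]
            have h10 : (2 * c) ^ 4 = 16 * c ^ 4 := by ring
            linarith
          · rw [Set.indicator_of_notMem hp, mul_zero]
            exact zero_le
      _ ≤ ENNReal.ofReal (8 * A + 128 * c ^ 4) := by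
          rw [lintegral_add_right _ measurable_const, lintegral_const, measure_univ, mul_one,
            lintegral_const_mul _ (by fun_prop), ENNReal.ofReal_add (by positivity) (by positivity),
            ENNReal.ofReal_mul (p := 8) (by norm_num)]
          gcongr
  have h9 : (∫⁻ ω, ENNReal.ofReal (X ω ^ 4) ∂ν) * (1 / 2) ≤ ENNReal.ofReal (8 * A + 128 * c ^ 4) :=
    (mul_le_mul_right hB2 _).trans h5
  rw [mul_one_div, ENNReal.div_le_iff (by norm_num) (by norm_num)] at h9
  refine h9.trans (le_of_eq ?_)
  rw [← ENNReal.ofReal_ofNat 2, ← ENNReal.ofReal_mul (by positivity)]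
  congr 1; ring

/-- Convexity bounds the fluctuations of each coordinate increment and the first moment bounds its
location. The extra `1` in the constant keeps the threshold positive. The bound depends on the
endpoints only through `R`, which gives tightness. -/
theorem LoopBound.lintegral_norm_pow_four_le (hα : α ∈ Set.Ioo (-1 : ℝ) 1) {C : ℝ}
    (h : LoopBound α C) (hC : 0 ≤ C) {z w : ℝ × ℝ} (hz : z ∈ openQuadrant) (hw : w ∈ openQuadrant)
    {R : ℝ} (hR : mahal α (w - z) ≤ R) (u v : Set.Icc (0 : ℝ) 1) :
    ∫⁻ f, ENNReal.ofReal (‖f u - f v‖ ^ 4) ∂(quadBridge α 0 1 z w) ≤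
      ENNReal.ofReal (2 * (16 * 72 + 256 * (6 * C + 4 * R + 1) ^ 4) * ((u : ℝ) - v) ^ 2) := by
  rcases eq_or_ne u v with rfl | huv
  · simp
  have i1 := isProbabilityMeasure_quadBridge hα zero_lt_one hz hw
  have hR0 : 0 ≤ R := (mahal_nonneg _ _).trans hR
  have hpos : 0 < |(u : ℝ) - v| := abs_pos.2 (sub_ne_zero.2 fun h ↦ huv (Subtype.ext h))
  have hsq : (√|(u : ℝ) - v|) ^ 4 = ((u : ℝ) - v) ^ 2 := by
    rw [show 4 = 2 * 2 by norm_num, pow_mul, Real.sq_sqrt hpos.le, sq_abs]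
  have key : ∀ e : ℝ × ℝ, (∀ x, |pairing e x| ≤ ‖x‖) →
      ∫⁻ f, ENNReal.ofReal (pairing e (f u - f v) ^ 4) ∂(quadBridge α 0 1 z w) ≤
        ENNReal.ofReal ((16 * 72 + 256 * (6 * C + 4 * R + 1) ^ 4) * ((u : ℝ) - v) ^ 2) := by
    intro e he
    have he' : ∀ x, |pairing e x| ≤ mahal α x := fun x ↦ (he x).trans (norm_le_mahal hα x)
    have hX : Measurable fun f : Path 0 1 ↦ pairing e (f u - f v) :=
      (measurable_pairing e).comp ((measurable_eval u).sub (measurable_eval v))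
    refine (lintegral_pow_four_le_of_two_copy hX
      (c := (6 * C + 4 * R + 1) * √|(u : ℝ) - v|) (A := 72 * ((u : ℝ) - v) ^ 2) (by positivity)
      (by positivity) ?_ (lintegral_pairing_sub_pow_four_le hα zero_lt_one hz hw he' u v)).trans
      (le_of_eq ?_)
    · refine (lintegral_mono fun f ↦ ENNReal.ofReal_le_ofReal (he' _)).trans
        ((h.lintegral_abs_sub_le hα hC hz hw hR v u).trans (ENNReal.ofReal_le_ofReal ?_))
      exact mul_le_mul_of_nonneg_right (by linarith) (Real.sqrt_nonneg _)
    · rw [mul_pow, hsq]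
      congr 1; ring
  have hm : ∀ e, Measurable fun f : Path 0 1 ↦ ENNReal.ofReal (pairing e (f u - f v) ^ 4) :=
    fun e ↦ (((measurable_pairing e).comp
      ((measurable_eval u).sub (measurable_eval v))).pow_const 4).ennreal_ofReal
  calc ∫⁻ f, ENNReal.ofReal (‖f u - f v‖ ^ 4) ∂(quadBridge α 0 1 z w)
      ≤ ∫⁻ f, (ENNReal.ofReal (pairing (1, 0) (f u - f v) ^ 4) +
        ENNReal.ofReal (pairing (0, 1) (f u - f v) ^ 4)) ∂(quadBridge α 0 1 z w) := by
        refine lintegral_mono fun f ↦ ?_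
        rw [← ENNReal.ofReal_add (by positivity) (by positivity)]
        refine ENNReal.ofReal_le_ofReal ?_
        simp only [pairing, one_mul, zero_mul, add_zero, zero_add, Prod.norm_def, Real.norm_eq_abs]
        rcases max_choice |(f u - f v).1| |(f u - f v).2| with h | h <;> rw [h] <;>
          rw [(by decide : Even 4).pow_abs]
        · exact le_add_of_nonneg_right (by positivity)
        · exact le_add_of_nonneg_left (by positivity)
    _ ≤ _ := by
        rw [lintegral_add_left (hm _)]
        refine (add_le_add (key _ fun x ↦ ?_) (key _ fun x ↦ ?_)).trans (le_of_eq ?_)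
        · simpa [pairing] using norm_fst_le x
        · simpa [pairing] using norm_snd_le x
        · rw [← ENNReal.ofReal_add (by positivity) (by positivity)]
          congr 1; ring

end QuadrantExcursion

/-! ### Quasi-invariance and repulsion from the boundary -/

namespace QuadrantExcursion

variable {α s t : ℝ}

/-- The normalised covariance function of the loop at an interior time. -/
noncomputable def tent (x : Set.Icc s t) (u : Set.Icc s t) : ℝ :=
  loopKernel s t u x / loopKernel s t x x

@[fun_prop] theorem continuous_tent (x : Set.Icc s t) : Continuous (tent x) := by
  unfold tent loopKernel; fun_prop

theorem loopKernel_nonneg (hst : s < t) (u v : Set.Icc s t) : 0 ≤ loopKernel s t u v :=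
  div_nonneg (mul_nonneg (sub_nonneg.2 (le_min u.2.1 v.2.1)) (sub_nonneg.2 (max_le u.2.2 v.2.2)))
    (sub_pos.2 hst).le

theorem tent_nonneg (hst : s < t) (x u : Set.Icc s t) : 0 ≤ tent x u :=
  div_nonneg (loopKernel_nonneg hst _ _) (loopKernel_nonneg hst _ _)

theorem loopKernel_self_pos {x : Set.Icc s t} (hx : (x : ℝ) ∈ Set.Ioo s t) :
    0 < loopKernel s t x x := by
  rw [loopKernel, min_self, max_self]
  exact div_pos (mul_pos (sub_pos.2 hx.1) (sub_pos.2 hx.2)) (sub_pos.2 (hx.1.trans hx.2))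

theorem tent_self {x : Set.Icc s t} (hx : (x : ℝ) ∈ Set.Ioo s t) : tent x x = 1 :=
  div_self (loopKernel_self_pos hx).ne'

/-- The path `u ↦ tent x u • h`. -/
noncomputable def tentPath (x : Set.Icc s t) (h : ℝ × ℝ) : Path s t where
  toFun u := tent x u • h

/-- Replace the value at time `x` of a loop. -/
noncomputable def setValue (x : Set.Icc s t) (f : Path s t) (ξ : ℝ × ℝ) : Path s t :=
  f + tentPath x (ξ - f x)

theorem continuous_setValue (x : Set.Icc s t) :
    Continuous fun p : Path s t × (ℝ × ℝ) ↦ setValue x p.1 p.2 := by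
  refine ContinuousMap.continuous_of_continuous_uncurry _ ?_
  simp only [setValue, tentPath, ContinuousMap.add_apply, ContinuousMap.coe_mk,
    Function.uncurry_def]
  fun_prop

theorem setValue_self {x : Set.Icc s t} (hx : (x : ℝ) ∈ Set.Ioo s t) (f : Path s t) (ξ : ℝ × ℝ) :
    setValue x f ξ x = ξ := by
  simp [setValue, tentPath, tent_self hx]

/-- Subtracting from the loop its value at `x` times the tent leaves a process independent of that
value, which may thus be replaced by an independent copy. -/
theorem map_setValue_loopLaw (hα : α ∈ Set.Ioo (-1 : ℝ) 1) {x : Set.Icc s t}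
    (hx : (x : ℝ) ∈ Set.Ioo s t) {v : ℝ≥0} (hv : (v : ℝ) = loopKernel s t x x) :
    ((loopLaw α s t).prod (corrGaussian α v)).map (fun p ↦ setValue x p.1 p.2) =
      loopLaw α s t := by
  have hst := hx.1.trans hx.2
  have hL := corrGauss_loopLaw hα hst
  have hpos := loopKernel_self_pos hx
  refine (CorrGauss.map_path_eq (continuous_setValue x).measurable
    ((hL.prod (corrGauss_corrGaussian hα v)).sum (A := Fin 3)
      (fun u ↦ ![1, tent x u, -tent x u]) (fun u ↦ ![Sum.inl u, Sum.inr (), Sum.inl x])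
      (fun u p ↦ ?_) fun u u' ↦ ?_)).path_measure_eq hL
  · simp only [setValue, tentPath, ContinuousMap.add_apply, ContinuousMap.coe_mk,
      Fin.sum_univ_three, Matrix.cons_val, Sum.elim_inl, Sum.elim_inr, id]
    module
  · simp only [Fin.sum_univ_three, Matrix.cons_val, Sum.elim_inl, Sum.elim_inr, hv, tent,
      loopKernel_comm x u']
    field_simp
    ring

/-- Quasi-invariance of the Brownian loop under multiples of a tent function. -/
theorem lintegral_loopLaw_add_tentPath (hα : α ∈ Set.Ioo (-1 : ℝ) 1) {x : Set.Icc s t}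
    (hx : (x : ℝ) ∈ Set.Ioo s t) {v : ℝ≥0} (hv : (v : ℝ) = loopKernel s t x x) (h : ℝ × ℝ)
    {φ : Path s t → ℝ≥0∞} (hφ : Measurable φ) :
    ∫⁻ f, φ (f + tentPath x h) ∂(loopLaw α s t) =
      ∫⁻ f, φ f * shiftDensity α v h (f x) ∂(loopLaw α s t) := by
  have i1 := (corrGauss_loopLaw hα (hx.1.trans hx.2)).isProbabilityMeasure
  have hm := (continuous_setValue x).measurable
  have hv0 : v ≠ 0 := by rw [← NNReal.coe_ne_zero, hv]; exact (loopKernel_self_pos hx).ne'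
  have hsh := measurable_shiftDensity α v h
  have h1 : Measurable fun f ↦ φ (f + tentPath x h) := hφ.comp (measurable_add_const _)
  have h2 : Measurable fun f : Path s t ↦ φ f * shiftDensity α v h (f x) :=
    hφ.mul (hsh.comp (measurable_eval x))
  -- A tent shift only moves the resampled value, so Cameron–Martin in the plane suffices.
  have e1 : ∀ f ξ, setValue x f ξ + tentPath x h = setValue x f (h + ξ) := fun f ξ ↦ by
    ext1 u
    simp only [setValue, tentPath, ContinuousMap.add_apply, ContinuousMap.coe_mk]
    module
  rw [← map_setValue_loopLaw hα hx hv, lintegral_map h1 hm, lintegral_map h2 hm]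
  refine (lintegral_prod _ (h1.comp hm).aemeasurable).trans (Eq.trans (lintegral_congr fun f ↦ ?_)
    (lintegral_prod _ (h2.comp hm).aemeasurable).symm)
  simp only [Function.comp_apply, e1, setValue_self hx]
  have h3 : Measurable fun ξ ↦ φ (setValue x f ξ) := hφ.comp (hm.comp measurable_prodMk_left)
  rw [← lintegral_map (f := fun ξ ↦ φ (setValue x f ξ)) h3 (measurable_const_add h),
    corrGaussian_map_add hα hv0, lintegral_withDensity_eq_lintegral_mul _ hsh h3]
  exact lintegral_congr fun ξ ↦ mul_comm _ _

theorem exp_mul_bridgeLaw_le (hα : α ∈ Set.Ioo (-1 : ℝ) 1) {x : Set.Icc s t}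
    (hx : (x : ℝ) ∈ Set.Ioo s t) {v : ℝ≥0} (hv : (v : ℝ) = loopKernel s t x x) (h : ℝ × ℝ)
    (z w : ℝ × ℝ) {B : Set (Path s t)} (hB : MeasurableSet B) {c : ℝ≥0∞}
    (hc : ∀ f ∈ B, c ≤ shiftDensity α v h (f x - linePath s t z w x)) :
    c * bridgeLaw α s t z w B ≤ bridgeLaw α s t z w ((· + tentPath x h) ⁻¹' B) := by
  have hl := measurable_linePath_add (s := s) (t := t) z w
  have hB' := measurable_add_const (tentPath x h) hB
  rw [bridgeLaw, Measure.map_apply hl hB, Measure.map_apply hl hB']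
  have key := lintegral_loopLaw_add_tentPath hα hx hv h
    (measurable_one.indicator (hl hB) : Measurable (((linePath s t z w + ·) ⁻¹' B).indicator
      (1 : Path s t → ℝ≥0∞)))
  have e1 : ∫⁻ f, ((linePath s t z w + ·) ⁻¹' B).indicator (1 : Path s t → ℝ≥0∞)
      (f + tentPath x h) ∂(loopLaw α s t) =
        loopLaw α s t ((linePath s t z w + ·) ⁻¹' ((· + tentPath x h) ⁻¹' B)) := by
    rw [← lintegral_indicator_one (hl hB')]
    refine lintegral_congr fun f ↦ ?_
    have hiff : f + tentPath x h ∈ (linePath s t z w + ·) ⁻¹' B ↔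
        f ∈ (linePath s t z w + ·) ⁻¹' ((· + tentPath x h) ⁻¹' B) := by
      simp only [Set.mem_preimage, add_assoc]
    by_cases hf : f + tentPath x h ∈ (linePath s t z w + ·) ⁻¹' B
    · rw [Set.indicator_of_mem hf, Set.indicator_of_mem (hiff.1 hf)]; rfl
    · rw [Set.indicator_of_notMem hf, Set.indicator_of_notMem (mt hiff.2 hf)]
  rw [← e1, key, ← lintegral_indicator_one (hl hB), ← lintegral_const_mul _
    (measurable_one.indicator (hl hB))]
  refine lintegral_mono fun f ↦ ?_
  by_cases hf : f ∈ (linePath s t z w + ·) ⁻¹' B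
  · rw [Set.indicator_of_mem hf, Pi.one_apply, mul_one, one_mul]
    have := hc _ hf
    rwa [ContinuousMap.add_apply, add_sub_cancel_left] at this
  · rw [Set.indicator_of_notMem hf, mul_zero]
    exact zero_le

/-- The conditioned bridges do not concentrate near the boundary of the quadrant. -/
theorem exp_mul_quadBridge_boundary_le (hα : α ∈ Set.Ioo (-1 : ℝ) 1) {x : Set.Icc s t}
    (hx : (x : ℝ) ∈ Set.Ioo s t) {e : ℝ × ℝ} (he : e ∈ quadrant) (he1 : pairing e e = 1) {R : ℝ}
    {z w : ℝ × ℝ} (hz : z ∈ openQuadrant) (hw : w ∈ openQuadrant) (hzR : ‖z‖ ≤ R) (hwR : ‖w‖ ≤ R)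
    {j : ℕ} (hj : 0 < j) :
    ENNReal.ofReal (Real.exp (-((mahal α e * (‖decorrelate α‖ * (2 * R)) + mahal α e ^ 2 / 2) /
        loopKernel s t x x))) * j * quadBridge α s t z w
          {f | pairing e (f x) ≤ 1 / (2 * j) ∧ ‖f x‖ ≤ R} ≤ 1 := by
  have hst := hx.1.trans hx.2
  have hpos := loopKernel_self_pos hx
  have i1 := isProbabilityMeasure_bridgeLaw hα hst z w
  have hR : 0 ≤ R := (norm_nonneg _).trans hzR
  have hj' : (0 : ℝ) < j := by exact_mod_cast hj
  set v : ℝ≥0 := ⟨loopKernel s t x x, hpos.le⟩ with hvd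
  have hv : (v : ℝ) = loopKernel s t x x := rfl
  have hm0 := mahal_nonneg α e
  set C := (mahal α e * (‖decorrelate α‖ * (2 * R)) + mahal α e ^ 2 / 2) / loopKernel s t x x
  have hmp := measurable_pairing e
  set A : Set (Path s t) := {f | pairing e (f x) ≤ 1 / (2 * j) ∧ ‖f x‖ ≤ R}
  have hA : MeasurableSet A := by
    refine MeasurableSet.inter (measurableSet_le (hmp.comp (measurable_eval x)) measurable_const)
      (measurableSet_le (measurable_eval x).norm measurable_const)
  have hQ := measurableSet_quadrantPaths s t
  set B := quadrantPaths s t ∩ A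
  have hB : MeasurableSet B := hQ.inter hA
  -- The layer of width `1 / (2j)` is pushed inward by the `j` multiples `k / j` of `e`. The copies
  -- are disjoint, stay in the quadrant because `e` and the tent are nonnegative, and each keeps the
  -- fraction `exp (-C)` of the mass; so the layer has conditional probability of order `1 / j`.
  let c : ℕ → ℝ := fun k ↦ k / j
  let Bk : ℕ → Set (Path s t) := fun k ↦ (· + tentPath x (-(c k) • e)) ⁻¹' B
  have hBk : ∀ k, MeasurableSet (Bk k) := fun k ↦ measurable_add_const _ hB
  have hval : ∀ k (f : Path s t), (f + tentPath x (-(c k) • e)) x = f x - c k • e := fun k f ↦ by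
    simp [tentPath, tent_self hx, sub_eq_add_neg]
  have hpe : ∀ k (f : Path s t), pairing e ((f + tentPath x (-(c k) • e)) x) =
      pairing e (f x) - c k := fun k f ↦ by
    rw [hval, sub_eq_add_neg, ← neg_smul, pairing_add_right, pairing_smul_right, he1]; ring
  have hmem : ∀ k f, f ∈ Bk k → c k ≤ pairing e (f x) ∧ pairing e (f x) ≤ c k + 1 / (2 * j) := by
    intro k f hf
    have h1 := hpe k f
    have h2 : 0 ≤ pairing e ((f + tentPath x (-(c k) • e)) x) :=
      add_nonneg (mul_nonneg he.1 (hf.1 x).1) (mul_nonneg he.2 (hf.1 x).2)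
    have h3 : pairing e ((f + tentPath x (-(c k) • e)) x) ≤ 1 / (2 * j) := hf.2.1
    constructor <;> linarith
  have hdisj : Pairwise (Function.onFun Disjoint Bk) := by
    have hlt : ∀ k l, k < l → Disjoint (Bk k) (Bk l) := by
      intro k l hkl
      rw [Set.disjoint_left]
      intro f hfk hfl
      have h1 := (hmem k f hfk).2
      have h2 := (hmem l f hfl).1
      have h3 : c k + 1 / j ≤ c l := by
        simp only [c]
        rw [← add_div]
        have : (k : ℝ) + 1 ≤ l := by exact_mod_cast hkl
        gcongr
      have h4 : 1 / (2 * (j : ℝ)) < 1 / j := by gcongr; linarith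
      linarith
    intro k l hkl
    rcases hkl.lt_or_gt with h | h
    · exact hlt k l h
    · exact (hlt l k h).symm
  have hsub : ∀ k, Bk k ⊆ quadrantPaths s t := by
    intro k f hf u
    have h1 := hf.1 u
    have hck : 0 ≤ c k := by positivity
    have ht := mul_nonneg (tent_nonneg hst x u) hck
    simp only [ContinuousMap.add_apply, tentPath, ContinuousMap.coe_mk, smul_smul] at h1
    constructor
    · have := h1.1
      simp only [Prod.fst_add, Prod.smul_fst, smul_eq_mul] at this
      nlinarith [mul_nonneg ht he.1]
    · have := h1.2
      simp only [Prod.snd_add, Prod.smul_snd, smul_eq_mul] at this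
      nlinarith [mul_nonneg ht he.2]
  have hle : ∀ k < j, ENNReal.ofReal (Real.exp (-C)) * bridgeLaw α s t z w B ≤
      bridgeLaw α s t z w (Bk k) := by
    intro k hk
    refine exp_mul_bridgeLaw_le hα hx hv _ z w hB fun f hf ↦ ?_
    have hck : 0 ≤ c k := by positivity
    have hck1 : c k ≤ 1 := (div_le_one hj').2 (by exact_mod_cast hk.le)
    have hn : ‖linePath s t z w x‖ ≤ R := by
      have := linePath_mem hst (convex_closedBall (0 : ℝ × ℝ) R) (z := z) (w := w) (by simpa)
        (by simpa) x
      simpa using this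
    have hy : ‖f x - linePath s t z w x‖ ≤ 2 * R := by
      refine (norm_sub_le _ _).trans ?_
      linarith [hf.2.2]
    set y := f x - linePath s t z w x
    have h1 : mahalInner α (-(c k) • e) y = -(c k) * mahalInner α e y := mahalInner_smul_left _ _ _ _
    have h2 : mahal α (-(c k) • e) = c k * mahal α e := by
      rw [mahal_smul, abs_neg, abs_of_nonneg hck]
    have h3 : |mahalInner α e y| ≤ mahal α e * (‖decorrelate α‖ * (2 * R)) :=
      (abs_mahalInner_le α e y).trans (by
        gcongr
        exact (mahal_le_mul_norm α y).trans (by gcongr))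
    rw [shiftDensity, h1, h2]
    refine ENNReal.ofReal_le_ofReal (Real.exp_le_exp.2 ?_)
    simp only [C, hv]
    rw [← neg_div]
    gcongr
    have h4 : -(c k) * mahalInner α e y ≥ -(mahal α e * (‖decorrelate α‖ * (2 * R))) := by
      have := abs_le.1 h3
      nlinarith [abs_nonneg (mahalInner α e y)]
    have h5 : (c k * mahal α e) ^ 2 ≤ mahal α e ^ 2 := by
      rw [mul_pow]
      exact mul_le_of_le_one_left (by positivity) (pow_le_one₀ hck hck1)
    linarith
  have hsum : (j : ℝ≥0∞) * (ENNReal.ofReal (Real.exp (-C)) * bridgeLaw α s t z w B) ≤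
      bridgeLaw α s t z w (quadrantPaths s t) := by
    calc (j : ℝ≥0∞) * (ENNReal.ofReal (Real.exp (-C)) * bridgeLaw α s t z w B)
        = ∑ _k ∈ Finset.range j, ENNReal.ofReal (Real.exp (-C)) * bridgeLaw α s t z w B := by simp
      _ ≤ ∑ k ∈ Finset.range j, bridgeLaw α s t z w (Bk k) :=
          Finset.sum_le_sum fun k hk ↦ hle k (Finset.mem_range.1 hk)
      _ = bridgeLaw α s t z w (⋃ k ∈ Finset.range j, Bk k) :=
          (measure_biUnion_finset (fun k _ l _ hkl ↦ hdisj hkl) fun k _ ↦ hBk k).symm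
      _ ≤ _ := measure_mono (Set.iUnion₂_subset fun k _ ↦ hsub k)
  have hQ0 := bridgeLaw_quadrantPaths_ne_zero hα hst hz hw
  rw [quadBridge, cond_apply hQ]
  calc ENNReal.ofReal (Real.exp (-C)) * j * ((bridgeLaw α s t z w (quadrantPaths s t))⁻¹ *
        bridgeLaw α s t z w B)
      = (bridgeLaw α s t z w (quadrantPaths s t))⁻¹ *
        (j * (ENNReal.ofReal (Real.exp (-C)) * bridgeLaw α s t z w B)) := by ring
    _ ≤ (bridgeLaw α s t z w (quadrantPaths s t))⁻¹ * bridgeLaw α s t z w (quadrantPaths s t) :=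
        mul_le_mul_right hsum _
    _ = 1 := ENNReal.inv_mul_cancel hQ0 (measure_ne_top _ _)

end QuadrantExcursion

/-! ### Lipschitz cylinder functions and the resampling property -/

namespace QuadrantExcursion

variable {α s t S T : ℝ}

/-- `F` is a bounded function of finitely many points which is Lipschitz for the sum of the
Mahalanobis distances with weights `L`. -/
structure CylinderLipschitz (α : ℝ) {ι : Type*} [Fintype ι] (L : ι → ℝ) (F : (ι → ℝ × ℝ) → ℝ) :
    Prop where
  abs_le : ∀ x, |F x| ≤ 1
  nonneg : ∀ i, 0 ≤ L i
  lipschitz : ∀ x y, |F x - F y| ≤ ∑ i, L i * mahal α (x i - y i)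

theorem CylinderLipschitz.continuous {ι : Type*} [Fintype ι] {L : ι → ℝ} {F : (ι → ℝ × ℝ) → ℝ}
    (hF : CylinderLipschitz α L F) : Continuous F := continuous_of_abs_sub_le_mahal hF.lipschitz

theorem continuous_evalMap {ι : Type*} (u : ι → Set.Icc s t) :
    Continuous fun (f : Path s t) i ↦ f (u i) :=
  continuous_pi fun i ↦ ContinuousEvalConst.continuous_eval_const (u i)

/-- Laws on path space are determined by bounded Lipschitz cylinder functions. -/
theorem path_measure_ext_of_lipschitz (hα : α ∈ Set.Ioo (-1 : ℝ) 1) {μ ν : Measure (Path s t)}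
    [IsFiniteMeasure μ] [IsFiniteMeasure ν]
    (h : ∀ {ι : Type} [Fintype ι] (u : ι → Set.Icc s t) (L : ι → ℝ) (F : (ι → ℝ × ℝ) → ℝ),
      CylinderLipschitz α L F → ∫ f, F (fun i ↦ f (u i)) ∂μ = ∫ f, F (fun i ↦ f (u i)) ∂ν) :
    μ = ν := by
  classical
  refine path_measure_ext fun {ι} _ u ↦ Measure.ext_of_charFunDual (funext fun D ↦ ?_)
  have hu := continuous_evalMap u
  have hlin : ∀ φ : ℝ → ℝ, (∀ x y, |φ x - φ y| ≤ |x - y|) → (∀ x, |φ x| ≤ 1) →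
      CylinderLipschitz α (fun _ : ι ↦ ‖D‖) fun x ↦ φ (D x) := by
    intro φ h1 h2
    refine ⟨fun x ↦ h2 _, fun _ ↦ norm_nonneg _, fun x y ↦ (h1 _ _).trans ?_⟩
    rw [← map_sub, ← Real.norm_eq_abs, ← Finset.mul_sum]
    refine (D.le_opNorm _).trans (mul_le_mul_of_nonneg_left ?_ (norm_nonneg _))
    refine (pi_norm_le_iff_of_nonneg (Finset.sum_nonneg fun i _ ↦ mahal_nonneg _ _)).2 fun i ↦ ?_
    exact (norm_le_mahal hα _).trans
      (Finset.single_le_sum (f := fun i ↦ mahal α (x i - y i)) (fun i _ ↦ mahal_nonneg _ _)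
        (Finset.mem_univ i))
  -- The real and imaginary parts of a character are bounded Lipschitz functions of finitely many
  -- values, so the hypothesis determines all characteristic functions.
  have hcos := h u _ _ (hlin Real.cos Real.abs_cos_sub_cos_le Real.abs_cos_le_one)
  have hsin := h u _ _ (hlin Real.sin Real.abs_sin_sub_sin_le Real.abs_sin_le_one)
  have hint : ∀ (ρ : Measure (Path s t)) [IsFiniteMeasure ρ],
      ∫ f, Complex.exp (D (fun i ↦ f (u i)) * Complex.I) ∂ρ =
        (∫ f, Real.cos (D fun i ↦ f (u i)) ∂ρ : ℝ) +
          (∫ f, Real.sin (D fun i ↦ f (u i)) ∂ρ : ℝ) * Complex.I := by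
    intro ρ _
    have hD : Continuous fun f : Path s t ↦ D fun i ↦ f (u i) := D.continuous.comp hu
    have i1 : Integrable (fun f : Path s t ↦ Real.cos (D fun i ↦ f (u i))) ρ :=
      .of_bound (Real.continuous_cos.comp hD).aestronglyMeasurable 1
        (.of_forall fun f ↦ Real.abs_cos_le_one _)
    have i2 : Integrable (fun f : Path s t ↦ Real.sin (D fun i ↦ f (u i))) ρ :=
      .of_bound (Real.continuous_sin.comp hD).aestronglyMeasurable 1
        (.of_forall fun f ↦ Real.abs_sin_le_one _)
    rw [← integral_complex_ofReal, ← integral_complex_ofReal, ← integral_mul_const,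
      ← integral_add i1.ofReal (i2.ofReal.mul_const _)]
    refine integral_congr_ae (.of_forall fun f ↦ ?_)
    simp only [Complex.exp_mul_I, Complex.ofReal_cos, Complex.ofReal_sin]
  have hme : Continuous fun x : ι → ℝ × ℝ ↦ Complex.exp (D x * Complex.I) := by fun_prop
  rw [charFunDual_apply, charFunDual_apply,
    integral_map hu.measurable.aemeasurable hme.aestronglyMeasurable,
    integral_map hu.measurable.aemeasurable hme.aestronglyMeasurable, hint, hint, hcos, hsin]

/-- Finite measures on the product with a path space are determined by products of bounded
continuous functions and Lipschitz cylinder functions. -/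
theorem prod_path_measure_ext (hα : α ∈ Set.Ioo (-1 : ℝ) 1) {X : Type*} [TopologicalSpace X]
    [MeasurableSpace X] [BorelSpace X] [HasOuterApproxClosed X] {μ ν : Measure (X × Path s t)}
    [IsFiniteMeasure μ] [IsFiniteMeasure ν]
    (h : ∀ (H : BoundedContinuousFunction X ℝ≥0) {ι : Type} [Fintype ι] (u : ι → Set.Icc s t)
      (L : ι → ℝ) (F : (ι → ℝ × ℝ) → ℝ), CylinderLipschitz α L F →
        ∫ p, (H p.1 : ℝ) * F (fun i ↦ p.2 (u i)) ∂μ = ∫ p, (H p.1 : ℝ) * F (fun i ↦ p.2 (u i)) ∂ν) :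
    μ = ν := by
  have key : ∀ (H : BoundedContinuousFunction X ℝ≥0),
      (μ.withDensity fun p ↦ (H p.1 : ℝ≥0∞)).map Prod.snd =
        (ν.withDensity fun p ↦ (H p.1 : ℝ≥0∞)).map Prod.snd := by
    intro H
    have hH : Measurable fun p : X × Path s t ↦ H p.1 :=
      H.continuous.measurable.comp measurable_fst
    have hfin : ∀ (ρ : Measure (X × Path s t)) [IsFiniteMeasure ρ],
        IsFiniteMeasure (ρ.withDensity fun p ↦ (H p.1 : ℝ≥0∞)) := by
      intro ρ _
      refine isFiniteMeasure_withDensity (ne_of_lt ?_)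
      have h1 := BoundedContinuousFunction.lintegral_lt_top_of_nnreal (ρ.map Prod.fst) H
      rwa [lintegral_map H.continuous.measurable.coe_nnreal_ennreal measurable_fst] at h1
    have i1 := hfin μ
    have i2 := hfin ν
    refine path_measure_ext_of_lipschitz hα fun u L F hF ↦ ?_
    have hFu : Continuous fun f : Path s t ↦ F fun i ↦ f (u i) :=
      hF.continuous.comp (continuous_evalMap u)
    rw [integral_map measurable_snd.aemeasurable hFu.aestronglyMeasurable,
      integral_map measurable_snd.aemeasurable hFu.aestronglyMeasurable,
      integral_withDensity_eq_integral_smul hH, integral_withDensity_eq_integral_smul hH]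
    exact h H u L F hF
  refine Measure.ext_prod fun {A B} hA hB ↦ ?_
  have h2 : (μ.restrict (Prod.snd ⁻¹' B)).map Prod.fst = (ν.restrict (Prod.snd ⁻¹' B)).map Prod.fst := by
    refine ext_of_forall_lintegral_eq_of_IsFiniteMeasure fun H ↦ ?_
    have hH : Measurable fun x : X ↦ (H x : ℝ≥0∞) := H.continuous.measurable.coe_nnreal_ennreal
    rw [lintegral_map hH measurable_fst, lintegral_map hH measurable_fst]
    have h3 := congrArg (fun ρ ↦ ρ B) (key H)
    simp only [Measure.map_apply measurable_snd hB,
      withDensity_apply _ (measurable_snd hB)] at h3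
    exact h3
  have h4 := congrArg (fun ρ ↦ ρ A) h2
  simp only [Measure.map_apply measurable_fst hA,
    Measure.restrict_apply (measurable_fst hA)] at h4
  exact h4

/-- The mean of a cylinder function under the conditioned bridge, as a function of the endpoints. -/
noncomputable def quadMean (α s t : ℝ) {ι : Type*} (u : ι → Set.Icc s t) (F : (ι → ℝ × ℝ) → ℝ)
    (p : (ℝ × ℝ) × (ℝ × ℝ)) : ℝ :=
  ∫ f, F (fun i ↦ f (u i)) ∂(quadBridge α s t p.1 p.2)

theorem abs_quadMean_le (hα : α ∈ Set.Ioo (-1 : ℝ) 1) (hst : s < t) {ι : Type*} [Fintype ι]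
    {L : ι → ℝ} {F : (ι → ℝ × ℝ) → ℝ} (hF : CylinderLipschitz α L F) (u : ι → Set.Icc s t)
    {p : (ℝ × ℝ) × (ℝ × ℝ)} (hp : p ∈ openQuadrant ×ˢ openQuadrant) :
    |quadMean α s t u F p| ≤ 1 := by
  have := isProbabilityMeasure_quadBridge hα hst hp.1 hp.2
  have h := norm_integral_le_of_norm_le_const (μ := quadBridge α s t p.1 p.2)
    (f := fun f ↦ F fun i ↦ f (u i)) (C := 1) (.of_forall fun f ↦ hF.abs_le _)
  exact (Real.norm_eq_abs _).symm.le.trans (h.trans (by simp))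

theorem abs_quadMean_sub_le (hα : α ∈ Set.Ioo (-1 : ℝ) 1) (hst : s < t) {ι : Type*} [Fintype ι]
    {L : ι → ℝ} {F : (ι → ℝ × ℝ) → ℝ} (hF : CylinderLipschitz α L F) (u : ι → Set.Icc s t)
    {p p' : (ℝ × ℝ) × (ℝ × ℝ)} (hp : p ∈ openQuadrant ×ˢ openQuadrant)
    (hp' : p' ∈ openQuadrant ×ˢ openQuadrant) :
    |quadMean α s t u F p - quadMean α s t u F p'| ≤
      (∑ i, L i) * (mahal α (p.1 - p'.1) + mahal α (p.2 - p'.2)) := by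
  refine (abs_integral_quadBridge_sub_le hα hst hp.1 hp.2 hp'.1 hp'.2 u hF.abs_le hF.nonneg
    hF.lipschitz).trans ?_
  rw [Finset.sum_mul]
  refine Finset.sum_le_sum fun i _ ↦ mul_le_mul_of_nonneg_left ?_ (hF.nonneg i)
  have h := frac_mem hst (u i).2
  have h1 := mahal_nonneg α (p.1 - p'.1)
  have h2 := mahal_nonneg α (p.2 - p'.2)
  exact add_le_add (mul_le_of_le_one_left h1 (by linarith [h.1])) (mul_le_of_le_one_left h2 h.2)

/-- The endpoints of the gap between the outer parts of a path. -/
def gapEnds (hS : S ≤ s) (hT : t ≤ T) (o : Path S s × Path t T) : (ℝ × ℝ) × (ℝ × ℝ) :=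
  (o.1 ⟨s, hS, le_rfl⟩, o.2 ⟨t, le_rfl, hT⟩)

theorem measurable_gapEnds (hS : S ≤ s) (hT : t ≤ T) : Measurable (gapEnds hS hT) :=
  ((measurable_eval _).comp measurable_fst).prodMk ((measurable_eval _).comp measurable_snd)

/-- The kernel of conditioned bridges, as a function of the outer parts of a path. -/
noncomputable def outerKernel (hα : α ∈ Set.Ioo (-1 : ℝ) 1) (hS : S ≤ s) (hst : s < t)
    (hT : t ≤ T) : Kernel (Path S s × Path t T) (Path s t) :=
  (quadKernel hα hst).comap (gapEnds hS hT) (measurable_gapEnds hS hT)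

instance (hα : α ∈ Set.Ioo (-1 : ℝ) 1) (hS : S ≤ s) (hst : s < t) (hT : t ≤ T) :
    IsFiniteKernel (outerKernel hα hS hst hT) := by
  unfold outerKernel; infer_instance

variable (hS : S ≤ s) (hst : s < t) (hT : t ≤ T)

theorem outerKernel_apply (hα : α ∈ Set.Ioo (-1 : ℝ) 1) (f : Path S T) :
    outerKernel hα hS hst hT (outerPath hS hst hT f) =
      quadBridge α s t (f ⟨s, hS, hst.le.trans hT⟩) (f ⟨t, hS.trans hst.le, hT⟩) := rfl

/-- The outer parts and the inner part of a path. -/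
def splitPath (f : Path S T) : (Path S s × Path t T) × Path s t :=
  (outerPath hS hst hT f, restrictPath (Set.Icc_subset_Icc hS hT) f)

theorem measurable_splitPath : Measurable (splitPath hS hst hT) :=
  (continuous_outerPath hS hst hT).measurable.prodMk (continuous_restrictPath _).measurable

/-- The law `μ` has the resampling property on `[s, t]`. -/
def Resampled (hα : α ∈ Set.Ioo (-1 : ℝ) 1) (μ : Measure (Path S T)) : Prop :=
  μ.map (splitPath hS hst hT) = μ.map (outerPath hS hst hT) ⊗ₘ outerKernel hα hS hst hT

theorem integral_map_outerPath_compProd (hα : α ∈ Set.Ioo (-1 : ℝ) 1) {μ : Measure (Path S T)}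
    [IsFiniteMeasure μ] {H : Path S s × Path t T → ℝ} (hH : Measurable H) {M : ℝ}
    (hM : ∀ o, |H o| ≤ M) {ι : Type*} [Fintype ι] {L : ι → ℝ} {F : (ι → ℝ × ℝ) → ℝ}
    (hF : CylinderLipschitz α L F) (u : ι → Set.Icc s t) :
    ∫ p, H p.1 * F (fun i ↦ p.2 (u i)) ∂(μ.map (outerPath hS hst hT) ⊗ₘ outerKernel hα hS hst hT) =
      ∫ f, H (outerPath hS hst hT f) * quadMean α s t u F
        (f ⟨s, hS, hst.le.trans hT⟩, f ⟨t, hS.trans hst.le, hT⟩) ∂μ := by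
  have ho := (continuous_outerPath hS hst hT).measurable
  have hFu : Continuous fun f : Path s t ↦ F fun i ↦ f (u i) :=
    hF.continuous.comp (continuous_evalMap u)
  have hm : Measurable fun p : (Path S s × Path t T) × Path s t ↦ H p.1 * F fun i ↦ p.2 (u i) :=
    (hH.comp measurable_fst).mul (hFu.measurable.comp measurable_snd)
  have hM0 : 0 ≤ M := (abs_nonneg _).trans (hM (0, 0))
  have i1 : Integrable (fun p : (Path S s × Path t T) × Path s t ↦ H p.1 * F fun i ↦ p.2 (u i))
      (μ.map (outerPath hS hst hT) ⊗ₘ outerKernel hα hS hst hT) := by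
    refine .of_bound hm.aestronglyMeasurable (M * 1) (.of_forall fun p ↦ ?_)
    rw [Real.norm_eq_abs, abs_mul]
    exact mul_le_mul (hM _) (hF.abs_le _) (abs_nonneg _) hM0
  rw [Measure.integral_compProd i1, integral_map ho.aemeasurable
    (hm.stronglyMeasurable.integral_kernel_prod_right'
      (κ := outerKernel hα hS hst hT)).aestronglyMeasurable]
  simp only [integral_const_mul]
  rfl

theorem Resampled.integral_eq (hα : α ∈ Set.Ioo (-1 : ℝ) 1) {μ : Measure (Path S T)}
    [IsFiniteMeasure μ] (hμ : Resampled hS hst hT hα μ) {H : Path S s × Path t T → ℝ}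
    (hH : Measurable H) {M : ℝ} (hM : ∀ o, |H o| ≤ M) {ι : Type*} [Fintype ι] {L : ι → ℝ}
    {F : (ι → ℝ × ℝ) → ℝ} (hF : CylinderLipschitz α L F) (u : ι → Set.Icc s t) :
    ∫ f, H (outerPath hS hst hT f) *
      F (fun i ↦ restrictPath (Set.Icc_subset_Icc hS hT) f (u i)) ∂μ =
      ∫ f, H (outerPath hS hst hT f) * quadMean α s t u F
        (f ⟨s, hS, hst.le.trans hT⟩, f ⟨t, hS.trans hst.le, hT⟩) ∂μ := by
  have hFu : Continuous fun f : Path s t ↦ F fun i ↦ f (u i) :=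
    hF.continuous.comp (continuous_evalMap u)
  have hm : Measurable fun p : (Path S s × Path t T) × Path s t ↦ H p.1 * F fun i ↦ p.2 (u i) :=
    (hH.comp measurable_fst).mul (hFu.measurable.comp measurable_snd)
  rw [← integral_map_outerPath_compProd hS hst hT hα hH hM hF u, ← hμ,
    integral_map (measurable_splitPath hS hst hT).aemeasurable hm.aestronglyMeasurable]
  rfl

theorem resampled_quadBridge (hα : α ∈ Set.Ioo (-1 : ℝ) 1) {z w : ℝ × ℝ}
    [IsFiniteMeasure (quadBridge α S T z w)] :
    Resampled hS hst hT hα (quadBridge α S T z w) := by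
  refine Measure.ext_of_lintegral _ fun Ψ hΨ ↦ ?_
  rw [lintegral_map hΨ (measurable_splitPath hS hst hT), Measure.lintegral_compProd hΨ,
    lintegral_map (hΨ.lintegral_kernel_prod_right')
      (continuous_outerPath hS hst hT).measurable]
  exact lintegral_quadBridge_resample hS hst hT hα z w hΨ

/-- By almost sure uniqueness of disintegrations, the statement about conditional laws becomes an
identity of joint laws, which can be tested by integrals and passed to weak limits. -/
theorem resampled_iff (hα : α ∈ Set.Ioo (-1 : ℝ) 1) {μ : Measure (Path S T)} [IsFiniteMeasure μ] :
    Resampled hS hst hT hα μ ↔ ∀ᵐ f ∂μ,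
      condDistrib (restrictPath (Set.Icc_subset_Icc hS hT)) (outerPath hS hst hT) μ
        (outerPath hS hst hT f) =
      quadBridge α s t (f ⟨s, hS, hst.le.trans hT⟩) (f ⟨t, hS.trans hst.le, hT⟩) := by
  have ho := (continuous_outerPath hS hst hT).measurable
  have hr := (continuous_restrictPath (Set.Icc_subset_Icc hS hT)).measurable
  constructor
  · intro h
    exact ae_of_ae_map ho.aemeasurable (condDistrib_ae_eq_of_measure_eq_compProd
      (outerPath hS hst hT) hr.aemeasurable h)
  · intro h
    have h1 := compProd_map_condDistrib (mβ := Prod.instMeasurableSpace) (μ := μ)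
      (X := outerPath hS hst hT) hr.aemeasurable
    refine h1.symm.trans (Measure.ext_of_lintegral _ fun Ψ hΨ ↦ ?_)
    rw [Measure.lintegral_compProd hΨ, Measure.lintegral_compProd hΨ,
      lintegral_map (hΨ.lintegral_kernel_prod_right') ho,
      lintegral_map (hΨ.lintegral_kernel_prod_right') ho]
    refine lintegral_congr_ae ?_
    filter_upwards [h] with f hf
    rw [hf, outerKernel_apply]

end QuadrantExcursion

/-! ### Uniqueness -/

namespace QuadrantExcursion

variable {α s t S T : ℝ}

theorem measurable_quadMean (hα : α ∈ Set.Ioo (-1 : ℝ) 1) (hst : s < t) {ι : Type*}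
    {F : (ι → ℝ × ℝ) → ℝ} (hF : Continuous F) (u : ι → Set.Icc s t) :
    Measurable (quadMean α s t u F) := by
  have h : StronglyMeasurable fun f : Path s t ↦ F fun i ↦ f (u i) :=
    (hF.comp (continuous_evalMap u)).stronglyMeasurable
  exact (h.integral_kernel (κ := quadKernel hα hst)).measurable

theorem IsExcursionLaw.resampled {w : ℝ × ℝ} {μ : Measure (Path 0 1)} [IsFiniteMeasure μ]
    (h : IsExcursionLaw α w μ) (hα : α ∈ Set.Ioo (-1 : ℝ) 1) (h0 : 0 < s) (hst : s < t)
    (h1 : t < 1) : Resampled h0.le hst h1.le hα μ := by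
  refine (resampled_iff h0.le hst h1.le hα).2 ?_
  filter_upwards [h.resampling s t h0 hst h1] with f hf
  exact (isQuadrantBridgeLaw_iff hα hst).1 hf

/-- Two laws with the resampling property on an interval assign almost the same mean to a cylinder
function on this interval if the endpoints are typically close. -/
theorem Resampled.abs_integral_sub_le (hα : α ∈ Set.Ioo (-1 : ℝ) 1) (hS : S ≤ s) (hst : s < t)
    (hT : t ≤ T) {μ μ' : Measure (Path S T)} [IsProbabilityMeasure μ] [IsProbabilityMeasure μ']
    (h : Resampled hS hst hT hα μ) (h' : Resampled hS hst hT hα μ')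
    (hpos : ∀ᵐ f ∂μ, (f ⟨s, hS, hst.le.trans hT⟩, f ⟨t, hS.trans hst.le, hT⟩) ∈
      openQuadrant ×ˢ openQuadrant)
    (hpos' : ∀ᵐ f ∂μ', (f ⟨s, hS, hst.le.trans hT⟩, f ⟨t, hS.trans hst.le, hT⟩) ∈
      openQuadrant ×ˢ openQuadrant)
    {ι : Type*} [Fintype ι] {L : ι → ℝ} {F : (ι → ℝ × ℝ) → ℝ} (hF : CylinderLipschitz α L F)
    (u : ι → Set.Icc s t) :
    |∫ f, F (fun i ↦ restrictPath (Set.Icc_subset_Icc hS hT) f (u i)) ∂μ -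
      ∫ f, F (fun i ↦ restrictPath (Set.Icc_subset_Icc hS hT) f (u i)) ∂μ'| ≤
      ∫ p, min 2 ((∑ i, L i) * (mahal α (p.1 ⟨s, hS, hst.le.trans hT⟩ -
        p.2 ⟨s, hS, hst.le.trans hT⟩) + mahal α (p.1 ⟨t, hS.trans hst.le, hT⟩ -
        p.2 ⟨t, hS.trans hst.le, hT⟩))) ∂(μ.prod μ') := by
  let e : Path S T → (ℝ × ℝ) × (ℝ × ℝ) := fun f ↦
    (f ⟨s, hS, hst.le.trans hT⟩, f ⟨t, hS.trans hst.le, hT⟩)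
  have he : Measurable e := (measurable_eval _).prodMk (measurable_eval _)
  have hq := measurable_quadMean hα hst hF.continuous u
  have e1 : ∀ {ρ : Measure (Path S T)} [IsProbabilityMeasure ρ], Resampled hS hst hT hα ρ →
      ∫ f, F (fun i ↦ restrictPath (Set.Icc_subset_Icc hS hT) f (u i)) ∂ρ =
        ∫ f, quadMean α s t u F (e f) ∂ρ := by
    intro ρ _ hρ
    have := hρ.integral_eq hS hst hT hα (H := fun _ ↦ 1) measurable_const (M := 1) (by simp) hF u
    simpa only [one_mul] using this
  have hint : ∀ {ρ : Measure (Path S T)} [IsProbabilityMeasure ρ],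
      (∀ᵐ f ∂ρ, e f ∈ openQuadrant ×ˢ openQuadrant) →
        Integrable (fun f ↦ quadMean α s t u F (e f)) ρ := by
    intro ρ _ hρ
    refine .of_bound (hq.comp he).aestronglyMeasurable 1 ?_
    filter_upwards [hρ] with f hf
    exact abs_quadMean_le hα hst hF u hf
  have i1 := hint hpos
  have i2 := hint hpos'
  have hL : 0 ≤ ∑ i, L i := Finset.sum_nonneg fun i _ ↦ hF.nonneg i
  -- The independent coupling is good enough: only the values at the two ends of the interval have
  -- to be compared.
  have e2 : ∫ f, quadMean α s t u F (e f) ∂μ - ∫ f, quadMean α s t u F (e f) ∂μ' =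
      ∫ p, (quadMean α s t u F (e p.1) - quadMean α s t u F (e p.2)) ∂(μ.prod μ') := by
    rw [integral_sub (i1.comp_fst μ') (i2.comp_snd μ),
      integral_fun_fst (fun f ↦ quadMean α s t u F (e f)),
      integral_fun_snd (fun f ↦ quadMean α s t u F (e f))]
    simp
  rw [e1 h, e1 h', e2]
  have hm1 := measurable_mahal α
  have hmm : Measurable fun p : Path S T × Path S T ↦ min 2 ((∑ i, L i) *
      (mahal α ((e p.1).1 - (e p.2).1) + mahal α ((e p.1).2 - (e p.2).2))) := by fun_prop
  refine (norm_integral_le_integral_norm _).trans (integral_mono_ae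
    ((i1.comp_fst μ').sub (i2.comp_snd μ)).norm (.of_bound hmm.aestronglyMeasurable 2
      (.of_forall fun p ↦ ?_)) ?_)
  · have h0 : 0 ≤ (∑ i, L i) *
        (mahal α ((e p.1).1 - (e p.2).1) + mahal α ((e p.1).2 - (e p.2).2)) :=
      mul_nonneg hL (add_nonneg (mahal_nonneg _ _) (mahal_nonneg _ _))
    rw [Real.norm_eq_abs, abs_of_nonneg (le_min zero_le_two h0)]
    exact min_le_left _ _
  · filter_upwards [Measure.quasiMeasurePreserving_fst.ae hpos,
      Measure.quasiMeasurePreserving_snd.ae hpos'] with p hp1 hp2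
    refine le_min ?_ (abs_quadMean_sub_le hα hst hF u hp1 hp2)
    refine (norm_sub_le _ _).trans ?_
    have := abs_quadMean_le hα hst hF u hp1
    have := abs_quadMean_le hα hst hF u hp2
    rw [Real.norm_eq_abs, Real.norm_eq_abs]
    linarith

/-- On `[δ, 1 - δ]` the means differ by at most the mean distance of independent paths at `δ` and `1
- δ`, cut at `2`. Both distances vanish as `δ → 0`, as the paths are continuous with common
endpoints. -/
theorem IsExcursionLaw.eq (hα : α ∈ Set.Ioo (-1 : ℝ) 1) {w : ℝ × ℝ} {μ μ' : Measure (Path 0 1)}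
    [IsProbabilityMeasure μ] [IsProbabilityMeasure μ'] (h : IsExcursionLaw α w μ)
    (h' : IsExcursionLaw α w μ') : μ = μ' := by
  refine path_measure_ext_of_lipschitz hα fun {ι} _ u L F hF ↦ ?_
  -- The shift by `3` gives `δ ≤ 1/3`, so that `δ < 1 - δ` for every `n`.
  let δ : ℕ → ℝ := fun n ↦ 1 / ((n : ℝ) + 3)
  have hδ0 : ∀ n, 0 < δ n := fun n ↦ by positivity
  have hδ1 : ∀ n, δ n ≤ 1 / 3 := fun n ↦
    one_div_le_one_div_of_le (by norm_num) (by linarith [n.cast_nonneg (α := ℝ)])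
  have hδlim : Filter.Tendsto δ .atTop (𝓝 0) := by
    have h1 := tendsto_one_div_atTop_nhds_zero_nat (𝕜 := ℝ)
    have h2 := h1.comp (Filter.tendsto_add_atTop_nat 3)
    refine h2.congr fun n ↦ ?_
    simp [δ]
  have hlt : ∀ n, δ n < 1 - δ n := fun n ↦ by linarith [hδ1 n]
  have hlt1 : ∀ n, 1 - δ n < 1 := fun n ↦ by linarith [hδ0 n]
  let lo : ℕ → Set.Icc (0 : ℝ) 1 := fun n ↦ ⟨δ n, (hδ0 n).le, by linarith [hδ1 n]⟩
  let hi : ℕ → Set.Icc (0 : ℝ) 1 := fun n ↦ ⟨1 - δ n, by linarith [hδ1 n], (hlt1 n).le⟩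
  have hlo : Filter.Tendsto lo .atTop (𝓝 ⟨0, le_rfl, zero_le_one⟩) := by
    rw [tendsto_subtype_rng]; exact hδlim
  have hhi : Filter.Tendsto hi .atTop (𝓝 ⟨1, zero_le_one, le_rfl⟩) := by
    rw [tendsto_subtype_rng]; simpa using hδlim.const_sub 1
  -- The test times may be `0` or `1`, so they are projected to the inner interval; the error
  -- vanishes by continuity of the paths.
  let v : ∀ n, ι → Set.Icc (δ n) (1 - δ n) := fun n i ↦ Set.projIcc _ _ (hlt n).le (u i)
  let v' : ℕ → ι → Set.Icc (0 : ℝ) 1 := fun n i ↦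
    ⟨v n i, (hδ0 n).le.trans (v n i).2.1, (v n i).2.2.trans (hlt1 n).le⟩
  have hv' : ∀ i, Filter.Tendsto (fun n ↦ v' n i) .atTop (𝓝 (u i)) := by
    intro i
    rw [tendsto_subtype_rng]
    have h1 : Filter.Tendsto (fun n ↦ max (δ n) (min (1 - δ n) (u i : ℝ))) .atTop
        (𝓝 (max 0 (min (1 - 0) (u i : ℝ)))) :=
      hδlim.max ((hδlim.const_sub 1).min tendsto_const_nhds)
    rw [sub_zero, min_eq_right (u i).2.2, max_eq_right (u i).2.1] at h1
    exact h1
  have hlim : ∀ (ρ : Measure (Path 0 1)) [IsProbabilityMeasure ρ],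
      Filter.Tendsto (fun n ↦ ∫ f, F (fun i ↦ f (v' n i)) ∂ρ) .atTop
        (𝓝 (∫ f, F (fun i ↦ f (u i)) ∂ρ)) := by
    intro ρ _
    refine tendsto_integral_of_dominated_convergence (fun _ ↦ 1)
      (fun n ↦ (hF.continuous.comp (continuous_evalMap _)).aestronglyMeasurable)
      (integrable_const _) (fun n ↦ .of_forall fun f ↦ hF.abs_le _) (.of_forall fun f ↦ ?_)
    exact (hF.continuous.tendsto _).comp (tendsto_pi_nhds.2 fun i ↦
      (f.continuous.tendsto (u i)).comp (hv' i))
  have hpos : ∀ {ρ : Measure (Path 0 1)} [IsProbabilityMeasure ρ], IsExcursionLaw α w ρ → ∀ n,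
      ∀ᵐ f ∂ρ, (f (lo n), f (hi n)) ∈ openQuadrant ×ˢ openQuadrant := by
    intro ρ _ hρ n
    filter_upwards [hρ.pos (δ n) (hδ0 n) (by linarith [hδ1 n]),
      hρ.pos (1 - δ n) (by linarith [hδ1 n]) (hlt1 n)] with f hf1 hf2
    exact ⟨hf1, hf2⟩
  let Φ : ℕ → Path 0 1 × Path 0 1 → ℝ := fun n p ↦ min 2 ((∑ i, L i) *
    (mahal α (p.1 (lo n) - p.2 (lo n)) + mahal α (p.1 (hi n) - p.2 (hi n))))
  have hL : 0 ≤ ∑ i, L i := Finset.sum_nonneg fun i _ ↦ hF.nonneg i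
  have hbound : ∀ n, |∫ f, F (fun i ↦ f (v' n i)) ∂μ - ∫ f, F (fun i ↦ f (v' n i)) ∂μ'| ≤
      ∫ p, Φ n p ∂(μ.prod μ') := fun n ↦
    (h.resampled hα (hδ0 n) (hlt n) (hlt1 n)).abs_integral_sub_le hα _ _ _
      (h'.resampled hα (hδ0 n) (hlt n) (hlt1 n)) (hpos h n) (hpos h' n) hF (v n)
  have hm1 := measurable_mahal α
  have hev : ∀ x : Set.Icc (0 : ℝ) 1, Measurable fun p : Path 0 1 × Path 0 1 ↦
      mahal α (p.1 x - p.2 x) := fun x ↦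
    hm1.comp (((measurable_eval x).comp measurable_fst).sub ((measurable_eval x).comp measurable_snd))
  have hΦ : Filter.Tendsto (fun n ↦ ∫ p, Φ n p ∂(μ.prod μ')) .atTop (𝓝 0) := by
    have h0 : ∫ _, (0 : ℝ) ∂(μ.prod μ') = 0 := integral_zero _ _
    refine Eq.subst (motive := fun x ↦ Filter.Tendsto (fun n ↦ ∫ p, Φ n p ∂(μ.prod μ')) .atTop (𝓝 x))
      h0 ?_
    refine tendsto_integral_of_dominated_convergence (fun _ ↦ 2)
      (fun n ↦ (measurable_const.min (((hev _).add (hev _)).const_mul _)).aestronglyMeasurable)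
      (integrable_const _) (fun n ↦ .of_forall fun p ↦ ?_) ?_
    · have h0 : 0 ≤ (∑ i, L i) *
          (mahal α (p.1 (lo n) - p.2 (lo n)) + mahal α (p.1 (hi n) - p.2 (hi n))) :=
        mul_nonneg hL (add_nonneg (mahal_nonneg _ _) (mahal_nonneg _ _))
      rw [Real.norm_eq_abs, abs_of_nonneg (le_min zero_le_two h0)]
      exact min_le_left _ _
    · filter_upwards [Measure.quasiMeasurePreserving_fst.ae h.start,
        Measure.quasiMeasurePreserving_snd.ae h'.start,
        Measure.quasiMeasurePreserving_fst.ae h.terminal,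
        Measure.quasiMeasurePreserving_snd.ae h'.terminal] with p h1 h2 h3 h4
      have hend : ∀ {x : ℕ → Set.Icc (0 : ℝ) 1} {y : Set.Icc (0 : ℝ) 1},
          Filter.Tendsto x .atTop (𝓝 y) → p.1 y = p.2 y →
            Filter.Tendsto (fun n ↦ mahal α (p.1 (x n) - p.2 (x n))) .atTop (𝓝 0) := by
        intro x y hx hy
        have h5 := ((continuous_mahal α).tendsto _).comp
          (((p.1.continuous.tendsto y).comp hx).sub ((p.2.continuous.tendsto y).comp hx))
        rw [hy, sub_self, mahal_zero] at h5
        exact h5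
      have h6 := tendsto_const_nhds (x := (2 : ℝ)).min (((hend hlo (h1.trans h2.symm)).add
        (hend hhi (h3.trans h4.symm))).const_mul (∑ i, L i))
      rw [add_zero, mul_zero, min_eq_right zero_le_two] at h6
      exact h6
  have h7 := squeeze_zero (fun n ↦ abs_nonneg _) hbound hΦ
  have h8 := ((hlim μ).sub (hlim μ')).abs
  exact sub_eq_zero.1 (abs_eq_zero.1 (tendsto_nhds_unique h8 h7))

end QuadrantExcursion

/-! ### Existence by approximation from inside the quadrant -/

namespace QuadrantExcursion

variable {α s t S T : ℝ}

/-- A continuous function on path space which is bounded by a constant has convergent means along a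
weakly convergent family of laws. -/
theorem tendsto_integral_path {ι : Type*} {l : Filter ι} {κ : ι → ProbabilityMeasure (Path S T)}
    {ν : ProbabilityMeasure (Path S T)} (h : Filter.Tendsto κ l (𝓝 ν)) {Φ : Path S T → ℝ}
    (hΦ : Continuous Φ) {M : ℝ} (hM : ∀ f, |Φ f| ≤ M) :
    Filter.Tendsto (fun n ↦ ∫ f, Φ f ∂(κ n : Measure (Path S T))) l
      (𝓝 (∫ f, Φ f ∂(ν : Measure (Path S T)))) :=
  ProbabilityMeasure.tendsto_iff_forall_integral_tendsto.1 h
    (BoundedContinuousFunction.ofNormedAddCommGroup Φ hΦ M hM)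

theorem ae_eval_eq_of_tendsto {ι : Type*} {l : Filter ι} [l.NeBot]
    {κ : ι → ProbabilityMeasure (Path S T)} {ν : ProbabilityMeasure (Path S T)}
    (h : Filter.Tendsto κ l (𝓝 ν)) {u : Set.Icc S T} {z : ι → ℝ × ℝ} {z' : ℝ × ℝ}
    (hz : Filter.Tendsto z l (𝓝 z')) (hκ : ∀ n, ∀ᵐ f ∂(κ n : Measure (Path S T)), f u = z n) :
    ∀ᵐ f ∂(ν : Measure (Path S T)), f u = z' := by
  let φ : ℝ × ℝ → ℝ := fun x ↦ min 1 ‖x - z'‖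
  have hφ : Continuous φ := by fun_prop
  have h0 : ∀ x, 0 ≤ φ x := fun x ↦ le_min zero_le_one (norm_nonneg _)
  have h1 : ∀ x, |φ x| ≤ 1 := fun x ↦ by rw [abs_of_nonneg (h0 x)]; exact min_le_left _ _
  have hc : Continuous fun f : Path S T ↦ φ (f u) :=
    hφ.comp (ContinuousEvalConst.continuous_eval_const u)
  have h2 := tendsto_integral_path h hc fun f ↦ h1 (f u)
  have h3 : (fun n ↦ ∫ f, φ (f u) ∂(κ n : Measure (Path S T))) = fun n ↦ φ (z n) := by
    funext n
    rw [integral_congr_ae ((hκ n).mono fun f hf ↦ congrArg φ hf)]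
    simp
  rw [h3] at h2
  have h4 := (hφ.tendsto z').comp hz
  have h5 : φ z' = 0 := by simp [φ]
  have h6 : ∫ f, φ (f u) ∂(ν : Measure (Path S T)) = 0 := (tendsto_nhds_unique h2 h4).trans h5
  have h7 := (integral_eq_zero_iff_of_nonneg (fun f : Path S T ↦ h0 (f u))
    (.of_bound hc.aestronglyMeasurable 1 (.of_forall fun f ↦ h1 (f u)))).1 h6
  filter_upwards [h7] with f hf
  have h7 : min 1 ‖f u - z'‖ = 0 := hf
  rcases min_choice 1 ‖f u - z'‖ with h8 | h8
  · linarith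
  · exact sub_eq_zero.1 (norm_eq_zero.1 (h8 ▸ h7))

/-- Uniform bounds on the probability of being close to a line pass to weak limits. -/
theorem ae_pairing_pos_of_tendsto {ι : Type*} {l : Filter ι} [l.NeBot]
    {κ : ι → ProbabilityMeasure (Path S T)} {ν : ProbabilityMeasure (Path S T)} (h : Filter.Tendsto κ l (𝓝 ν)) {x : Set.Icc S T}
    {e : ℝ × ℝ} {c : ℕ → ℝ≥0∞} (hc : ∀ R, c R ≠ 0) (R₀ : ℕ)
    (hκ : ∀ n, ∀ R ≥ R₀, ∀ j : ℕ, 0 < j → c R * j * (κ n : Measure (Path S T))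
      {f | pairing e (f x) ≤ 1 / (2 * j) ∧ ‖f x‖ ≤ R} ≤ 1) :
    ∀ᵐ f ∂(ν : Measure (Path S T)), 0 < pairing e (f x) := by
  have hx : Continuous fun f : Path S T ↦ f x := ContinuousEvalConst.continuous_eval_const x
  have he : Continuous fun f : Path S T ↦ pairing e (f x) := by unfold pairing; fun_prop
  have hR : ∀ R ≥ R₀, (ν : Measure (Path S T)) {f | pairing e (f x) ≤ 0 ∧ ‖f x‖ < R} = 0 := by
    intro R hR
    by_contra h0
    obtain ⟨j, hj⟩ := ENNReal.exists_nat_mul_gt (mul_ne_zero (hc R) h0) ENNReal.one_ne_top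
    have hj0 : 0 < j := by
      rcases j.eq_zero_or_pos with rfl | h1
      · simp at hj
      · exact h1
    have hj1 : (0 : ℝ) < 1 / (2 * j) := by positivity
    -- The portmanteau theorem bounds the limit mass of open sets, so the layer is taken open; it
    -- still contains the boundary event whose mass is to vanish.
    have hG : IsOpen {f : Path S T | pairing e (f x) < 1 / (2 * j) ∧ ‖f x‖ < R} :=
      (isOpen_lt he continuous_const).inter (isOpen_lt hx.norm continuous_const)
    have h1 := ProbabilityMeasure.le_liminf_measure_open_of_tendsto h hG
    have h2 : ∀ n, (κ n : Measure (Path S T)) {f | pairing e (f x) < 1 / (2 * j) ∧ ‖f x‖ < R} ≤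
        (c R * j)⁻¹ := by
      intro n
      have h3 := hκ n R hR j hj0
      rw [mul_comm, ← ENNReal.le_inv_iff_mul_le] at h3
      refine (measure_mono ?_).trans h3
      exact fun f hf ↦ ⟨hf.1.le, hf.2.le⟩
    have h2 := h1.trans ((Filter.liminf_le_liminf (.of_forall h2)).trans_eq (Filter.liminf_const _))
    have h4 : {f : Path S T | pairing e (f x) ≤ 0 ∧ ‖f x‖ < R} ⊆
        {f | pairing e (f x) < 1 / (2 * j) ∧ ‖f x‖ < R} := fun f hf ↦ ⟨hf.1.trans_lt hj1, hf.2⟩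
    replace h2 := (measure_mono h4).trans h2
    refine hj.not_ge ?_
    rw [ENNReal.le_inv_iff_mul_le] at h2
    exact Eq.trans_le (by ring) h2
  have h1 : (ν : Measure (Path S T)) (⋃ k : ℕ, {f | pairing e (f x) ≤ 0 ∧ ‖f x‖ < (R₀ + k : ℕ)}) = 0 :=
    measure_iUnion_null fun k ↦ hR _ (Nat.le_add_right _ _)
  filter_upwards [measure_eq_zero_iff_ae_notMem.1 h1] with f hf
  by_contra! h2
  obtain ⟨k, hk⟩ := exists_nat_gt ‖f x‖
  refine hf (Set.mem_iUnion.2 ⟨k, h2, hk.trans_le ?_⟩)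
  exact_mod_cast Nat.le_add_left k R₀

/-- The resampling identity is tested against a function of the outer parts times a Lipschitz
cylinder function of the inner part. The conditional mean is Lipschitz in the endpoints on the open
quadrant and extends to a continuous function of the plane, so both sides converge; positivity at
`s` and `t` under each law makes the extension harmless. -/
theorem Resampled.of_tendsto (hS : S ≤ s) (hst : s < t) (hT : t ≤ T)
    (hα : α ∈ Set.Ioo (-1 : ℝ) 1) {ι : Type*} {l : Filter ι} [l.NeBot]
    {κ : ι → ProbabilityMeasure (Path S T)} {ν : ProbabilityMeasure (Path S T)}
    (h : Filter.Tendsto κ l (𝓝 ν))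
    (hκ : ∀ n, Resampled hS hst hT hα (κ n : Measure (Path S T)))
    (hpos : ∀ n, ∀ᵐ f ∂(κ n : Measure (Path S T)), (f ⟨s, hS, hst.le.trans hT⟩,
      f ⟨t, hS.trans hst.le, hT⟩) ∈ openQuadrant ×ˢ openQuadrant)
    (hpos' : ∀ᵐ f ∂(ν : Measure (Path S T)), (f ⟨s, hS, hst.le.trans hT⟩,
      f ⟨t, hS.trans hst.le, hT⟩) ∈ openQuadrant ×ˢ openQuadrant) :
    Resampled hS hst hT hα (ν : Measure (Path S T)) := by
  refine prod_path_measure_ext hα fun H {J} _ u L F hF ↦ ?_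
  let e : Path S T → (ℝ × ℝ) × (ℝ × ℝ) := fun f ↦
    (f ⟨s, hS, hst.le.trans hT⟩, f ⟨t, hS.trans hst.le, hT⟩)
  have he : Continuous e := (ContinuousEvalConst.continuous_eval_const _).prodMk
    (ContinuousEvalConst.continuous_eval_const _)
  have hL : 0 ≤ ∑ i, L i := Finset.sum_nonneg fun i _ ↦ hF.nonneg i
  let K : ℝ≥0 := ⟨(∑ i, L i) * (2 * ‖decorrelate α‖), by positivity⟩
  obtain ⟨q, hq, hqe⟩ := LipschitzOnWith.extend_real (f := quadMean α s t u F)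
    (s := openQuadrant ×ˢ openQuadrant) (K := K) (LipschitzOnWith.of_dist_le_mul fun p hp p' hp' ↦ by
      rw [Real.dist_eq]
      refine (abs_quadMean_sub_le hα hst hF u hp hp').trans ?_
      have h1 := mahal_le_mul_norm α (p.1 - p'.1)
      have h2 := mahal_le_mul_norm α (p.2 - p'.2)
      have h3 : ‖p.1 - p'.1‖ ≤ dist p p' := by rw [dist_eq_norm]; exact norm_fst_le (p - p')
      have h4 : ‖p.2 - p'.2‖ ≤ dist p p' := by rw [dist_eq_norm]; exact norm_snd_le (p - p')
      have h5 := mul_le_mul_of_nonneg_left h3 (norm_nonneg (decorrelate α))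
      have h6 := mul_le_mul_of_nonneg_left h4 (norm_nonneg (decorrelate α))
      refine (mul_le_mul_of_nonneg_left (show _ ≤ 2 * ‖decorrelate α‖ * dist p p' by linarith)
        hL).trans_eq (mul_assoc _ _ _).symm)
  -- The Lipschitz extension may be unbounded; truncation restores the bound without changing it on
  -- the open quadrant.
  let q' : (ℝ × ℝ) × (ℝ × ℝ) → ℝ := fun p ↦ max (-1) (min 1 (q p))
  have hq' : Continuous q' := continuous_const.max (continuous_const.min hq.continuous)
  have hq1 : ∀ p, |q' p| ≤ 1 := fun p ↦
    abs_le.2 ⟨le_max_left _ _, max_le (by norm_num) (min_le_left _ _)⟩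
  have hqq : ∀ p ∈ openQuadrant ×ˢ openQuadrant, q' p = quadMean α s t u F p := by
    intro p hp
    have h1 := abs_le.1 (abs_quadMean_le hα hst hF u hp)
    simp only [q', ← hqe hp, min_eq_right h1.2, max_eq_right h1.1]
  have hHm : Measurable fun o ↦ (H o : ℝ) := H.continuous.measurable.coe_nnreal_real
  have ho := continuous_outerPath (S := S) (T := T) hS hst hT
  have hHc : Continuous fun f : Path S T ↦ (H (outerPath hS hst hT f) : ℝ) :=
    NNReal.continuous_coe.comp (H.continuous.comp ho)
  obtain ⟨M, hM⟩ : ∃ M : ℝ, ∀ o, |(H o : ℝ)| ≤ M := by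
    refine ⟨nndist H 0, fun o ↦ ?_⟩
    rw [NNReal.abs_eq]
    have := H.dist_coe_le_dist (g := 0) o
    rwa [BoundedContinuousFunction.coe_zero, Pi.zero_apply, NNReal.dist_eq, NNReal.coe_zero, sub_zero,
      NNReal.abs_eq] at this
  have hM0 : 0 ≤ M := (abs_nonneg _).trans (hM (0, 0))
  have hFc : Continuous fun f : Path S T ↦
      F fun i ↦ restrictPath (Set.Icc_subset_Icc hS hT) f (u i) :=
    hF.continuous.comp ((continuous_evalMap u).comp (continuous_restrictPath _))
  have hm : Measurable fun p : (Path S s × Path t T) × Path s t ↦ (H p.1 : ℝ) * F fun i ↦ p.2 (u i) :=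
    (hHm.comp measurable_fst).mul
      ((hF.continuous.comp (continuous_evalMap u)).measurable.comp measurable_snd)
  have l1 := tendsto_integral_path h (hHc.mul hFc) (M := M * 1) fun f ↦ by
    rw [Pi.mul_apply, abs_mul]; exact mul_le_mul (hM _) (hF.abs_le _) (abs_nonneg _) hM0
  have l2 := tendsto_integral_path h (hHc.mul (hq'.comp he)) (M := M * 1) fun f ↦ by
    rw [Pi.mul_apply, abs_mul]; exact mul_le_mul (hM _) (hq1 _) (abs_nonneg _) hM0
  have e1 : (fun n ↦ ∫ f, (H (outerPath hS hst hT f) : ℝ) *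
      F (fun i ↦ restrictPath (Set.Icc_subset_Icc hS hT) f (u i)) ∂(κ n : Measure (Path S T))) =
      fun n ↦ ∫ f, (H (outerPath hS hst hT f) : ℝ) * q' (e f) ∂(κ n : Measure (Path S T)) := by
    funext n
    rw [(hκ n).integral_eq hS hst hT hα hHm hM hF u]
    refine integral_congr_ae ?_
    filter_upwards [hpos n] with f hf
    exact congrArg _ (hqq _ hf).symm
  rw [integral_map_outerPath_compProd hS hst hT hα hHm hM hF u,
    integral_map (measurable_splitPath hS hst hT).aemeasurable hm.aestronglyMeasurable]
  refine (tendsto_nhds_unique l1 (e1 ▸ l2)).trans (integral_congr_ae ?_)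
  filter_upwards [hpos'] with f hf
  exact congrArg _ (hqq _ hf)

theorem exists_isExcursionLaw (hα : α ∈ Set.Ioo (-1 : ℝ) 1) {w : ℝ × ℝ} (hw : w ∈ quadrant) :
    ∃ ν : ProbabilityMeasure (Path 0 1), IsExcursionLaw α w (ν : Measure (Path 0 1)) := by
  let δ : ℕ → ℝ := fun n ↦ 1 / ((n : ℝ) + 1)
  have hδ0 : ∀ n, 0 < δ n := fun n ↦ by positivity
  have hδ1 : ∀ n, δ n ≤ 1 := fun n ↦ by
    rw [div_le_one (by positivity)]; linarith [n.cast_nonneg (α := ℝ)]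
  have hδ : Filter.Tendsto (fun n ↦ (δ n, δ n)) (Filter.hyperfilter ℕ : Filter ℕ) (𝓝 0) :=
    (tendsto_one_div_add_atTop_nhds_zero_nat.prodMk_nhds
      tendsto_one_div_add_atTop_nhds_zero_nat).mono_left Nat.hyperfilter_le_atTop
  have hz : ∀ n, (δ n, δ n) ∈ openQuadrant := fun n ↦ ⟨hδ0 n, hδ0 n⟩
  have hw' : ∀ n, w + (δ n, δ n) ∈ openQuadrant := fun n ↦
    ⟨add_pos_of_nonneg_of_pos hw.1 (hδ0 n), add_pos_of_nonneg_of_pos hw.2 (hδ0 n)⟩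
  have hzn : ∀ n, ‖(δ n, δ n)‖ ≤ 1 := fun n ↦ by
    rw [Prod.norm_mk, max_self, Real.norm_eq_abs, abs_of_pos (hδ0 n)]; exact hδ1 n
  have hwn : ∀ n, ‖w + (δ n, δ n)‖ ≤ ‖w‖ + 1 := fun n ↦
    (norm_add_le _ _).trans (by linarith [hzn n])
  let κ : ℕ → ProbabilityMeasure (Path 0 1) := fun n ↦
    ⟨quadBridge α 0 1 (δ n, δ n) (w + (δ n, δ n)),
      isProbabilityMeasure_quadBridge hα zero_lt_one (hz n) (hw' n)⟩
  have hstart : ∀ n, ∀ {u : Set.Icc (0 : ℝ) 1}, (u : ℝ) = 0 →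
      ∀ᵐ f ∂(κ n : Measure (Path 0 1)), f u = (δ n, δ n) := fun n _ hu ↦
    quadBridge_start hα zero_lt_one _ _ hu
  have hend : ∀ n, ∀ {u : Set.Icc (0 : ℝ) 1}, (u : ℝ) = 1 →
      ∀ᵐ f ∂(κ n : Measure (Path 0 1)), f u = w + (δ n, δ n) := fun n _ hu ↦
    quadBridge_terminal hα zero_lt_one _ _ hu
  obtain ⟨C, hC, hloop⟩ := exists_lintegral_mahal_quadBridge_self_le hα
  -- Both endpoints are shifted by the same vector, so their displacement is always `w` and the
  -- moment constant does not depend on `n`.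
  obtain ⟨ν, hν⟩ := exists_tendsto_of_moment_le κ (R := 1)
    (C := 2 * (16 * 72 + 256 * (6 * C + 4 * mahal α w + 1) ^ 4))
    (by have := mahal_nonneg α w; positivity)
    (fun n ↦ (hstart n (by simp [unitPt])).mono fun f hf ↦ hf ▸ hzn n)
    (fun n u v ↦ LoopBound.lintegral_norm_pow_four_le hα hloop hC (hz n) (hw' n)
      (by rw [add_sub_cancel_right]) u v)
  have hpos : ∀ (x : Set.Icc (0 : ℝ) 1), (x : ℝ) ∈ Set.Ioo (0 : ℝ) 1 →
      ∀ᵐ f ∂(ν : Measure (Path 0 1)), f x ∈ openQuadrant := by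
    intro x hx
    obtain ⟨R₀, hR₀⟩ := exists_nat_ge (‖w‖ + 1)
    have key : ∀ e ∈ quadrant, pairing e e = 1 →
        ∀ᵐ f ∂(ν : Measure (Path 0 1)), 0 < pairing e (f x) := fun e he he1 ↦
      ae_pairing_pos_of_tendsto hν (c := fun R ↦ ENNReal.ofReal (Real.exp
        (-((mahal α e * (‖decorrelate α‖ * (2 * R)) + mahal α e ^ 2 / 2) / loopKernel 0 1 x x))))
        (fun R ↦ (ENNReal.ofReal_pos.2 (Real.exp_pos _)).ne') R₀ fun n R hR j hj ↦ by
          have hR' : ‖w‖ + 1 ≤ R := hR₀.trans (by exact_mod_cast hR)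
          exact exp_mul_quadBridge_boundary_le hα hx he he1 (hz n) (hw' n)
            ((hzn n).trans (by linarith [norm_nonneg w])) ((hwn n).trans hR') hj
    filter_upwards [key (1, 0) ⟨zero_le_one, le_rfl⟩ (by simp [pairing]),
      key (0, 1) ⟨le_rfl, zero_le_one⟩ (by simp [pairing])] with f h1 h2
    exact ⟨by simpa [pairing] using h1, by simpa [pairing] using h2⟩
  refine ⟨ν, ⟨ae_eval_eq_of_tendsto hν hδ fun n ↦ hstart n rfl,
    ae_eval_eq_of_tendsto hν (by simpa using hδ.const_add w) fun n ↦ hend n rfl,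
    fun t h0 h1 ↦ hpos _ ⟨h0, h1⟩, fun s t h0 hst h1 ↦ ?_⟩⟩
  have hν' : Resampled h0.le hst h1.le hα (ν : Measure (Path 0 1)) := by
    refine Resampled.of_tendsto h0.le hst h1.le hα hν (fun n ↦ ?_) (fun n ↦ ?_) ?_
    · have := isProbabilityMeasure_quadBridge hα zero_lt_one (hz n) (hw' n)
      exact resampled_quadBridge h0.le hst h1.le hα
    · filter_upwards [quadBridge_mem_openQuadrant hα zero_lt_one (hz n) (hw' n)
        ⟨s, h0.le, hst.le.trans h1.le⟩, quadBridge_mem_openQuadrant hα zero_lt_one (hz n) (hw' n)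
        ⟨t, h0.le.trans hst.le, h1.le⟩] with f h2 h3
      exact ⟨h2, h3⟩
    · filter_upwards [hpos ⟨s, h0.le, hst.le.trans h1.le⟩ ⟨h0, hst.trans h1⟩,
        hpos ⟨t, h0.le.trans hst.le, h1.le⟩ ⟨h0.trans hst, h1⟩] with f h2 h3
      exact ⟨h2, h3⟩
  filter_upwards [(resampled_iff h0.le hst h1.le hα).1 hν'] with f hf
  exact (isQuadrantBridgeLaw_iff hα hst).2 hf

end QuadrantExcursion

theorem theorem3p1 (α : ℝ) (hα : α ∈ Set.Ioo (-1 : ℝ) 1) (w : ℝ × ℝ)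
    (hw : w ∈ frontier QuadrantExcursion.quadrant) :
    ∃! μ : ProbabilityMeasure (QuadrantExcursion.Path 0 1),
      QuadrantExcursion.IsExcursionLaw α w (μ : Measure (QuadrantExcursion.Path 0 1)) := by
  obtain ⟨ν, hν⟩ := QuadrantExcursion.exists_isExcursionLaw hα
    (QuadrantExcursion.isClosed_quadrant.frontier_subset hw)
  exact ⟨ν, hν, fun μ hμ ↦ Subtype.ext (QuadrantExcursion.IsExcursionLaw.eq
    (μ := (μ : Measure _)) (μ' := (ν : Measure _)) hα hμ hν)⟩
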